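/- **Theorem 1.1 (Self-adjointness).** Let $n\ge 2$, masses $m_1,\dots,m_n\ge 0$, $\omega_i(k)=\sqrt{k^2+m_i^2}$ for $k\in\mathbb R^3$, and $\xi=(k,\lambda)\in X:=\mathbb{R}^3\times\{-\frac12,\frac12\}$, with $\int d\xi=\sum_\lambda\int dk$. Let $\mathcal F=\bigoplus_{l\ge 0}\otimes_a^l L^2(X)$ be the antisymmetric Fock space over $L^2(X)$ and $\mathcal H=\bigotimes_{i=1}^n\mathcal F$, with annihilation operators $b_i(\xi)$ on the $i$-th factor satisfying the canonical anticommutation relations, operators of different species also anticommuting (by means of the signs $(-1)^{N_1+\cdots+N_{i-1}}$, where $N_j$ is the number operator of species $j$). Let $H_f=\sum_{i=1}^n \mathrm d\Gamma(\omega_i)$, a self-adjoint operator on $\mathcal H$. For $0\le p\le n$ let $\mathfrak I_p$ be the set of all $(i_1,\dots,i_n)$ with $\{i_1,\dots,i_n\}=\{1,\dots,n\}$, $i_1<\dots<i_p$, $i_{p+1}<\dots<i_n$, and $i_1<i_{p+1}$ if $1\le p\le n-1$. Given kernels $G^{(p)}_{i_1,\dots,i_n}\in L^2(X^n)$, consider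 $$H_I=\sum_{p=0}^n\sum_{(i_1,\dots,i_n)\in\mathfrak I_p}\Big(\int G^{(p)}_{i_1,\dots,i_n}(\xi_1,\dots,\xi_n)\,b^*_{i_1}(\xi_{i_1})\cdots b^*_{i_p}(\xi_{i_p})\,b_{i_{p+1}}(\xi_{i_{p+1}})\cdots b_{i_n}(\xi_{i_n})\,d\xi_1\cdots d\xi_n+\mathrm{h.c.}\Big)$$ as a quadratic form on the algebraic tensor product $\mathcal Q=\hat\otimes_{i=1}^n\mathcal F_{\mathrm{fin}}(\mathcal S)$, where $\mathcal F_{\mathrm{fin}}(\mathcal S)\subset\mathcal F$ consists of the vectors with finitely many nonzero components, all of them Schwartz functions. Let $\mathrm h_i^j=-\partial_{k_{i,j}}^2+k_{i,j}^2$ be the one-dimensional harmonic oscillator in the $j$-th component of $k_i$, acting on $L^2(X^n)$. Let $i_0\in\{1,\dots,n\}$ and $\varepsilon>0$; if $n=2$ and $m_1=m_2=0$, assume in addition $\varepsilon\ge\frac12$. Suppose that for all $p\in\{0,\dots,n\}$ and all $(i_1,\dots,i_n)\in\mathfrak I_p$, $$G^{(p)}_{i_1,\dots,i_n}\in\mathcal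 D\Big(\Big(\prod_{\substack{i\ne i_0,\ m_i>0\\ 1\le j\le 3}}(\mathrm h_i^j)^{\frac12-\frac1{n-1}+\varepsilon}\Big)\Big(\prod_{\substack{i\ne i_0,\ m_i=0\\ 1\le j\le 3}}(\mathrm h_i^j)^{\frac12-\frac56\frac1{n-1}+\varepsilon}\Big)\Big).$$ Then the quadratic form $H_f+H_I$ on $\mathcal Q$ extends to a self-adjoint operator $H$ on $\mathcal H$: there is a self-adjoint operator $H$ with $\mathcal D(H)=\mathcal D(H_f)\supset\mathcal Q$ and $\langle\Phi,H\Psi\rangle=\langle\Phi,H_f\Psi\rangle+H_I(\Phi,\Psi)$ for all $\Phi,\Psi\in\mathcal Q$. Moreover, $H$ is bounded from below, and every core for $H_f$ is a core for $H$. No smallness of the kernels is assumed. -/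

import Mathlib

open MeasureTheory
open scoped ComplexConjugate

noncomputable section

namespace FermiFields

/-! ### One-particle space -/

/-- The two spin values `-1/2` (`false`) and `1/2` (`true`), with counting measure. -/
def Spin : Type := Bool

instance : Fintype Spin := inferInstanceAs (Fintype Bool)
instance : DecidableEq Spin := inferInstanceAs (DecidableEq Bool)
instance : Nonempty Spin := inferInstanceAs (Nonempty Bool)
instance : MeasurableSpace Spin := ⊤
instance : DiscreteMeasurableSpace Spin := ⟨fun _ => trivial⟩
instance : MeasureSpace Spin := ⟨Measure.count⟩
instance : IsFiniteMeasure (volume : Measure Spin) :=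
  inferInstanceAs (IsFiniteMeasure (Measure.count : Measure Spin))

/-- `ξ = (k, lam)`, with `k ∈ ℝ³` in Cartesian coordinates; `volume` is Lebesgue measure times
counting measure. -/
abbrev Particle : Type := (Fin 3 → ℝ) × Spin

/-- The relativistic dispersion relation `ω(k) = √(k² + m²)`. -/
def dispersion (m : ℝ) (k : Fin 3 → ℝ) : ℝ := Real.sqrt ((∑ j, k j ^ 2) + m ^ 2)

/-! ### The tensor product of `n` antisymmetric Fock spaces

The tensor product of the `n` Fock spaces is the Hilbert direct sum, over the occupation numbers
`l = (l 0, …, l (n-1))`, of the spaces `⨂ᵢ ⨂ₐ^{l i} L²(ℝ³ × {±1/2})`. The latter consists of the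
square integrable functions of `l i` variables of each species `i` that are antisymmetric in the
variables of each species separately. -/

/-- Positions of all the particles, `l i` of them for species `i`. -/
abbrev Config {n : ℕ} (l : Fin n → ℕ) : Type := (i : Fin n) → Fin (l i) → Particle

/-- Permute the variables of each species. -/
def permute {n : ℕ} {l : Fin n → ℕ} (σ : (i : Fin n) → Equiv.Perm (Fin (l i)))
    (η : Config l) : Config l := fun i a => η i (σ i a)

theorem measurePreserving_permute {n : ℕ} {l : Fin n → ℕ}
    (σ : (i : Fin n) → Equiv.Perm (Fin (l i))) :
    MeasurePreserving (permute σ) (volume : Measure (Config l)) volume := by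
  refine measurePreserving_pi (fun i => (volume : Measure (Fin (l i) → Particle)))
    (fun i => volume) (f := fun i (y : Fin (l i) → Particle) a => y (σ i a)) fun i => ?_
  have h := volume_measurePreserving_piCongrLeft (fun _ : Fin (l i) => Particle) (σ i).symm
  convert! h using 1
  funext y a
  have := MeasurableEquiv.piCongrLeft_apply_apply (β := fun _ : Fin (l i) => Particle)
    (σ i).symm y (σ i a)
  simpa using this.symm

/-- The species-wise antisymmetric square integrable functions with occupation numbers `l`. -/
def antisymL2 {n : ℕ} (l : Fin n → ℕ) : Submodule ℂ (Lp ℂ 2 (volume : Measure (Config l))) :=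
  ⨅ σ : (i : Fin n) → Equiv.Perm (Fin (l i)),
    LinearMap.ker
      ((Lp.compMeasurePreservingₗᵢ ℂ (permute σ) (measurePreserving_permute σ)).toLinearMap -
        ((∏ i, ((Equiv.Perm.sign (σ i) : ℤ) : ℂ)) •
          (LinearMap.id : Lp ℂ 2 (volume : Measure (Config l)) →ₗ[ℂ] _)))

theorem isClosed_antisymL2 {n : ℕ} (l : Fin n → ℕ) :
    IsClosed (antisymL2 l : Set (Lp ℂ 2 (volume : Measure (Config l)))) := by
  simp only [antisymL2, Submodule.coe_iInf]
  refine isClosed_iInter fun σ => ?_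
  refine isClosed_singleton.preimage (f := fun f : Lp ℂ 2 (volume : Measure (Config l)) =>
    Lp.compMeasurePreservingₗᵢ ℂ (permute σ) (measurePreserving_permute σ) f -
      (∏ i, ((Equiv.Perm.sign (σ i) : ℤ) : ℂ)) • f) ?_
  exact (LinearIsometry.continuous _).sub (continuous_const_smul _)

instance {n : ℕ} (l : Fin n → ℕ) : CompleteSpace (antisymL2 l) :=
  (isClosed_antisymL2 l).completeSpace_coe

/-- The total Hilbert space: the tensor product of `n` antisymmetric Fock spaces. -/
abbrev FockSpace (n : ℕ) : Type := lp (fun l : Fin n → ℕ => antisymL2 l) 2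

/-- Wave functions, as everywhere defined functions on each sector. -/
abbrev WaveFunction (n : ℕ) : Type := (l : Fin n → ℕ) → Config l → ℂ

/-- A representative of each sector of a vector of the total Hilbert space. -/
def wave {n : ℕ} (Ψ : FockSpace n) : WaveFunction n := fun l η =>
  ((Ψ l : antisymL2 l) : Lp ℂ 2 (volume : Measure (Config l))) η

theorem wave_add {n : ℕ} (Φ Ψ : FockSpace n) (l : Fin n → ℕ) :
    wave (Φ + Ψ) l =ᵐ[volume] fun η => wave Φ l η + wave Ψ l η :=
  Lp.coeFn_add _ _

theorem wave_smul {n : ℕ} (c : ℂ) (Ψ : FockSpace n) (l : Fin n → ℕ) :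
    wave (c • Ψ) l =ᵐ[volume] fun η => c * wave Ψ l η :=
  Lp.coeFn_smul _ _

theorem wave_zero {n : ℕ} (l : Fin n → ℕ) :
    wave (0 : FockSpace n) l =ᵐ[volume] fun _ => 0 :=
  Lp.coeFn_zero _ _ _

theorem ext_wave {n : ℕ} {Φ Ψ : FockSpace n}
    (h : ∀ l, wave Φ l =ᵐ[volume] wave Ψ l) : Φ = Ψ := by
  ext1
  funext l
  exact Subtype.ext (Lp.ext (h l))

/-! ### The free Hamiltonian -/

/-- The free energy of a configuration, `∑ᵢ ∑ₐ ωᵢ(k_{i,a})`. -/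
def freeEnergy {n : ℕ} (m : Fin n → ℝ) {l : Fin n → ℕ} (η : Config l) : ℝ :=
  ∑ i, ∑ a, dispersion (m i) (η i a).1

/-- The graph of `H_f = ∑ᵢ dΓ(ωᵢ)`: on each sector, `H_f` multiplies by the free energy. -/
def freeGraph {n : ℕ} (m : Fin n → ℝ) : Submodule ℂ (FockSpace n × FockSpace n) where
  carrier := {P | ∀ l, wave P.2 l =ᵐ[volume] fun η => (freeEnergy m η : ℂ) * wave P.1 l η}
  zero_mem' l := by
    filter_upwards [wave_zero (n := n) l] with η h
    simp [h]
  add_mem' {P Q} hP hQ l := by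
    filter_upwards [hP l, hQ l, wave_add P.1 Q.1 l, wave_add P.2 Q.2 l] with η h1 h2 h3 h4
    simp only [Prod.fst_add, Prod.snd_add, h1, h2, h3, h4]
    ring
  smul_mem' c P hP l := by
    filter_upwards [hP l, wave_smul c P.1 l, wave_smul c P.2 l] with η h1 h2 h3
    simp only [Prod.smul_fst, Prod.smul_snd, h1, h2, h3]
    ring

/-- The free Hamiltonian `H_f`, on its maximal domain
`{Ψ | ∑_l ‖(free energy) Ψ_l‖² < ∞}`. -/
def freeHamiltonian {n : ℕ} (m : Fin n → ℝ) : FockSpace n →ₗ.[ℂ] FockSpace n :=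
  (freeGraph m).toLinearPMap

theorem freeHamiltonian_graph {n : ℕ} (m : Fin n → ℝ) :
    (freeHamiltonian m).graph = freeGraph m := by
  refine Submodule.toLinearPMap_graph_eq _ ?_
  rintro ⟨Ψ, Θ⟩ hP h0
  obtain rfl : Ψ = 0 := h0
  refine ext_wave fun l => ?_
  filter_upwards [hP l, wave_zero (n := n) l] with η h1 h2
  simp only [h2, mul_zero] at h1
  rw [h1, h2]

/-! ### Annihilation operators and the interaction -/

/-- Add a particle at `x` to species `i`, as the first variable of that species. -/
def insertParticle {n : ℕ} {l : Fin n → ℕ} (i : Fin n) (x : Particle) (η : Config l) :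
    Config (Function.update l i (l i + 1)) := fun j a =>
  if h : j = i then
    if h0 : (a : ℕ) = 0 then x
    else η j ⟨(a : ℕ) - 1, by
      have ha := a.2
      subst h
      simp only [Function.update_self] at ha
      omega⟩
  else η j ⟨(a : ℕ), by
    have ha := a.2
    simpa only [Function.update_of_ne h] using ha⟩

/-- The annihilation operator `bᵢ(x)`. On the `i`-th Fock space it is
`(b(x)φ)_l(ξ₁,…,ξ_l) = √(l+1) φ_{l+1}(x,ξ₁,…,ξ_l)`; the sign `(-1)^{N_0+⋯+N_{i-1}}` makes the
operators of different species anticommute. -/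
def annihilate {n : ℕ} (i : Fin n) (x : Particle) (Φ : WaveFunction n) : WaveFunction n :=
  fun l η => (-1 : ℂ) ^ (∑ j ∈ Finset.univ.filter (fun j => j < i), l j) *
    (Real.sqrt ((l i : ℝ) + 1) : ℂ) * Φ (Function.update l i (l i + 1)) (insertParticle i x η)

/-- `b_{i₁}(ξ_{i₁}) ⋯ b_{i_r}(ξ_{i_r}) Φ` for a list of species `[i₁, …, i_r]`. -/
def annihilateList {n : ℕ} (L : List (Fin n)) (ξ : Fin n → Particle) (Φ : WaveFunction n) :
    WaveFunction n := L.foldr (fun i Θ => annihilate i (ξ i) Θ) Φ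

/-- The inner product `⟨Φ, Ψ⟩` of wave functions (antilinear in the first argument). -/
def waveInner {n : ℕ} (Φ Ψ : WaveFunction n) : ℂ :=
  ∑' l : Fin n → ℕ, ∫ η : Config l, conj (Φ l η) * Ψ l η

/-- Interaction kernels: elements of `⨂ᵢ L²(ℝ³ × {±1/2}) = L²((ℝ³ × {±1/2})ⁿ)`. -/
abbrev FormFactor (n : ℕ) : Type := Lp ℂ 2 (volume : Measure (Fin n → Particle))

/-- With `A = {i₁ < ⋯ < i_p}` and complement `{i_{p+1} < ⋯ < i_n}`, the quadratic form
`⟨Φ, ∫ G(ξ₁,…,ξ_n) b*_{i₁}(ξ_{i₁}) ⋯ b*_{i_p}(ξ_{i_p}) b_{i_{p+1}}(ξ_{i_{p+1}}) ⋯ b_{i_n}(ξ_{i_n})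
dξ₁⋯dξ_n Ψ⟩`; the creation operators act on the left factor as
`b_{i_p}(ξ_{i_p}) ⋯ b_{i₁}(ξ_{i₁}) Φ`. -/
def processForm {n : ℕ} (A : Finset (Fin n)) (G : FormFactor n) (Φ Ψ : FockSpace n) : ℂ :=
  ∫ ξ : Fin n → Particle, G ξ *
    waveInner (annihilateList (A.sort (· ≤ ·)).reverse ξ (wave Φ))
      (annihilateList (Aᶜ.sort (· ≤ ·)) ξ (wave Ψ))

open scoped Classical in
/-- The processes with `p` created particles: `A = {i₁ < ⋯ < i_p}` is the set of created species,
its complement `{i_{p+1} < ⋯ < i_n}` that of annihilated species, and `i₁ < i_{p+1}` when both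
exist. -/
def processes (n p : ℕ) : Finset (Finset (Fin n)) :=
  (Finset.powersetCard p Finset.univ).filter fun A =>
    ∀ (hA : A.Nonempty) (hB : Aᶜ.Nonempty), A.min' hA < Aᶜ.min' hB

/-- The quadratic form `H_I`: the sum over all processes of the corresponding form plus its
hermitian conjugate. -/
def interactionForm {n : ℕ} (G : ℕ → Finset (Fin n) → FormFactor n) (Φ Ψ : FockSpace n) : ℂ :=
  ∑ p ∈ Finset.range (n + 1), ∑ A ∈ processes n p,
    (processForm A (G p A) Φ Ψ + conj (processForm A (G p A) Ψ Φ))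

/-! ### The form domain -/

/-- `φ ∈ F_fin(S)`: antisymmetric, with finitely many nonzero components, each of which is a
Schwartz function of the momenta for all values of the spins. -/
structure IsFiniteSchwartz (φ : (r : ℕ) → (Fin r → Particle) → ℂ) : Prop where
  antisymm : ∀ (r : ℕ) (σ : Equiv.Perm (Fin r)) (η : Fin r → Particle),
    φ r (fun a => η (σ a)) = ((Equiv.Perm.sign σ : ℤ) : ℂ) * φ r η
  schwartz : ∀ (r : ℕ) (s : Fin r → Spin), ∃ f : SchwartzMap (Fin r → Fin 3 → ℝ) ℂ,
    ∀ k, φ r (fun a => (k a, s a)) = f k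
  finite : ∃ N : ℕ, ∀ r, N < r → ∀ η, φ r η = 0

/-- The algebraic tensor product of `n` copies of `F_fin(S)`: the span of the vectors
`φ₁ ⊗ ⋯ ⊗ φ_n`. -/
def formDomain (n : ℕ) : Submodule ℂ (FockSpace n) :=
  Submodule.span ℂ {Ψ | ∃ φ : Fin n → (r : ℕ) → (Fin r → Particle) → ℂ,
    (∀ i, IsFiniteSchwartz (φ i)) ∧
      ∀ l, wave Ψ l =ᵐ[volume] fun η => ∏ i, φ i (l i) (η i)}

/-! ### Powers of harmonic oscillators -/

/-- The normalized Hermite functions `e_r`, the eigenfunctions of `-d²/dt² + t²` with eigenvalues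
`2r + 1`. (`Polynomial.hermite` is the probabilists' Hermite polynomial.) -/
def hermiteFun (r : ℕ) (t : ℝ) : ℝ :=
  (Real.sqrt (r.factorial * Real.sqrt Real.pi))⁻¹ *
    Polynomial.aeval (Real.sqrt 2 * t) (Polynomial.hermite r) * Real.exp (-(t ^ 2) / 2)

theorem derivative_hermite_succ (r : ℕ) : Polynomial.derivative (Polynomial.hermite (r + 1)) =
    (r + 1 : Polynomial ℤ) * Polynomial.hermite r := by
  induction r with
  | zero => simp
  | succ r ih =>
    have e : Polynomial.hermite (r + 2) = Polynomial.X * Polynomial.hermite (r + 1) -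
      Polynomial.derivative (Polynomial.hermite (r + 1)) := Polynomial.hermite_succ _
    rw [e, ih]
    simp only [Polynomial.derivative_sub, Polynomial.derivative_mul, Polynomial.derivative_X, ih,
      Polynomial.derivative_add, Polynomial.derivative_natCast, Polynomial.derivative_one]
    rw [Polynomial.hermite_succ r]
    push_cast
    ring

theorem hermite_ode (r : ℕ) :
    Polynomial.derivative (Polynomial.derivative (Polynomial.hermite r)) =
      Polynomial.X * Polynomial.derivative (Polynomial.hermite r) -
        (r : Polynomial ℤ) * Polynomial.hermite r := by
  cases r with
  | zero => simp
  | succ r =>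
    rw [derivative_hermite_succ]
    simp only [Polynomial.derivative_mul, Polynomial.derivative_add, Polynomial.derivative_natCast,
      Polynomial.derivative_one]
    rw [Polynomial.hermite_succ r]
    push_cast
    ring

/-- The Hermite functions are eigenfunctions of the harmonic oscillator. -/
theorem hermiteFun_eigen (r : ℕ) (t : ℝ) :
    -deriv (deriv (hermiteFun r)) t + t ^ 2 * hermiteFun r t = (2 * r + 1) * hermiteFun r t := by
  obtain ⟨c, hc⟩ : ∃ c : ℝ, ∀ t, hermiteFun r t =
      c * Polynomial.aeval (Real.sqrt 2 * t) (Polynomial.hermite r) * Real.exp (-(t ^ 2) / 2) :=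
    ⟨_, fun _ => rfl⟩
  have key : ∀ (p : Polynomial ℤ) (t : ℝ),
      HasDerivAt
        (fun t => c * Polynomial.aeval (Real.sqrt 2 * t) p * Real.exp (-(t ^ 2) / 2))
        (c * (Real.sqrt 2 * Polynomial.aeval (Real.sqrt 2 * t) (Polynomial.derivative p) -
          t * Polynomial.aeval (Real.sqrt 2 * t) p) * Real.exp (-(t ^ 2) / 2)) t := by
    intro p t
    have h1 := (Polynomial.hasDerivAt_aeval p (Real.sqrt 2 * t)).comp t
      ((hasDerivAt_id t).const_mul (Real.sqrt 2))
    have h2 : HasDerivAt (fun t : ℝ => Real.exp (-(t ^ 2) / 2))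
        (Real.exp (-(t ^ 2) / 2) * (-(2 * t) / 2)) t := by
      have := (((hasDerivAt_pow 2 t).neg).div_const 2).exp
      simpa using this
    have := (h1.const_mul c).mul h2
    convert! this using 1
    simp
    ring
  have hf : hermiteFun r = fun t => c * Polynomial.aeval (Real.sqrt 2 * t) (Polynomial.hermite r) *
    Real.exp (-(t ^ 2) / 2) := funext hc
  have d1 : deriv (hermiteFun r) = fun t => Real.sqrt 2 *
      (c * Polynomial.aeval (Real.sqrt 2 * t) (Polynomial.derivative (Polynomial.hermite r)) *
        Real.exp (-(t ^ 2) / 2)) - t * (c * Polynomial.aeval (Real.sqrt 2 * t)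
          (Polynomial.hermite r) * Real.exp (-(t ^ 2) / 2)) := by
    funext t
    rw [hf]
    refine ((key _ t).deriv).trans ?_
    ring
  have d2 := ((key (Polynomial.derivative (Polynomial.hermite r)) t).const_mul (Real.sqrt 2)).sub
    ((hasDerivAt_id t).mul (key (Polynomial.hermite r) t))
  have hs : Real.sqrt 2 * Real.sqrt 2 = 2 := Real.mul_self_sqrt (by norm_num)
  rw [d1, hc]
  refine (congrArg (fun y : ℝ => -y + _) d2.deriv).trans ?_
  rw [hermite_ode]
  simp only [map_sub, map_mul, Polynomial.aeval_X, map_natCast, id]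
  linear_combination (c * Real.exp (-(t ^ 2) / 2) *
    (r * Polynomial.aeval (Real.sqrt 2 * t) (Polynomial.hermite r) -
      Real.sqrt 2 * t * Polynomial.aeval (Real.sqrt 2 * t)
        (Polynomial.derivative (Polynomial.hermite r)))) * hs

/-- The coefficient `∫ e_r(t) G(…, k_{i,j} = t, …) dt` of `G` with respect to the variable
`k_{i,j}`, as a function of the other variables. -/
def hermiteCoeff {n : ℕ} (i : Fin n) (j : Fin 3) (r : ℕ) (G : FormFactor n)
    (ξ : Fin n → Particle) : ℂ :=
  ∫ t : ℝ, (hermiteFun r t : ℂ) *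
    G (Function.update ξ i (Function.update (ξ i).1 j t, (ξ i).2))

/-- `G' = (h_i^j)^s G`, where `h_i^j` is the harmonic oscillator in the variable `k_{i,j}`: the
power of the self-adjoint operator `h_i^j` multiplies the `r`-th Hermite coefficient by
`(2r+1)^s`. In particular `G` is in the domain of `(h_i^j)^s` if and only if such a `G'` exists
in `L²`. -/
def IsHarmonicPower {n : ℕ} (i : Fin n) (j : Fin 3) (s : ℝ) (G G' : FormFactor n) : Prop :=
  ∀ r : ℕ, ∀ᵐ ξ : Fin n → Particle,
    hermiteCoeff i j r G' ξ = (((2 * r + 1 : ℝ) ^ s : ℝ) : ℂ) * hermiteCoeff i j r G ξ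

/-- The domain of a product `A₁ ⋯ A_N` of powers `(h_i^j)^s`, given as a list:
`D(A₁ ⋯ A_N) = {v ∈ D(A_N) | A_N v ∈ D(A₁ ⋯ A_{N-1})}`. The list is written with `A_N` first. -/
def InProductDomain {n : ℕ} : List (Fin n × Fin 3 × ℝ) → FormFactor n → Prop
  | [], _ => True
  | a :: L, G => ∃ G', IsHarmonicPower a.1 a.2.1 a.2.2 G G' ∧ InProductDomain L G'

open scoped Classical in
/-- The factors `(h_i^j)^s`, over all species `i ≠ i₀` satisfying `P` and all `j`. -/
def harmonicFactors {n : ℕ} (i₀ : Fin n) (P : Fin n → Prop) (s : ℝ) :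
    List (Fin n × Fin 3 × ℝ) :=
  ((List.finRange n).filter fun i => i ≠ i₀ ∧ P i).flatMap fun i =>
    (List.finRange 3).map fun j => (i, j, s)

/-- Regularity of a kernel: it is in the domain of
`(∏_{m_i>0, i≠i₀, j} (h_i^j)^α) (∏_{m_i=0, i≠i₀, j} (h_i^j)^β)` with
`α = 1/2 - 1/(n-1) + ε` and `β = 1/2 - (5/6)/(n-1) + ε`. -/
def IsRegularFormFactor {n : ℕ} (m : Fin n → ℝ) (i₀ : Fin n) (ε : ℝ) (G : FormFactor n) : Prop :=
  InProductDomain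
    ((harmonicFactors i₀ (fun i => 0 < m i) (1 / 2 - 1 / ((n : ℝ) - 1) + ε) ++
      harmonicFactors i₀ (fun i => m i = 0)
        (1 / 2 - 5 / 6 * (1 / ((n : ℝ) - 1)) + ε)).reverse) G

end FermiFields

end

open FermiFields

/-! The interaction is relatively bounded with bound zero with respect to `freeHamiltonian m`, so a
Kato-Rellich argument needs no smallness of the kernels. Let E_i be the energy of species i and E
the total energy. It suffices to find γ_i ≥ 0 with ∑ γ_i < 1 such that H_I M is bounded, where M = ∏
(1 + E_i)^(-γ_i) is the `regularizer`. Indeed M⁻¹ (H_f + μ)⁻¹ has norm at most μ^(∑ γ_i - 1), which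
tends to 0 as μ → ∞. The abstract part is `katoRellich` and `exists_selfAdjoint_of_factorization`.

To bound H_I M, each kernel is expanded in the tensor Hermite basis. The interaction becomes a
series over labels α of coefficients times products of smeared creation and annihilation operators,
and the regularity hypothesis makes the coefficients square summable after multiplication by powers
of the oscillator eigenvalues of all species but i₀ (`IsRegularFormFactor.hasDecay`). It remains to
bound ∑ d_α O_α by the ℓ² norm of d, where O_α carries the inverse weights and M. Different species
anticommute up to signs, so the product can be arranged with creation operators on the left,
annihilation operators on the right and species i₀ between them. A bounded row, a
coefficient-bounded family and a bounded column compose to a coefficient-bounded family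
(`exists_coeffBdd_prod`). The middle species costs neither weight nor energy, because ‖b(f)‖ ≤ ‖f‖
for fermions (`lintegral_smear_le`). Thus only n - 1 species share the available power of the
energy, whence the 1/(n - 1) in the hypothesis.

For one species there are two estimates for b(1_S e_α). Bessel's inequality bounds the sum over α of
‖b(1_S e_α) X‖² by the expectation of the number of particles in S; the Pauli bound gives ‖b(1_S
e_α)‖² ≤ ∫_S e_α². Interpolation (`colBdd_interpolation`) trades a weight exponent s against a power
γ of the particle number, for s > 1/2 - γ. If the mass is positive, the number is at most E_i / m
and S is the whole space. If the mass is zero, the space is cut into shells |k| ~ 2^(-q), where the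
number is at most 2^q E_i. The loss is compensated by the smallness of ∫_S e_α² near the origin: it
is of order 8^(-q), and it even decays in the label (`hermiteFun_sq_le`). The shells sum up if an
interpolation parameter θ > 1/4 with θ/4 < s is available; the factor 5/6 in the hypothesis provides
s ≥ 1/12, which is enough.

Finally, Parseval's identity (`hasSum_coeff`) identifies the operator so obtained with the given
quadratic form on vectors with finitely many sectors. -/

noncomputable section

namespace FermiFields

/-! ### Families of operators with square-summable bounds -/

section OperatorFamilies

variable {H : Type*} [NormedAddCommGroup H] [InnerProductSpace ℂ H]
variable {ι κ : Type*}

/-- The column `(O_a)_a` is a bounded operator `H → ℓ²(ι, H)` of norm at most `C`. -/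
def ColBdd (O : ι → H →L[ℂ] H) (C : ℝ) : Prop :=
  0 ≤ C ∧ ∀ (F : Finset ι) (X : H), ∑ a ∈ F, ‖O a X‖ ^ 2 ≤ C ^ 2 * ‖X‖ ^ 2

/-- The row `(O_a)_a` is a bounded operator `ℓ²(ι, H) → H` of norm at most `C`. -/
def RowBdd (O : ι → H →L[ℂ] H) (C : ℝ) : Prop :=
  0 ≤ C ∧ ∀ (F : Finset ι) (X : ι → H),
    ‖∑ a ∈ F, O a (X a)‖ ^ 2 ≤ C ^ 2 * ∑ a ∈ F, ‖X a‖ ^ 2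

/-- `d ↦ ∑ d_a O_a` is bounded from `ℓ²(ι)` to the bounded operators. -/
def CoeffBdd (O : ι → H →L[ℂ] H) (C : ℝ) : Prop :=
  0 ≤ C ∧ ∀ (F : Finset ι) (d : ι → ℂ) (X : H),
    ‖∑ a ∈ F, d a • O a X‖ ^ 2 ≤ C ^ 2 * (∑ a ∈ F, ‖d a‖ ^ 2) * ‖X‖ ^ 2

theorem ColBdd.comp_right {O : ι → H →L[ℂ] H} {C : ℝ} (h : ColBdd O C) {M : H →L[ℂ] H} {K : ℝ}
    (hM : ‖M‖ ≤ K) : ColBdd (fun a => O a ∘L M) (C * K) := by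
  have hK : 0 ≤ K := (norm_nonneg _).trans hM
  refine ⟨mul_nonneg h.1 hK, fun F X => ?_⟩
  refine (h.2 F (M X)).trans ?_
  have : ‖M X‖ ≤ K * ‖X‖ := (M.le_opNorm X).trans (by gcongr)
  calc C ^ 2 * ‖M X‖ ^ 2 ≤ C ^ 2 * (K * ‖X‖) ^ 2 := by gcongr
    _ = _ := by ring

theorem RowBdd.comp_right {O : ι → H →L[ℂ] H} {C : ℝ} (h : RowBdd O C) {M : H →L[ℂ] H} {K : ℝ}
    (hM : ‖M‖ ≤ K) : RowBdd (fun a => O a ∘L M) (C * K) := by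
  have hK : 0 ≤ K := (norm_nonneg _).trans hM
  refine ⟨mul_nonneg h.1 hK, fun F X => ?_⟩
  refine (h.2 F (fun a => M (X a))).trans ?_
  calc C ^ 2 * ∑ a ∈ F, ‖M (X a)‖ ^ 2 ≤ C ^ 2 * ∑ a ∈ F, (K * ‖X a‖) ^ 2 := by
        gcongr with a _
        exact (M.le_opNorm _).trans (by gcongr)
    _ = _ := by simp only [mul_pow, ← Finset.mul_sum]; ring

/-- Duality: for Y = ∑ O_a* X_a, moving the adjoints gives ‖Y‖² = ∑ ⟨X_a, O_a Y⟩, and Cauchy-Schwarz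
together with the column bound at Y gives ‖Y‖² ≤ ‖X‖ · C ‖Y‖. Creation operators are handled in this
way. -/
theorem ColBdd.adjoint [CompleteSpace H] {O : ι → H →L[ℂ] H} {C : ℝ} (h : ColBdd O C) :
    RowBdd (fun a => (O a).adjoint) C := by
  refine ⟨h.1, fun F X => ?_⟩
  set Y := ∑ a ∈ F, (O a).adjoint (X a) with hY
  have h1 : ‖Y‖ ^ 2 = ‖∑ a ∈ F, inner ℂ (X a) (O a Y)‖ := by
    have : (inner ℂ Y Y : ℂ) = ∑ a ∈ F, inner ℂ (X a) (O a Y) := by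
      conv_lhs => rw [hY]
      rw [sum_inner]
      simp [ContinuousLinearMap.adjoint_inner_left, ← hY]
    rw [← this, inner_self_eq_norm_sq_to_K]
    simp
  have h2 : ‖Y‖ ^ 2 ≤ √(∑ a ∈ F, ‖X a‖ ^ 2) * √(∑ a ∈ F, ‖O a Y‖ ^ 2) := by
    rw [h1]
    refine (norm_sum_le _ _).trans ((Finset.sum_le_sum fun a _ => norm_inner_le_norm _ _).trans ?_)
    exact Real.sum_mul_le_sqrt_mul_sqrt _ _ _
  have h3 : √(∑ a ∈ F, ‖O a Y‖ ^ 2) ≤ C * ‖Y‖ := by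
    rw [← Real.sqrt_sq (mul_nonneg h.1 (norm_nonneg Y))]
    exact Real.sqrt_le_sqrt (by rw [mul_pow]; exact h.2 F Y)
  have hS : (0 : ℝ) ≤ ∑ a ∈ F, ‖X a‖ ^ 2 := Finset.sum_nonneg fun _ _ => by positivity
  rcases (norm_nonneg Y).eq_or_lt' with h0 | h0
  · rw [h0]
    simpa using mul_nonneg (sq_nonneg C) hS
  · have h4 : ‖Y‖ ≤ C * √(∑ a ∈ F, ‖X a‖ ^ 2) := by
      refine le_of_mul_le_mul_right ?_ h0
      calc ‖Y‖ * ‖Y‖ = ‖Y‖ ^ 2 := by ring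
        _ ≤ √(∑ a ∈ F, ‖X a‖ ^ 2) * (C * ‖Y‖) := h2.trans (by gcongr)
        _ = _ := by ring
    calc ‖Y‖ ^ 2 ≤ (C * √(∑ a ∈ F, ‖X a‖ ^ 2)) ^ 2 := by gcongr
      _ = _ := by rw [mul_pow, Real.sq_sqrt hS]

theorem subset_product_images [DecidableEq ι] [DecidableEq κ] (F : Finset (ι × κ)) :
    F ⊆ F.image Prod.fst ×ˢ F.image Prod.snd := fun _ hp =>
  Finset.mem_product.2 ⟨Finset.mem_image_of_mem _ hp, Finset.mem_image_of_mem _ hp⟩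

/-- Enlarging a finite set of pairs to a rectangle only adds nonnegative terms; on a rectangle the
two bounds are applied one after the other. -/
theorem ColBdd.prod {O : ι → H →L[ℂ] H} {C : ℝ} (h : ColBdd O C) {O' : κ → H →L[ℂ] H} {C' : ℝ}
    (h' : ColBdd O' C') : ColBdd (fun p : ι × κ => O p.1 ∘L O' p.2) (C * C') := by
  classical
  refine ⟨mul_nonneg h.1 h'.1, fun F X => ?_⟩
  refine (Finset.sum_le_sum_of_subset_of_nonneg (subset_product_images F)
    fun _ _ _ => by positivity).trans ?_
  rw [Finset.sum_product_right]
  calc _ ≤ ∑ b ∈ F.image Prod.snd, C ^ 2 * ‖O' b X‖ ^ 2 :=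
        Finset.sum_le_sum fun b _ => h.2 _ (O' b X)
    _ ≤ C ^ 2 * (C' ^ 2 * ‖X‖ ^ 2) := by
        rw [← Finset.mul_sum]
        gcongr
        exact h'.2 _ X
    _ = _ := by ring

theorem RowBdd.prod {O : ι → H →L[ℂ] H} {C : ℝ} (h : RowBdd O C) {O' : κ → H →L[ℂ] H} {C' : ℝ}
    (h' : RowBdd O' C') : RowBdd (fun p : ι × κ => O p.1 ∘L O' p.2) (C * C') := by
  classical
  refine ⟨mul_nonneg h.1 h'.1, fun F X => ?_⟩
  -- Extension by zero: a row bound is not monotone in the index set, so the vectors outside `F`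
  -- must vanish when `F` is enlarged to a rectangle.
  set X' : ι × κ → H := fun p => if p ∈ F then X p else 0 with hX'
  have e1 : ∑ p ∈ F, (O p.1 ∘L O' p.2) (X p) =
      ∑ p ∈ F.image Prod.fst ×ˢ F.image Prod.snd, (O p.1 ∘L O' p.2) (X' p) := by
    rw [← Finset.sum_subset (subset_product_images F)]
    · exact Finset.sum_congr rfl fun p hp => by simp [hX', hp]
    · intro p _ hp
      simp [hX', hp]
  have e2 : ∑ p ∈ F, ‖X p‖ ^ 2 = ∑ p ∈ F.image Prod.fst ×ˢ F.image Prod.snd, ‖X' p‖ ^ 2 := by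
    rw [← Finset.sum_subset (subset_product_images F)]
    · exact Finset.sum_congr rfl fun p hp => by simp [hX', hp]
    · intro p _ hp
      simp [hX', hp]
  rw [e1, e2, Finset.sum_product, Finset.sum_product]
  simp only [ContinuousLinearMap.comp_apply, ← map_sum]
  refine (h.2 _ fun a => ∑ b ∈ F.image Prod.snd, O' b (X' (a, b))).trans ?_
  rw [mul_pow, mul_assoc]
  gcongr
  rw [Finset.mul_sum]
  exact Finset.sum_le_sum fun a _ => h'.2 _ fun b => X' (a, b)

theorem CoeffBdd.of_product {O : ι × κ → H →L[ℂ] H} {C : ℝ} (hC : 0 ≤ C)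
    (h : ∀ (F : Finset ι) (F' : Finset κ) (d : ι × κ → ℂ) (X : H),
      ‖∑ a ∈ F, ∑ b ∈ F', d (a, b) • O (a, b) X‖ ^ 2 ≤
        C ^ 2 * (∑ a ∈ F, ∑ b ∈ F', ‖d (a, b)‖ ^ 2) * ‖X‖ ^ 2) : CoeffBdd O C := by
  classical
  refine ⟨hC, fun F d X => ?_⟩
  set d' : ι × κ → ℂ := fun p => if p ∈ F then d p else 0 with hd'
  have e1 : ∑ p ∈ F, d p • O p X =
      ∑ p ∈ F.image Prod.fst ×ˢ F.image Prod.snd, d' p • O p X := by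
    rw [← Finset.sum_subset (subset_product_images F)]
    · exact Finset.sum_congr rfl fun p hp => by simp [hd', hp]
    · intro p _ hp
      simp [hd', hp]
  have e2 : ∑ p ∈ F, ‖d p‖ ^ 2 = ∑ p ∈ F.image Prod.fst ×ˢ F.image Prod.snd, ‖d' p‖ ^ 2 := by
    rw [← Finset.sum_subset (subset_product_images F)]
    · exact Finset.sum_congr rfl fun p hp => by simp [hd', hp]
    · intro p _ hp
      simp [hd', hp]
  rw [e1, e2, Finset.sum_product, Finset.sum_product]
  exact h _ _ _ _

/-- For fixed b the coefficient bound is used at the vector O'_b X; Cauchy-Schwarz in b then pairs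
the ℓ² norms of the slices d(·, b) with the column norm of O'. -/
theorem CoeffBdd.comp_col {O : ι → H →L[ℂ] H} {C : ℝ} (h : CoeffBdd O C)
    {O' : κ → H →L[ℂ] H} {C' : ℝ} (h' : ColBdd O' C') :
    CoeffBdd (fun p : ι × κ => O p.1 ∘L O' p.2) (C * C') := by
  refine CoeffBdd.of_product (mul_nonneg h.1 h'.1) fun F F' d X => ?_
  rw [Finset.sum_comm]
  have h1 : ∀ b, ‖∑ a ∈ F, d (a, b) • (O a ∘L O' b) X‖ ≤
      C * (√(∑ a ∈ F, ‖d (a, b)‖ ^ 2) * ‖O' b X‖) := fun b => by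
    refine le_of_sq_le_sq ?_ (by have := h.1; positivity)
    rw [mul_pow, mul_pow, Real.sq_sqrt (Finset.sum_nonneg fun _ _ => by positivity), ← mul_assoc]
    exact h.2 F (fun a => d (a, b)) (O' b X)
  have h2 : ‖∑ b ∈ F', ∑ a ∈ F, d (a, b) • (O a ∘L O' b) X‖ ≤
      C * (√(∑ b ∈ F', ∑ a ∈ F, ‖d (a, b)‖ ^ 2) * (C' * ‖X‖)) := by
    refine (norm_sum_le _ _).trans ((Finset.sum_le_sum fun b _ => h1 b).trans ?_)
    rw [← Finset.mul_sum]
    refine mul_le_mul_of_nonneg_left ((Real.sum_mul_le_sqrt_mul_sqrt _ _ _).trans ?_) h.1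
    have : √(∑ b ∈ F', ‖O' b X‖ ^ 2) ≤ C' * ‖X‖ := by
      rw [← Real.sqrt_sq (mul_nonneg h'.1 (norm_nonneg X))]
      exact Real.sqrt_le_sqrt (by rw [mul_pow]; exact h'.2 F' X)
    refine le_trans (mul_le_mul_of_nonneg_left this (Real.sqrt_nonneg _)) (le_of_eq ?_)
    congr 2
    refine Finset.sum_congr rfl fun b _ => Real.sq_sqrt (Finset.sum_nonneg fun _ _ => by positivity)
  rw [Finset.sum_comm (s := F) (t := F')]
  calc _ ≤ (C * (√(∑ b ∈ F', ∑ a ∈ F, ‖d (a, b)‖ ^ 2) * (C' * ‖X‖))) ^ 2 := by gcongr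
    _ = _ := by
      rw [mul_pow, mul_pow, Real.sq_sqrt (Finset.sum_nonneg fun _ _ =>
        Finset.sum_nonneg fun _ _ => by positivity)]
      ring

/-- The slices d(a, ·) produce vectors Y_a whose squared norms add up to the full ℓ² norm of d; the
row bound sums them. With `CoeffBdd.comp_col` this gives the pattern row, coefficients, column of
the interaction. -/
theorem RowBdd.comp_coeff {O : ι → H →L[ℂ] H} {C : ℝ} (h : RowBdd O C)
    {O' : κ → H →L[ℂ] H} {C' : ℝ} (h' : CoeffBdd O' C') :
    CoeffBdd (fun p : ι × κ => O p.1 ∘L O' p.2) (C * C') := by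
  refine CoeffBdd.of_product (mul_nonneg h.1 h'.1) fun F F' d X => ?_
  have e : ∑ a ∈ F, ∑ b ∈ F', d (a, b) • (O a ∘L O' b) X =
      ∑ a ∈ F, O a (∑ b ∈ F', d (a, b) • O' b X) := by simp
  rw [e]
  refine (h.2 F _).trans ?_
  calc _ ≤ C ^ 2 * ∑ a ∈ F, C' ^ 2 * (∑ b ∈ F', ‖d (a, b)‖ ^ 2) * ‖X‖ ^ 2 := by
        gcongr with a _
        exact h'.2 F' (fun b => d (a, b)) X
    _ = _ := by rw [← Finset.sum_mul, ← Finset.mul_sum]; ring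

theorem CoeffBdd.precomp {O : ι → H →L[ℂ] H} {C : ℝ} (h : CoeffBdd O C) {f : κ → ι}
    (hf : Function.Injective f) : CoeffBdd (fun b => O (f b)) C := by
  classical
  refine ⟨h.1, fun F d X => ?_⟩
  have := h.2 (F.map ⟨f, hf⟩) (Function.extend f d 0) X
  simpa [Finset.sum_map, hf.extend_apply] using this

/-! ### Infinite sums of bounded families, by Minkowski's inequality in ℓ². -/

theorem sqrt_sum_norm_add_sq_le {H : Type*} [NormedAddCommGroup H] (F : Finset ι) (x y : ι → H) :
    √(∑ a ∈ F, ‖x a + y a‖ ^ 2) ≤ √(∑ a ∈ F, ‖x a‖ ^ 2) + √(∑ a ∈ F, ‖y a‖ ^ 2) := by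
  have h := Real.Lp_add_le_of_nonneg (s := F) (p := 2) (f := fun a => ‖x a‖) (g := fun a => ‖y a‖)
    one_le_two (fun _ _ => norm_nonneg _) (fun _ _ => norm_nonneg _)
  simp only [Real.rpow_two, ← Real.sqrt_eq_rpow] at h
  refine le_trans (Real.sqrt_le_sqrt ?_) h
  gcongr
  exact norm_add_le _ _

theorem sqrt_sum_norm_sum_sq_le {H : Type*} [NormedAddCommGroup H] (F : Finset ι) (Q : Finset κ) (x : κ → ι → H) :
    √(∑ a ∈ F, ‖∑ q ∈ Q, x q a‖ ^ 2) ≤ ∑ q ∈ Q, √(∑ a ∈ F, ‖x q a‖ ^ 2) := by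
  classical
  induction Q using Finset.induction_on with
  | empty => simp
  | insert q Q hq ih =>
    simp only [Finset.sum_insert hq]
    exact (sqrt_sum_norm_add_sq_le F _ _).trans (by gcongr)

theorem ColBdd.of_hasSum {O : κ → ι → H →L[ℂ] H} {T : ι → H →L[ℂ] H} {C : κ → ℝ}
    (h : ∀ q, ColBdd (O q) (C q)) (hC : Summable C)
    (hT : ∀ a X, HasSum (fun q => O q a X) (T a X)) : ColBdd T (∑' q, C q) := by
  have h0 : 0 ≤ ∑' q, C q := tsum_nonneg fun q => (h q).1
  refine ⟨h0, fun F X => ?_⟩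
  have hlim : Filter.Tendsto (fun Q : Finset κ => √(∑ a ∈ F, ‖∑ q ∈ Q, O q a X‖ ^ 2)) Filter.atTop
      (nhds (√(∑ a ∈ F, ‖T a X‖ ^ 2))) :=
    (Real.continuous_sqrt.tendsto _).comp
      (tendsto_finsetSum _ fun a _ => ((hT a X).norm.pow 2))
  have hb : √(∑ a ∈ F, ‖T a X‖ ^ 2) ≤ (∑' q, C q) * ‖X‖ := by
    refine le_of_tendsto' hlim fun Q => (sqrt_sum_norm_sum_sq_le F Q _).trans ?_
    calc _ ≤ ∑ q ∈ Q, C q * ‖X‖ := Finset.sum_le_sum fun q _ => by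
          rw [← Real.sqrt_sq (mul_nonneg (h q).1 (norm_nonneg X)), mul_pow]
          exact Real.sqrt_le_sqrt ((h q).2 F X)
      _ ≤ _ := by
          rw [← Finset.sum_mul]
          gcongr
          exact hC.sum_le_tsum Q fun q _ => (h q).1
  have := pow_le_pow_left₀ (Real.sqrt_nonneg _) hb 2
  rwa [Real.sq_sqrt (Finset.sum_nonneg fun _ _ => by positivity), mul_pow] at this

theorem RowBdd.of_hasSum {O : κ → ι → H →L[ℂ] H} {T : ι → H →L[ℂ] H} {C : κ → ℝ}
    (h : ∀ q, RowBdd (O q) (C q)) (hC : Summable C)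
    (hT : ∀ a X, HasSum (fun q => O q a X) (T a X)) : RowBdd T (∑' q, C q) := by
  have h0 : 0 ≤ ∑' q, C q := tsum_nonneg fun q => (h q).1
  refine ⟨h0, fun F X => ?_⟩
  have hlim : Filter.Tendsto (fun Q : Finset κ => ‖∑ q ∈ Q, ∑ a ∈ F, O q a (X a)‖) Filter.atTop
      (nhds ‖∑ a ∈ F, T a (X a)‖) := (hasSum_sum fun a _ => hT a (X a)).norm
  have hb : ‖∑ a ∈ F, T a (X a)‖ ≤ (∑' q, C q) * √(∑ a ∈ F, ‖X a‖ ^ 2) := by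
    refine le_of_tendsto' hlim fun Q => (norm_sum_le _ _).trans ?_
    calc _ ≤ ∑ q ∈ Q, C q * √(∑ a ∈ F, ‖X a‖ ^ 2) := Finset.sum_le_sum fun q _ => by
          refine le_of_sq_le_sq ?_ (by have := (h q).1; positivity)
          rw [mul_pow, Real.sq_sqrt (Finset.sum_nonneg fun _ _ => by positivity)]
          exact (h q).2 F X
      _ ≤ _ := by
          rw [← Finset.sum_mul]
          gcongr
          exact hC.sum_le_tsum Q fun q _ => (h q).1
  have := pow_le_pow_left₀ (norm_nonneg _) hb 2
  rwa [mul_pow, Real.sq_sqrt (Finset.sum_nonneg fun _ _ => by positivity)] at this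

/-- A square summable combination of a coefficient-bounded family converges in norm. -/
theorem CoeffBdd.summable [CompleteSpace H] {O : ι → H →L[ℂ] H} {C : ℝ} (h : CoeffBdd O C)
    {d : ι → ℂ} (hd : Summable fun a => ‖d a‖ ^ 2) : Summable fun a => d a • O a := by
  rw [summable_iff_vanishing_norm] at hd ⊢
  intro ε hε
  have hC := h.1
  -- The denominator has `C + 1` in place of `C` to allow `C = 0`; the tails then have norm at most
  -- ε/2, hence less than ε.
  obtain ⟨s, hs⟩ := hd ((ε / (2 * (C + 1))) ^ 2) (by positivity)
  refine ⟨s, fun t ht => ?_⟩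
  have h1 := hs t ht
  rw [Real.norm_of_nonneg (Finset.sum_nonneg fun _ _ => by positivity)] at h1
  refine lt_of_le_of_lt (ContinuousLinearMap.opNorm_le_bound _ (M := ε / 2) (by positivity)
    fun X => ?_) (by linarith)
  refine le_of_sq_le_sq ?_ (by positivity)
  simp only [sum_apply, smul_apply]
  refine (h.2 t d X).trans ?_
  calc _ ≤ C ^ 2 * (ε / (2 * (C + 1))) ^ 2 * ‖X‖ ^ 2 := by gcongr
    _ = (C / (C + 1)) ^ 2 * ((ε / 2) * ‖X‖) ^ 2 := by field_simp
    _ ≤ 1 * ((ε / 2) * ‖X‖) ^ 2 := by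
        gcongr
        rw [sq_le_one_iff₀ (by positivity), div_le_one (by positivity)]
        linarith
    _ = _ := one_mul _

end OperatorFamilies

/-! ### Perturbations of self-adjoint operators -/

section Perturbation

variable {H : Type*} [NormedAddCommGroup H] [InnerProductSpace ℂ H]

/-- `R` is the resolvent `(A + μ)⁻¹`. -/
structure IsResolvent (A : H →ₗ.[ℂ] H) (μ : ℝ) (R : H →L[ℂ] H) : Prop where
  mem : ∀ y, R y ∈ A.domain
  apply : ∀ y, A ⟨R y, mem y⟩ = y - (μ : ℂ) • R y
  left_inv : ∀ x : A.domain, R (A x + (μ : ℂ) • (x : H)) = x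

/-- A single real μ suffices, since A + μ is onto: for u in the domain of the adjoint put v = (A* +
μ) u. Testing against vectors y = (A + μ) R y gives u = R v, which lies in the domain of A. -/
theorem isSelfAdjoint_of_resolvent [CompleteSpace H] {A : H →ₗ.[ℂ] H}
    (hd : Dense (A.domain : Set H)) (hs : A.IsFormalAdjoint A) {μ : ℝ} {R : H →L[ℂ] H}
    (hR : IsResolvent A μ R) : IsSelfAdjoint A := by
  rw [LinearPMap.isSelfAdjoint_def]
  have hle : A ≤ A.adjoint := hs.le_adjoint hd
  refine (LinearPMap.eq_of_le_of_domain_eq hle (le_antisymm hle.1 fun u hu => ?_)).symm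
  set v := A.adjoint ⟨u, hu⟩ + (μ : ℂ) • u with hv
  have key : u = R v := by
    refine ext_inner_right ℂ fun y => ?_
    have h1 := LinearPMap.adjoint_isFormalAdjoint hd ⟨u, hu⟩ ⟨R y, hR.mem y⟩
    have h2 := hs ⟨R v, hR.mem v⟩ ⟨R y, hR.mem y⟩
    simp only [hR.apply, inner_sub_left, inner_sub_right, inner_smul_left, inner_smul_right] at h1 h2
    rw [eq_sub_iff_add_eq] at h1
    have h3 : (inner ℂ v (R y) : ℂ) = inner ℂ u y := by
      rw [← h1, hv, inner_add_left, inner_smul_left, Complex.conj_ofReal]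
    rw [← h3]
    rw [Complex.conj_ofReal] at h2
    linear_combination h2
  rw [key]
  exact hR.mem v

/-- The operator `A + V` on the domain of `A`. -/
def perturb (A : H →ₗ.[ℂ] H) (V : A.domain →ₗ[ℂ] H) : H →ₗ.[ℂ] H where
  domain := A.domain
  toFun := A.toFun + V

theorem perturb_apply (A : H →ₗ.[ℂ] H) (V : A.domain →ₗ[ℂ] H) (x : A.domain) :
    perturb A V x = A x + V x := rfl

/-- With K = V R one has A + V + μ = (1 + K)(A + μ), so the new resolvent is R (1 + K)⁻¹, and the
Neumann series inverts 1 + K. -/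
theorem IsResolvent.perturb [CompleteSpace H] {A : H →ₗ.[ℂ] H} {V : A.domain →ₗ[ℂ] H} {μ : ℝ}
    {R : H →L[ℂ] H} (hR : IsResolvent A μ R) {K : H →L[ℂ] H} (hK : ∀ y, K y = V ⟨R y, hR.mem y⟩)
    (hK1 : ‖K‖ < 1) : ∃ B, IsResolvent (FermiFields.perturb A V) μ B := by
  have hu : IsUnit (1 + K) := by
    have := isUnit_one_sub_of_norm_lt_one (x := -K) (by rwa [norm_neg])
    rwa [sub_neg_eq_add] at this
  obtain ⟨J, hJ1, hJ2⟩ := isUnit_iff_exists.1 hu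
  have h1 : ∀ y, J y + K (J y) = y := fun y => by
    simpa using congrArg (fun T : H →L[ℂ] H => T y) hJ1
  have h2 : ∀ y, J (y + K y) = y := fun y => by
    simpa using congrArg (fun T : H →L[ℂ] H => T y) hJ2
  refine ⟨R ∘L J, fun y => hR.mem (J y), fun y => ?_, fun x => ?_⟩
  · refine (perturb_apply A V ⟨R (J y), hR.mem _⟩).trans ?_
    rw [hR.apply, ← hK]
    simp only [ContinuousLinearMap.comp_apply]
    refine Eq.trans ?_ (congrArg (· - (μ : ℂ) • R (J y)) (h1 y))
    abel
  · have hx : R (A x + (μ : ℂ) • (x : H)) = x := hR.left_inv x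
    have hV : K (A x + (μ : ℂ) • (x : H)) = V x := by
      rw [hK]
      exact congrArg V (Subtype.ext hx)
    refine Eq.trans ?_ hx
    rw [ContinuousLinearMap.comp_apply]
    congr 1
    refine Eq.trans ?_ (h2 _)
    rw [hV]
    refine congrArg J ?_
    refine (congrArg (· + (μ : ℂ) • (x : H)) (perturb_apply A V x)).trans ?_
    abel

theorem IsResolvent.identity {A : H →ₗ.[ℂ] H} {μ ν : ℝ} {B B' : H →L[ℂ] H}
    (h : IsResolvent A μ B) (h' : IsResolvent A ν B') (y : H) :
    B' y = B y + ((μ : ℂ) - ν) • B (B' y) := by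
  have h1 := h.left_inv ⟨B' y, h'.mem y⟩
  rw [h'.apply] at h1
  have h2 : y - (ν : ℂ) • B' y + (μ : ℂ) • B' y = y + ((μ : ℂ) - ν) • B' y := by
    rw [sub_smul]; abel
  have h3 : B (y + ((μ : ℂ) - ν) • B' y) = B' y := by
    rw [← h2]; exact h1
  rw [map_add, map_smul] at h3
  exact h3.symm

/-- The operator B = (A + μ₀)⁻¹ is self-adjoint. A negative spectral value r of B would obstruct the
inversion of A + (μ₀ - 1/r), which exists because μ₀ - 1/r ≥ μ₀. Hence B ≥ 0, and evaluating it at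
(A + μ₀) x gives the bound. -/
theorem bounded_below_of_resolvents [CompleteSpace H] {A : H →ₗ.[ℂ] H}
    (hs : A.IsFormalAdjoint A) {μ₀ : ℝ} (hR : ∀ μ, μ₀ ≤ μ → ∃ B, IsResolvent A μ B) (x : A.domain) :
    -μ₀ * ‖(x : H)‖ ^ 2 ≤ (inner ℂ (x : H) (A x)).re := by
  obtain ⟨B, hB⟩ := hR μ₀ le_rfl
  have hsa : IsSelfAdjoint B := by
    rw [ContinuousLinearMap.isSelfAdjoint_iff_isSymmetric]
    intro y z
    have h2 := hs ⟨B y, hB.mem y⟩ ⟨B z, hB.mem z⟩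
    simp only [hB.apply, inner_sub_left, inner_sub_right, inner_smul_left, inner_smul_right,
      Complex.conj_ofReal] at h2
    simp only [ContinuousLinearMap.coe_coe]
    linear_combination -h2
  have hpos : 0 ≤ B := by
    rw [StarOrderedRing.nonneg_iff_spectrum_nonneg (R := ℝ) B hsa]
    intro r hr
    by_contra! hneg
    refine spectrum.mem_iff.1 hr ?_
    obtain ⟨B', hB'⟩ := hR (μ₀ + -r⁻¹) (by
      have := inv_lt_zero.2 hneg
      linarith)
    have h1 := hB.identity hB'
    have h2 := hB'.identity hB
    have hr0 : (r : ℂ) ≠ 0 := by exact_mod_cast hneg.ne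
    have e : ∀ z : H, r • ((r⁻¹ : ℂ) • z) = z := fun z => by
      rw [← Complex.coe_smul r, smul_smul, mul_inv_cancel₀ hr0, one_smul]
    rw [isUnit_iff_exists]
    -- From 1 - B/r = (A + μ₀ - 1/r)(A + μ₀)⁻¹ the inverse of r - B is r⁻¹ (1 + r⁻¹ B'). The two
    -- resolvent identities verify the two products.
    refine ⟨(r⁻¹ : ℂ) • (1 + (r⁻¹ : ℂ) • B'), ?_, ?_⟩
    · ext y
      have h3 : B' y = B y + (r⁻¹ : ℂ) • B (B' y) := by
        simpa using h1 y
      change r • ((r⁻¹ : ℂ) • (y + (r⁻¹ : ℂ) • B' y)) - B ((r⁻¹ : ℂ) • (y + (r⁻¹ : ℂ) • B' y)) = y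
      rw [e, map_smul, map_add, map_smul, ← h3]
      abel
    · ext y
      have h3 : B y = B' y - (r⁻¹ : ℂ) • B' (B y) := by
        simpa [sub_eq_add_neg] using h2 y
      change (r⁻¹ : ℂ) • ((r • y - B y) + (r⁻¹ : ℂ) • B' (r • y - B y)) = y
      have e' : (r⁻¹ : ℂ) • r • B' y = B' y := by
        rw [← Complex.coe_smul r, smul_smul, inv_mul_cancel₀ hr0, one_smul]
      have e'' : B' (r • y - B y) = r • B' y - B' (B y) := by
        rw [map_sub, ← Complex.coe_smul r, map_smul, Complex.coe_smul]
      have h4 : r • y - B y + (B' y - (r⁻¹ : ℂ) • B' (B y)) = r • y := by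
        rw [← h3]
        abel
      rw [e'', smul_sub _ _ (B' (B y)), e', h4, ← Complex.coe_smul r, smul_smul,
        inv_mul_cancel₀ hr0, one_smul]
  have h1 := ((ContinuousLinearMap.nonneg_iff_isPositive B).1 hpos).2 (A x + (μ₀ : ℂ) • (x : H))
  rw [ContinuousLinearMap.reApplyInnerSelf_apply, hB.left_inv, inner_add_right, inner_smul_right,
    inner_self_eq_norm_sq_to_K] at h1
  simp only [RCLike.re_to_complex, Complex.add_re] at h1
  have h2 : ((μ₀ : ℂ) * ((‖(x : H)‖ : ℝ) : ℂ) ^ 2).re = μ₀ * ‖(x : H)‖ ^ 2 := by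
    rw [← Complex.ofReal_pow, ← Complex.ofReal_mul, Complex.ofReal_re]
  have h3 : ((μ₀ : ℂ) * ((‖(x : H)‖ : ℂ)) ^ 2).re = μ₀ * ‖(x : H)‖ ^ 2 := h2
  erw [h3] at h1
  linarith

/-- A formulation by closures of sets in `H × H`, which a continuous map of graphs can transport. -/
theorem hasCore_iff {A : H →ₗ.[ℂ] H} (hA : A.IsClosed) (D : Submodule ℂ H) :
    A.HasCore D ↔ D ≤ A.domain ∧ ∀ x : A.domain,
      ((x : H), A x) ∈ closure {p : H × H | ∃ z : A.domain, (z : H) ∈ D ∧ p = (↑z, A z)} := by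
  have hle : A.domRestrict D ≤ A := LinearPMap.domRestrict_le
  have hcl : (A.domRestrict D).IsClosable := hA.isClosable.leIsClosable hle
  have hg : ((A.domRestrict D).graph : Set (H × H)) =
      {p : H × H | ∃ z : A.domain, (z : H) ∈ D ∧ p = (↑z, A z)} := by
    ext p
    simp only [SetLike.mem_coe, LinearPMap.mem_graph_iff, Set.mem_ofPred_eq]
    constructor
    · rintro ⟨⟨y, hy⟩, h1, h2⟩
      have hy' : y ∈ D ⊓ A.domain := hy
      refine ⟨⟨y, hy'.2⟩, hy'.1, Prod.ext h1.symm ?_⟩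
      rw [← h2]
      exact LinearPMap.domRestrict_apply rfl
    · rintro ⟨z, hz, rfl⟩
      refine ⟨⟨z, show (z : H) ∈ D ⊓ A.domain from ⟨hz, z.2⟩⟩, rfl, ?_⟩
      exact LinearPMap.domRestrict_apply rfl
  have hgc : ((A.domRestrict D).closure.graph : Set (H × H)) =
      closure {p : H × H | ∃ z : A.domain, (z : H) ∈ D ∧ p = (↑z, A z)} := by
    rw [← hg, ← hcl.graph_closure_eq_closure_graph]
    rfl
  constructor
  · intro h
    refine ⟨h.1, fun x => ?_⟩
    rw [← hgc, h.2]
    exact A.mem_graph x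
  · rintro ⟨h1, h2⟩
    refine ⟨h1, LinearPMap.eq_of_eq_graph (SetLike.coe_injective ?_)⟩
    rw [hgc]
    refine Set.Subset.antisymm (closure_minimal ?_ hA) ?_
    · rintro p ⟨z, -, rfl⟩
      exact A.mem_graph z
    · rintro p hp
      obtain ⟨y, hy1, hy2⟩ := (LinearPMap.mem_graph_iff A).1 hp
      have := h2 y
      rwa [hy1, hy2] at this

/-- Because V factors through A + 1 by a bounded operator, (x, y) ↦ (x, y + W (y + x)) is a
continuous map taking the graph of A onto that of A + V. It carries the approximation of graph
points along. -/
theorem HasCore.perturb {A : H →ₗ.[ℂ] H} (hA : A.IsClosed) {V : A.domain →ₗ[ℂ] H}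
    (hAV : (perturb A V).IsClosed) {W : H →L[ℂ] H} (hW : ∀ x, V x = W (A x + (x : H)))
    {D : Submodule ℂ H} (hD : A.HasCore D) : (perturb A V).HasCore D := by
  rw [hasCore_iff hA] at hD
  rw [hasCore_iff hAV]
  refine ⟨hD.1, fun x => ?_⟩
  have hc : Continuous fun p : H × H => (p.1, p.2 + W (p.2 + p.1)) := by fun_prop
  have h1 := map_mem_closure hc (hD.2 x) (t := {p : H × H | ∃ z : (FermiFields.perturb A V).domain,
    (z : H) ∈ D ∧ p = (↑z, FermiFields.perturb A V z)}) (by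
      rintro p ⟨z, hz, rfl⟩
      refine ⟨z, hz, Prod.ext rfl ?_⟩
      refine Eq.trans ?_ (perturb_apply A V z).symm
      rw [hW])
  have h2 : FermiFields.perturb A V x = A x + W (A x + (x : H)) :=
    (perturb_apply A V x).trans (congrArg (A x + ·) (hW x))
  rw [h2]
  exact h1

/-- A version of the Kato-Rellich theorem: the perturbation `V` is symmetric and relatively bounded
with respect to `A`, and `V (A + μ)⁻¹` is small for large `μ`. -/
theorem katoRellich [CompleteSpace H] {A : H →ₗ.[ℂ] H} (hd : Dense (A.domain : Set H))
    (hs : A.IsFormalAdjoint A) {R : ℝ → H →L[ℂ] H} {μ₁ : ℝ}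
    (hR : ∀ μ, μ₁ ≤ μ → IsResolvent A μ (R μ)) {V : A.domain →ₗ[ℂ] H}
    (hV : ∀ x y : A.domain, (inner ℂ (V x) (y : H) : ℂ) = inner ℂ (x : H) (V y))
    {W : H →L[ℂ] H} (hW : ∀ x, V x = W (A x + (x : H)))
    {K : ℝ → H →L[ℂ] H} (hK : ∀ μ (h : μ₁ ≤ μ) y, K μ y = V ⟨R μ y, (hR μ h).mem y⟩)
    (hK1 : ∀ᶠ μ in Filter.atTop, ‖K μ‖ < 1) :
    IsSelfAdjoint (perturb A V) ∧
      (∃ c : ℝ, ∀ x : (perturb A V).domain,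
        c * ‖(x : H)‖ ^ 2 ≤ (inner ℂ (x : H) (perturb A V x)).re) ∧
      ∀ D : Submodule ℂ H, A.HasCore D → (perturb A V).HasCore D := by
  obtain ⟨μ₂, h2⟩ := Filter.eventually_atTop.1 hK1
  have hB : ∀ μ, max μ₁ μ₂ ≤ μ → ∃ B, IsResolvent (perturb A V) μ B := fun μ hμ =>
    (hR μ ((le_max_left _ _).trans hμ)).perturb (hK μ ((le_max_left _ _).trans hμ)) (h2 μ ((le_max_right _ _).trans hμ))
  have hs' : (perturb A V).IsFormalAdjoint (perturb A V) := fun x y => by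
    have e1 : perturb A V x = A x + V x := rfl
    have e2 : perturb A V y = A y + V y := rfl
    rw [e1, e2, inner_add_left, inner_add_right]
    exact congrArg₂ (· + ·) (hs x y) (hV x y)
  have hsa : IsSelfAdjoint (perturb A V) := by
    obtain ⟨B, hB⟩ := hB _ le_rfl
    exact isSelfAdjoint_of_resolvent (A := perturb A V) hd hs' hB
  refine ⟨hsa, ⟨_, bounded_below_of_resolvents hs' hB⟩, fun D hD => ?_⟩
  exact HasCore.perturb (isSelfAdjoint_of_resolvent hd hs (hR μ₁ le_rfl)).isClosed hsa.isClosed hW hD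

end Perturbation

/-! ### Coordinates of product measure spaces -/

section Lens

/-- `get` and `put` read and overwrite one factor of a product decomposition of `(Ω, μ)`, the
factor being `(X, ν)`. -/
def IsLens {Ω X : Type} [MeasurableSpace Ω] [MeasurableSpace X] (μ : Measure Ω) (ν : Measure X)
    (get : Ω → X) (put : Ω → X → Ω) : Prop :=
  ∃ (Y : Type) (_ : MeasurableSpace Y) (ρ : Measure Y) (_ : SigmaFinite ρ) (e : Ω ≃ᵐ X × Y),
    MeasurePreserving e μ (ν.prod ρ) ∧ (∀ ω, (e ω).1 = get ω) ∧
      ∀ ω x, put ω x = e.symm (x, (e ω).2)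

variable {Ω X T : Type} [MeasurableSpace Ω] [MeasurableSpace X] [MeasurableSpace T]
  {μ : Measure Ω} {ν : Measure X} {τ : Measure T} {get : Ω → X} {put : Ω → X → Ω}

theorem IsLens.get_put (h : IsLens μ ν get put) (ω : Ω) (x : X) : get (put ω x) = x := by
  obtain ⟨Y, _, ρ, _, e, -, h1, h2⟩ := h
  simp [← h1, h2]

theorem IsLens.put_get (h : IsLens μ ν get put) (ω : Ω) : put ω (get ω) = ω := by
  obtain ⟨Y, _, ρ, _, e, -, h1, h2⟩ := h
  simp [← h1, h2]

theorem IsLens.put_put (h : IsLens μ ν get put) (ω : Ω) (x y : X) :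
    put (put ω x) y = put ω y := by
  obtain ⟨Y, _, ρ, _, e, -, h1, h2⟩ := h
  simp [h2]

theorem measurePreserving_swap_factor {X Y : Type} [MeasurableSpace X] [MeasurableSpace Y]
    (ν : Measure X) (ρ : Measure Y) [SigmaFinite ν] [SigmaFinite ρ] :
    MeasurePreserving (fun p : (X × Y) × X => ((p.2, p.1.2), p.1.1))
      ((ν.prod ρ).prod ν) ((ν.prod ρ).prod ν) := by
  have h1 := measurePreserving_prodAssoc ν ρ ν
  have h2 : MeasurePreserving (Prod.map id Prod.swap) (ν.prod (ρ.prod ν)) (ν.prod (ν.prod ρ)) :=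
    (MeasurePreserving.id ν).prod Measure.measurePreserving_swap
  have h3 : MeasurePreserving (Prod.swap : X × (X × Y) → (X × Y) × X) (ν.prod (ν.prod ρ))
    ((ν.prod ρ).prod ν) := Measure.measurePreserving_swap
  exact h3.comp (h2.comp h1)

/-- Under the product decomposition this map exchanges the stored coordinate with the additional
one. It replaces explicit Fubini arguments in the remaining variables when a one-variable operator
is shown to be symmetric. -/
theorem IsLens.measurePreserving_swap [SigmaFinite ν] (h : IsLens μ ν get put) :
    MeasurePreserving (fun p : Ω × X => (put p.1 p.2, get p.1)) (μ.prod ν) (μ.prod ν) := by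
  obtain ⟨Y, _, ρ, _, e, he, h1, h2⟩ := h
  have : SigmaFinite μ := he.sigmaFinite
  have a1 : MeasurePreserving (Prod.map e id) (μ.prod ν) ((ν.prod ρ).prod ν) :=
    he.prod (MeasurePreserving.id ν)
  have a2 : MeasurePreserving (Prod.map e.symm id) ((ν.prod ρ).prod ν) (μ.prod ν) :=
    he.symm.prod (MeasurePreserving.id ν)
  have := a2.comp ((measurePreserving_swap_factor ν ρ).comp a1)
  convert this using 2 with p
  simp [h1, h2]

theorem IsLens.fst {A B : Type} [MeasurableSpace A] [MeasurableSpace B] (α : Measure A)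
    (β : Measure B) [SigmaFinite β] :
    IsLens (α.prod β) α (fun p => p.1) (fun p x => (x, p.2)) :=
  ⟨B, inferInstance, β, inferInstance, MeasurableEquiv.refl _, MeasurePreserving.id _,
    fun _ => rfl, fun _ _ => rfl⟩

theorem IsLens.pi {m : ℕ} (Y : Fin m → Type) [∀ i, MeasurableSpace (Y i)]
    (α : ∀ i, Measure (Y i)) [∀ i, SigmaFinite (α i)] (i : Fin m) :
    IsLens (Measure.pi α) (α i) (fun η => η i) (fun η x => Function.update η i x) := by
  cases m with
  | zero => exact i.elim0
  | succ k =>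
    refine ⟨_, inferInstance, Measure.pi fun j => α (i.succAbove j), inferInstance,
      MeasurableEquiv.piFinSuccAbove Y i, measurePreserving_piFinSuccAbove α i,
      fun _ => rfl, fun η x => ?_⟩
    rw [MeasurableEquiv.piFinSuccAbove_symm_apply]
    exact (Fin.insertNth_removeNth i x η).symm

theorem IsLens.comp [SigmaFinite τ] (h : IsLens μ ν get put) {get' : X → T} {put' : X → T → X}
    (h' : IsLens ν τ get' put') :
    IsLens μ τ (fun ω => get' (get ω)) (fun ω t => put ω (put' (get ω) t)) := by
  obtain ⟨Y, _, ρ, _, e, he, h1, h2⟩ := h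
  obtain ⟨Z, _, σ, _, f, hf, h3, h4⟩ := h'
  refine ⟨Z × Y, inferInstance, σ.prod ρ, inferInstance,
    (e.trans (f.prodCongr (MeasurableEquiv.refl Y))).trans MeasurableEquiv.prodAssoc,
    ?_, fun ω => ?_, fun ω t => ?_⟩
  · have : SigmaFinite ν := hf.sigmaFinite
    exact (measurePreserving_prodAssoc τ σ ρ).comp ((hf.prod (MeasurePreserving.id ρ)).comp he)
  · simp [← h1, ← h3, MeasurableEquiv.prodAssoc, MeasurableEquiv.prodCongr]
  · simp [← h1, h2, h4, MeasurableEquiv.prodAssoc, MeasurableEquiv.prodCongr]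

end Lens

/-! ### Adding a particle -/

theorem measurePreserving_reindex {X : Type} [MeasureSpace X] [SigmaFinite (volume : Measure X)]
    {k m : ℕ} (h : ∀ a : Fin m, (a : ℕ) < k) (hkm : m = k) :
    MeasurePreserving (fun (y : Fin k → X) (a : Fin m) => y ⟨a, h a⟩) volume volume := by
  subst hkm
  exact MeasurePreserving.id _

theorem measurePreserving_consReindex {X : Type} [MeasureSpace X]
    [SigmaFinite (volume : Measure X)] {k m : ℕ} (h : ∀ a : Fin m, (a : ℕ) ≠ 0 → (a : ℕ) - 1 < k)
    (hkm : m = k + 1) :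
    MeasurePreserving (fun (p : X × (Fin k → X)) (a : Fin m) =>
      if h0 : (a : ℕ) = 0 then p.1 else p.2 ⟨(a : ℕ) - 1, h a h0⟩) volume volume := by
  subst hkm
  have := (volume_preserving_piFinSuccAbove (fun _ : Fin (k + 1) => X) 0).symm
  convert! this using 1
  funext p a
  rw [MeasurableEquiv.piFinSuccAbove_symm_apply]
  refine Fin.cases ?_ (fun b => ?_) a
  · simp
  · simp

/-- The occupation numbers are only propositionally `l j` or `l i + 1`, so the map is analysed
species by species (`comp`) and the measures are compared on boxes. Species j ≠ i are merely
reindexed, and species i is a Fubini decomposition along its first variable. -/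
theorem measurePreserving_insertParticle {n : ℕ} (l : Fin n → ℕ) (i : Fin n) :
    MeasurePreserving (fun p : Particle × Config l => insertParticle i p.1 p.2)
      volume volume := by
  have hupd : ∀ j, j ≠ i → Function.update l i (l i + 1) j = l j := fun j hj =>
    Function.update_of_ne hj _ _
  have hupi : Function.update l i (l i + 1) i = l i + 1 := Function.update_self _ _ _
  set comp : (j : Fin n) → Particle → (Fin (l j) → Particle) →
      (Fin (Function.update l i (l i + 1) j) → Particle) := fun j x y a =>
    if h : j = i then
      if h0 : (a : ℕ) = 0 then x
      else y ⟨(a : ℕ) - 1, by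
        have ha := a.2
        subst h
        simp only [Function.update_self] at ha
        omega⟩
    else y ⟨(a : ℕ), by
      have ha := a.2
      simpa only [Function.update_of_ne h] using ha⟩ with hcomp
  have hne : ∀ j, j ≠ i → ∀ x, MeasurePreserving (comp j x) volume volume := by
    intro j hj x
    have := measurePreserving_reindex (X := Particle) (k := l j)
      (m := Function.update l i (l i + 1) j) (fun a => by rw [← hupd j hj]; exact a.2) (hupd j hj)
    convert this using 1
    funext y a
    simp only [hcomp, dif_neg hj]
  have hi : MeasurePreserving (fun p : Particle × (Fin (l i) → Particle) => comp i p.1 p.2)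
      volume volume := by
    have := measurePreserving_consReindex (X := Particle) (k := l i)
      (m := Function.update l i (l i + 1) i) (fun a h0 => by have := a.2; omega) hupi
    convert this using 1
    funext y a
    simp only [hcomp, dif_pos]
  have hcm : ∀ j, Measurable fun p : Particle × (Fin (l j) → Particle) => comp j p.1 p.2 := by
    intro j
    refine measurable_pi_lambda _ fun a => ?_
    by_cases hj : j = i
    · by_cases h0 : (a : ℕ) = 0
      · simp only [hcomp, dif_pos hj, dif_pos h0]
        exact measurable_fst
      · simp only [hcomp, dif_pos hj, dif_neg h0]
        exact (measurable_pi_apply _).comp measurable_snd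
    · simp only [hcomp, dif_neg hj]
      exact (measurable_pi_apply _).comp measurable_snd
  have hmeas : Measurable fun p : Particle × Config l => insertParticle i p.1 p.2 :=
    measurable_pi_lambda _ fun j => (hcm j).comp
      (measurable_fst.prodMk ((measurable_pi_apply j).comp measurable_snd))
  refine ⟨hmeas, ?_⟩
  refine Eq.symm ?_
  rw [volume_pi]
  refine Measure.pi_eq fun s hs => ?_
  rw [Measure.map_apply hmeas (MeasurableSet.univ_pi hs)]
  have hpre : (fun p : Particle × Config l => insertParticle i p.1 p.2) ⁻¹' Set.univ.pi s =
      {p : Particle × Config l | ∀ j, comp j p.1 (p.2 j) ∈ s j} := by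
    ext p
    simp only [Set.mem_preimage, Set.mem_univ_pi]
    rfl
  have hmp := hmeas (MeasurableSet.univ_pi hs)
  rw [Measure.volume_eq_prod, Measure.prod_apply hmp, hpre]
  have hsec : ∀ x : Particle, volume (Prod.mk x ⁻¹' {p : Particle × Config l |
      ∀ j, comp j p.1 (p.2 j) ∈ s j}) =
      volume (comp i x ⁻¹' s i) * ∏ j ∈ Finset.univ.erase i, volume (s j) := by
    intro x
    have : Prod.mk x ⁻¹' {p : Particle × Config l | ∀ j, comp j p.1 (p.2 j) ∈ s j} =
        Set.univ.pi fun j => comp j x ⁻¹' s j := by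
      ext η
      simp
    rw [this, volume_pi, Measure.pi_pi, ← Finset.mul_prod_erase _ _ (Finset.mem_univ i)]
    congr 1
    refine Finset.prod_congr rfl fun j hj => ?_
    exact (hne j (Finset.ne_of_mem_erase hj) x).measure_preimage (hs j).nullMeasurableSet
  simp only [hsec]
  have hv : volume ((fun p : Particle × (Fin (l i) → Particle) => comp i p.1 p.2) ⁻¹' s i) =
      ∫⁻ x : Particle, volume (comp i x ⁻¹' s i) := by
    rw [Measure.volume_eq_prod Particle, Measure.prod_apply (hcm i (hs i))]
    rfl
  rw [lintegral_mul_const, ← Finset.mul_prod_erase _ _ (Finset.mem_univ i)]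
  · congr 1
    rw [← hi.measure_preimage (hs i).nullMeasurableSet]
    exact hv.symm
  · exact measurable_measure_prodMk_left (hcm i (hs i))

/-! ### Contractions with a square integrable function -/

section Contraction

variable {Ω X : Type} [MeasurableSpace Ω] [MeasurableSpace X] {μ : Measure Ω} {ν : Measure X}

theorem lintegral_enorm_sq_lt_top {f : X → ℂ} (hf : MemLp f 2 ν) : ∫⁻ x, ‖f x‖ₑ ^ 2 ∂ν < ⊤ := by
  have := lintegral_rpow_enorm_lt_top_of_eLpNorm_lt_top (p := 2) (by norm_num) (by norm_num) hf.2
  simpa using this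

theorem memLp_two_iff {f : X → ℂ} (hf : AEStronglyMeasurable f ν) :
    MemLp f 2 ν ↔ ∫⁻ x, ‖f x‖ₑ ^ 2 ∂ν < ⊤ := by
  refine ⟨lintegral_enorm_sq_lt_top, fun h => ⟨hf, ?_⟩⟩
  rw [eLpNorm_lt_top_iff_lintegral_rpow_enorm_lt_top (by norm_num) (by norm_num)]
  simpa using h

theorem enorm_integral_mul_sq_le {f g : X → ℂ} (hf : AEStronglyMeasurable f ν)
    (hg : AEStronglyMeasurable g ν) :
    ‖∫ x, f x * g x ∂ν‖ₑ ^ 2 ≤ (∫⁻ x, ‖f x‖ₑ ^ 2 ∂ν) * ∫⁻ x, ‖g x‖ₑ ^ 2 ∂ν := by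
  have h1 : ‖∫ x, f x * g x ∂ν‖ₑ ≤ ∫⁻ x, ‖f x‖ₑ * ‖g x‖ₑ ∂ν := by
    refine (enorm_integral_le_lintegral_enorm _).trans_eq ?_
    simp only [enorm_mul]
  have h2 := ENNReal.lintegral_mul_le_Lp_mul_Lq ν Real.HolderConjugate.two_two hf.enorm hg.enorm
  calc ‖∫ x, f x * g x ∂ν‖ₑ ^ 2 ≤ ((∫⁻ x, ‖f x‖ₑ ^ (2 : ℝ) ∂ν) ^ (1 / 2 : ℝ) *
        (∫⁻ x, ‖g x‖ₑ ^ (2 : ℝ) ∂ν) ^ (1 / 2 : ℝ)) ^ 2 := by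
        gcongr
        exact h1.trans h2
    _ = _ := by
        rw [mul_pow, ← ENNReal.rpow_natCast, ← ENNReal.rpow_natCast, ← ENNReal.rpow_mul,
          ← ENNReal.rpow_mul]
        simp

theorem aestronglyMeasurable_contract [SFinite ν] {f : X → ℂ} (hf : AEStronglyMeasurable f ν)
    {A : Ω × X → ℂ} (hA : AEStronglyMeasurable A (μ.prod ν)) :
    AEStronglyMeasurable (fun ω => ∫ x, f x * A (ω, x) ∂ν) μ :=
  ((hf.comp_snd (μ := μ)).mul hA).integral_prod_right'

theorem lintegral_contract_le [SFinite ν] {f : X → ℂ} (hf : AEStronglyMeasurable f ν)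
    {A : Ω × X → ℂ} (hA : AEStronglyMeasurable A (μ.prod ν)) :
    ∫⁻ ω, ‖∫ x, f x * A (ω, x) ∂ν‖ₑ ^ 2 ∂μ ≤
      (∫⁻ x, ‖f x‖ₑ ^ 2 ∂ν) * ∫⁻ p, ‖A p‖ₑ ^ 2 ∂(μ.prod ν) := by
  rw [lintegral_prod _ (hA.enorm.pow_const 2)]
  refine le_trans (lintegral_mono_ae ?_) (lintegral_const_mul'' _ ?_).le
  · filter_upwards [hA.prodMk_left] with ω hω
    exact enorm_integral_mul_sq_le hf hω
  · exact (hA.enorm.pow_const 2).lintegral_prod_right'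

theorem memLp_contract [SFinite ν] {f : X → ℂ} (hf : MemLp f 2 ν)
    {A : Ω × X → ℂ} (hA : MemLp A 2 (μ.prod ν)) :
    MemLp (fun ω => ∫ x, f x * A (ω, x) ∂ν) 2 μ := by
  rw [memLp_two_iff (aestronglyMeasurable_contract hf.1 hA.1)]
  exact (lintegral_contract_le hf.1 hA.1).trans_lt
    (ENNReal.mul_lt_top (lintegral_enorm_sq_lt_top hf) (lintegral_enorm_sq_lt_top hA))

theorem lintegral_tensor [SFinite ν] [SFinite μ] {F : Ω → ℂ} {f : X → ℂ}
    (hF : AEStronglyMeasurable F μ) (hf : AEStronglyMeasurable f ν) :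
    ∫⁻ p : Ω × X, ‖F p.1 * f p.2‖ₑ ^ 2 ∂(μ.prod ν) =
      (∫⁻ ω, ‖F ω‖ₑ ^ 2 ∂μ) * ∫⁻ x, ‖f x‖ₑ ^ 2 ∂ν := by
  simp only [enorm_mul, mul_pow]
  exact lintegral_prod_mul (hF.enorm.pow_const 2) (hf.enorm.pow_const 2)

theorem memLp_tensor [SFinite ν] [SFinite μ] {F : Ω → ℂ} (hF : MemLp F 2 μ) {f : X → ℂ}
    (hf : MemLp f 2 ν) :
    MemLp (fun p : Ω × X => F p.1 * f p.2) 2 (μ.prod ν) := by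
  rw [memLp_two_iff (f := fun p : Ω × X => F p.1 * f p.2) (hF.1.comp_fst.mul hf.1.comp_snd), lintegral_tensor hF.1 hf.1]
  exact ENNReal.mul_lt_top (lintegral_enorm_sq_lt_top hF) (lintegral_enorm_sq_lt_top hf)

theorem MemLp.conj {f : X → ℂ} (hf : MemLp f 2 ν) : MemLp (fun x => conj (f x)) 2 ν := hf.star

theorem inner_toLp {f g : X → ℂ} (hf : MemLp f 2 ν) (hg : MemLp g 2 ν) :
    inner ℂ (hf.toLp f) (hg.toLp g) = ∫ x, conj (f x) * g x ∂ν := by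
  rw [L2.inner_def]
  refine integral_congr_ae ?_
  filter_upwards [hf.coeFn_toLp, hg.coeFn_toLp] with x h1 h2
  rw [h1, h2, RCLike.inner_apply, mul_comm]

theorem ofReal_norm_toLp_sq {f : X → ℂ} (hf : MemLp f 2 ν) :
    ENNReal.ofReal (‖hf.toLp f‖ ^ 2) = ∫⁻ x, ‖f x‖ₑ ^ 2 ∂ν := by
  rw [Lp.norm_toLp, ENNReal.ofReal_pow ENNReal.toReal_nonneg, ENNReal.ofReal_toReal hf.2.ne,
    eLpNorm_eq_lintegral_rpow_enorm_toReal (by norm_num) (by norm_num), ← ENNReal.rpow_natCast,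
    ← ENNReal.rpow_mul]
  simp

/-- With y = ∑ v_a, orthogonality gives ‖y‖² = ∑ ‖v_a‖² = N ⟨y, x⟩ ≤ |N| ‖y‖ ‖x‖; divide by ‖y‖. It
is meant for v_a = P_a x with symmetric P_a satisfying P_a² = N P_a. -/
theorem sum_norm_sq_le_of_orthogonal {E ι : Type*} [NormedAddCommGroup E] [InnerProductSpace ℂ E]
    (s : Finset ι) (v : ι → E) (x : E) {N : ℝ}
    (horth : ∀ a ∈ s, ∀ b ∈ s, a ≠ b → inner ℂ (v a) (v b) = (0 : ℂ))
    (h : ∀ a ∈ s, ((‖v a‖ ^ 2 : ℝ) : ℂ) = N * inner ℂ (v a) x) :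
    ∑ a ∈ s, ‖v a‖ ^ 2 ≤ N ^ 2 * ‖x‖ ^ 2 := by
  have h1 : (inner ℂ (∑ a ∈ s, v a) (∑ a ∈ s, v a) : ℂ) = ((∑ a ∈ s, ‖v a‖ ^ 2 : ℝ) : ℂ) := by
    rw [sum_inner]
    push_cast
    refine Finset.sum_congr rfl fun a ha => ?_
    rw [inner_sum, Finset.sum_eq_single a (fun b hb hab => horth a ha b hb hab.symm)
      (fun h => absurd ha h), inner_self_eq_norm_sq_to_K]
    rfl
  have h2 : (N : ℂ) * inner ℂ (∑ a ∈ s, v a) x = ((∑ a ∈ s, ‖v a‖ ^ 2 : ℝ) : ℂ) := by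
    rw [sum_inner, Finset.mul_sum]
    push_cast
    exact Finset.sum_congr rfl fun a ha => by rw [← h a ha]; push_cast; rfl
  set S := ∑ a ∈ s, ‖v a‖ ^ 2 with hS
  set y := ∑ a ∈ s, v a with hy
  have h3 : ‖y‖ ^ 2 = S := by
    have := inner_self_eq_norm_sq_to_K (𝕜 := ℂ) y
    rw [h1] at this
    have h4 : ((‖y‖ ^ 2 : ℝ) : ℂ) = (S : ℂ) := by rw [this]; push_cast; rfl
    exact_mod_cast h4
  have h5 : S ≤ |N| * (‖y‖ * ‖x‖) := by
    have h6 : ‖(N : ℂ) * inner ℂ y x‖ = S := by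
      rw [h2, Complex.norm_real, Real.norm_of_nonneg]
      exact Finset.sum_nonneg fun _ _ => by positivity
    rw [← h6, norm_mul, Complex.norm_real, Real.norm_eq_abs]
    gcongr
    exact norm_inner_le_norm _ _
  rcases (norm_nonneg y).eq_or_lt' with h0 | h0
  · rw [← h3, h0, zero_pow two_ne_zero]
    positivity
  · have h7 : ‖y‖ ≤ |N| * ‖x‖ := by
      refine le_of_mul_le_mul_right ?_ h0
      calc ‖y‖ * ‖y‖ = S := by rw [← h3]; ring
        _ ≤ _ := h5
        _ = _ := by ring
    rw [← h3, ← sq_abs N, ← mul_pow]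
    gcongr

/-! ### Rank one operators in one variable. -/

/-- The rank one operator `|f̄⟩⟨f̄|` acting on one coordinate. -/
def slotProj (ν : Measure X) (get : Ω → X) (put : Ω → X → Ω) (f : X → ℂ) (F : Ω → ℂ) (ω : Ω) : ℂ :=
  conj (f (get ω)) * ∫ x, f x * F (put ω x) ∂ν

variable {get : Ω → X} {put : Ω → X → Ω}

theorem IsLens.memLp_swap [SigmaFinite ν] [SigmaFinite μ] (h : IsLens μ ν get put) {f : X → ℂ}
    (hf : MemLp f 2 ν) {F : Ω → ℂ} (hF : MemLp F 2 μ) :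
    MemLp (fun p : Ω × X => f (get p.1) * F (put p.1 p.2)) 2 (μ.prod ν) := by
  have := (memLp_tensor hF hf).comp_measurePreserving h.measurePreserving_swap
  refine this.congr_norm ?_ (Filter.Eventually.of_forall fun p => ?_)
  · convert this.1 using 2 with p
    exact mul_comm _ _
  · simp [mul_comm]

theorem IsLens.memLp_slotProj [SigmaFinite ν] [SigmaFinite μ] (h : IsLens μ ν get put) {f : X → ℂ}
    (hf : MemLp f 2 ν) {F : Ω → ℂ} (hF : MemLp F 2 μ) : MemLp (slotProj ν get put f F) 2 μ := by
  have := memLp_contract hf (h.memLp_swap (MemLp.conj hf) hF)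
  convert this using 2 with ω
  rw [slotProj, ← integral_const_mul]
  congr 1
  funext x
  ring

/-- Both sides are integrals over Ω × X, and their integrands `I` and `J` are exchanged by the
measure-preserving swap of the slot with the extra variable. -/
theorem IsLens.inner_slotProj [SigmaFinite ν] [SigmaFinite μ] (h : IsLens μ ν get put) {f : X → ℂ}
    (hf : MemLp f 2 ν) {F G : Ω → ℂ} (hF : MemLp F 2 μ) (hG : MemLp G 2 μ) :
    ∫ ω, conj (slotProj ν get put f F ω) * G ω ∂μ = ∫ ω, conj (F ω) * slotProj ν get put f G ω ∂μ := by
  set I : Ω × X → ℂ := fun p => (f (get p.1) * conj (F (put p.1 p.2))) * (G p.1 * conj (f p.2))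
    with hI
  have hint : Integrable I (μ.prod ν) :=
    (h.memLp_swap hf (MemLp.conj hF)).integrable_mul (memLp_tensor hG (MemLp.conj hf))
  set J : Ω × X → ℂ := fun p => (conj (f (get p.1)) * G (put p.1 p.2)) * (conj (F p.1) * f p.2)
    with hJ
  have hintJ : Integrable J (μ.prod ν) :=
    (h.memLp_swap (MemLp.conj hf) hG).integrable_mul (memLp_tensor (MemLp.conj hF) hf)
  have e1 : ∫ ω, conj (slotProj ν get put f F ω) * G ω ∂μ = ∫ p, I p ∂(μ.prod ν) := by
    rw [integral_prod _ hint]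
    congr 1
    funext ω
    rw [slotProj, map_mul, Complex.conj_conj, ← integral_conj, mul_right_comm, mul_comm,
      ← integral_mul_const]
    congr 1
    funext x
    simp only [hI, map_mul]
    ring
  have e2 : ∫ ω, conj (F ω) * slotProj ν get put f G ω ∂μ = ∫ p, J p ∂(μ.prod ν) := by
    rw [integral_prod _ hintJ]
    congr 1
    funext ω
    rw [slotProj, mul_left_comm, mul_comm, mul_assoc, mul_comm, mul_assoc, ← integral_mul_const]
    congr 1
    funext x
    simp only [hJ]
    ring
  have hsw := h.measurePreserving_swap
  have e3 : I = fun p : Ω × X => J (put p.1 p.2, get p.1) := by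
    funext p
    simp only [hI, hJ, h.get_put, h.put_put, h.put_get]
    ring
  have e4 : ∫ p, J p ∂(μ.prod ν) = ∫ p : Ω × X, J (put p.1 p.2, get p.1) ∂(μ.prod ν) := by
    rw [← hsw.map_eq, integral_map hsw.measurable.aemeasurable (by rw [hsw.map_eq]; exact hintJ.1),
      hsw.map_eq]
  rw [e1, e2, e4, e3]

theorem IsLens.slotProj_slotProj (h : IsLens μ ν get put) (f : X → ℂ) (F : Ω → ℂ) (ω : Ω) :
    slotProj ν get put f (slotProj ν get put f F) ω =
      (∫ x, f x * conj (f x) ∂ν) * slotProj ν get put f F ω := by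
  simp only [slotProj, h.get_put, h.put_put]
  simp only [← mul_assoc, integral_mul_const]
  ring

theorem IsLens.ae_put [SigmaFinite ν] (h : IsLens μ ν get put) {p : Ω → Prop}
    (hp : ∀ᵐ ω ∂μ, p ω) : ∀ᵐ ω ∂μ, ∀ᵐ x ∂ν, p (put ω x) := by
  obtain ⟨Y, _, ρ, _, e, he, h1, h2⟩ := h
  have a1 : ∀ᵐ q ∂(ν.prod ρ), p (e.symm q) := he.symm.quasiMeasurePreserving.ae hp
  have a2 : ∀ᵐ q ∂(ρ.prod ν), p (e.symm q.swap) :=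
    Measure.measurePreserving_swap.quasiMeasurePreserving.ae a1
  have a3 := Measure.ae_ae_of_ae_prod a2
  have a4 : ∀ᵐ q ∂(ν.prod ρ), ∀ᵐ x ∂ν, p (e.symm (x, q.2)) :=
    Measure.quasiMeasurePreserving_snd.ae a3
  filter_upwards [he.quasiMeasurePreserving.ae a4] with ω hω
  simpa only [h2] using hω

theorem IsLens.slotProj_congr [SigmaFinite ν] (h : IsLens μ ν get put) (f : X → ℂ) {F G : Ω → ℂ}
    (hFG : F =ᵐ[μ] G) : slotProj ν get put f F =ᵐ[μ] slotProj ν get put f G := by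
  filter_upwards [h.ae_put hFG] with ω hω
  rw [slotProj, slotProj]
  congr 1
  refine integral_congr_ae ?_
  filter_upwards [hω] with x hx
  rw [hx]

end Contraction

/-! ### States and operators on the Fock space -/

section Operators

variable {n : ℕ}

/-- The squared norm of a wave function. -/
def normSq (Φ : WaveFunction n) : ENNReal := ∑' l, ∫⁻ η : Config l, ‖Φ l η‖ₑ ^ 2

theorem ofReal_norm_sq_wave (Ψ : FockSpace n) : ENNReal.ofReal (‖Ψ‖ ^ 2) = normSq (wave Ψ) := by
  have h1 : HasSum (fun l => ‖Ψ l‖ ^ 2) (‖Ψ‖ ^ 2) := by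
    have := lp.hasSum_norm (p := 2) (by norm_num) Ψ
    simpa using this
  rw [← h1.tsum_eq, ENNReal.ofReal_tsum_of_nonneg (fun _ => by positivity) h1.summable, normSq]
  congr 1
  funext l
  have h2 := ofReal_norm_toLp_sq (Lp.memLp ((Ψ l : antisymL2 l) : Lp ℂ 2 (volume : Measure (Config l))))
  rw [Lp.toLp_coeFn] at h2
  exact h2

/-- Antisymmetry under permutations of the variables of each species. -/
def IsAntisymm {l : Fin n → ℕ} (F : Config l → ℂ) : Prop :=
  ∀ σ : (i : Fin n) → Equiv.Perm (Fin (l i)),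
    (fun η => F (permute σ η)) =ᵐ[volume] fun η => (∏ i, ((Equiv.Perm.sign (σ i) : ℤ) : ℂ)) * F η

/-- The wave functions of the vectors of the Fock space. -/
structure IsState (Φ : WaveFunction n) : Prop where
  meas : ∀ l, AEStronglyMeasurable (Φ l) volume
  antisymm : ∀ l, IsAntisymm (Φ l)
  finite : normSq Φ < ⊤

theorem mem_antisymL2_iff {l : Fin n → ℕ} (F : Lp ℂ 2 (volume : Measure (Config l))) :
    F ∈ antisymL2 l ↔ IsAntisymm F := by
  simp only [antisymL2, Submodule.mem_iInf, LinearMap.mem_ker, LinearMap.sub_apply,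
    sub_eq_zero, LinearMap.smul_apply, LinearMap.id_apply]
  refine forall_congr' fun σ => ?_
  have h1 : (Lp.compMeasurePreservingₗᵢ ℂ (permute σ) (measurePreserving_permute σ)).toLinearMap F
      =ᵐ[volume] fun η => F (permute σ η) :=
    Lp.coeFn_compMeasurePreserving F (measurePreserving_permute σ)
  have h2 := Lp.coeFn_smul (∏ i, ((Equiv.Perm.sign (σ i) : ℤ) : ℂ)) F
  rw [Lp.ext_iff]
  constructor
  · intro h
    filter_upwards [h, h1, h2] with η a1 a2 a3
    rw [← a2, a1, a3]
    rfl
  · intro h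
    filter_upwards [h, h1, h2] with η a1 a2 a3
    rw [a2, a1, a3]
    rfl

theorem isState_wave (Ψ : FockSpace n) : IsState (wave Ψ) where
  meas l := Lp.aestronglyMeasurable _
  antisymm l := (mem_antisymL2_iff _).1 (Ψ l).2
  finite := by rw [← ofReal_norm_sq_wave]; exact ENNReal.ofReal_lt_top

theorem IsState.memLp {Φ : WaveFunction n} (h : IsState Φ) (l : Fin n → ℕ) :
    MemLp (Φ l) 2 volume := by
  rw [memLp_two_iff (h.meas l)]
  exact (ENNReal.le_tsum l).trans_lt h.finite

theorem memLp_wave (Ψ : FockSpace n) (l : Fin n → ℕ) : MemLp (wave Ψ l) 2 volume :=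
  (isState_wave Ψ).memLp l

theorem IsState.exists_wave {Φ : WaveFunction n} (h : IsState Φ) :
    ∃ Ψ : FockSpace n, ∀ l, wave Ψ l =ᵐ[volume] Φ l := by
  have hanti : ∀ l, (h.memLp l).toLp (Φ l) ∈ antisymL2 l := fun l => by
    rw [mem_antisymL2_iff]
    intro σ
    filter_upwards [h.antisymm l σ, (h.memLp l).coeFn_toLp,
      (measurePreserving_permute σ).quasiMeasurePreserving.ae (h.memLp l).coeFn_toLp]
      with η a1 a2 a3
    rw [a3, a2, a1]
  have hmem : Memℓp (fun l => (⟨(h.memLp l).toLp (Φ l), hanti l⟩ : antisymL2 l)) 2 := by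
    refine memℓp_gen ?_
    have hsum : ∑' l, ENNReal.ofReal (‖(h.memLp l).toLp (Φ l)‖ ^ 2) ≠ ⊤ := by
      simp only [ofReal_norm_toLp_sq]
      exact h.finite.ne
    have := ENNReal.summable_toReal hsum
    simp only [ENNReal.toReal_ofReal (sq_nonneg _)] at this
    simpa using this
  refine ⟨⟨_, hmem⟩, fun l => ?_⟩
  exact (h.memLp l).coeFn_toLp

theorem normSq_congr {Φ Θ : WaveFunction n} (h : ∀ l, Φ l =ᵐ[volume] Θ l) :
    normSq Φ = normSq Θ := by
  refine tsum_congr fun l => lintegral_congr_ae ?_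
  filter_upwards [h l] with η hη
  rw [hη]

/-- Bounded operators given by their action on wave functions. -/
theorem exists_operator (L : WaveFunction n → WaveFunction n) {C : ℝ} (hC : 0 ≤ C)
    (hs : ∀ Ψ : FockSpace n, IsState (L (wave Ψ)))
    (ha : ∀ (Φ Ψ : FockSpace n) l, L (wave (Φ + Ψ)) l =ᵐ[volume]
      fun η => L (wave Φ) l η + L (wave Ψ) l η)
    (hm : ∀ (c : ℂ) (Ψ : FockSpace n) l, L (wave (c • Ψ)) l =ᵐ[volume]
      fun η => c * L (wave Ψ) l η)
    (hb : ∀ Ψ : FockSpace n, normSq (L (wave Ψ)) ≤ ENNReal.ofReal (C ^ 2) * normSq (wave Ψ)) :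
    ∃ T : FockSpace n →L[ℂ] FockSpace n, (∀ Ψ l, wave (T Ψ) l =ᵐ[volume] L (wave Ψ) l) ∧
      ‖T‖ ≤ C := by
  choose t ht using fun Ψ => (hs Ψ).exists_wave
  let T₀ : FockSpace n →ₗ[ℂ] FockSpace n :=
    { toFun := t
      map_add' := fun Φ Ψ => ext_wave fun l => by
        filter_upwards [ht (Φ + Ψ) l, ht Φ l, ht Ψ l, ha Φ Ψ l, wave_add (t Φ) (t Ψ) l]
          with η h1 h2 h3 h4 h5
        rw [h1, h5, h2, h3, h4]
      map_smul' := fun c Ψ => ext_wave fun l => by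
        filter_upwards [ht (c • Ψ) l, ht Ψ l, hm c Ψ l, wave_smul c (t Ψ) l] with η h1 h2 h3 h4
        rw [h1, RingHom.id_apply, h4, h2, h3] }
  have hb' : ∀ Ψ, ‖T₀ Ψ‖ ≤ C * ‖Ψ‖ := fun Ψ => by
    refine le_of_sq_le_sq ?_ (by positivity)
    rw [← ENNReal.ofReal_le_ofReal_iff (by positivity), mul_pow,
      ENNReal.ofReal_mul (by positivity), ofReal_norm_sq_wave, ofReal_norm_sq_wave]
    exact (normSq_congr (ht Ψ)).trans_le (hb Ψ)
  exact ⟨T₀.mkContinuous C hb', fun Ψ l => ht Ψ l, LinearMap.mkContinuous_norm_le _ hC _⟩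

/-! ### Multiplication operators -/

/-- A bounded measurable permutation invariant real function of the configurations. -/
structure IsWeight (v : (l : Fin n → ℕ) → Config l → ℝ) (C : ℝ) : Prop where
  nonneg : 0 ≤ C
  meas : ∀ l, Measurable (v l)
  symm : ∀ l σ (η : Config l), v l (permute σ η) = v l η
  bound : ∀ l η, |v l η| ≤ C

theorem IsWeight.isState {v : (l : Fin n → ℕ) → Config l → ℝ} {C : ℝ} (hv : IsWeight v C)
    {Φ : WaveFunction n} (h : IsState Φ) : IsState (fun l η => (v l η : ℂ) * Φ l η) ∧
      normSq (fun l η => (v l η : ℂ) * Φ l η) ≤ ENNReal.ofReal (C ^ 2) * normSq Φ := by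
  have hb : normSq (fun l η => (v l η : ℂ) * Φ l η) ≤ ENNReal.ofReal (C ^ 2) * normSq Φ := by
    rw [normSq, normSq, ← ENNReal.tsum_mul_left]
    refine ENNReal.tsum_le_tsum fun l => ?_
    rw [← lintegral_const_mul'' _ ((h.meas l).enorm.pow_const 2)]
    refine lintegral_mono fun η => ?_
    rw [enorm_mul, mul_pow]
    gcongr
    rw [ENNReal.ofReal_pow hv.nonneg]
    gcongr
    rw [← ofReal_norm, Complex.norm_real]
    exact ENNReal.ofReal_le_ofReal (hv.bound l η)
  refine ⟨⟨fun l => ?_, fun l σ => ?_, hb.trans_lt (ENNReal.mul_lt_top ENNReal.ofReal_lt_top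
    h.finite)⟩, hb⟩
  · exact (Complex.measurable_ofReal.comp (hv.meas l)).aestronglyMeasurable.mul (h.meas l)
  · filter_upwards [h.antisymm l σ] with η hη
    rw [hη, hv.symm]
    ring

theorem IsWeight.exists_mulOp {v : (l : Fin n → ℕ) → Config l → ℝ} {C : ℝ} (hv : IsWeight v C) :
    ∃ T : FockSpace n →L[ℂ] FockSpace n,
      (∀ Ψ l, wave (T Ψ) l =ᵐ[volume] fun η => (v l η : ℂ) * wave Ψ l η) ∧ ‖T‖ ≤ C := by
  refine exists_operator (fun Φ l η => (v l η : ℂ) * Φ l η) hv.nonneg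
    (fun Ψ => (hv.isState (isState_wave Ψ)).1) (fun Φ Ψ l => ?_) (fun c Ψ l => ?_)
    (fun Ψ => (hv.isState (isState_wave Ψ)).2)
  · filter_upwards [wave_add Φ Ψ l] with η h
    rw [h, mul_add]
  · filter_upwards [wave_smul c Ψ l] with η h
    rw [h]
    ring

open scoped Classical in
/-- The operator of multiplication by a bounded weight. -/
def mulOp (v : (l : Fin n → ℕ) → Config l → ℝ) : FockSpace n →L[ℂ] FockSpace n :=
  if h : ∃ C, IsWeight v C then h.choose_spec.exists_mulOp.choose else 0

theorem IsWeight.wave_mulOp {v : (l : Fin n → ℕ) → Config l → ℝ} {C : ℝ} (hv : IsWeight v C)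
    (Ψ : FockSpace n) (l : Fin n → ℕ) :
    wave (mulOp v Ψ) l =ᵐ[volume] fun η => (v l η : ℂ) * wave Ψ l η := by
  have h : ∃ C, IsWeight v C := ⟨C, hv⟩
  rw [mulOp, dif_pos h]
  exact h.choose_spec.exists_mulOp.choose_spec.1 Ψ l

theorem IsWeight.norm_mulOp_le {v : (l : Fin n → ℕ) → Config l → ℝ} {C : ℝ} (hv : IsWeight v C) :
    ‖mulOp v‖ ≤ C := by
  obtain ⟨T, hT, hTC⟩ := hv.exists_mulOp
  have : mulOp v = T := by
    ext1 Ψ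
    exact ext_wave fun l => (hv.wave_mulOp Ψ l).trans (hT Ψ l).symm
  rwa [this]

theorem IsWeight.mul {v w : (l : Fin n → ℕ) → Config l → ℝ} {C D : ℝ} (hv : IsWeight v C)
    (hw : IsWeight w D) : IsWeight (fun l η => v l η * w l η) (C * D) where
  nonneg := mul_nonneg hv.nonneg hw.nonneg
  meas l := (hv.meas l).mul (hw.meas l)
  symm l σ η := by rw [hv.symm, hw.symm]
  bound l η := by
    rw [abs_mul]
    exact mul_le_mul (hv.bound l η) (hw.bound l η) (abs_nonneg _) hv.nonneg

theorem mulOp_comp_mulOp {v w : (l : Fin n → ℕ) → Config l → ℝ} {C D : ℝ} (hv : IsWeight v C)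
    (hw : IsWeight w D) : mulOp v ∘L mulOp w = mulOp (fun l η => v l η * w l η) := by
  ext1 Ψ
  refine ext_wave fun l => ?_
  filter_upwards [hv.wave_mulOp (mulOp w Ψ) l, hw.wave_mulOp Ψ l, (hv.mul hw).wave_mulOp Ψ l]
    with η h1 h2 h3
  rw [ContinuousLinearMap.comp_apply, h1, h2, h3]
  push_cast
  ring

theorem inner_wave (Φ Ψ : FockSpace n) :
    inner ℂ Φ Ψ = ∑' l, ∫ η, conj (wave Φ l η) * wave Ψ l η := by
  rw [lp.inner_eq_tsum]
  congr 1
  funext l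
  rw [Submodule.coe_inner, L2.inner_def]
  congr 1
  funext η
  rw [RCLike.inner_apply, mul_comm]
  rfl

theorem IsWeight.adjoint_mulOp {v : (l : Fin n → ℕ) → Config l → ℝ} {C : ℝ} (hv : IsWeight v C) :
    (mulOp v).adjoint = mulOp v := by
  refine Eq.symm ((ContinuousLinearMap.eq_adjoint_iff _ _).2 fun Φ Ψ => ?_)
  rw [inner_wave, inner_wave]
  congr 1
  funext l
  refine integral_congr_ae ?_
  filter_upwards [hv.wave_mulOp Φ l, hv.wave_mulOp Ψ l] with η h1 h2
  rw [h1, h2, map_mul, Complex.conj_ofReal]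
  ring

end Operators

/-! ### The Pauli principle -/

section Pauli

variable {n : ℕ}

/-- Overwrite the variable of the `a`-th particle of species `i`. -/
def putSlot {m : Fin n → ℕ} (i : Fin n) (a : Fin (m i)) (η : Config m) (x : Particle) : Config m :=
  Function.update η i (Function.update (η i) a x)

theorem isLens_slot {m : Fin n → ℕ} (i : Fin n) (a : Fin (m i)) :
    IsLens (volume : Measure (Config m)) (volume : Measure Particle) (fun η => η i a)
      (putSlot i a) :=
  (IsLens.pi (fun j => Fin (m j) → Particle) (fun _ => volume) i).comp
    (IsLens.pi (fun _ => Particle) (fun _ => volume) a)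

/-- The transposition of two particles of species `i`. -/
def slotSwap {m : Fin n → ℕ} (i : Fin n) (a b : Fin (m i)) (j : Fin n) : Equiv.Perm (Fin (m j)) :=
  Function.update (fun j => (1 : Equiv.Perm (Fin (m j)))) i (Equiv.swap a b) j

theorem prod_sign_slotSwap {m : Fin n → ℕ} (i : Fin n) {a b : Fin (m i)} (hab : a ≠ b) :
    ∏ j, ((Equiv.Perm.sign (slotSwap i a b j) : ℤ) : ℂ) = -1 := by
  rw [Finset.prod_eq_single i]
  · simp [slotSwap, Equiv.Perm.sign_swap hab]
  · intro j _ hj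
    simp [slotSwap, Function.update_of_ne hj]
  · simp

theorem permute_slotSwap_apply {m : Fin n → ℕ} (i : Fin n) (a b : Fin (m i)) (η : Config m) :
    permute (slotSwap i a b) η = Function.update η i (fun c => η i (Equiv.swap a b c)) := by
  funext j c
  by_cases hj : j = i
  · subst hj
    simp [permute, slotSwap]
  · simp [permute, slotSwap, Function.update_of_ne hj]

theorem putSlot_permute {m : Fin n → ℕ} (i : Fin n) (a b : Fin (m i)) (η : Config m)
    (x : Particle) :
    putSlot i a (permute (slotSwap i a b) η) x = permute (slotSwap i a b) (putSlot i b η x) := by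
  simp only [permute_slotSwap_apply, putSlot, Function.update_idem, Function.update_self]
  congr 1
  funext c
  by_cases hc : c = a
  · subst hc
    simp
  · rw [Function.update_of_ne hc]
    have : Equiv.swap a b c ≠ b := fun h => hc (by
      rw [← Equiv.swap_apply_self a b c, h, Equiv.swap_apply_right])
    rw [Function.update_of_ne this]

theorem putSlot_comm {m : Fin n → ℕ} (i : Fin n) {a b : Fin (m i)} (hab : a ≠ b) (η : Config m)
    (x y : Particle) : putSlot i a (putSlot i b η y) x = putSlot i b (putSlot i a η x) y := by
  simp only [putSlot, Function.update_idem, Function.update_self]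
  rw [Function.update_comm hab]

theorem putSlot_apply_ne {m : Fin n → ℕ} (i : Fin n) {a b : Fin (m i)} (hab : a ≠ b) (η : Config m)
    (x : Particle) : putSlot i a η x i b = η i b := by
  simp [putSlot, Function.update_of_ne hab.symm]

theorem permute_slotSwap_eq_putSlot {m : Fin n → ℕ} (i : Fin n) {a b : Fin (m i)} (hab : a ≠ b)
    (η : Config m) : permute (slotSwap i a b) η = putSlot i a (putSlot i b η (η i a)) (η i b) := by
  simp only [permute_slotSwap_apply, putSlot, Function.update_idem, Function.update_self]
  congr 1
  funext c
  by_cases hc : c = a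
  · subst hc
    simp
  · rw [Function.update_of_ne hc]
    by_cases hc' : c = b
    · subst hc'
      simp
    · rw [Function.update_of_ne hc', Equiv.swap_apply_of_ne_of_ne hc hc']

/-- The slot projection of the `a`-th particle of species `i`. -/
def pauliProj {m : Fin n → ℕ} (i : Fin n) (a : Fin (m i)) (f : Particle → ℂ) :
    (Config m → ℂ) → Config m → ℂ :=
  slotProj (volume : Measure Particle) (fun η : Config m => η i a) (putSlot i a) f

theorem pauliProj_permute {m : Fin n → ℕ} (i : Fin n) (a b : Fin (m i)) (f : Particle → ℂ)
    (F : Config m → ℂ) (η : Config m) :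
    pauliProj i a f F (permute (slotSwap i a b) η) =
      pauliProj i b f (fun η => F (permute (slotSwap i a b) η)) η := by
  simp only [pauliProj, slotProj, putSlot_permute]
  congr 3
  simp [permute_slotSwap_apply]

/-- The function P_a P_b F depends on the two slots only through the factor f̄ ⊗ f̄, which is
symmetric. -/
theorem pauliProj_pauliProj_permute {m : Fin n → ℕ} (i : Fin n) {a b : Fin (m i)} (hab : a ≠ b)
    (f : Particle → ℂ) (F : Config m → ℂ) (η : Config m) :
    pauliProj i a f (pauliProj i b f F) (permute (slotSwap i a b) η) =
      pauliProj i a f (pauliProj i b f F) η := by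
  have h : ∀ η : Config m, pauliProj i a f (pauliProj i b f F) η =
      conj (f (η i a)) * conj (f (η i b)) *
        ∫ x, f x * ∫ y, f y * F (putSlot i b (putSlot i a η x) y) := by
    intro η
    simp only [pauliProj, slotProj, putSlot_apply_ne i hab]
    rw [mul_assoc]
    congr 1
    rw [← integral_const_mul]
    congr 1
    funext x
    ring
  rw [h, h, permute_slotSwap_eq_putSlot i hab]
  have hla := isLens_slot (m := m) i a
  have hlb := isLens_slot (m := m) i b
  have e : ∀ x y, putSlot i b (putSlot i a (putSlot i a (putSlot i b η (η i a)) (η i b)) x) y =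
      putSlot i b (putSlot i a η x) y := by
    intro x y
    rw [hla.put_put, putSlot_comm i hab, hlb.put_put]
  simp only [e, hla.get_put, putSlot_apply_ne i hab, hlb.get_put]
  ring

/-- The Pauli principle. The vectors P_a F are orthogonal for different a: ⟨P_a F, P_b F⟩ = ⟨F, P_a
P_b F⟩, where exchanging the two particles changes the sign of F but not of P_a P_b F. As P_a² =
‖f‖² P_a, `sum_norm_sq_le_of_orthogonal` applies, and the bound does not grow with the number of
particles. -/
theorem sum_normSq_pauliProj_le {m : Fin n → ℕ} (i : Fin n) {f : Particle → ℂ}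
    (hf : MemLp f 2 volume) {F : Config m → ℂ} (hF : MemLp F 2 volume) (hanti : IsAntisymm F) :
    ∑ a : Fin (m i), ∫⁻ η, ‖pauliProj i a f F η‖ₑ ^ 2 ≤
      (∫⁻ x, ‖f x‖ₑ ^ 2) ^ 2 * ∫⁻ η, ‖F η‖ₑ ^ 2 := by
  have hv : ∀ (a : Fin (m i)) {G : Config m → ℂ}, MemLp G 2 volume →
      MemLp (pauliProj i a f G) 2 volume := fun a G hG => (isLens_slot i a).memLp_slotProj hf hG
  have hinner : ∀ (a : Fin (m i)) {G K : Config m → ℂ}, MemLp G 2 volume → MemLp K 2 volume →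
      ∫ η, conj (pauliProj i a f G η) * K η = ∫ η, conj (G η) * pauliProj i a f K η :=
    fun a G K hG hK => (isLens_slot i a).inner_slotProj hf hG hK
  set N : ℝ := ‖hf.toLp f‖ ^ 2 with hN
  have hNC : ∫ x, f x * conj (f x) = (N : ℂ) := by
    have h1 := inner_toLp hf hf
    rw [inner_self_eq_norm_sq_to_K] at h1
    simp only [mul_comm (f _), ← h1, hN]
    push_cast
    rfl
  have key := sum_norm_sq_le_of_orthogonal (N := N) Finset.univ
    (fun a => (hv a hF).toLp (pauliProj i a f F)) (hF.toLp F) ?_ ?_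
  · have h1 : ∑ a : Fin (m i), ∫⁻ η, ‖pauliProj i a f F η‖ₑ ^ 2 =
        ENNReal.ofReal (∑ a, ‖(hv a hF).toLp (pauliProj i a f F)‖ ^ 2) := by
      rw [ENNReal.ofReal_sum_of_nonneg fun _ _ => by positivity]
      simp only [ofReal_norm_toLp_sq]
    rw [h1, ← ofReal_norm_toLp_sq hf, ← ofReal_norm_toLp_sq hF, ← hN,
      ← ENNReal.ofReal_pow (by positivity), ← ENNReal.ofReal_mul (by positivity)]
    exact ENNReal.ofReal_le_ofReal key
  · intro a _ b _ hab
    rw [inner_toLp, hinner a hF (hv b hF)]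
    have hmp := measurePreserving_permute (slotSwap (m := m) i a b)
    have hPP := hv a (hv b hF)
    have hI : AEStronglyMeasurable
        (fun η => conj (F η) * pauliProj i a f (pauliProj i b f F) η) volume :=
      (MemLp.conj hF).1.mul hPP.1
    have h1 : ∫ η, conj (F η) * pauliProj i a f (pauliProj i b f F) η =
        ∫ η, conj (F (permute (slotSwap i a b) η)) *
          pauliProj i a f (pauliProj i b f F) (permute (slotSwap i a b) η) := by
      conv_lhs => rw [← hmp.map_eq]
      rw [integral_map hmp.measurable.aemeasurable (by rw [hmp.map_eq]; exact hI)]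
    have h2 : ∫ η, conj (F (permute (slotSwap i a b) η)) *
          pauliProj i a f (pauliProj i b f F) (permute (slotSwap i a b) η) =
        ∫ η, -(conj (F η) * pauliProj i a f (pauliProj i b f F) η) := by
      refine integral_congr_ae ?_
      filter_upwards [hanti (slotSwap i a b)] with η hη
      rw [hη, pauliProj_pauliProj_permute i hab, prod_sign_slotSwap i hab]
      simp
    rw [h2, integral_neg] at h1
    exact CharZero.eq_neg_self_iff.1 h1
  · intro a _
    rw [inner_toLp (hv a hF) hF]
    have h1 := inner_toLp (hv a hF) (hv a hF)
    rw [inner_self_eq_norm_sq_to_K] at h1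
    have h2 : ((‖(hv a hF).toLp (pauliProj i a f F)‖ ^ 2 : ℝ) : ℂ) =
        ∫ η, conj (pauliProj i a f F η) * pauliProj i a f F η := by
      rw [← h1]; push_cast; rfl
    rw [h2, hinner a hF (hv a hF), hinner a hF hF, ← integral_const_mul]
    congr 1
    funext η
    have := (isLens_slot (m := m) i a).slotProj_slotProj f F η
    rw [hNC] at this
    change conj (F η) * slotProj _ _ _ f (slotProj _ _ _ f F) η = _
    rw [this]
    simp only [pauliProj]
    ring

end Pauli

/-! ### Smeared annihilation operators -/

section Annihilation

variable {n : ℕ}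

/-- The occupation numbers `l` with one more particle of species `i`. -/
abbrev addOne (l : Fin n → ℕ) (i : Fin n) : Fin n → ℕ := Function.update l i (l i + 1)

/-- The first slot of the species to which a particle has been added. -/
def firstSlot (l : Fin n → ℕ) (i : Fin n) : Fin (addOne l i i) := ⟨0, by simp [addOne]⟩

theorem insertParticle_apply_self_zero {l : Fin n → ℕ} (i : Fin n) (x : Particle) (η : Config l)
    (a : Fin (addOne l i i)) (ha : (a : ℕ) = 0) : insertParticle i x η i a = x := by
  simp [insertParticle, ha]

theorem insertParticle_apply_self_succ {l : Fin n → ℕ} (i : Fin n) (x : Particle) (η : Config l)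
    (a : Fin (addOne l i i)) (b : Fin (l i)) (hab : (a : ℕ) = b + 1) :
    insertParticle i x η i a = η i b := by
  simp [insertParticle, hab]

theorem insertParticle_apply_ne {l : Fin n → ℕ} {i j : Fin n} (hj : j ≠ i) (x : Particle)
    (η : Config l) (a : Fin (addOne l i j)) (b : Fin (l j)) (hab : (a : ℕ) = b) :
    insertParticle i x η j a = η j b := by
  simp only [insertParticle, dif_neg hj]
  exact congrArg (η j) (Fin.ext hab)

theorem putSlot_insertParticle {l : Fin n → ℕ} (i : Fin n) (x y : Particle) (η : Config l) :
    putSlot i (firstSlot l i) (insertParticle i x η) y = insertParticle i y η := by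
  funext j a
  by_cases hj : j = i
  · subst hj
    by_cases ha : (a : ℕ) = 0
    · have : a = firstSlot l j := Fin.ext ha
      subst this
      rw [insertParticle_apply_self_zero j y η _ ha]
      simp [putSlot]
    · have hne : a ≠ firstSlot l j := fun h => ha (congrArg Fin.val h)
      simp only [putSlot, Function.update_self, Function.update_of_ne hne]
      simp [insertParticle, ha]
  · simp only [putSlot, Function.update_of_ne hj]
    simp only [insertParticle, dif_neg hj]

/-- Extend a permutation by a fixed point at the beginning. -/
def consPerm {k m : ℕ} (h : m = k + 1) (σ : Equiv.Perm (Fin k)) : Equiv.Perm (Fin m) :=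
  (finCongr h).symm.permCongr (Equiv.Perm.decomposeFin.symm (0, σ))

theorem sign_consPerm {k m : ℕ} (h : m = k + 1) (σ : Equiv.Perm (Fin k)) :
    Equiv.Perm.sign (consPerm h σ) = Equiv.Perm.sign σ := by
  rw [consPerm, Equiv.Perm.sign_permCongr, Equiv.Perm.decomposeFin.symm_sign]
  simp

theorem consPerm_zero {k m : ℕ} (h : m = k + 1) (σ : Equiv.Perm (Fin k)) (a : Fin m)
    (ha : (a : ℕ) = 0) : (consPerm h σ a : ℕ) = 0 := by
  subst h
  obtain rfl : a = 0 := Fin.ext ha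
  simp [consPerm]

theorem consPerm_succ {k m : ℕ} (h : m = k + 1) (σ : Equiv.Perm (Fin k)) (a : Fin m) (b : Fin k)
    (ha : (a : ℕ) = b + 1) : (consPerm h σ a : ℕ) = σ b + 1 := by
  subst h
  obtain rfl : a = b.succ := Fin.ext ha
  simp [consPerm]

/-- Extend a permutation of a configuration to the configuration with one more particle. -/
def extendPerm {l : Fin n → ℕ} (i : Fin n) (σ : (j : Fin n) → Equiv.Perm (Fin (l j))) (j : Fin n) :
    Equiv.Perm (Fin (addOne l i j)) :=
  if h : j = i then consPerm (by subst h; simp [addOne]) (σ j)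
  else (finCongr (by simp [addOne, Function.update_of_ne h])).permCongr (σ j)

theorem sign_extendPerm {l : Fin n → ℕ} (i : Fin n) (σ : (j : Fin n) → Equiv.Perm (Fin (l j)))
    (j : Fin n) : Equiv.Perm.sign (extendPerm i σ j) = Equiv.Perm.sign (σ j) := by
  by_cases h : j = i
  · simp only [extendPerm, dif_pos h, sign_consPerm]
  · simp only [extendPerm, dif_neg h, Equiv.Perm.sign_permCongr]

theorem insertParticle_permute {l : Fin n → ℕ} (i : Fin n)
    (σ : (j : Fin n) → Equiv.Perm (Fin (l j))) (x : Particle) (η : Config l) :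
    insertParticle i x (permute σ η) = permute (extendPerm i σ) (insertParticle i x η) := by
  funext j a
  by_cases hj : j = i
  · subst hj
    have hlt : (a : ℕ) < l j + 1 := by simpa [addOne] using a.2
    by_cases ha : (a : ℕ) = 0
    · rw [insertParticle_apply_self_zero j x _ a ha, permute, insertParticle_apply_self_zero]
      simp only [extendPerm, dif_pos]
      exact consPerm_zero _ _ _ ha
    · have hab : (a : ℕ) = (⟨a - 1, by omega⟩ : Fin (l j)) + 1 := by
        change (a : ℕ) = a - 1 + 1
        omega
      rw [insertParticle_apply_self_succ j x _ a _ hab, permute, permute]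
      refine (insertParticle_apply_self_succ j x η _ _ ?_).symm
      simp only [extendPerm, dif_pos]
      exact consPerm_succ _ _ _ _ hab
  · have hb : (a : ℕ) < l j := by simpa [addOne, Function.update_of_ne hj] using a.2
    rw [insertParticle_apply_ne hj x _ a ⟨a, hb⟩ rfl, permute, permute]
    refine (insertParticle_apply_ne hj x η _ _ ?_).symm
    simp only [extendPerm, dif_neg hj]
    rfl

/-- The sign and normalization of the annihilation operator of species `i`. -/
def annCoeff (i : Fin n) (l : Fin n → ℕ) : ℂ :=
  (-1 : ℂ) ^ (∑ j ∈ Finset.univ.filter (fun j => j < i), l j) * (Real.sqrt ((l i : ℝ) + 1) : ℂ)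

theorem annihilate_apply (i : Fin n) (x : Particle) (Φ : WaveFunction n) (l : Fin n → ℕ)
    (η : Config l) : annihilate i x Φ l η = annCoeff i l * Φ (addOne l i) (insertParticle i x η) :=
  rfl

theorem enorm_annCoeff_sq (i : Fin n) (l : Fin n → ℕ) : ‖annCoeff i l‖ₑ ^ 2 = ((l i + 1 : ℕ) : ENNReal) := by
  have h : ‖annCoeff i l‖ ^ 2 = l i + 1 := by
    rw [annCoeff, norm_mul, norm_pow, norm_neg, norm_one, one_pow, one_mul, Complex.norm_real,
      Real.norm_of_nonneg (Real.sqrt_nonneg _), Real.sq_sqrt (by positivity)]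
  rw [← ofReal_norm, ← ENNReal.ofReal_pow (norm_nonneg _), h]
  exact_mod_cast ENNReal.ofReal_natCast (l i + 1)

/-- `∫ f(x) b_i(x) dx` on wave functions. -/
def smear (i : Fin n) (f : Particle → ℂ) (Φ : WaveFunction n) : WaveFunction n := fun l η =>
  ∫ x, f x * annihilate i x Φ l η

theorem smear_apply (i : Fin n) (f : Particle → ℂ) (Φ : WaveFunction n) (l : Fin n → ℕ)
    (η : Config l) :
    smear i f Φ l η = annCoeff i l * ∫ x, f x * Φ (addOne l i) (insertParticle i x η) := by
  rw [smear, ← integral_const_mul]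
  congr 1
  funext x
  rw [annihilate_apply]
  ring

theorem const_mul_smear (c : ℂ) (i : Fin n) (f : Particle → ℂ) (Φ : WaveFunction n)
    (l : Fin n → ℕ) (η : Config l) : c * smear i f Φ l η =
      annCoeff i l * ∫ x, c * (f x * Φ (addOne l i) (insertParticle i x η)) := by
  rw [smear_apply, integral_const_mul]
  ring

theorem measurePreserving_insertParticle_swap (l : Fin n → ℕ) (i : Fin n) :
    MeasurePreserving (fun p : Config l × Particle => insertParticle i p.2 p.1)
      (volume.prod volume) volume :=
  (measurePreserving_insertParticle l i).comp Measure.measurePreserving_swap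

theorem ae_insertParticle {l : Fin n → ℕ} (i : Fin n) {p : Config (addOne l i) → Prop}
    (hp : ∀ᵐ ζ, p ζ) : ∀ᵐ η : Config l, ∀ᵐ x : Particle, p (insertParticle i x η) :=
  Measure.ae_ae_of_ae_prod
    ((measurePreserving_insertParticle_swap l i).quasiMeasurePreserving.ae hp)

theorem memLp_insertParticle {Φ : WaveFunction n} {l : Fin n → ℕ} {i : Fin n}
    (hΦ : MemLp (Φ (addOne l i)) 2 volume) :
    MemLp (fun p : Config l × Particle => Φ (addOne l i) (insertParticle i p.2 p.1)) 2
      (volume.prod volume) :=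
  hΦ.comp_measurePreserving (measurePreserving_insertParticle_swap l i)

theorem ae_memLp_insertParticle {Φ : WaveFunction n} {l : Fin n → ℕ} {i : Fin n}
    (hΦ : MemLp (Φ (addOne l i)) 2 volume) :
    ∀ᵐ η : Config l, MemLp (fun x => Φ (addOne l i) (insertParticle i x η)) 2 volume := by
  have h := memLp_insertParticle hΦ
  have h1 := lintegral_enorm_sq_lt_top h
  rw [lintegral_prod _ (h.1.enorm.pow_const 2)] at h1
  filter_upwards [h.1.prodMk_left, ae_lt_top' ((h.1.enorm.pow_const 2).lintegral_prod_right') h1.ne]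
    with η h2 h3
  exact (memLp_two_iff h2).2 h3

theorem ae_integrable_smear {Φ : WaveFunction n} {l : Fin n → ℕ} {i : Fin n}
    (hΦ : MemLp (Φ (addOne l i)) 2 volume) {f : Particle → ℂ} (hf : MemLp f 2 volume) :
    ∀ᵐ η : Config l, Integrable (fun x => f x * Φ (addOne l i) (insertParticle i x η)) volume := by
  filter_upwards [ae_memLp_insertParticle hΦ] with η hη
  exact hf.integrable_mul hη

/-- Exchanging the particles a and b maps one integrand to the other up to a sign inside the norm.
Hence the sum over slots is the number of particles times the contribution of the first one. -/
theorem lintegral_pauliProj_eq {m : Fin n → ℕ} (i : Fin n) (a b : Fin (m i)) {f : Particle → ℂ}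
    (hf : MemLp f 2 volume) {F : Config m → ℂ} (hF : MemLp F 2 volume) (hanti : IsAntisymm F) :
    ∫⁻ η, ‖pauliProj i a f F η‖ₑ ^ 2 = ∫⁻ η, ‖pauliProj i b f F η‖ₑ ^ 2 := by
  by_cases hab : a = b
  · rw [hab]
  have hmp := measurePreserving_permute (slotSwap (m := m) i a b)
  have hv : MemLp (pauliProj i a f F) 2 volume := (isLens_slot i a).memLp_slotProj hf hF
  have h1 : ∫⁻ η, ‖pauliProj i a f F η‖ₑ ^ 2 =
      ∫⁻ η, ‖pauliProj i a f F (permute (slotSwap i a b) η)‖ₑ ^ 2 := by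
    conv_lhs => rw [← hmp.map_eq]
    rw [lintegral_map' (by rw [hmp.map_eq]; exact hv.1.enorm.pow_const 2)
      hmp.measurable.aemeasurable]
  rw [h1]
  have h2 : pauliProj i b f (fun η => F (permute (slotSwap i a b) η)) =ᵐ[volume]
      pauliProj i b f (fun η => (-1) * F η) := by
    refine (isLens_slot i b).slotProj_congr f ?_
    filter_upwards [hanti (slotSwap i a b)] with η hη
    rw [hη, prod_sign_slotSwap i hab]
  refine lintegral_congr_ae ?_
  filter_upwards [h2] with η hη
  rw [pauliProj_permute, hη]
  have : pauliProj i b f (fun η => (-1) * F η) η = - pauliProj i b f F η := by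
    simp only [pauliProj, slotProj, neg_mul, one_mul, mul_neg, integral_neg]
  rw [this, enorm_neg]

/-- The norm of a smeared fermionic annihilation operator on one sector. -/
theorem lintegral_smear_le (i : Fin n) {f : Particle → ℂ} (hf : MemLp f 2 volume)
    {Φ : WaveFunction n} (l : Fin n → ℕ) (hΦ : MemLp (Φ (addOne l i)) 2 volume)
    (hanti : IsAntisymm (Φ (addOne l i))) :
    ∫⁻ η, ‖smear i f Φ l η‖ₑ ^ 2 ≤
      (∫⁻ x, ‖f x‖ₑ ^ 2) * ∫⁻ ζ, ‖Φ (addOne l i) ζ‖ₑ ^ 2 := by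
  set N := ∫⁻ x, ‖f x‖ₑ ^ 2 with hN
  have hNt : N ≠ ⊤ := (lintegral_enorm_sq_lt_top hf).ne
  set u : Config l → ℂ := fun η => ∫ x, f x * Φ (addOne l i) (insertParticle i x η) with hu
  have hum : MemLp u 2 volume := memLp_contract hf (memLp_insertParticle hΦ)
  have h1 : ∫⁻ η, ‖smear i f Φ l η‖ₑ ^ 2 = ((l i + 1 : ℕ) : ENNReal) * ∫⁻ η, ‖u η‖ₑ ^ 2 := by
    rw [← lintegral_const_mul'' _ (hum.1.enorm.pow_const 2)]
    refine lintegral_congr fun η => ?_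
    rw [smear_apply, enorm_mul, mul_pow, enorm_annCoeff_sq]
  have hP : MemLp (pauliProj i (firstSlot l i) f (Φ (addOne l i))) 2 volume :=
    (isLens_slot i _).memLp_slotProj hf hΦ
  have h2 : ∫⁻ ζ, ‖pauliProj i (firstSlot l i) f (Φ (addOne l i)) ζ‖ₑ ^ 2 =
      (∫⁻ η, ‖u η‖ₑ ^ 2) * N := by
    have hmp := measurePreserving_insertParticle_swap l i
    rw [← hmp.map_eq, lintegral_map' (by rw [hmp.map_eq]; exact hP.1.enorm.pow_const 2)
      hmp.measurable.aemeasurable]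
    have h3 := lintegral_tensor hum.1 (MemLp.conj hf).1
    simp only [RCLike.enorm_conj] at h3
    rw [← hN] at h3
    rw [← h3]
    refine lintegral_congr fun p => ?_
    simp only [pauliProj, slotProj, putSlot_insertParticle]
    rw [insertParticle_apply_self_zero i _ _ _ rfl, mul_comm]
  have h3 := sum_normSq_pauliProj_le i hf hΦ hanti
  -- The number of slots equals the squared normalization `l i + 1` of the annihilation operator, so
  -- the sum over slots is N times the squared norm of the smeared function.
  have h4 : ∑ a : Fin (addOne l i i), ∫⁻ ζ, ‖pauliProj i a f (Φ (addOne l i)) ζ‖ₑ ^ 2 =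
      ((l i + 1 : ℕ) : ENNReal) * ((∫⁻ η, ‖u η‖ₑ ^ 2) * N) := by
    rw [Finset.sum_congr rfl fun a _ =>
      (lintegral_pauliProj_eq i a (firstSlot l i) hf hΦ hanti).trans h2]
    simp [addOne]
  rw [h4, ← hN] at h3
  rw [h1]
  -- The estimate has an extra factor N on both sides, to be cancelled. For N = 0 the function f
  -- vanishes almost everywhere and so does the left side.
  rcases eq_or_ne N 0 with h0 | h0
  · have hf0 : f =ᵐ[volume] 0 := by
      rw [hN, lintegral_eq_zero_iff' (hf.1.enorm.pow_const 2)] at h0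
      filter_upwards [h0] with x hx
      simpa using hx
    have : ∀ η, u η = 0 := fun η => by
      rw [hu]
      refine integral_eq_zero_of_ae ?_
      filter_upwards [hf0] with x hx
      simp [hx]
    simp [this]
  · have h5 : ((l i + 1 : ℕ) : ENNReal) * (∫⁻ η, ‖u η‖ₑ ^ 2) * N ≤
        (N * ∫⁻ ζ, ‖Φ (addOne l i) ζ‖ₑ ^ 2) * N := by
      calc _ = ((l i + 1 : ℕ) : ENNReal) * ((∫⁻ η, ‖u η‖ₑ ^ 2) * N) := by ring
        _ ≤ _ := h3
        _ = _ := by ring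
    exact (ENNReal.mul_le_mul_iff_left h0 hNt).1 h5

theorem addOne_injective (i : Fin n) : Function.Injective fun l : Fin n → ℕ => addOne l i := by
  intro l l' h
  funext j
  have := congrFun h j
  by_cases hj : j = i
  · subst hj
    simpa [addOne] using this
  · simpa [addOne, Function.update_of_ne hj] using this

theorem isAntisymm_smear (i : Fin n) (f : Particle → ℂ) {Φ : WaveFunction n} (l : Fin n → ℕ)
    (hanti : IsAntisymm (Φ (addOne l i))) : IsAntisymm (smear i f Φ l) := by
  intro σ
  filter_upwards [ae_insertParticle i (hanti (extendPerm i σ))] with η hη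
  rw [smear_apply, const_mul_smear]
  congr 1
  refine integral_congr_ae ?_
  filter_upwards [hη] with x hx
  rw [insertParticle_permute, hx]
  simp only [sign_extendPerm]
  ring

theorem IsState.smear (i : Fin n) {f : Particle → ℂ} (hf : MemLp f 2 volume)
    {Φ : WaveFunction n} (h : IsState Φ) : IsState (smear i f Φ) ∧
      normSq (FermiFields.smear i f Φ) ≤ (∫⁻ x, ‖f x‖ₑ ^ 2) * normSq Φ := by
  have hb : normSq (FermiFields.smear i f Φ) ≤ (∫⁻ x, ‖f x‖ₑ ^ 2) * normSq Φ := by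
    calc normSq (FermiFields.smear i f Φ)
        ≤ ∑' l, (∫⁻ x, ‖f x‖ₑ ^ 2) * ∫⁻ ζ, ‖Φ (addOne l i) ζ‖ₑ ^ 2 :=
          ENNReal.tsum_le_tsum fun l =>
            lintegral_smear_le i hf l (h.memLp _) (h.antisymm _)
      _ ≤ _ := by
          rw [ENNReal.tsum_mul_left]
          gcongr
          exact ENNReal.tsum_comp_le_tsum_of_injective (addOne_injective i)
            fun l => ∫⁻ ζ, ‖Φ l ζ‖ₑ ^ 2
  refine ⟨⟨fun l => ?_, fun l => isAntisymm_smear i f l (h.antisymm _), hb.trans_lt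
    (ENNReal.mul_lt_top (lintegral_enorm_sq_lt_top hf) h.finite)⟩, hb⟩
  have := (aestronglyMeasurable_contract hf.1 (memLp_insertParticle (h.memLp (addOne l i))).1)
  refine (this.const_mul (annCoeff i l)).congr (Filter.Eventually.of_forall fun η => ?_)
  exact (smear_apply i f Φ l η).symm

theorem exists_annih (i : Fin n) {f : Particle → ℂ} (hf : MemLp f 2 volume) :
    ∃ T : FockSpace n →L[ℂ] FockSpace n,
      (∀ Ψ l, wave (T Ψ) l =ᵐ[volume] smear i f (wave Ψ) l) ∧ ‖T‖ ≤ ‖hf.toLp f‖ := by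
  refine exists_operator (smear i f) (norm_nonneg _) (fun Ψ => ((isState_wave Ψ).smear i hf).1)
    (fun Φ Ψ l => ?_) (fun c Ψ l => ?_) (fun Ψ => ?_)
  · filter_upwards [ae_insertParticle i (wave_add Φ Ψ (addOne l i)),
      ae_integrable_smear (memLp_wave Φ (addOne l i)) hf,
      ae_integrable_smear (memLp_wave Ψ (addOne l i)) hf] with η h1 h2 h3
    rw [smear_apply, smear_apply, smear_apply, ← mul_add, ← integral_add h2 h3]
    congr 1
    refine integral_congr_ae ?_
    filter_upwards [h1] with x hx
    rw [hx, mul_add]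
  · filter_upwards [ae_insertParticle i (wave_smul c Ψ (addOne l i))] with η h1
    rw [smear_apply, const_mul_smear]
    congr 1
    refine integral_congr_ae ?_
    filter_upwards [h1] with x hx
    rw [hx]
    ring
  · rw [ofReal_norm_toLp_sq hf]
    exact ((isState_wave Ψ).smear i hf).2

open scoped Classical in
/-- The smeared annihilation operator `∫ f(x) b_i(x) dx`. -/
def annih (i : Fin n) (f : Particle → ℂ) : FockSpace n →L[ℂ] FockSpace n :=
  if h : MemLp f 2 volume then (exists_annih i h).choose else 0

theorem wave_annih (i : Fin n) {f : Particle → ℂ} (hf : MemLp f 2 volume) (Ψ : FockSpace n)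
    (l : Fin n → ℕ) : wave (annih i f Ψ) l =ᵐ[volume] smear i f (wave Ψ) l := by
  rw [annih, dif_pos hf]
  exact (exists_annih i hf).choose_spec.1 Ψ l

theorem norm_annih_le (i : Fin n) {f : Particle → ℂ} (hf : MemLp f 2 volume) :
    ‖(annih i f : FockSpace n →L[ℂ] FockSpace n)‖ ≤ ‖hf.toLp f‖ := by
  rw [annih, dif_pos hf]
  exact (exists_annih i hf).choose_spec.2

theorem annih_add (i : Fin n) {f g : Particle → ℂ} (hf : MemLp f 2 volume)
    (hg : MemLp g 2 volume) :
    (annih i (fun x => f x + g x) : FockSpace n →L[ℂ] FockSpace n) = annih i f + annih i g := by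
  ext1 Ψ
  refine ext_wave fun l => ?_
  filter_upwards [wave_annih i (hf.add hg) Ψ l, wave_annih i hf Ψ l, wave_annih i hg Ψ l,
    wave_add (annih i f Ψ) (annih i g Ψ) l, ae_integrable_smear (memLp_wave Ψ (addOne l i)) hf,
    ae_integrable_smear (memLp_wave Ψ (addOne l i)) hg] with η h1 h2 h3 h4 h5 h6
  refine h1.trans (Eq.trans ?_ h4.symm)
  rw [h2, h3, smear_apply, smear_apply, smear_apply, ← mul_add, ← integral_add h5 h6]
  congr 2
  funext x
  exact add_mul _ _ _

theorem annih_smul (i : Fin n) (c : ℂ) {f : Particle → ℂ} (hf : MemLp f 2 volume) :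
    (annih i (fun x => c * f x) : FockSpace n →L[ℂ] FockSpace n) = c • annih i f := by
  ext1 Ψ
  refine ext_wave fun l => ?_
  filter_upwards [wave_annih i (hf.const_mul c) Ψ l, wave_annih i hf Ψ l,
    wave_smul c (annih i f Ψ) l] with η h1 h2 h3
  refine h1.trans (Eq.trans ?_ h3.symm)
  rw [h2, smear_apply, const_mul_smear]
  congr 2
  funext x
  ring

theorem annih_zero (i : Fin n) : (annih i (fun _ => 0) : FockSpace n →L[ℂ] FockSpace n) = 0 := by
  have := annih_smul (n := n) i 0 (f := fun _ => 0) MemLp.zero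
  simpa using this

theorem annih_sum {ι : Type*} (i : Fin n) (s : Finset ι) (d : ι → ℂ) {f : ι → Particle → ℂ}
    (hf : ∀ a, MemLp (f a) 2 volume) :
    (annih i (fun x => ∑ a ∈ s, d a * f a x) : FockSpace n →L[ℂ] FockSpace n) =
      ∑ a ∈ s, d a • annih i (f a) := by
  classical
  induction s using Finset.induction_on with
  | empty => simpa using annih_zero i
  | insert a s ha ih =>
    simp only [Finset.sum_insert ha]
    rw [annih_add i ((hf a).const_mul (d a)) (memLp_finsetSum s fun b _ => (hf b).const_mul (d b)),
      annih_smul i (d a) (hf a), ih]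

/-- Commutation of weights with annihilation operators. -/
theorem annih_comp_mulOp (i : Fin n) {f : Particle → ℂ} (hf : MemLp f 2 volume)
    {v w : (l : Fin n → ℕ) → Config l → ℝ} {C D : ℝ} (hv : IsWeight v C) (hw : IsWeight w D)
    (hvw : ∀ l (η : Config l) x, f x ≠ 0 → v (addOne l i) (insertParticle i x η) = w l η) :
    annih i f ∘L mulOp v = mulOp w ∘L annih i f := by
  ext1 Ψ
  refine ext_wave fun l => ?_
  filter_upwards [wave_annih i hf (mulOp v Ψ) l, hw.wave_mulOp (annih i f Ψ) l,
    wave_annih i hf Ψ l, ae_insertParticle i (hv.wave_mulOp Ψ (addOne l i))] with η h1 h2 h3 h4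
  refine h1.trans (Eq.trans ?_ h2.symm)
  rw [h3, smear_apply, const_mul_smear]
  congr 1
  refine integral_congr_ae ?_
  filter_upwards [h4] with x hx
  rw [hx]
  by_cases h0 : f x = 0
  · simp [h0]
  · rw [hvw l η x h0]
    ring

end Annihilation

/-! ### Real orthonormal systems -/

section OrthonormalSystems

variable {X ι : Type} [MeasurableSpace X] {ν : Measure X}

open scoped Classical in
/-- An orthonormal system of real functions in `L²(ν)`. -/
structure IsONSystem (ν : Measure X) (e : ι → X → ℝ) : Prop where
  meas : ∀ a, Measurable (e a)
  memLp : ∀ a, MemLp (fun x => (e a x : ℂ)) 2 ν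
  inner : ∀ a b, ∫ x, e a x * e b x ∂ν = if a = b then 1 else 0

theorem IsONSystem.orthonormal {e : ι → X → ℝ} (h : IsONSystem ν e) :
    Orthonormal ℂ fun a => (h.memLp a).toLp fun x => (e a x : ℂ) := by
  classical
  rw [orthonormal_iff_ite]
  intro a b
  rw [inner_toLp]
  simp only [Complex.conj_ofReal, ← Complex.ofReal_mul]
  rw [integral_complex_ofReal, h.inner]
  split_ifs <;> simp

theorem IsONSystem.norm_sum_sq {e : ι → X → ℝ} (h : IsONSystem ν e) (s : Finset ι) (d : ι → ℂ)
    (hm : MemLp (fun x => ∑ a ∈ s, d a * (e a x : ℂ)) 2 ν) :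
    ‖hm.toLp fun x => ∑ a ∈ s, d a * (e a x : ℂ)‖ ^ 2 = ∑ a ∈ s, ‖d a‖ ^ 2 := by
  have e1 : hm.toLp (fun x => ∑ a ∈ s, d a * (e a x : ℂ)) =
      ∑ a ∈ s, d a • (h.memLp a).toLp fun x => (e a x : ℂ) := by
    refine Lp.ext ?_
    have h2 : ∀ a ∈ s, (d a • (h.memLp a).toLp fun x => (e a x : ℂ) : Lp ℂ 2 ν) =ᵐ[ν]
        fun x => d a * (e a x : ℂ) := fun a _ => by
      filter_upwards [Lp.coeFn_smul (d a) ((h.memLp a).toLp fun x => (e a x : ℂ)),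
        (h.memLp a).coeFn_toLp] with x h3 h4
      rw [h3, Pi.smul_apply, h4, smul_eq_mul]
    have h3 := Lp.coeFn_finsetSum s fun a => d a • (h.memLp a).toLp fun x => (e a x : ℂ)
    have h4 := (Filter.eventually_all_finset s).2 h2
    filter_upwards [hm.coeFn_toLp, h3, h4] with x a1 a2 a3
    rw [a1, a2, Finset.sum_apply]
    exact Finset.sum_congr rfl fun a ha => (a3 a ha).symm
  rw [e1]
  have := h.orthonormal.inner_sum d d s
  rw [inner_self_eq_norm_sq_to_K] at this
  have h5 : ((‖∑ a ∈ s, d a • (h.memLp a).toLp fun x => (e a x : ℂ)‖ ^ 2 : ℝ) : ℂ) =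
      ((∑ a ∈ s, ‖d a‖ ^ 2 : ℝ) : ℂ) := by
    push_cast
    refine this.trans (Finset.sum_congr rfl fun a _ => ?_)
    rw [Complex.conj_mul']
  exact_mod_cast h5

theorem IsONSystem.bessel {e : ι → X → ℝ} (h : IsONSystem ν e) {g : X → ℂ} (hg : MemLp g 2 ν)
    (s : Finset ι) : ∑ a ∈ s, ‖∫ x, (e a x : ℂ) * g x ∂ν‖ₑ ^ 2 ≤ ∫⁻ x, ‖g x‖ₑ ^ 2 ∂ν := by
  have h1 := h.orthonormal.sum_inner_products_le (s := s) (hg.toLp g)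
  simp only [inner_toLp (h.memLp _) hg, Complex.conj_ofReal] at h1
  rw [← ofReal_norm_toLp_sq hg]
  refine le_trans (le_of_eq ?_) (ENNReal.ofReal_le_ofReal h1)
  rw [ENNReal.ofReal_sum_of_nonneg fun _ _ => by positivity]
  refine Finset.sum_congr rfl fun a _ => ?_
  rw [ENNReal.ofReal_pow (norm_nonneg _), ofReal_norm]

end OrthonormalSystems

/-! ### Additive functions of the configuration -/

section SpeciesSum

variable {n : ℕ}

/-- The sum of `g` over the particles of species `i`. -/
def speciesSum (i : Fin n) (g : Particle → ℝ) (l : Fin n → ℕ) (η : Config l) : ℝ :=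
  ∑ a, g (η i a)

theorem measurable_speciesSum (i : Fin n) {g : Particle → ℝ} (hg : Measurable g)
    (l : Fin n → ℕ) : Measurable (speciesSum i g l) :=
  Finset.measurable_sum _ fun a _ => hg.comp ((measurable_pi_apply a).comp (measurable_pi_apply i))

theorem speciesSum_permute (i : Fin n) (g : Particle → ℝ) (l : Fin n → ℕ)
    (σ : (i : Fin n) → Equiv.Perm (Fin (l i))) (η : Config l) :
    speciesSum i g l (permute σ η) = speciesSum i g l η :=
  Equiv.sum_comp (σ i) fun a => g (η i a)

theorem speciesSum_nonneg (i : Fin n) {g : Particle → ℝ} (hg : ∀ x, 0 ≤ g x) (l : Fin n → ℕ)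
    (η : Config l) : 0 ≤ speciesSum i g l η := Finset.sum_nonneg fun _ _ => hg _

theorem speciesSum_insert_self (i : Fin n) (g : Particle → ℝ) (l : Fin n → ℕ) (η : Config l)
    (x : Particle) : speciesSum i g (addOne l i) (insertParticle i x η) =
      speciesSum i g l η + g x := by
  have h : l i + 1 = addOne l i i := by simp [addOne]
  rw [speciesSum, ← Equiv.sum_comp (finCongr h), Fin.sum_univ_succ, add_comm, speciesSum]
  congr 1
  · refine Finset.sum_congr rfl fun a _ => ?_
    rw [insertParticle_apply_self_succ i x η _ a (by simp)]
  · rw [insertParticle_apply_self_zero i x η _ (by simp)]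

theorem speciesSum_insert_ne {i j : Fin n} (hj : j ≠ i) (g : Particle → ℝ) (l : Fin n → ℕ)
    (η : Config l) (x : Particle) :
    speciesSum j g (addOne l i) (insertParticle i x η) = speciesSum j g l η := by
  have h : l j = addOne l i j := by simp [addOne, Function.update_of_ne hj]
  rw [speciesSum, ← Equiv.sum_comp (finCongr h), speciesSum]
  refine Finset.sum_congr rfl fun a _ => ?_
  rw [insertParticle_apply_ne hj x η _ a (by simp)]

theorem isWeight_speciesSum (i : Fin n) {g : Particle → ℝ} (hg : Measurable g)
    {φ : ℝ → ℝ} (hφ : Measurable φ) {C : ℝ} (hC : 0 ≤ C)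
    (hb : ∀ l (η : Config l), |φ (speciesSum i g l η)| ≤ C) :
    IsWeight (fun l η => φ (speciesSum i g l η)) C where
  nonneg := hC
  meas l := hφ.comp (measurable_speciesSum i hg l)
  symm l σ η := by rw [speciesSum_permute]
  bound := hb

end SpeciesSum

/-! ### Square function estimates for annihilation operators -/

section SquareFunction

variable {n : ℕ} {ι : Type}

/-- The number of particles of species `i` with variable in `S`. -/
abbrev count (i : Fin n) (S : Set Particle) (l : Fin n → ℕ) (η : Config l) : ℝ :=
  speciesSum i (S.indicator 1) l η

theorem measurable_indicator_one {S : Set Particle} (hS : MeasurableSet S) :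
    Measurable (S.indicator (1 : Particle → ℝ)) := measurable_one.indicator hS

theorem indicator_one_nonneg (S : Set Particle) (x : Particle) :
    0 ≤ S.indicator (1 : Particle → ℝ) x := Set.indicator_nonneg (fun _ _ => zero_le_one) x

theorem count_nonneg (i : Fin n) (S : Set Particle) (l : Fin n → ℕ) (η : Config l) :
    0 ≤ count i S l η := speciesSum_nonneg i (indicator_one_nonneg S) l η

theorem memLp_indicator {f : Particle → ℂ} (hf : MemLp f 2 volume) {S : Set Particle}
    (hS : MeasurableSet S) : MemLp (S.indicator f) 2 volume := hf.indicator hS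

/-- Antisymmetry of F makes |F|² symmetric, so all particles of the species contribute as much as
the one in slot `a₀`. -/
theorem lintegral_count {m : Fin n → ℕ} (i : Fin n) {S : Set Particle} (hS : MeasurableSet S)
    (a₀ : Fin (m i)) {F : Config m → ℂ} (hF : MemLp F 2 volume) (hanti : IsAntisymm F) :
    ∫⁻ ζ, ENNReal.ofReal (count i S m ζ) * ‖F ζ‖ₑ ^ 2 =
      (m i : ENNReal) * ∫⁻ ζ, ENNReal.ofReal (S.indicator 1 (ζ i a₀)) * ‖F ζ‖ₑ ^ 2 := by
  have hmS : ∀ a : Fin (m i), Measurable fun ζ : Config m =>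
      ENNReal.ofReal (S.indicator (1 : Particle → ℝ) (ζ i a)) := fun a =>
    ENNReal.measurable_ofReal.comp ((measurable_indicator_one hS).comp
      ((measurable_pi_apply a).comp (measurable_pi_apply i)))
  have h1 : ∀ a : Fin (m i), ∫⁻ ζ, ENNReal.ofReal (S.indicator 1 (ζ i a)) * ‖F ζ‖ₑ ^ 2 =
      ∫⁻ ζ, ENNReal.ofReal (S.indicator 1 (ζ i a₀)) * ‖F ζ‖ₑ ^ 2 := by
    intro a
    by_cases hab : a = a₀
    · rw [hab]
    have hmp := measurePreserving_permute (slotSwap (m := m) i a a₀)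
    conv_lhs => rw [← hmp.map_eq]
    rw [lintegral_map' (by
      rw [hmp.map_eq]; exact (hmS a).aemeasurable.mul (hF.1.enorm.pow_const 2))
      hmp.measurable.aemeasurable]
    refine lintegral_congr_ae ?_
    filter_upwards [hanti (slotSwap i a a₀)] with ζ hζ
    rw [hζ, prod_sign_slotSwap i hab, permute_slotSwap_apply]
    simp
  simp only [speciesSum]
  have h2 : ∀ ζ : Config m, ENNReal.ofReal (∑ a, S.indicator 1 (ζ i a)) * ‖F ζ‖ₑ ^ 2 =
      ∑ a, ENNReal.ofReal (S.indicator 1 (ζ i a)) * ‖F ζ‖ₑ ^ 2 := fun ζ => by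
    rw [ENNReal.ofReal_sum_of_nonneg fun _ _ => indicator_one_nonneg S _, Finset.sum_mul]
  simp only [h2]
  refine (lintegral_finsetSum' Finset.univ (f := fun a ζ =>
    ENNReal.ofReal (S.indicator 1 (ζ i a)) * ‖F ζ‖ₑ ^ 2)
    fun a _ => (hmS a).aemeasurable.mul (hF.1.enorm.pow_const 2)).trans ?_
  simp [h1]

/-- Bessel's inequality in the annihilated variable, for almost every position of the others, leaves
∫_S |Φ|². The factor `l i + 1` turns this into the expected number of particles in S on the sector
with one more particle. -/
theorem sum_normSq_smear_le (i : Fin n) {e : ι → Particle → ℝ} (he : IsONSystem volume e)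
    {S : Set Particle} (hS : MeasurableSet S) {Φ : WaveFunction n} (hΦ : IsState Φ)
    (s : Finset ι) :
    ∑ a ∈ s, normSq (smear i (S.indicator fun x => (e a x : ℂ)) Φ) ≤
      ∑' l, ∫⁻ ζ, ENNReal.ofReal (count i S l ζ) * ‖Φ l ζ‖ₑ ^ 2 := by
  have hsec : ∀ l, ∑ a ∈ s, ∫⁻ η, ‖smear i (S.indicator fun x => (e a x : ℂ)) Φ l η‖ₑ ^ 2 ≤
      ∫⁻ ζ, ENNReal.ofReal (count i S (addOne l i) ζ) * ‖Φ (addOne l i) ζ‖ₑ ^ 2 := by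
    intro l
    have hl := hΦ.memLp (addOne l i)
    have hst : ∀ a, AEStronglyMeasurable
        (smear i (S.indicator fun x => (e a x : ℂ)) Φ l) volume := fun a =>
      (hΦ.smear i ((he.memLp a).indicator hS)).1.meas l
    rw [lintegral_count i hS (firstSlot l i) hl (hΦ.antisymm _),
      ← lintegral_finsetSum' _ fun a _ => (hst a).enorm.pow_const 2]
    have hmS : Measurable fun ζ : Config (addOne l i) =>
        ENNReal.ofReal (S.indicator (1 : Particle → ℝ) (ζ i (firstSlot l i))) :=
      ENNReal.measurable_ofReal.comp ((measurable_indicator_one hS).comp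
        ((measurable_pi_apply _).comp (measurable_pi_apply i)))
    have hmp := measurePreserving_insertParticle_swap l i
    have h1 : ∫⁻ ζ, ENNReal.ofReal (S.indicator 1 (ζ i (firstSlot l i))) *
        ‖Φ (addOne l i) ζ‖ₑ ^ 2 = ∫⁻ η : Config l, ∫⁻ x : Particle,
          ENNReal.ofReal (S.indicator 1 x) * ‖Φ (addOne l i) (insertParticle i x η)‖ₑ ^ 2 := by
      have hm : AEMeasurable (fun ζ : Config (addOne l i) =>
          ENNReal.ofReal (S.indicator 1 (ζ i (firstSlot l i))) * ‖Φ (addOne l i) ζ‖ₑ ^ 2)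
          volume := hmS.aemeasurable.mul (hl.1.enorm.pow_const 2)
      conv_lhs => rw [← hmp.map_eq]
      rw [lintegral_map' (by rw [hmp.map_eq]; exact hm) hmp.measurable.aemeasurable,
        lintegral_prod (fun p : Config l × Particle =>
          ENNReal.ofReal (S.indicator 1 (insertParticle i p.2 p.1 i (firstSlot l i))) *
            ‖Φ (addOne l i) (insertParticle i p.2 p.1)‖ₑ ^ 2)
          (hm.comp_quasiMeasurePreserving hmp.quasiMeasurePreserving)]
      simp only [insertParticle_apply_self_zero i _ _ (firstSlot l i) rfl]
    rw [h1]
    have hcast : ((addOne l i i : ℕ) : ENNReal) = ((l i + 1 : ℕ) : ENNReal) := by simp [addOne]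
    rw [hcast, ← lintegral_const_mul' _ _ (ENNReal.natCast_ne_top _)]
    refine lintegral_mono_ae ?_
    filter_upwards [ae_memLp_insertParticle hl] with η hη
    have hb := he.bessel (hη.indicator hS) s
    calc ∑ a ∈ s, ‖smear i (S.indicator fun x => (e a x : ℂ)) Φ l η‖ₑ ^ 2
        = ((l i + 1 : ℕ) : ENNReal) * ∑ a ∈ s, ‖∫ x, (e a x : ℂ) *
            S.indicator (fun x => Φ (addOne l i) (insertParticle i x η)) x‖ₑ ^ 2 := by
          rw [Finset.mul_sum]
          refine Finset.sum_congr rfl fun a _ => ?_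
          rw [smear_apply, enorm_mul, mul_pow, enorm_annCoeff_sq]
          congr 4
          funext x
          by_cases hx : x ∈ S <;> simp [hx]
      _ ≤ _ := by
          gcongr
          refine hb.trans (le_of_eq (lintegral_congr fun x => ?_))
          by_cases hx : x ∈ S <;> simp [hx]
  calc ∑ a ∈ s, normSq (smear i (S.indicator fun x => (e a x : ℂ)) Φ)
      = ∑' l, ∑ a ∈ s, ∫⁻ η, ‖smear i (S.indicator fun x => (e a x : ℂ)) Φ l η‖ₑ ^ 2 := by
        simp only [normSq]
        rw [← Summable.tsum_finsetSum fun _ _ => ENNReal.summable]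
    _ ≤ ∑' l, ∫⁻ ζ, ENNReal.ofReal (count i S (addOne l i) ζ) * ‖Φ (addOne l i) ζ‖ₑ ^ 2 :=
        ENNReal.tsum_le_tsum hsec
    _ ≤ _ := ENNReal.tsum_comp_le_tsum_of_injective (addOne_injective i)
        fun l => ∫⁻ ζ, ENNReal.ofReal (count i S l ζ) * ‖Φ l ζ‖ₑ ^ 2

/-- A weight that compensates the number of particles in `S` makes the column bounded. -/
theorem colBdd_annih_mulOp (i : Fin n) {e : ι → Particle → ℝ} (he : IsONSystem volume e)
    {S : Set Particle} (hS : MeasurableSet S) {v : (l : Fin n → ℕ) → Config l → ℝ} {C : ℝ}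
    (hv : IsWeight v C) (hvS : ∀ l η, count i S l η * v l η ^ 2 ≤ 1) :
    ColBdd (fun a => annih i (S.indicator fun x => (e a x : ℂ)) ∘L mulOp v) 1 := by
  refine ⟨zero_le_one, fun F X => ?_⟩
  rw [one_pow, one_mul, ← ENNReal.ofReal_le_ofReal_iff (by positivity), ofReal_norm_sq_wave,
    ENNReal.ofReal_sum_of_nonneg fun _ _ => by positivity]
  have hst := isState_wave (mulOp v X)
  calc ∑ a ∈ F, ENNReal.ofReal (‖(annih i (S.indicator fun x => (e a x : ℂ)) ∘L mulOp v) X‖ ^ 2)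
      = ∑ a ∈ F, normSq (smear i (S.indicator fun x => (e a x : ℂ)) (wave (mulOp v X))) := by
        refine Finset.sum_congr rfl fun a _ => ?_
        rw [ofReal_norm_sq_wave]
        exact normSq_congr fun l => wave_annih i ((he.memLp a).indicator hS) _ l
    _ ≤ ∑' l, ∫⁻ ζ, ENNReal.ofReal (count i S l ζ) * ‖wave (mulOp v X) l ζ‖ₑ ^ 2 :=
        sum_normSq_smear_le i he hS hst F
    _ ≤ normSq (wave X) := by
        refine ENNReal.tsum_le_tsum fun l => lintegral_mono_ae ?_
        filter_upwards [hv.wave_mulOp X l] with ζ hζ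
        rw [hζ, enorm_mul, mul_pow, ← mul_assoc]
        refine mul_le_of_le_one_left' ?_
        have : ‖(v l ζ : ℂ)‖ₑ ^ 2 = ENNReal.ofReal (v l ζ ^ 2) := by
          rw [← ofReal_norm, ← ENNReal.ofReal_pow (norm_nonneg _), Complex.norm_real,
            Real.norm_eq_abs, sq_abs]
        rw [this, ← ENNReal.ofReal_mul (count_nonneg _ _ _ _), ← ENNReal.ofReal_one]
        exact ENNReal.ofReal_le_ofReal (hvS l ζ)

theorem norm_mulOp_sq_le {u v : (l : Fin n → ℕ) → Config l → ℝ} {C D : ℝ} (hu : IsWeight u C)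
    (hv : IsWeight v D) {A B : ℝ} (hA : 0 ≤ A) (hB : 0 ≤ B)
    (h : ∀ l η, u l η ^ 2 ≤ A + B * v l η ^ 2) (X : FockSpace n) :
    ‖mulOp u X‖ ^ 2 ≤ A * ‖X‖ ^ 2 + B * ‖mulOp v X‖ ^ 2 := by
  rw [← ENNReal.ofReal_le_ofReal_iff (by positivity), ENNReal.ofReal_add (by positivity)
    (by positivity), ENNReal.ofReal_mul hA, ENNReal.ofReal_mul hB]
  simp only [ofReal_norm_sq_wave]
  simp only [normSq, ← ENNReal.tsum_mul_left]
  rw [← ENNReal.tsum_add]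
  refine ENNReal.tsum_le_tsum fun l => ?_
  have hX := (isState_wave X).meas l
  have hvX := (isState_wave (mulOp v X)).meas l
  rw [← lintegral_const_mul'' _ (hX.enorm.pow_const 2),
    ← lintegral_const_mul'' _ (hvX.enorm.pow_const 2),
    ← lintegral_add_left' ((hX.enorm.pow_const 2).const_mul _)]
  refine lintegral_mono_ae ?_
  filter_upwards [hu.wave_mulOp X l, hv.wave_mulOp X l] with η h1 h2
  have key : ∀ r : ℝ, ‖(r : ℂ)‖ₑ ^ 2 = ENNReal.ofReal (r ^ 2) := fun r => by
    rw [← ofReal_norm, ← ENNReal.ofReal_pow (norm_nonneg _), Complex.norm_real,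
      Real.norm_eq_abs, sq_abs]
  rw [h1, h2, enorm_mul, enorm_mul, mul_pow, mul_pow, key, key, ← mul_assoc, ← add_mul,
    ← ENNReal.ofReal_mul hB, ← ENNReal.ofReal_add hA (by positivity)]
  gcongr
  exact h l η

end SquareFunction

/-! ### Families of annihilation operators of one species -/

section OneSpecies

variable {n : ℕ} {ι : Type}

/-- By linearity ∑ d_a b(e_a) = b(∑ d_a e_a), and the fermionic bound ‖b(f)‖ ≤ ‖f‖ gives the ℓ² norm
of d. This is why one species needs neither decay of the kernel nor energy. -/
theorem coeffBdd_annih (i : Fin n) {e : ι → Particle → ℝ} (he : IsONSystem volume e) :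
    CoeffBdd (fun a => (annih i fun x => (e a x : ℂ) : FockSpace n →L[ℂ] FockSpace n)) 1 := by
  refine ⟨zero_le_one, fun F d X => ?_⟩
  have hm : MemLp (fun x => ∑ a ∈ F, d a * (e a x : ℂ)) 2 volume :=
    memLp_finsetSum _ fun a _ => (he.memLp a).const_mul _
  have h1 := norm_annih_le (n := n) i hm
  rw [annih_sum i F d he.memLp] at h1
  have h2 := ((∑ a ∈ F, d a • (annih i fun x => (e a x : ℂ)) :
    FockSpace n →L[ℂ] FockSpace n).le_opNorm X).trans
    (mul_le_mul_of_nonneg_right h1 (norm_nonneg X))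
  rw [one_pow, one_mul, ← he.norm_sum_sq F d hm, ← mul_pow]
  refine pow_le_pow_left₀ (norm_nonneg _) ?_ 2
  simpa using h2

theorem CoeffBdd.adjoint {H ι : Type*} [NormedAddCommGroup H] [InnerProductSpace ℂ H]
    [CompleteSpace H] {O : ι → H →L[ℂ] H} {C : ℝ} (h : CoeffBdd O C) :
    CoeffBdd (fun a => (O a).adjoint) C := by
  refine ⟨h.1, fun F d X => ?_⟩
  have e : ∑ a ∈ F, d a • (O a).adjoint X =
      (∑ a ∈ F, conj (d a) • O a : H →L[ℂ] H).adjoint X := by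
    simp only [map_sum, sum_apply, map_smulₛₗ, starRingEnd_self_apply, smul_apply]
  set r := C * √(∑ a ∈ F, ‖d a‖ ^ 2) with hr
  have hr0 : 0 ≤ r := mul_nonneg h.1 (Real.sqrt_nonneg _)
  have hrsq : r ^ 2 = C ^ 2 * ∑ a ∈ F, ‖d a‖ ^ 2 := by
    rw [hr, mul_pow, Real.sq_sqrt (Finset.sum_nonneg fun _ _ => by positivity)]
  have h1 : ‖(∑ a ∈ F, conj (d a) • O a : H →L[ℂ] H)‖ ≤ r := by
    refine ContinuousLinearMap.opNorm_le_bound _ hr0 fun Y => le_of_sq_le_sq ?_ (by positivity)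
    have := h.2 F (fun a => conj (d a)) Y
    rw [mul_pow, hrsq]
    simpa using this
  rw [e, ← hrsq, ← mul_pow]
  refine pow_le_pow_left₀ (norm_nonneg _) ?_ 2
  refine (ContinuousLinearMap.le_opNorm _ _).trans ?_
  gcongr
  rwa [LinearIsometryEquiv.norm_map]

theorem norm_toLp_indicator_sq {f : Particle → ℝ} (hf : MemLp (fun x => (f x : ℂ)) 2 volume)
    {S : Set Particle} (hS : MeasurableSet S) :
    ‖(memLp_indicator hf hS).toLp _‖ ^ 2 = ∫ x in S, f x ^ 2 := by
  have h := inner_toLp (memLp_indicator hf hS) (memLp_indicator hf hS)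
  rw [inner_self_eq_norm_sq_to_K] at h
  have h2 : ∀ x, conj (S.indicator (fun x => (f x : ℂ)) x) * S.indicator (fun x => (f x : ℂ)) x =
      ((S.indicator (fun x => f x ^ 2) x : ℝ) : ℂ) := fun x => by
    by_cases hx : x ∈ S <;> simp [hx, sq]
  simp only [h2] at h
  rw [integral_complex_ofReal, integral_indicator hS] at h
  exact Complex.ofReal_injective (by simpa using h)

/-- `(K + c)^γ`, where `K` is the number of particles of species `i` in `S`. -/
def countPow (i : Fin n) (S : Set Particle) (c γ : ℝ) (l : Fin n → ℕ) (η : Config l) : ℝ :=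
  (count i S l η + c) ^ γ

theorem isWeight_countPow (i : Fin n) {S : Set Particle} (hS : MeasurableSet S) {c γ : ℝ}
    (hc : 1 ≤ c) (hγ : 0 ≤ γ) : IsWeight (countPow i S c (-γ)) 1 := by
  refine isWeight_speciesSum i (measurable_indicator_one hS) (φ := fun t => (t + c) ^ (-γ))
    (by fun_prop) zero_le_one fun l η => ?_
  have h := count_nonneg i S l η
  change |(count i S l η + c) ^ (-γ)| ≤ 1
  rw [abs_of_nonneg (by positivity)]
  exact Real.rpow_le_one_of_one_le_of_nonpos (by linarith) (by linarith)

/-- The annihilated particle lies in S, so the count drops by one and the shift 1 becomes 2. On the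
left of b the weight remains available after taking adjoints. -/
theorem annih_comp_countPow (i : Fin n) {S : Set Particle} (hS : MeasurableSet S) {f : Particle → ℂ}
    (hf : MemLp f 2 volume) {γ : ℝ} (hγ : 0 ≤ γ) :
    annih i (S.indicator f) ∘L mulOp (countPow i S 1 (-γ)) =
      mulOp (countPow i S 2 (-γ)) ∘L annih i (S.indicator f) := by
  refine annih_comp_mulOp i (memLp_indicator hf hS) (isWeight_countPow i hS le_rfl hγ)
    (isWeight_countPow i hS one_le_two hγ) fun l η x hx => ?_
  have hxS : x ∈ S := by
    by_contra h
    exact hx (Set.indicator_of_notMem h f)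
  rw [countPow, countPow, count, count, speciesSum_insert_self, Set.indicator_of_mem hxS,
    Pi.one_apply, add_assoc, one_add_one_eq_two]

/-- Weighted arithmetic-geometric mean, with weights θ and 1 - θ, of a^(2/θ) / D and k⁻¹. The scale
D is the total of the first kind of terms, which balances the two contributions. -/
theorem interpolation_le {a k D θ : ℝ} (ha : 0 < a) (hk : 0 < k) (hD : 0 < D) (h0 : 0 < θ)
    (h1 : θ < 1) : (k ^ (-((1 - θ) / 2))) ^ 2 ≤ D ^ θ * (θ * (a ^ (2 / θ) / D)) / a ^ 2 +
      D ^ θ * (1 - θ) / a ^ 2 * (k ^ (-(1 / 2 : ℝ))) ^ 2 := by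
  have h := Real.geom_mean_le_arith_mean2_weighted h0.le (sub_nonneg.2 h1.le)
    (p₁ := a ^ (2 / θ) / D) (p₂ := k⁻¹) (by positivity) (by positivity) (by ring)
  rw [Real.div_rpow (by positivity) hD.le, ← Real.rpow_mul ha.le, div_mul_cancel₀ _ h0.ne',
    Real.rpow_two, Real.inv_rpow hk.le, ← Real.rpow_neg hk.le] at h
  rw [← Real.rpow_natCast (k ^ _), ← Real.rpow_natCast (k ^ (-(1 / 2) : ℝ)), ← Real.rpow_mul hk.le,
    ← Real.rpow_mul hk.le]
  have e1 : -((1 - θ) / 2) * ((2 : ℕ) : ℝ) = -(1 - θ) := by push_cast; ring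
  have e2 : -(1 / 2 : ℝ) * ((2 : ℕ) : ℝ) = -1 := by norm_num
  rw [e1, e2, Real.rpow_neg_one]
  have hDp : 0 < D ^ θ := by positivity
  have : k ^ (-(1 - θ)) * a ^ 2 ≤ D ^ θ * (θ * (a ^ (2 / θ) / D) + (1 - θ) * k⁻¹) := by
    calc k ^ (-(1 - θ)) * a ^ 2 = D ^ θ * (a ^ 2 / D ^ θ * k ^ (-(1 - θ))) := by field_simp
      _ ≤ _ := by gcongr
  calc k ^ (-(1 - θ)) ≤ D ^ θ * (θ * (a ^ (2 / θ) / D) + (1 - θ) * k⁻¹) / a ^ 2 := by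
        rwa [le_div_iff₀ (by positivity)]
    _ = _ := by ring

/-- Interpolation between two bounds for Y_α = b(1_S e_α) X: the Pauli bound ‖Y_α‖² ≤ ‖X‖² ∫_S e_α²,
and the Bessel bound ∑ ‖(K + 2)^(-1/2) Y_α‖² ≤ ‖X‖². After summation they contribute θ D^θ and (1 -
θ) D^θ. -/
theorem colBdd_interpolation (i : Fin n) {e : ι → Particle → ℝ} (he : IsONSystem volume e)
    {S : Set Particle} (hS : MeasurableSet S) {a : ι → ℝ} (ha : ∀ α, 0 < a α) {θ D : ℝ}
    (h0 : 0 < θ) (h1 : θ < 1) (hD0 : 0 < D)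
    (hD : ∀ F : Finset ι, ∑ α ∈ F, a α ^ (2 / θ) * ∫ x in S, e α x ^ 2 ≤ D) :
    ColBdd (fun α => (a α : ℂ) • ((annih i (S.indicator fun x => (e α x : ℂ)) ∘L
      mulOp (countPow i S 1 (-((1 - θ) / 2))) : FockSpace n →L[ℂ] FockSpace n)))
      (D ^ (θ / 2)) := by
  refine ⟨by positivity, fun F X => ?_⟩
  have hγ : 0 ≤ (1 - θ) / 2 := by linarith
  have hDθ : (D ^ (θ / 2)) ^ 2 = D ^ θ := by
    rw [← Real.rpow_natCast, ← Real.rpow_mul hD0.le]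
    congr 1
    push_cast
    ring
  have hw : ∀ l (η : Config l), 0 < count i S l η + 2 := fun l η => by
    have := count_nonneg i S l η
    linarith
  have key : ∀ α, ‖((a α : ℂ) • ((annih i (S.indicator fun x => (e α x : ℂ)) ∘L
      mulOp (countPow i S 1 (-((1 - θ) / 2))) : FockSpace n →L[ℂ] FockSpace n))) X‖ ^ 2 ≤
      D ^ θ * θ / D * (a α ^ (2 / θ) * ∫ x in S, e α x ^ 2) * ‖X‖ ^ 2 + D ^ θ * (1 - θ) *
        ‖(annih i (S.indicator fun x => (e α x : ℂ)) ∘L mulOp (countPow i S 1 (-(1 / 2)))) X‖ ^ 2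
      := by
    intro α
    have hae := ha α
    set Y := annih i (S.indicator fun x => (e α x : ℂ)) X with hY
    rw [annih_comp_countPow i hS (he.memLp α) hγ,
      annih_comp_countPow i hS (he.memLp α) (by norm_num : (0 : ℝ) ≤ 1 / 2),
      smul_apply, ContinuousLinearMap.comp_apply,
      ContinuousLinearMap.comp_apply, ← hY, norm_smul, mul_pow, Complex.norm_real,
      Real.norm_of_nonneg hae.le]
    have h2 := norm_mulOp_sq_le (isWeight_countPow i hS one_le_two hγ)
      (isWeight_countPow i hS one_le_two (by norm_num : (0 : ℝ) ≤ 1 / 2))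
      (A := D ^ θ * (θ * (a α ^ (2 / θ) / D)) / a α ^ 2) (B := D ^ θ * (1 - θ) / a α ^ 2)
      (by positivity) (div_nonneg (mul_nonneg (by positivity) (by linarith)) (by positivity))
      (fun l η => interpolation_le hae (hw l η) hD0 h0 h1) Y
    have h3 : ‖Y‖ ^ 2 ≤ (∫ x in S, e α x ^ 2) * ‖X‖ ^ 2 := by
      rw [← norm_toLp_indicator_sq (he.memLp α) hS, ← mul_pow]
      refine pow_le_pow_left₀ (norm_nonneg _) ?_ 2
      exact (ContinuousLinearMap.le_opNorm _ _).trans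
        (mul_le_mul_of_nonneg_right (norm_annih_le i _) (norm_nonneg _))
    calc _ ≤ a α ^ 2 * (D ^ θ * (θ * (a α ^ (2 / θ) / D)) / a α ^ 2 * ‖Y‖ ^ 2 +
          D ^ θ * (1 - θ) / a α ^ 2 * ‖mulOp (countPow i S 2 (-(1 / 2))) Y‖ ^ 2) := by gcongr
      _ = D ^ θ * θ / D * a α ^ (2 / θ) * ‖Y‖ ^ 2 +
          D ^ θ * (1 - θ) * ‖mulOp (countPow i S 2 (-(1 / 2))) Y‖ ^ 2 := by field_simp
      _ ≤ D ^ θ * θ / D * a α ^ (2 / θ) * ((∫ x in S, e α x ^ 2) * ‖X‖ ^ 2) +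
          D ^ θ * (1 - θ) * ‖mulOp (countPow i S 2 (-(1 / 2))) Y‖ ^ 2 := by gcongr
      _ = _ := by ring
  have h4 : ∑ α ∈ F, ‖(annih i (S.indicator fun x => (e α x : ℂ)) ∘L
      mulOp (countPow i S 1 (-(1 / 2)))) X‖ ^ 2 ≤ ‖X‖ ^ 2 := by
    have := (colBdd_annih_mulOp i he hS
      (isWeight_countPow (n := n) i hS le_rfl (by norm_num : (0 : ℝ) ≤ 1 / 2))
      (fun l η => ?_)).2 F X
    · simpa using this
    · have hc := count_nonneg i S l η
      rw [countPow, ← Real.rpow_natCast, ← Real.rpow_mul (by positivity)]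
      norm_num
      rw [Real.rpow_neg_one, ← div_eq_mul_inv, div_le_one (by positivity)]
      linarith
  refine (Finset.sum_le_sum fun α _ => key α).trans ?_
  rw [Finset.sum_add_distrib, ← Finset.sum_mul, ← Finset.mul_sum, ← Finset.mul_sum, hDθ]
  have h5 : (0 : ℝ) ≤ D ^ θ * (1 - θ) := mul_nonneg (by positivity) (by linarith)
  calc _ ≤ D ^ θ * θ / D * D * ‖X‖ ^ 2 + D ^ θ * (1 - θ) * ‖X‖ ^ 2 := by
        gcongr
        exact hD F
    _ = _ := by field_simp; ring

/-- The endpoint θ = 0 of the interpolation: Bessel's inequality alone, without decay of the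
weights. -/
theorem colBdd_annih_of_le_one (i : Fin n) {e : ι → Particle → ℝ} (he : IsONSystem volume e)
    {S : Set Particle} (hS : MeasurableSet S) {a : ι → ℝ} (ha : ∀ α, |a α| ≤ 1) :
    ColBdd (fun α => (a α : ℂ) • ((annih i (S.indicator fun x => (e α x : ℂ)) ∘L
      mulOp (countPow i S 1 (-(1 / 2))) : FockSpace n →L[ℂ] FockSpace n))) 1 := by
  refine ⟨zero_le_one, fun F X => ?_⟩
  refine le_trans (Finset.sum_le_sum fun α _ => ?_) ((colBdd_annih_mulOp i he hS
      (isWeight_countPow (n := n) i hS le_rfl (by norm_num : (0 : ℝ) ≤ 1 / 2))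
      (fun l η => ?_)).2 F X)
  · rw [smul_apply, norm_smul, Complex.norm_real, Real.norm_eq_abs]
    exact pow_le_pow_left₀ (by positivity) (mul_le_of_le_one_left (norm_nonneg _) (ha α)) 2
  · have hc := count_nonneg i S l η
    rw [countPow, ← Real.rpow_natCast, ← Real.rpow_mul (by positivity)]
    norm_num
    rw [Real.rpow_neg_one, ← div_eq_mul_inv, div_le_one (by positivity)]
    linarith

end OneSpecies

/-! ### Decomposition of the one-particle space into channels -/

section Channels

variable {n : ℕ} {ι : Type}

theorem norm_toLp_sub_sum_indicator_sq {f : Particle → ℝ} (hf : MemLp (fun x => (f x : ℂ)) 2 volume)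
    {S : ℕ → Set Particle} (hS : ∀ q, MeasurableSet (S q)) (hd : Pairwise fun p q => Disjoint (S p) (S q))
    (Q : Finset ℕ) (hm : MemLp (fun x => (f x : ℂ) - ∑ q ∈ Q, (S q).indicator (fun x => (f x : ℂ)) x)
      2 volume) : ‖hm.toLp _‖ ^ 2 = (∫ x, f x ^ 2) - ∑ q ∈ Q, ∫ x in S q, f x ^ 2 := by
  set U := ⋃ q ∈ Q, S q with hU
  have hUm : MeasurableSet U := Finset.measurableSet_biUnion Q fun q _ => hS q
  have hi : Integrable (fun x => f x ^ 2) volume := by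
    have := hf.integrable_norm_pow two_ne_zero
    simpa using this
  have e1 : (fun x => (f x : ℂ) - ∑ q ∈ Q, (S q).indicator (fun x => (f x : ℂ)) x) =
      Uᶜ.indicator fun x => (f x : ℂ) := by
    funext x
    rw [← Finset.indicator_biUnion_apply Q S fun p _ q _ hpq => hd hpq]
    by_cases hx : x ∈ U
    · rw [Set.indicator_of_mem hx, Set.indicator_of_notMem (by simpa using hx), sub_self]
    · rw [Set.indicator_of_notMem hx, Set.indicator_of_mem (by simpa using hx), sub_zero]
  have e2 : ‖hm.toLp _‖ ^ 2 = ‖(memLp_indicator hf hUm.compl).toLp _‖ ^ 2 := by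
    simp only [e1]
  rw [e2, norm_toLp_indicator_sq hf hUm.compl, setIntegral_compl hUm hi]
  congr 1
  exact integral_biUnion_finset Q (fun q _ => hS q) (fun p _ q _ hpq => hd hpq)
    fun q _ => hi.integrableOn

theorem hasSum_of_norm_sub_le {H κ : Type*} [NormedAddCommGroup H] [InnerProductSpace ℂ H]
    {f : κ → H →L[ℂ] H} {T : H →L[ℂ] H} {b : Finset κ → ℝ}
    (hb : Filter.Tendsto b Filter.atTop (nhds 0)) (h : ∀ Q, ‖∑ q ∈ Q, f q - T‖ ≤ b Q) :
    HasSum f T := by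
  rw [HasSum, SummationFilter.unconditional_filter, tendsto_iff_norm_sub_tendsto_zero]
  exact squeeze_zero (fun _ => norm_nonneg _) h hb

/-- The remainder after finitely many pieces is the annihilation operator of f restricted to the
rest of the space. The Pauli bound controls its operator norm by an L² norm that tends to 0. -/
theorem hasSum_annih_indicator (i : Fin n) {f : Particle → ℝ}
    (hf : MemLp (fun x => (f x : ℂ)) 2 volume) {S : ℕ → Set Particle}
    (hS : ∀ q, MeasurableSet (S q)) (hd : Pairwise fun p q => Disjoint (S p) (S q))
    (hu : ∀ᵐ x, x ∈ ⋃ q, S q) :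
    HasSum (fun q => (annih i ((S q).indicator fun x => (f x : ℂ)) :
      FockSpace n →L[ℂ] FockSpace n)) (annih i fun x => (f x : ℂ)) := by
  have hi : Integrable (fun x => f x ^ 2) volume := by
    have := hf.integrable_norm_pow two_ne_zero
    simpa using this
  have h1 : HasSum (fun q => ∫ x in S q, f x ^ 2) (∫ x, f x ^ 2) := by
    have := hasSum_integral_iUnion hS hd hi.integrableOn
    rwa [setIntegral_congr_set (Filter.eventuallyEq_univ.2 hu : (⋃ q, S q) =ᵐ[volume] Set.univ),
      setIntegral_univ] at this
  have h2 : Filter.Tendsto (fun Q : Finset ℕ => √((∫ x, f x ^ 2) - ∑ q ∈ Q, ∫ x in S q, f x ^ 2))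
      Filter.atTop (nhds 0) := by
    have := (Real.continuous_sqrt.tendsto _).comp (Filter.Tendsto.const_sub (∫ x, f x ^ 2) h1)
    simpa [Function.comp_def] using this
  refine hasSum_of_norm_sub_le h2 fun Q => ?_
  have hm : MemLp (fun x => (f x : ℂ) - ∑ q ∈ Q, (S q).indicator (fun x => (f x : ℂ)) x)
      2 volume := hf.sub (memLp_finsetSum _ fun q _ => memLp_indicator hf (hS q))
  have e : (annih i fun x => (f x : ℂ) - ∑ q ∈ Q, (S q).indicator (fun x => (f x : ℂ)) x :
      FockSpace n →L[ℂ] FockSpace n) = (annih i fun x => (f x : ℂ)) -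
        ∑ q ∈ Q, annih i ((S q).indicator fun x => (f x : ℂ)) := by
    have hs := annih_sum (n := n) i Q (fun _ => 1) (f := fun q => (S q).indicator fun x => (f x : ℂ))
      fun q => memLp_indicator hf (hS q)
    simp only [one_mul, one_smul] at hs
    have hms : MemLp (fun x => ∑ q ∈ Q, (S q).indicator (fun x => (f x : ℂ)) x) 2 volume :=
      memLp_finsetSum _ fun q _ => memLp_indicator hf (hS q)
    rw [← hs, eq_sub_iff_add_eq, ← annih_add i hm hms]
    simp
  rw [norm_sub_rev, ← e]
  refine (norm_annih_le i hm).trans (Real.le_sqrt_of_sq_le ?_)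
  exact (norm_toLp_sub_sum_indicator_sq hf hS hd Q hm).le

theorem hasSum_adjoint_apply {H κ : Type*} [NormedAddCommGroup H] [InnerProductSpace ℂ H]
    [CompleteSpace H] {f : κ → H →L[ℂ] H} {T : H →L[ℂ] H} (h : HasSum f T) (X : H) :
    HasSum (fun q => (f q).adjoint X) (T.adjoint X) := by
  have h1 := h.map (ContinuousLinearMap.adjoint : (H →L[ℂ] H) ≃ₗᵢ⋆[ℂ] (H →L[ℂ] H))
    (LinearIsometryEquiv.continuous _)
  exact h1.mapL (ContinuousLinearMap.apply ℂ H X)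

/-! ### From particle numbers in the channels to the energy. -/

/-- `(1 + E)^γ`, where `E` is the sum of `ω` over the particles of species `i`. -/
def energyPow (i : Fin n) (ω : Particle → ℝ) (γ : ℝ) (l : Fin n → ℕ) (η : Config l) : ℝ :=
  (1 + speciesSum i ω l η) ^ γ

variable {ω : Particle → ℝ}

theorem isWeight_energyPow (i : Fin n) (hω : Measurable ω) (h0 : ∀ x, 0 ≤ ω x) {γ : ℝ}
    (hγ : 0 ≤ γ) : IsWeight (energyPow (n := n) i ω (-γ)) 1 := by
  refine isWeight_speciesSum i hω (φ := fun t => (1 + t) ^ (-γ)) (by fun_prop) zero_le_one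
    fun l η => ?_
  have h := speciesSum_nonneg i h0 l η
  change |(1 + speciesSum i ω l η) ^ (-γ)| ≤ 1
  rw [abs_of_nonneg (by positivity)]
  exact Real.rpow_le_one_of_one_le_of_nonpos (by linarith) (by linarith)

theorem count_le_mul_speciesSum (i : Fin n) (h0 : ∀ x, 0 ≤ ω x) {S : Set Particle} {κ : ℝ}
    (hκ : 0 ≤ κ) (hS : ∀ x ∈ S, 1 ≤ κ * ω x) (l : Fin n → ℕ) (η : Config l) :
    count i S l η ≤ κ * speciesSum i ω l η := by
  simp only [count, speciesSum, Finset.mul_sum]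
  refine Finset.sum_le_sum fun a _ => ?_
  by_cases hx : η i a ∈ S
  · simpa [hx] using hS _ hx
  · simpa [hx] using mul_nonneg hκ (h0 _)

/-- Every particle in S has energy at least 1/κ, so the count plus c is at most κ E + 2 ≤ 2 κ (1 +
E). -/
theorem isWeight_count_energy (i : Fin n) (hω : Measurable ω) (h0 : ∀ x, 0 ≤ ω x)
    {S : Set Particle} (hS : MeasurableSet S) {κ : ℝ} (hκ : 1 ≤ κ) (hSκ : ∀ x ∈ S, 1 ≤ κ * ω x)
    {c : ℝ} (hc : 1 ≤ c) (hc2 : c ≤ 2) {γ' γ : ℝ} (h0γ : 0 ≤ γ') (hγ : γ' ≤ γ) :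
    IsWeight (fun l (η : Config l) => countPow i S c γ' l η * energyPow i ω (-γ) l η)
      ((2 * κ) ^ γ') where
  nonneg := by positivity
  meas l := by
    have h1 := measurable_speciesSum (n := n) i (measurable_indicator_one hS) l
    have h2 := measurable_speciesSum (n := n) i hω l
    exact ((h1.add_const _).pow_const _).mul ((h2.const_add _).pow_const _)
  symm l σ η := by simp only [countPow, energyPow, count, speciesSum_permute]
  bound l η := by
    have h1 := count_nonneg i S l η
    have h2 := speciesSum_nonneg i h0 l η
    have h3 := count_le_mul_speciesSum i h0 (zero_le_one.trans hκ) hSκ l η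
    have hE : 0 < 1 + speciesSum i ω l η := by linarith
    rw [countPow, energyPow, abs_of_nonneg (by positivity), Real.rpow_neg hE.le,
      ← div_eq_mul_inv, div_le_iff₀ (by positivity)]
    calc (count i S l η + c) ^ γ' ≤ (2 * κ * (1 + speciesSum i ω l η)) ^ γ' := by
          refine Real.rpow_le_rpow (by linarith) ?_ h0γ
          nlinarith
      _ = (2 * κ) ^ γ' * (1 + speciesSum i ω l η) ^ γ' := by
          rw [Real.mul_rpow (by positivity) hE.le]
      _ ≤ _ := by
          refine mul_le_mul_of_nonneg_left ?_ (by positivity)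
          exact Real.rpow_le_rpow_of_exponent_le (by linarith) hγ

theorem countPow_comp_count_energy (i : Fin n) (hω : Measurable ω) (h0 : ∀ x, 0 ≤ ω x)
    {S : Set Particle} (hS : MeasurableSet S) {κ : ℝ} (hκ : 1 ≤ κ) (hSκ : ∀ x ∈ S, 1 ≤ κ * ω x)
    {c : ℝ} (hc : 1 ≤ c) (hc2 : c ≤ 2) {γ' γ : ℝ} (h0γ : 0 ≤ γ') (hγ : γ' ≤ γ) :
    mulOp (countPow i S c (-γ')) ∘L
      mulOp (fun l (η : Config l) => countPow i S c γ' l η * energyPow i ω (-γ) l η) =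
      mulOp (energyPow (n := n) i ω (-γ)) := by
  rw [mulOp_comp_mulOp (isWeight_countPow i hS hc h0γ)
    (isWeight_count_energy i hω h0 hS hκ hSκ hc hc2 h0γ hγ)]
  congr 1
  funext l η
  have h1 : 0 < count i S l η + c := by linarith [count_nonneg i S l η]
  rw [← mul_assoc, countPow, countPow, Real.rpow_neg h1.le,
    inv_mul_cancel₀ (Real.rpow_pos_of_pos h1 _).ne', one_mul]

variable {S : ℕ → Set Particle} {κ γ' C : ℕ → ℝ} {γ : ℝ} {e : ι → Particle → ℝ} {a : ι → ℝ}

/-- In channel q the factor (1 + E)^(-γ) is (K_q + 1)^(-γ'_q) times a multiplier of norm at most (2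
κ_q)^γ'_q. The channel bounds are then added by Minkowski's inequality; the exponents may differ
from channel to channel. -/
theorem colBdd_of_channels (i : Fin n) (he : IsONSystem volume e) (hω : Measurable ω)
    (h0 : ∀ x, 0 ≤ ω x) (hS : ∀ q, MeasurableSet (S q))
    (hd : Pairwise fun p q => Disjoint (S p) (S q)) (hu : ∀ᵐ x, x ∈ ⋃ q, S q)
    (hκ : ∀ q, 1 ≤ κ q) (hSκ : ∀ q, ∀ x ∈ S q, 1 ≤ κ q * ω x) (h0γ : ∀ q, 0 ≤ γ' q)
    (hγ : ∀ q, γ' q ≤ γ)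
    (hC : ∀ q, ColBdd (fun α => (a α : ℂ) • ((annih i ((S q).indicator fun x => (e α x : ℂ)) ∘L
      mulOp (countPow i (S q) 1 (-(γ' q))) : FockSpace n →L[ℂ] FockSpace n))) (C q))
    (hsum : Summable fun q => C q * (2 * κ q) ^ γ' q) :
    ColBdd (fun α => (a α : ℂ) • ((annih i (fun x => (e α x : ℂ)) ∘L
      mulOp (energyPow i ω (-γ)) : FockSpace n →L[ℂ] FockSpace n)))
        (∑' q, C q * (2 * κ q) ^ γ' q) := by
  refine ColBdd.of_hasSum (fun q => (hC q).comp_right (isWeight_count_energy i hω h0 (hS q) (hκ q)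
    (hSκ q) le_rfl one_le_two (h0γ q) (hγ q)).norm_mulOp_le) hsum fun α X => ?_
  have h := ((hasSum_annih_indicator (n := n) i (he.memLp α) hS hd hu).mapL
    (ContinuousLinearMap.apply ℂ (FockSpace n) (mulOp (energyPow i ω (-γ)) X))).const_smul (a α : ℂ)
  convert! h using 1
  funext q
  rw [← countPow_comp_count_energy (n := n) i hω h0 (hS q) (hκ q) (hSκ q) le_rfl one_le_two (h0γ q) (hγ q)]
  rfl

theorem rowBdd_of_channels (i : Fin n) (he : IsONSystem volume e) (hω : Measurable ω)
    (h0 : ∀ x, 0 ≤ ω x) (hS : ∀ q, MeasurableSet (S q))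
    (hd : Pairwise fun p q => Disjoint (S p) (S q)) (hu : ∀ᵐ x, x ∈ ⋃ q, S q)
    (hκ : ∀ q, 1 ≤ κ q) (hSκ : ∀ q, ∀ x ∈ S q, 1 ≤ κ q * ω x) (h0γ : ∀ q, 0 ≤ γ' q)
    (hγ : ∀ q, γ' q ≤ γ)
    (hC : ∀ q, ColBdd (fun α => (a α : ℂ) • ((annih i ((S q).indicator fun x => (e α x : ℂ)) ∘L
      mulOp (countPow i (S q) 1 (-(γ' q))) : FockSpace n →L[ℂ] FockSpace n))) (C q))
    (hsum : Summable fun q => C q * (2 * κ q) ^ γ' q) :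
    RowBdd (fun α => (a α : ℂ) • (((annih i fun x => (e α x : ℂ)).adjoint ∘L
      mulOp (energyPow i ω (-γ)) : FockSpace n →L[ℂ] FockSpace n)))
        (∑' q, C q * (2 * κ q) ^ γ' q) := by
  -- The column b (K + 1)^(-γ') equals (K + 2)^(-γ') b, whose adjoint is the row b* (K + 2)^(-γ').
  -- The shift is therefore 2 from here on.
  have h1 : ∀ q, RowBdd (fun α => (a α : ℂ) • ((((annih i ((S q).indicator fun x =>
      (e α x : ℂ))).adjoint ∘L mulOp (countPow i (S q) 2 (-(γ' q)))) :
        FockSpace n →L[ℂ] FockSpace n))) (C q) := fun q => by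
    have h := (hC q).adjoint
    simp only [annih_comp_countPow i (hS q) (he.memLp _) (h0γ q), map_smulₛₗ,
      ContinuousLinearMap.adjoint_comp, Complex.conj_ofReal,
      (isWeight_countPow (n := n) i (hS q) one_le_two (h0γ q)).adjoint_mulOp] at h
    exact h
  refine RowBdd.of_hasSum (fun q => (h1 q).comp_right (isWeight_count_energy i hω h0
    (hS q) (hκ q) (hSκ q) one_le_two le_rfl (h0γ q) (hγ q)).norm_mulOp_le) hsum fun α X => ?_
  have h := (hasSum_adjoint_apply (hasSum_annih_indicator (n := n) i (he.memLp α) hS hd hu)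
    (mulOp (energyPow i ω (-γ)) X)).const_smul (a α : ℂ)
  convert! h using 1
  funext q
  rw [← countPow_comp_count_energy (n := n) i hω h0 (hS q) (hκ q) (hSκ q) one_le_two le_rfl
    (h0γ q) (hγ q)]
  rfl

end Channels

/-! ### Hermite functions -/

section Hermite

open Polynomial

theorem integrable_aeval_mul_gaussian (p : ℤ[X]) {b : ℝ} (hb : 0 < b) :
    Integrable fun t : ℝ => aeval (√2 * t) p * Real.exp (-b * t ^ 2) := by
  have h : ∀ i : ℕ, Integrable fun t : ℝ => t ^ i * Real.exp (-b * t ^ 2) := fun i => by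
    have := integrable_rpow_mul_exp_neg_mul_sq hb (s := i) (by linarith [i.cast_nonneg (α := ℝ)])
    simpa only [Real.rpow_natCast] using this
  have e : (fun t : ℝ => aeval (√2 * t) p * Real.exp (-b * t ^ 2)) = fun t : ℝ =>
      ∑ i ∈ Finset.range (p.natDegree + 1), ((p.coeff i : ℝ) * √2 ^ i) *
        (t ^ i * Real.exp (-b * t ^ 2)) := by
    funext t
    rw [aeval_eq_sum_range, Finset.sum_mul]
    refine Finset.sum_congr rfl fun i _ => ?_
    rw [zsmul_eq_mul, mul_pow]
    ring
  rw [e]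
  exact integrable_finsetSum _ fun i _ => (h i).const_mul _

/-- The integral of a polynomial in `√2 t` against `exp (-t²)`. -/
def gaussMoment (p : ℤ[X]) : ℝ := ∫ t : ℝ, aeval (√2 * t) p * Real.exp (-1 * t ^ 2)

/-- Gaussian integration by parts: the derivative of p(√2 t) exp(-t²) has integral zero. -/
theorem gaussMoment_X_mul (p : ℤ[X]) : gaussMoment (X * p) = gaussMoment (derivative p) := by
  have hs : √2 * √2 = (2 : ℝ) := Real.mul_self_sqrt (by norm_num)
  have hd : ∀ t : ℝ, HasDerivAt (fun t : ℝ => aeval (√2 * t) p * Real.exp (-1 * t ^ 2))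
      (√2 * (aeval (√2 * t) (derivative p - X * p) * Real.exp (-1 * t ^ 2))) t := by
    intro t
    have h1 := (Polynomial.hasDerivAt_aeval p (√2 * t)).comp t
      ((hasDerivAt_id t).const_mul (√2))
    have h2 : HasDerivAt (fun t : ℝ => Real.exp (-1 * t ^ 2))
        (Real.exp (-1 * t ^ 2) * (-1 * (2 * t))) t := by
      have := ((hasDerivAt_pow 2 t).const_mul (-1)).exp
      simpa using this
    have := h1.mul h2
    convert! this using 1
    simp only [map_sub, map_mul, aeval_X, Function.comp]
    linear_combination (-(t * aeval (√2 * t) p * Real.exp (-1 * t ^ 2))) * hs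
  have h := integral_eq_zero_of_hasDerivAt_of_integrable hd
    ((integrable_aeval_mul_gaussian _ one_pos).const_mul _) (integrable_aeval_mul_gaussian _ one_pos)
  rw [integral_const_mul] at h
  have h3 := (mul_eq_zero.1 h).resolve_left (by positivity)
  have h4 : gaussMoment (derivative p) - gaussMoment (X * p) = 0 := by
    rw [gaussMoment, gaussMoment, ← integral_sub (integrable_aeval_mul_gaussian _ one_pos)
      (integrable_aeval_mul_gaussian _ one_pos), ← h3]
    congr 1
    funext t
    rw [map_sub]
    ring
  linarith

theorem gaussMoment_sub (p q : ℤ[X]) : gaussMoment (p - q) = gaussMoment p - gaussMoment q := by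
  rw [gaussMoment, gaussMoment, gaussMoment, ← integral_sub
    (integrable_aeval_mul_gaussian _ one_pos) (integrable_aeval_mul_gaussian _ one_pos)]
  congr 1
  funext t
  rw [map_sub]
  ring

/-- The operator p ↦ X p - p' is the adjoint of differentiation for the Gaussian pairing, and it
raises the Hermite polynomials. Orthogonality follows by lowering both indices together. -/
theorem gaussMoment_hermite_succ_mul (r : ℕ) (q : ℤ[X]) :
    gaussMoment (hermite (r + 1) * q) = gaussMoment (hermite r * derivative q) := by
  have e : hermite (r + 1) * q = X * (hermite r * q) - derivative (hermite r) * q := by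
    rw [hermite_succ]
    ring
  have e2 : derivative (hermite r * q) - derivative (hermite r) * q = hermite r * derivative q := by
    rw [derivative_mul]
    ring
  rw [e, gaussMoment_sub, gaussMoment_X_mul, ← gaussMoment_sub, e2]

theorem gaussMoment_natCast_mul (c : ℕ) (p : ℤ[X]) :
    gaussMoment ((c : ℤ[X]) * p) = c * gaussMoment p := by
  rw [gaussMoment, gaussMoment, ← integral_const_mul]
  congr 1
  funext t
  rw [map_mul, map_natCast]
  ring

theorem gaussMoment_hermite_mul (r s : ℕ) : gaussMoment (hermite r * hermite s) =
    if r = s then r.factorial * √Real.pi else 0 := by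
  have hcomm : ∀ r s, gaussMoment (hermite r * hermite s) = gaussMoment (hermite s * hermite r) :=
    fun r s => by rw [mul_comm]
  have h0 : gaussMoment (hermite 0 * hermite 0) = √Real.pi := by
    have := integral_gaussian 1
    simpa [gaussMoment] using this
  have hz : ∀ r, gaussMoment (hermite (r + 1) * hermite 0) = 0 := fun r => by
    rw [gaussMoment_hermite_succ_mul]
    simp [gaussMoment]
  induction r generalizing s with
  | zero =>
    cases s with
    | zero => simpa using h0
    | succ s => rw [hcomm, hz]; simp
  | succ r ih =>
    cases s with
    | zero => rw [hz]; simp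
    | succ s =>
      have e : hermite r * ((s + 1 : ℤ[X]) * hermite s) =
          ((s + 1 : ℕ) : ℤ[X]) * (hermite r * hermite s) := by push_cast; ring
      rw [gaussMoment_hermite_succ_mul, derivative_hermite_succ, e, gaussMoment_natCast_mul, ih]
      by_cases h : r = s
      · subst h
        rw [if_pos rfl, if_pos rfl, Nat.factorial_succ]
        push_cast
        ring
      · rw [if_neg h, if_neg (by omega), mul_zero]

theorem exp_half_mul_exp_half (t : ℝ) :
    Real.exp (-(t ^ 2) / 2) * Real.exp (-(t ^ 2) / 2) = Real.exp (-1 * t ^ 2) := by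
  rw [← Real.exp_add]
  congr 1
  ring

theorem integrable_hermiteFun_mul (r s : ℕ) :
    Integrable fun t => hermiteFun r t * hermiteFun s t := by
  have := (integrable_aeval_mul_gaussian (hermite r * hermite s) one_pos).const_mul
    ((√(r.factorial * √Real.pi))⁻¹ * (√(s.factorial * √Real.pi))⁻¹)
  convert this using 2 with t
  rw [hermiteFun, hermiteFun, map_mul, ← exp_half_mul_exp_half]
  ring

theorem integral_hermiteFun_mul (r s : ℕ) :
    ∫ t, hermiteFun r t * hermiteFun s t = if r = s then 1 else 0 := by
  have e : ∀ t, hermiteFun r t * hermiteFun s t = ((√(r.factorial * √Real.pi))⁻¹ *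
      (√(s.factorial * √Real.pi))⁻¹) * (aeval (√2 * t) (hermite r * hermite s) *
        Real.exp (-1 * t ^ 2)) := fun t => by
    rw [hermiteFun, hermiteFun, map_mul, ← exp_half_mul_exp_half]
    ring
  simp only [e]
  rw [integral_const_mul]
  change _ * gaussMoment _ = _
  rw [gaussMoment_hermite_mul]
  by_cases h : r = s
  · subst h
    have hp : 0 < r.factorial * √Real.pi := by
      have := Real.pi_pos
      positivity
    rw [if_pos rfl, if_pos rfl, ← mul_inv, Real.mul_self_sqrt hp.le, inv_mul_cancel₀ hp.ne']
  · rw [if_neg h, if_neg h, mul_zero]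

theorem continuous_hermiteFun (r : ℕ) : Continuous (hermiteFun r) := by
  unfold hermiteFun
  have : Continuous fun t : ℝ => aeval (√2 * t) (hermite r) :=
    (Polynomial.continuous_aeval _).comp (by fun_prop)
  fun_prop

theorem isONSystem_hermiteFun : IsONSystem volume hermiteFun where
  meas r := (continuous_hermiteFun r).measurable
  memLp r := by
    refine (memLp_two_iff_integrable_sq_norm
      (Complex.continuous_ofReal.comp (continuous_hermiteFun r)).aestronglyMeasurable).2 ?_
    have := integrable_hermiteFun_mul r r
    refine this.congr (Filter.Eventually.of_forall fun t => ?_)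
    simp [sq]
  inner r s := by
    rw [integral_hermiteFun_mul]
    congr

/-! ### Local size of the Hermite functions -/

/-- The energy `e_r'² + (2r + 1 - t²) e_r²`. -/
def hermiteEnergy (r : ℕ) (t : ℝ) : ℝ :=
  deriv (hermiteFun r) t ^ 2 + (2 * r + 1 - t ^ 2) * hermiteFun r t ^ 2

theorem contDiff_hermiteFun (r : ℕ) : ContDiff ℝ 2 (hermiteFun r) := by
  unfold hermiteFun
  have : ContDiff ℝ 2 fun t : ℝ => aeval (√2 * t) (hermite r) :=
    (Polynomial.contDiff_aeval _ _).comp (by fun_prop)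
  fun_prop

/-- By the eigenvalue equation all terms cancel except the one from the derivative of -t². The
energy thus increases up to 0 and decreases afterwards, and its value at 0 bounds it everywhere. -/
theorem hasDerivAt_hermiteEnergy (r : ℕ) (t : ℝ) :
    HasDerivAt (hermiteEnergy r) (-(2 * t) * hermiteFun r t ^ 2) t := by
  have h2 : ContDiff ℝ 1 (deriv (hermiteFun r)) := by
    have h := contDiff_hermiteFun r
    rw [show (2 : WithTop ℕ∞) = 1 + 1 by norm_num, contDiff_succ_iff_deriv] at h
    exact h.2.2
  have d0 := ((contDiff_hermiteFun r).differentiable (by norm_num) t).hasDerivAt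
  have d1 := (h2.differentiable (by norm_num) t).hasDerivAt
  have d2 : HasDerivAt (fun t : ℝ => 2 * (r : ℝ) + 1 - t ^ 2) (-(2 * t)) t := by
    have := (hasDerivAt_pow 2 t).const_sub (2 * (r : ℝ) + 1)
    simpa using this
  have h := (d1.pow 2).add (d2.mul (d0.pow 2))
  have he := hermiteFun_eigen r t
  convert! h using 1
  simp only [Pi.pow_apply]
  push_cast
  linear_combination (2 * deriv (hermiteFun r) t) * he

theorem hermiteEnergy_le (r : ℕ) (t : ℝ) : hermiteEnergy r t ≤ hermiteEnergy r 0 := by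
  have hc : Continuous (hermiteEnergy r) :=
    continuous_iff_continuousAt.2 fun t => (hasDerivAt_hermiteEnergy r t).continuousAt
  rcases le_total 0 t with ht | ht
  · refine antitoneOn_of_deriv_nonpos (convex_Ici 0) hc.continuousOn
      (fun s _ => (hasDerivAt_hermiteEnergy r s).differentiableAt.differentiableWithinAt)
      (fun s hs => ?_) (Set.self_mem_Ici) ht ht
    rw [interior_Ici] at hs
    rw [(hasDerivAt_hermiteEnergy r s).deriv]
    have : 0 < s := hs
    nlinarith [sq_nonneg (hermiteFun r s)]
  · refine monotoneOn_of_deriv_nonneg (convex_Iic 0) hc.continuousOn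
      (fun s _ => (hasDerivAt_hermiteEnergy r s).differentiableAt.differentiableWithinAt)
      (fun s hs => ?_) ht (Set.self_mem_Iic) ht
    rw [interior_Iic] at hs
    rw [(hasDerivAt_hermiteEnergy r s).deriv]
    have : s < 0 := hs
    nlinarith [sq_nonneg (hermiteFun r s)]

/-- The value of the `r`-th Hermite polynomial at the origin. -/
def hermiteZero (r : ℕ) : ℝ := aeval (0 : ℝ) (hermite r)

theorem hermiteZero_add_two (r : ℕ) : hermiteZero (r + 2) = -((r + 1) * hermiteZero r) := by
  rw [hermiteZero, hermiteZero, hermite_succ, derivative_hermite_succ]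
  simp

/-- Induction in steps of two by the recursion at the origin; the step is (r + 3)(r + 1) ≤ (r + 2)².
It encodes He_r(0)² ≤ r! / √(r + 1) without square roots. -/
theorem hermiteZero_sq_le (r : ℕ) :
    (r + 1) * (hermiteZero r ^ 2) ^ 2 ≤ (r.factorial : ℝ) ^ 2 := by
  induction r using Nat.strong_induction_on with
  | _ r ih =>
    match r with
    | 0 => simp [hermiteZero]
    | 1 => simp [hermiteZero]
    | r + 2 =>
      have h := ih r (by omega)
      rw [hermiteZero_add_two, Nat.factorial_succ, Nat.factorial_succ]
      push_cast
      set x := (hermiteZero r ^ 2) ^ 2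
      have hx : 0 ≤ x := by positivity
      have e : ((-((r + 1 : ℝ) * hermiteZero r)) ^ 2) ^ 2 = (r + 1) ^ 4 * x := by ring
      rw [e]
      calc ((r : ℝ) + 2 + 1) * ((r + 1) ^ 4 * x) ≤ (r + 2) ^ 2 * (r + 1) ^ 3 * x := by
            have h1 : ((r : ℝ) + 2 + 1) * (r + 1) ≤ (r + 2) ^ 2 := by nlinarith
            calc ((r : ℝ) + 2 + 1) * ((r + 1) ^ 4 * x) = (((r : ℝ) + 2 + 1) * (r + 1)) * ((r + 1) ^ 3 * x) := by ring
              _ ≤ (r + 2) ^ 2 * ((r + 1) ^ 3 * x) := by gcongr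
              _ = _ := by ring
        _ = ((r + 2) * (r + 1)) ^ 2 * ((r + 1) * x) := by ring
        _ ≤ ((r + 2) * (r + 1)) ^ 2 * (r.factorial : ℝ) ^ 2 := by gcongr
        _ = _ := by ring

theorem hermiteZero_sq_div_le (r : ℕ) : hermiteZero r ^ 2 / r.factorial ≤ 1 / √(r + 1) := by
  have hf : (0 : ℝ) < r.factorial := by positivity
  rw [div_le_div_iff₀ hf (by positivity), one_mul]
  refine le_of_sq_le_sq ?_ hf.le
  rw [mul_pow, Real.sq_sqrt (by positivity), mul_comm]
  exact hermiteZero_sq_le r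

/-- At 0 the energy has two terms, from He_r'(0) = r He_(r-1)(0) and from He_r(0). Each is at most 2
√(r + 1). -/
theorem hermiteEnergy_zero_le (r : ℕ) : hermiteEnergy r 0 ≤ 4 * √(r + 1) := by
  have hπ : 1 ≤ √Real.pi := by
    rw [Real.one_le_sqrt]
    linarith [Real.pi_gt_three]
  set c : ℝ := (√(r.factorial * √Real.pi))⁻¹ with hc
  have hc2 : c ^ 2 * r.factorial ≤ 1 := by
    rw [hc, inv_pow, Real.sq_sqrt (by positivity), mul_inv, mul_right_comm,
      inv_mul_cancel₀ (by positivity), one_mul]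
    exact inv_le_one_of_one_le₀ hπ
  have hval : hermiteFun r 0 = c * hermiteZero r := by
    simp [hermiteFun, hermiteZero, hc]
  have hder : deriv (hermiteFun r) 0 = c * (√2 * aeval (0 : ℝ) (derivative (hermite r))) := by
    have h1 := (Polynomial.hasDerivAt_aeval (hermite r) (√2 * 0)).comp (0 : ℝ)
      ((hasDerivAt_id (0 : ℝ)).const_mul (√2))
    have h2 : HasDerivAt (fun t : ℝ => Real.exp (-(t ^ 2) / 2)) 0 0 := by
      have := (((hasDerivAt_pow 2 (0 : ℝ)).neg).div_const 2).exp
      simpa using this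
    have h3 := ((h1.const_mul c).mul h2).deriv
    refine Eq.trans ?_ (h3.trans ?_)
    · rfl
    · have h4 : Real.exp (-(0 : ℝ) ^ 2 / 2) = 1 := by simp
      simp only [mul_zero, h4]
      ring
  have hD : (aeval (0 : ℝ) (derivative (hermite r))) ^ 2 * c ^ 2 ≤ √(r + 1) := by
    cases r with
    | zero => simp
    | succ r =>
      have h := hermiteZero_sq_div_le r
      have e : aeval (0 : ℝ) (derivative (hermite (r + 1))) = (r + 1) * hermiteZero r := by
        rw [derivative_hermite_succ]
        simp [hermiteZero]
      have hf : (0 : ℝ) < r.factorial := by positivity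
      rw [e]
      rw [Nat.factorial_succ] at hc2
      push_cast at hc2 ⊢
      calc ((r + 1 : ℝ) * hermiteZero r) ^ 2 * c ^ 2 =
            (r + 1) * (hermiteZero r ^ 2 / r.factorial) * (c ^ 2 * ((r + 1) * r.factorial)) := by
            field_simp
        _ ≤ (r + 1) * (1 / √(r + 1)) * 1 := by gcongr
        _ = √(r + 1) := by
            rw [mul_one, mul_one_div, Real.div_sqrt]
        _ ≤ _ := Real.sqrt_le_sqrt (by linarith)
  have hV : (r + 1) * (c ^ 2 * hermiteZero r ^ 2) ≤ √(r + 1) := by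
    have h := hermiteZero_sq_div_le r
    have hf : (0 : ℝ) < r.factorial := by positivity
    calc (r + 1) * (c ^ 2 * hermiteZero r ^ 2) =
          (r + 1) * (hermiteZero r ^ 2 / r.factorial) * (c ^ 2 * r.factorial) := by field_simp
      _ ≤ (r + 1) * (1 / √(r + 1)) * 1 := by gcongr
      _ = √(r + 1) := by rw [mul_one, mul_one_div, Real.div_sqrt]
  have hs : √2 ^ 2 = (2 : ℝ) := Real.sq_sqrt (by norm_num)
  rw [hermiteEnergy, hval, hder]
  have e : (c * (√2 * aeval (0 : ℝ) (derivative (hermite r)))) ^ 2 =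
      2 * ((aeval (0 : ℝ) (derivative (hermite r))) ^ 2 * c ^ 2) := by
    rw [mul_pow, mul_pow, hs]
    ring
  rw [e]
  nlinarith [sq_nonneg (c * hermiteZero r)]

/-- For |t| ≤ 1 and r ≥ 1 the potential term satisfies 2r + 1 - t² ≥ 2r, so the energy bound gives
2r e_r(t)² ≤ 4 √(r + 1). This decay in r near the origin makes low momenta harmless for massless
particles. -/
theorem hermiteFun_sq_le (r : ℕ) {t : ℝ} (ht : |t| ≤ 1) :
    hermiteFun r t ^ 2 ≤ 8 * (2 * r + 1 : ℝ) ^ (-(1 / 2 : ℝ)) := by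
  rw [Real.rpow_neg (by positivity), ← Real.sqrt_eq_rpow, ← div_eq_mul_inv,
    le_div_iff₀ (by positivity)]
  have ht2 : t ^ 2 ≤ 1 := (sq_le_one_iff_abs_le_one t).2 ht
  rcases Nat.eq_zero_or_pos r with rfl | hr
  · have h : hermiteFun 0 t ^ 2 ≤ 1 := by
      have hπ : 1 ≤ √Real.pi := by
        rw [Real.one_le_sqrt]
        linarith [Real.pi_gt_three]
      simp only [hermiteFun, hermite_zero, map_one, mul_one, Nat.factorial_zero, Nat.cast_one,
        one_mul, mul_pow, inv_pow]
      rw [Real.sq_sqrt (by positivity), ← Real.exp_nat_mul]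
      refine mul_le_one₀ (inv_le_one_of_one_le₀ hπ) (by positivity) (Real.exp_le_one_iff.2 ?_)
      push_cast
      nlinarith
    simp
    linarith
  · have h1 := (hermiteEnergy_le r t).trans (hermiteEnergy_zero_le r)
    have hr1 : (1 : ℝ) ≤ r := by exact_mod_cast hr
    have h2 : 2 * r * hermiteFun r t ^ 2 ≤ 4 * √(r + 1) := by
      refine le_trans ?_ h1
      rw [hermiteEnergy]
      nlinarith [sq_nonneg (deriv (hermiteFun r) t), sq_nonneg (hermiteFun r t)]
    have h3 : √(r + 1 : ℝ) * √(2 * r + 1) ≤ 4 * r := by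
      rw [← Real.sqrt_mul (by positivity)]
      refine Real.sqrt_le_iff.2 ⟨by positivity, ?_⟩
      nlinarith
    have h4 : 0 ≤ √(2 * r + 1 : ℝ) := Real.sqrt_nonneg _
    have h5 : 2 * r * (hermiteFun r t ^ 2 * √(2 * r + 1)) ≤ 2 * r * 8 := by
      calc 2 * r * (hermiteFun r t ^ 2 * √(2 * r + 1)) =
            (2 * r * hermiteFun r t ^ 2) * √(2 * r + 1) := by ring
        _ ≤ 4 * √(r + 1) * √(2 * r + 1) := by gcongr
        _ ≤ _ := by nlinarith
    exact le_of_mul_le_mul_left h5 (by positivity)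

end Hermite

/-! ### Totality of the Hermite functions -/

section Total

open Polynomial

/-- Square integrable functions orthogonal to all the `e a` vanish. -/
def IsTotal {X ι : Type} [MeasurableSpace X] (ν : Measure X) (e : ι → X → ℝ) : Prop :=
  ∀ g : X → ℂ, MemLp g 2 ν → (∀ a, ∫ x, (e a x : ℂ) * g x ∂ν = 0) → g =ᵐ[ν] 0

/-- The positive and negative parts of h are densities of finite measures with equal characteristic
functions, so the measures agree. -/
theorem ae_eq_zero_of_fourier {h : ℝ → ℝ} (hi : Integrable h)
    (hF : ∀ ξ : ℝ, ∫ t : ℝ, Complex.exp (ξ * t * Complex.I) * h t = 0) : h =ᵐ[volume] 0 := by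
  have hm : AEMeasurable h := hi.1.aemeasurable
  have hp : AEMeasurable fun t => ENNReal.ofReal (h t) := hm.ennreal_ofReal
  have hn : AEMeasurable fun t => ENNReal.ofReal (-h t) := hm.neg.ennreal_ofReal
  have fp : ∫⁻ t, ENNReal.ofReal (h t) ≠ ⊤ := hi.lintegral_lt_top.ne
  have fn : ∫⁻ t, ENNReal.ofReal (-h t) ≠ ⊤ := hi.neg.lintegral_lt_top.ne
  have : IsFiniteMeasure ((volume : Measure ℝ).withDensity fun t => ENNReal.ofReal (h t)) :=
    isFiniteMeasure_withDensity fp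
  have : IsFiniteMeasure ((volume : Measure ℝ).withDensity fun t => ENNReal.ofReal (-h t)) :=
    isFiniteMeasure_withDensity fn
  have key : (volume : Measure ℝ).withDensity (fun t => ENNReal.ofReal (h t)) =
      (volume : Measure ℝ).withDensity fun t => ENNReal.ofReal (-h t) := by
    refine Measure.ext_of_charFun (funext fun ξ => ?_)
    rw [charFun_apply_real, charFun_apply_real,
      integral_withDensity_eq_integral_toReal_smul₀ hp (by simp),
      integral_withDensity_eq_integral_toReal_smul₀ hn (by simp), ← sub_eq_zero]
    have hexp : ∀ (g : ℝ → ℝ), Integrable g →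
        Integrable fun t => g t • Complex.exp (ξ * t * Complex.I) := by
      intro g hg
      refine hg.norm.mono (hg.1.smul (by fun_prop)) (Filter.Eventually.of_forall fun t => ?_)
      rw [norm_smul, ← Complex.ofReal_mul, Complex.norm_exp_ofReal_mul_I, mul_one, norm_norm]
    rw [← integral_sub, ← hF ξ]
    · congr 1
      funext t
      rw [ENNReal.toReal_ofReal', ENNReal.toReal_ofReal', ← sub_smul, max_zero_sub_eq_self,
        Complex.real_smul, mul_comm]
    · refine hexp _ ?_
      simpa only [ENNReal.toReal_ofReal'] using hi.pos_part
    · refine hexp _ ?_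
      simpa only [ENNReal.toReal_ofReal'] using hi.neg_part
  filter_upwards [(withDensity_eq_iff hp hn fp).1 key] with t ht
  rcases le_total (h t) 0 with h0 | h0
  · rw [ENNReal.ofReal_of_nonpos h0] at ht
    have := ENNReal.ofReal_eq_zero.1 ht.symm
    simp only [Pi.zero_apply]
    linarith
  · rw [ENNReal.ofReal_of_nonpos (neg_nonpos.2 h0)] at ht
    have := ENNReal.ofReal_eq_zero.1 ht
    simp only [Pi.zero_apply]
    linarith

theorem memLp_exp_neg_sq {b : ℝ} (hb : 0 < b) :
    MemLp (fun t : ℝ => Real.exp (-b * t ^ 2)) 2 volume := by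
  refine (memLp_two_iff_integrable_sq (by fun_prop)).2 ?_
  refine (integrable_exp_neg_mul_sq (b := 2 * b) (by positivity)).congr
    (Filter.Eventually.of_forall fun t => ?_)
  simp only
  rw [← Real.exp_nat_mul]
  congr 1
  push_cast
  ring

theorem memLp_aeval_mul_exp (p : ℤ[X]) :
    MemLp (fun t : ℝ => aeval (√2 * t) p * Real.exp (-(t ^ 2) / 2)) 2 volume := by
  have hc : Continuous fun t : ℝ => aeval (√2 * t) p :=
    (Polynomial.continuous_aeval _).comp (by fun_prop)
  refine (memLp_two_iff_integrable_sq (by fun_prop)).2 ?_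
  refine (integrable_aeval_mul_gaussian (p * p) one_pos).congr
    (Filter.Eventually.of_forall fun t => ?_)
  simp only
  rw [map_mul, ← exp_half_mul_exp_half]
  ring

/-- Since X He_r = He_(r+1) + He_r' and He_r' is a multiple of He_(r-1), orthogonality to all
Hermite functions passes to all X^k He_r by induction on k. -/
theorem moment_eq_zero {f : ℝ → ℝ} (hf : MemLp f 2 volume)
    (h : ∀ r, ∫ t, hermiteFun r t * f t = 0) (k : ℕ) :
    ∫ t, t ^ k * (Real.exp (-(t ^ 2) / 2) * f t) = 0 := by
  have hI : ∀ p : ℤ[X], Integrable fun t => aeval (√2 * t) p * Real.exp (-(t ^ 2) / 2) * f t :=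
    fun p => (memLp_aeval_mul_exp p).integrable_mul hf
  have hk : ∀ (k r : ℕ), ∫ t, aeval (√2 * t) (X ^ k * hermite r) * Real.exp (-(t ^ 2) / 2) * f t
      = 0 := by
    intro k
    induction k with
    | zero =>
      intro r
      have hπ := Real.pi_pos
      have hc : (√(r.factorial * √Real.pi))⁻¹ ≠ 0 := by positivity
      refine (mul_eq_zero.1 (?_ : (√(r.factorial * √Real.pi))⁻¹ * _ = 0)).resolve_left hc
      rw [← integral_const_mul, ← h r]
      congr 1
      funext t
      rw [hermiteFun, pow_zero, one_mul]
      ring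
    | succ k ih =>
      intro r
      have e : (X ^ (k + 1) * hermite r : ℤ[X]) =
          X ^ k * hermite (r + 1) + X ^ k * derivative (hermite r) := by
        rw [hermite_succ]
        ring
      have e2 : ∫ t, aeval (√2 * t) (X ^ k * derivative (hermite r)) * Real.exp (-(t ^ 2) / 2) * f t
          = 0 := by
        cases r with
        | zero => simp
        | succ r =>
          rw [derivative_hermite_succ]
          have := congrArg (fun y => ((r : ℝ) + 1) * y) (ih r)
          simp only [mul_zero] at this
          rw [← this, ← integral_const_mul]
          congr 1
          funext t
          simp only [map_mul, map_add, map_natCast, map_one]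
          ring
      have e3 := integral_add (hI (X ^ k * hermite (r + 1))) (hI (X ^ k * derivative (hermite r)))
      rw [ih, e2, add_zero] at e3
      rw [e, ← e3]
      congr 1
      funext t
      rw [map_add]
      ring
  have hc : (√2 : ℝ) ^ k ≠ 0 := by positivity
  refine (mul_eq_zero.1 (?_ : (√2 : ℝ) ^ k * _ = 0)).resolve_left hc
  rw [← integral_const_mul, ← hk k 0]
  congr 1
  funext t
  rw [hermite_zero, map_one, mul_one, map_pow, aeval_X]
  ring

theorem integrable_exp_mul_of_memLp {f : ℝ → ℝ} (hf : MemLp f 2 volume) (ξ : ℝ) :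
    Integrable fun t => Real.exp |ξ * t| * |Real.exp (-(t ^ 2) / 2) * f t| := by
  have h1 : MemLp (fun t : ℝ => Real.exp |ξ * t| * Real.exp (-(t ^ 2) / 2)) 2 volume := by
    refine ((memLp_exp_neg_sq (b := 1 / 4) (by norm_num)).const_mul (Real.exp (ξ ^ 2))).mono
      (by fun_prop) (Filter.Eventually.of_forall fun t => ?_)
    rw [← Real.exp_add, ← Real.exp_add, Real.norm_of_nonneg (Real.exp_pos _).le,
      Real.norm_of_nonneg (Real.exp_pos _).le, Real.exp_le_exp, abs_mul]
    -- Completing the square gives |ξ t| - t²/2 ≤ ξ² - t²/4.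
    have : (|ξ| - |t| / 2) ^ 2 ≥ 0 := sq_nonneg _
    have a1 := sq_abs ξ
    have a2 := sq_abs t
    nlinarith
  refine (h1.integrable_mul hf.norm).congr (Filter.Eventually.of_forall fun t => ?_)
  simp only [Pi.mul_apply, Real.norm_eq_abs, abs_mul, Real.abs_exp]
  ring

/-- The exponential series may be integrated term by term, with the integrable majorant exp |ξ t|
exp(-t²/2) |f|, and every term is a vanishing moment. -/
theorem fourier_eq_zero {f : ℝ → ℝ} (hf : MemLp f 2 volume)
    (h : ∀ r, ∫ t, hermiteFun r t * f t = 0) (ξ : ℝ) :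
    ∫ t : ℝ, Complex.exp (ξ * t * Complex.I) * ((Real.exp (-(t ^ 2) / 2) * f t : ℝ) : ℂ) = 0 := by
  have hs := hasSum_integral_of_dominated_convergence (μ := volume)
    (F := fun (k : ℕ) (t : ℝ) => (ξ * t * Complex.I) ^ k / (k.factorial : ℂ) *
      ((Real.exp (-(t ^ 2) / 2) * f t : ℝ) : ℂ))
    (f := fun t : ℝ => Complex.exp (ξ * t * Complex.I) * ((Real.exp (-(t ^ 2) / 2) * f t : ℝ) : ℂ))
    (fun k t => |ξ * t| ^ k / k.factorial * |Real.exp (-(t ^ 2) / 2) * f t|) (fun k => ?_)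
    (fun k => Filter.Eventually.of_forall fun t => ?_) (Filter.Eventually.of_forall fun t => ?_)
    ?_ (Filter.Eventually.of_forall fun t => ?_)
  · refine hs.unique ?_
    have h0 : ∀ k : ℕ, ∫ t : ℝ, (ξ * t * Complex.I) ^ k / (k.factorial : ℂ) *
        ((Real.exp (-(t ^ 2) / 2) * f t : ℝ) : ℂ) = 0 := fun k => by
      have e : ∀ t : ℝ, (ξ * t * Complex.I) ^ k / (k.factorial : ℂ) *
          ((Real.exp (-(t ^ 2) / 2) * f t : ℝ) : ℂ) = ((ξ * Complex.I) ^ k / (k.factorial : ℂ)) *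
            ((t ^ k * (Real.exp (-(t ^ 2) / 2) * f t) : ℝ) : ℂ) := fun t => by
        push_cast
        rw [mul_right_comm (ξ : ℂ), mul_pow]
        ring
      simp only [e]
      rw [integral_const_mul, integral_complex_ofReal, moment_eq_zero hf h k]
      simp
    simp only [h0]
    exact hasSum_zero
  · have := hf.1
    exact AEStronglyMeasurable.mul (by fun_prop)
      (Complex.continuous_ofReal.comp_aestronglyMeasurable (AEStronglyMeasurable.mul (by fun_prop) hf.1))
  · simp only [norm_mul, norm_div, norm_pow, Complex.norm_real, Complex.norm_I, mul_one,
      Complex.norm_natCast, Real.norm_eq_abs, abs_mul]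
    exact le_rfl
  · exact (Real.summable_pow_div_factorial _).mul_right _
  · refine (integrable_exp_mul_of_memLp hf ξ).congr (Filter.Eventually.of_forall fun t => ?_)
    simp only
    rw [tsum_mul_right, Real.exp_eq_exp_ℝ, NormedSpace.exp_eq_tsum_div]
  · rw [Complex.exp_eq_exp_ℂ]
    have h1 := NormedSpace.expSeries_div_hasSum_exp (𝔸 := ℂ) (ξ * t * Complex.I)
    exact h1.mul_right ((Real.exp (-(t ^ 2) / 2) * f t : ℝ) : ℂ)

theorem isTotal_hermiteFun : IsTotal volume hermiteFun := by
  have hreal : ∀ f : ℝ → ℝ, MemLp f 2 volume → (∀ r, ∫ t, hermiteFun r t * f t = 0) →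
      f =ᵐ[volume] 0 := by
    intro f hf h
    have hi : Integrable fun t => Real.exp (-(t ^ 2) / 2) * f t := by
      have h1 : MemLp (fun t : ℝ => Real.exp (-(t ^ 2) / 2)) 2 volume := by
        simpa using memLp_aeval_mul_exp 1
      exact h1.integrable_mul hf
    filter_upwards [ae_eq_zero_of_fourier hi (fourier_eq_zero hf h)] with t ht
    exact (mul_eq_zero.1 ht).resolve_left (Real.exp_pos _).ne'
  intro g hg h
  have hI : ∀ r, Integrable fun t => (hermiteFun r t : ℂ) * g t := fun r =>
    (isONSystem_hermiteFun.memLp r).integrable_mul hg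
  have h1 := hreal (fun t => (g t).re) hg.re fun r => by
    have := congrArg Complex.re (h r)
    rw [← RCLike.re_eq_complex_re, ← integral_re (hI r)] at this
    simpa using this
  have h2 := hreal (fun t => (g t).im) hg.im fun r => by
    have := congrArg Complex.im (h r)
    rw [← RCLike.im_eq_complex_im, ← integral_im (hI r)] at this
    simpa using this
  filter_upwards [h1, h2] with t a1 a2
  exact Complex.ext a1 a2

end Total

/-! ### Products of orthonormal systems -/

section ProductSystems

variable {X Y ι κ : Type} [MeasurableSpace X] [MeasurableSpace Y] {ν : Measure X} {ρ : Measure Y}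

/-- The tensor products of the members of two systems. -/
def prodSystem (e : ι → X → ℝ) (f : κ → Y → ℝ) (p : ι × κ) (z : X × Y) : ℝ := e p.1 z.1 * f p.2 z.2

/-- The tensor powers of a system. -/
def piSystem {m : ℕ} (e : ι → X → ℝ) (α : Fin m → ι) (y : Fin m → X) : ℝ := ∏ j, e (α j) (y j)

theorem IsONSystem.prod [SigmaFinite ν] [SigmaFinite ρ] {e : ι → X → ℝ} {f : κ → Y → ℝ}
    (he : IsONSystem ν e) (hf : IsONSystem ρ f) : IsONSystem (ν.prod ρ) (prodSystem e f) where
  meas p := ((he.meas p.1).comp measurable_fst).mul ((hf.meas p.2).comp measurable_snd)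
  memLp p := by
    have := memLp_tensor (he.memLp p.1) (hf.memLp p.2)
    simpa only [prodSystem, Complex.ofReal_mul] using this
  inner p q := by
    have e1 : ∀ z, prodSystem e f p z * prodSystem e f q z =
        (e p.1 z.1 * e q.1 z.1) * (f p.2 z.2 * f q.2 z.2) := fun z => by
      simp only [prodSystem]
      ring
    simp only [e1]
    rw [integral_prod_mul (fun x => e p.1 x * e q.1 x) (fun y => f p.2 y * f q.2 y), he.inner,
      hf.inner]
    by_cases h1 : p.1 = q.1
    · by_cases h2 : p.2 = q.2
      · simp [h1, h2, Prod.ext_iff]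
      · simp [h2, Prod.ext_iff]
    · simp [h1, Prod.ext_iff]

theorem IsONSystem.integrable_mul {e : ι → X → ℝ} (he : IsONSystem ν e) (a b : ι) :
    Integrable (fun x => e a x * e b x) ν := by
  have h := ((he.memLp a).integrable_mul (he.memLp b)).re
  refine h.congr (Filter.Eventually.of_forall fun x => ?_)
  simp

theorem IsONSystem.pi [SigmaFinite ν] {e : ι → X → ℝ} (he : IsONSystem ν e) (m : ℕ) :
    IsONSystem (Measure.pi fun _ : Fin m => ν) (piSystem e) where
  meas α := Finset.measurable_fun_prod _ fun j _ => (he.meas (α j)).comp (measurable_pi_apply j)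
  memLp α := by
    have hm : Measurable fun y : Fin m → X => piSystem e α y :=
      Finset.measurable_fun_prod _ fun j _ => (he.meas (α j)).comp (measurable_pi_apply j)
    refine (memLp_two_iff_integrable_sq_norm (by fun_prop)).2 ?_
    have := Integrable.fintype_prod (f := fun (j : Fin m) (x : X) => e (α j) x * e (α j) x)
      (μ := fun _ => ν) fun j => he.integrable_mul _ _
    refine this.congr (Filter.Eventually.of_forall fun y => ?_)
    simp only [Complex.norm_real, Real.norm_eq_abs, sq_abs, piSystem, ← Finset.prod_pow]
    exact Finset.prod_congr rfl fun j _ => (sq _).symm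
  inner α β := by
    have e1 : ∀ y : Fin m → X, piSystem e α y * piSystem e β y =
        ∏ j, (fun (j : Fin m) x => e (α j) x * e (β j) x) j (y j) := fun y => by
      simp only [piSystem, Finset.prod_mul_distrib]
    rw [integral_congr_ae (Filter.Eventually.of_forall e1),
      integral_fintype_prod_eq_prod (μ := fun _ : Fin m => ν)
        (fun (j : Fin m) x => e (α j) x * e (β j) x)]
    simp only [he.inner]
    by_cases h : α = β
    · subst h
      simp
    · rw [if_neg h]
      obtain ⟨j, hj⟩ := Function.ne_iff.1 h
      exact Finset.prod_eq_zero (Finset.mem_univ j) (if_neg hj)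

/-- Contracting g with f_b gives a function of x orthogonal to all e_a, hence zero. Countability of
the labels b makes this hold for almost every x and all b at once, and then the slice g(x, ·)
vanishes. -/
theorem IsTotal.prod [SigmaFinite ν] [SigmaFinite ρ] [Countable κ] {e : ι → X → ℝ} {f : κ → Y → ℝ}
    (hes : IsONSystem ν e) (hfs : IsONSystem ρ f)
    (he : IsTotal ν e) (hf : IsTotal ρ f) : IsTotal (ν.prod ρ) (prodSystem e f) := by
  intro g hg h
  have h1 : ∀ b, (fun x => ∫ y, (f b y : ℂ) * g (x, y) ∂ρ) =ᵐ[ν] 0 := by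
    intro b
    refine he _ (memLp_contract (hfs.memLp b) hg) fun a => ?_
    rw [← h (a, b)]
    have hi : Integrable (fun z => (prodSystem e f (a, b) z : ℂ) * g z) (ν.prod ρ) :=
      ((hes.prod hfs).memLp (a, b)).integrable_mul hg
    rw [integral_prod _ hi]
    congr 1
    funext x
    rw [← integral_const_mul]
    congr 1
    funext y
    simp only [prodSystem]
    push_cast
    ring
  have h2 := lintegral_enorm_sq_lt_top hg
  rw [lintegral_prod _ (hg.1.enorm.pow_const 2)] at h2
  have h3 : ∀ᵐ x ∂ν, ∀ᵐ y ∂ρ, g (x, y) = 0 := by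
    filter_upwards [ae_all_iff.2 h1, hg.1.prodMk_left,
      ae_lt_top' ((hg.1.enorm.pow_const 2).lintegral_prod_right') h2.ne] with x a1 a2 a3
    exact hf _ ((memLp_two_iff a2).2 a3) a1
  -- Passing from almost every slice back to the product measure requires a measurable zero set,
  -- hence a strongly measurable representative.
  obtain ⟨g', hg', hgg'⟩ := hg.1
  have h4 : ∀ᵐ x ∂ν, ∀ᵐ y ∂ρ, g' (x, y) = 0 := by
    filter_upwards [h3, Measure.ae_ae_of_ae_prod hgg'] with x a1 a2
    filter_upwards [a1, a2] with y b1 b2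
    rw [← b2, b1]
  have hs : MeasurableSet {z | g' z = 0} := hg'.measurable (measurableSet_singleton 0)
  filter_upwards [hgg', (Measure.ae_prod_iff_ae_ae hs).2 h4] with z a1 a2
  rw [a1, a2]
  rfl

theorem IsTotal.of_measurePreserving {e : ι → X → ℝ} {f : κ → Y → ℝ} (T : X ≃ᵐ Y)
    (hT : MeasurePreserving T ν ρ) (hf : IsTotal ρ f) (h : ∀ b, ∃ a, ∀ x, e a x = f b (T x)) :
    IsTotal ν e := by
  intro g hg hz
  have h1 := hf (g ∘ T.symm) (hg.comp_measurePreserving hT.symm) fun b => by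
    obtain ⟨a, ha⟩ := h b
    rw [← hz a, ← hT.integral_comp' (g := fun y => (f b y : ℂ) * (g ∘ T.symm) y)]
    simp [ha]
  have h2 := hT.quasiMeasurePreserving.ae h1
  filter_upwards [h2] with x hx
  simpa using hx

theorem IsTotal.pi [SigmaFinite ν] [Countable ι] {e : ι → X → ℝ} (hes : IsONSystem ν e)
    (he : IsTotal ν e) (m : ℕ) : IsTotal (Measure.pi fun _ : Fin m => ν) (piSystem e) := by
  induction m with
  | zero =>
    intro g hg h
    have h1 := h Fin.elim0
    simp only [piSystem, Finset.univ_eq_empty, Finset.prod_empty, Complex.ofReal_one, one_mul] at h1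
    rw [Measure.pi_of_empty, integral_dirac] at h1
    refine Filter.Eventually.of_forall fun y => ?_
    rw [Subsingleton.elim y isEmptyElim]
    exact h1
  | succ m ih =>
    refine (IsTotal.prod hes (hes.pi m) he ih).of_measurePreserving
      (MeasurableEquiv.piFinSuccAbove (fun _ => X) 0)
      (measurePreserving_piFinSuccAbove (fun _ => ν) 0) fun b => ⟨Fin.cons b.1 b.2, fun y => ?_⟩
    simp [piSystem, prodSystem, Fin.prod_univ_succ, MeasurableEquiv.piFinSuccAbove]
    left
    rfl

/-- Parseval's identity for the Hilbert basis, applied to the conjugate of G; no conjugation is left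
because the basis functions are real. -/
theorem IsONSystem.hasSum_mul {e : ι → X → ℝ} (hes : IsONSystem ν e) (he : IsTotal ν e)
    {G R : X → ℂ} (hG : MemLp G 2 ν) (hR : MemLp R 2 ν) :
    HasSum (fun a => (∫ x, (e a x : ℂ) * G x ∂ν) * ∫ x, (e a x : ℂ) * R x ∂ν)
      (∫ x, G x * R x ∂ν) := by
  have hb : (Submodule.span ℂ (Set.range fun a => (hes.memLp a).toLp fun x => (e a x : ℂ)))ᗮ = ⊥ := by
    rw [Submodule.eq_bot_iff]
    intro g hg
    have hgm : MemLp g 2 ν := Lp.memLp g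
    have h := he g hgm fun a => by
      have h1 := Submodule.inner_right_of_mem_orthogonal
        (Submodule.subset_span (Set.mem_range_self a)) hg
      have h2 := inner_toLp (hes.memLp a) hgm
      rw [Lp.toLp_coeFn, h1] at h2
      simpa using h2.symm
    exact Lp.ext (h.trans (Lp.coeFn_zero _ _ _).symm)
  have h := (HilbertBasis.mkOfOrthogonalEqBot hes.orthonormal hb).hasSum_inner_mul_inner
    ((MemLp.conj hG).toLp _) (hR.toLp _)
  simp only [HilbertBasis.coe_mkOfOrthogonalEqBot] at h
  rw [inner_toLp (MemLp.conj hG) hR] at h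
  simp only [inner_toLp (MemLp.conj hG) (hes.memLp _), inner_toLp (hes.memLp _) hR,
    Complex.conj_conj, Complex.conj_ofReal] at h
  simpa only [mul_comm (G _) _] using h

end ProductSystems

/-! ### The Hermite basis of the one-particle space -/

section ParticleBasis

/-- The standard basis of the functions of the spin. -/
def spinSystem (s t : Spin) : ℝ := if s = t then 1 else 0

theorem integral_spin (f : Spin → ℂ) : ∫ t, f t = ∑ t, f t := integral_count f

theorem isONSystem_spinSystem : IsONSystem volume spinSystem where
  meas _ := measurable_of_finite _
  memLp _ := MemLp.of_bound (measurable_of_finite _).aestronglyMeasurable 1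
    (Filter.Eventually.of_forall fun t => by simp only [spinSystem]; split_ifs <;> simp)
  inner a b := by
    have : ∫ t, spinSystem a t * spinSystem b t = ∑ t, spinSystem a t * spinSystem b t :=
      integral_count _
    rw [this]
    simp [spinSystem]

theorem isTotal_spinSystem : IsTotal volume spinSystem := by
  intro g _ h
  refine Filter.Eventually.of_forall fun t => ?_
  have := h t
  rw [integral_spin] at this
  simpa only [spinSystem, Pi.zero_apply, apply_ite, ite_mul, Complex.ofReal_one,
    Complex.ofReal_zero, one_mul, zero_mul, Finset.sum_ite_eq, Finset.mem_univ, if_true] using this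

/-- Labels of the Hermite basis of the one-particle space. -/
abbrev Mode : Type := (Fin 3 → ℕ) × Spin

/-- The Hermite basis of the one-particle space. -/
def modeFun : Mode → Particle → ℝ := prodSystem (piSystem hermiteFun) spinSystem

instance : Countable Spin := Finite.to_countable

theorem isONSystem_modeFun : IsONSystem volume modeFun :=
  (isONSystem_hermiteFun.pi 3).prod isONSystem_spinSystem

theorem isTotal_modeFun : IsTotal volume modeFun :=
  IsTotal.prod (isONSystem_hermiteFun.pi 3) isONSystem_spinSystem
    (isTotal_hermiteFun.pi isONSystem_hermiteFun 3) isTotal_spinSystem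

end ParticleBasis

/-! ### Weighted square function estimates for one species -/

section SpeciesBounds

variable {n : ℕ}

/-- The finite set of labels is enclosed in a cube of momentum labels times the spins; the factor 2
counts the spin values. -/
theorem sum_mode_le {g : ℕ → ℝ} (hg : ∀ r, 0 ≤ g r) (hs : Summable g) (F : Finset Mode) :
    ∑ α ∈ F, ∏ j, g (α.1 j) ≤ 2 * (∑' r, g r) ^ 3 := by
  classical
  set N := (F.sup fun α => Finset.univ.sup α.1) + 1 with hN
  have hsub : F ⊆ (Fintype.piFinset fun _ : Fin 3 => Finset.range N) ×ˢ (Finset.univ : Finset Spin) := by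
    intro α hα
    simp only [Finset.mem_product, Fintype.mem_piFinset, Finset.mem_range, Finset.mem_univ,
      and_true]
    intro j
    rw [hN, Nat.lt_succ_iff]
    exact (Finset.le_sup (f := α.1) (Finset.mem_univ j)).trans
      (Finset.le_sup (f := fun α : Mode => Finset.univ.sup α.1) hα)
  refine (Finset.sum_le_sum_of_subset_of_nonneg hsub
    fun α _ _ => Finset.prod_nonneg fun j _ => hg _).trans ?_
  have hcard : Fintype.card Spin = 2 := Fintype.card_bool
  rw [Finset.sum_product, Finset.sum_comm]
  simp only
  rw [Finset.sum_const, Finset.card_univ, hcard, nsmul_eq_mul,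
    ← Finset.prod_univ_sum, Finset.prod_const, Finset.card_univ, Fintype.card_fin]
  push_cast
  have h1 := hs.sum_le_tsum (Finset.range N) fun r _ => hg r
  have h2 : 0 ≤ ∑ r ∈ Finset.range N, g r := Finset.sum_nonneg fun r _ => hg r
  gcongr

/-! ### Eigenvalue weights and the local mass of the basis functions. -/

theorem summable_odd_rpow {p : ℝ} (hp : 1 < p) : Summable fun r : ℕ => (2 * r + 1 : ℝ) ^ (-p) := by
  have h := (summable_nat_add_iff 1).2 (Real.summable_nat_rpow.2 (by linarith : -p < -1))
  refine h.of_nonneg_of_le (fun r => by positivity) fun r => ?_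
  refine Real.rpow_le_rpow_of_nonpos (by positivity) ?_ (by linarith)
  push_cast
  linarith [r.cast_nonneg (α := ℝ)]

/-- The weights `∏_j (2 r_j + 1)^s`, eigenvalues of the powers of the harmonic oscillators. -/
def modeWeight (s : ℝ) (α : Mode) : ℝ := ∏ j, (2 * (α.1 j : ℝ) + 1) ^ s

theorem modeWeight_pos (s : ℝ) (α : Mode) : 0 < modeWeight s α :=
  Finset.prod_pos fun _ _ => by positivity

theorem modeWeight_rpow (s t : ℝ) (α : Mode) : modeWeight s α ^ t = modeWeight (s * t) α := by
  rw [modeWeight, modeWeight, ← Real.finsetProd_rpow _ _ fun _ _ => by positivity]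
  exact Finset.prod_congr rfl fun j _ => (Real.rpow_mul (by positivity) _ _).symm

theorem modeWeight_add (s t : ℝ) (α : Mode) :
    modeWeight (s + t) α = modeWeight s α * modeWeight t α := by
  rw [modeWeight, modeWeight, modeWeight, ← Finset.prod_mul_distrib]
  exact Finset.prod_congr rfl fun j _ => Real.rpow_add (by positivity) _ _

theorem integrable_modeFun_sq (α : Mode) : Integrable fun x => modeFun α x ^ 2 := by
  have := isONSystem_modeFun.integrable_mul α α
  simpa only [sq] using this

theorem setIntegral_modeFun_sq_le_one (α : Mode) (S : Set Particle) :
    ∫ x in S, modeFun α x ^ 2 ≤ 1 := by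
  have h := isONSystem_modeFun.inner α α
  rw [if_pos rfl] at h
  simp only [← sq] at h
  rw [← h]
  exact setIntegral_le_integral (integrable_modeFun_sq α)
    (Filter.Eventually.of_forall fun x => sq_nonneg _)

theorem modeFun_sq_le (α : Mode) {x : Particle} (hx : ∀ j, |x.1 j| ≤ 1) :
    modeFun α x ^ 2 ≤ 8 ^ 3 * modeWeight (-(1 / 2)) α := by
  have h1 : spinSystem α.2 x.2 ^ 2 ≤ 1 := by
    rw [spinSystem]
    split_ifs <;> simp
  have h2 : piSystem hermiteFun α.1 x.1 ^ 2 ≤ 8 ^ 3 * modeWeight (-(1 / 2)) α := by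
    rw [piSystem, ← Finset.prod_pow]
    calc ∏ j, hermiteFun (α.1 j) (x.1 j) ^ 2 ≤ ∏ j, 8 * (2 * (α.1 j : ℝ) + 1) ^ (-(1 / 2 : ℝ)) :=
          Finset.prod_le_prod (fun _ _ => sq_nonneg _) fun j _ => hermiteFun_sq_le _ (hx j)
      _ = _ := by simp [Finset.prod_mul_distrib, modeWeight]
  rw [modeFun, prodSystem, mul_pow]
  exact (mul_le_of_le_one_right (sq_nonneg _) h1).trans h2

/-- The set lies in a cube of side 2δ with two spins, of measure 16 δ³, and on it the pointwise
bound holds with one factor 8 for each momentum component. -/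
theorem setIntegral_modeFun_sq_le (α : Mode) {S : Set Particle} {δ : ℝ} (hδ0 : 0 ≤ δ) (hδ : δ ≤ 1)
    (hS : ∀ x ∈ S, ∀ j, |x.1 j| ≤ δ) :
    ∫ x in S, modeFun α x ^ 2 ≤ 16 * 8 ^ 3 * δ ^ 3 * modeWeight (-(1 / 2)) α := by
  have hw := (modeWeight_pos (-(1 / 2)) α).le
  have hvol : volume (Set.Icc (fun _ : Fin 3 => -δ) (fun _ => δ) ×ˢ (Set.univ : Set Spin)) =
      ENNReal.ofReal (16 * δ ^ 3) := by
    have h2 : (volume : Measure Spin) Set.univ = 2 := by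
      refine (Measure.count_apply_finite _ Set.finite_univ).trans ?_
      simp [show Fintype.card Spin = 2 from Fintype.card_bool]
    rw [Measure.volume_eq_prod, Measure.prod_prod, Real.volume_Icc_pi, h2, Finset.prod_const,
      ← ENNReal.ofReal_pow (by linarith), show (2 : ENNReal) = ENNReal.ofReal 2 by simp,
      ← ENNReal.ofReal_mul (by simp; positivity)]
    congr 1
    simp
    ring
  have hsub : S ⊆ Set.Icc (fun _ : Fin 3 => -δ) (fun _ => δ) ×ˢ (Set.univ : Set Spin) :=
    fun x hx => ⟨⟨fun j => (abs_le.1 (hS x hx j)).1, fun j => (abs_le.1 (hS x hx j)).2⟩, trivial⟩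
  have hle : volume S ≤ ENNReal.ofReal (16 * δ ^ 3) := (measure_mono hsub).trans_eq hvol
  have h := norm_setIntegral_le_of_norm_le_const (μ := volume) (s := S)
    (f := fun x => modeFun α x ^ 2) (C := 8 ^ 3 * modeWeight (-(1 / 2)) α)
    (hle.trans_lt ENNReal.ofReal_lt_top) fun x hx => by
      rw [Real.norm_of_nonneg (sq_nonneg _)]
      exact modeFun_sq_le α fun j => (hS x hx j).trans hδ
  refine (le_abs_self _).trans (h.trans ?_)
  have h3 : volume.real S ≤ 16 * δ ^ 3 :=
    ENNReal.toReal_le_of_le_ofReal (by positivity) hle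
  calc 8 ^ 3 * modeWeight (-(1 / 2)) α * volume.real S ≤
        8 ^ 3 * modeWeight (-(1 / 2)) α * (16 * δ ^ 3) := by gcongr
    _ = _ := by ring

/-- The bounds for the annihilation and creation operators of species `i` relative to a power of
the energy of that species. -/
def SpeciesBdd (i : Fin n) (ω : Particle → ℝ) (s γ : ℝ) : Prop :=
  ∃ C, ColBdd (fun α => (modeWeight (-s) α : ℂ) • ((annih i (fun x => (modeFun α x : ℂ)) ∘L
      mulOp (energyPow i ω (-γ)) : FockSpace n →L[ℂ] FockSpace n))) C ∧
    RowBdd (fun α => (modeWeight (-s) α : ℂ) • (((annih i fun x => (modeFun α x : ℂ)).adjoint ∘L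
      mulOp (energyPow i ω (-γ)) : FockSpace n →L[ℂ] FockSpace n))) C

theorem sum_modeWeight_le {p : ℝ} (hp : 1 < p) (F : Finset Mode) :
    ∑ α ∈ F, modeWeight (-p) α ≤ 2 * (∑' r : ℕ, (2 * r + 1 : ℝ) ^ (-p)) ^ 3 :=
  sum_mode_le (g := fun r : ℕ => (2 * r + 1 : ℝ) ^ (-p)) (fun r => by positivity)
    (summable_odd_rpow hp) F

theorem tsum_odd_rpow_pos {p : ℝ} (hp : 1 < p) : 0 < ∑' r : ℕ, (2 * r + 1 : ℝ) ^ (-p) :=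
  (summable_odd_rpow hp).tsum_pos (fun r => by positivity) 0 (by positivity)

/-- Interpolation with θ = 1 - 2γ, using only that the mass of e_α on S is at most 1. The condition
on s says that the exponent 2s/θ of the eigenvalues exceeds 1. -/
theorem exists_colBdd_channel (i : Fin n) {S : Set Particle} (hS : MeasurableSet S) {s γ : ℝ}
    (hγ0 : 0 < γ) (hγ : γ < 1 / 2) (hs : 1 / 2 - γ < s) :
    ∃ C, ColBdd (fun α => (modeWeight (-s) α : ℂ) • ((annih i (S.indicator fun x =>
      (modeFun α x : ℂ)) ∘L mulOp (countPow i S 1 (-γ)) : FockSpace n →L[ℂ] FockSpace n))) C := by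
  have hθ : (1 - (1 - 2 * γ)) / 2 = γ := by ring
  have hp : 1 < s * (2 / (1 - 2 * γ)) := by
    rw [← mul_div_assoc, lt_div_iff₀ (by linarith)]
    linarith
  have h := colBdd_interpolation (n := n) i isONSystem_modeFun hS (a := modeWeight (-s))
    (modeWeight_pos _) (θ := 1 - 2 * γ) (by linarith) (by linarith)
    (D := 2 * (∑' r : ℕ, (2 * r + 1 : ℝ) ^ (-(s * (2 / (1 - 2 * γ))))) ^ 3)
    (by have := tsum_odd_rpow_pos hp; positivity) fun F => by
      refine le_trans (Finset.sum_le_sum fun α _ => ?_) (sum_modeWeight_le hp F)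
      rw [modeWeight_rpow, neg_mul]
      exact mul_le_of_le_one_right (modeWeight_pos _ _).le (setIntegral_modeFun_sq_le_one α S)
  rw [hθ] at h
  exact ⟨_, h⟩

/-! ### Massive species. -/

theorem measurable_dispersion (m : ℝ) : Measurable fun x : Particle => dispersion m x.1 := by
  unfold dispersion
  fun_prop

theorem dispersion_nonneg (m : ℝ) (x : Particle) : 0 ≤ dispersion m x.1 := Real.sqrt_nonneg _

/-- Each particle has energy at least m, so a single channel, the whole space, controls the particle
number. The channel q = 0 is everything and all the others are empty. -/
theorem speciesBdd_of_pos (i : Fin n) {m s γ : ℝ} (hm : 0 < m)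
    (h : (γ = 1 / 2 ∧ 0 ≤ s) ∨ (0 < γ ∧ γ < 1 / 2 ∧ 1 / 2 - γ < s)) :
    SpeciesBdd i (fun x => dispersion m x.1) s γ := by
  have hγ : 0 ≤ γ := by rcases h with h | h <;> linarith [h.1]
  obtain ⟨C, hC⟩ : ∃ C, ColBdd (fun α => (modeWeight (-s) α : ℂ) •
      ((annih i (Set.univ.indicator fun x => (modeFun α x : ℂ)) ∘L
        mulOp (countPow i Set.univ 1 (-γ)) : FockSpace n →L[ℂ] FockSpace n))) C := by
    rcases h with ⟨rfl, hs⟩ | ⟨h1, h2, h3⟩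
    · refine ⟨1, colBdd_annih_of_le_one i isONSystem_modeFun MeasurableSet.univ fun α => ?_⟩
      rw [abs_of_pos (modeWeight_pos _ _)]
      refine Finset.prod_le_one (fun _ _ => by positivity) fun j _ => ?_
      exact Real.rpow_le_one_of_one_le_of_nonpos (by linarith [(α.1 j).cast_nonneg (α := ℝ)])
        (by linarith)
    · exact exists_colBdd_channel i MeasurableSet.univ h1 h2 h3
  set S : ℕ → Set Particle := fun q => if q = 0 then Set.univ else ∅ with hS
  have hSm : ∀ q, MeasurableSet (S q) := fun q => by
    by_cases hq : q = 0 <;> simp [hS, hq]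
  have hd : Pairwise fun p q => Disjoint (S p) (S q) := by
    intro p q hpq
    by_cases hp : p = 0
    · have hq : q ≠ 0 := by omega
      simp [hS, hq]
    · simp [hS, hp]
  have hu : ∀ᵐ x : Particle, x ∈ ⋃ q, S q :=
    Filter.Eventually.of_forall fun x => Set.mem_iUnion.2 ⟨0, by simp [hS]⟩
  have hκ : ∀ _ : ℕ, 1 ≤ max 1 (1 / m) := fun _ => le_max_left _ _
  have hSκ : ∀ q, ∀ x ∈ S q, 1 ≤ max 1 (1 / m) * dispersion m x.1 := fun q x _ => by
    have h1 : m ≤ dispersion m x.1 := by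
      refine Real.le_sqrt_of_sq_le ?_
      have : 0 ≤ ∑ j, x.1 j ^ 2 := Finset.sum_nonneg fun j _ => sq_nonneg _
      linarith
    calc (1 : ℝ) = 1 / m * m := by field_simp
      _ ≤ _ := by gcongr; exact le_max_right _ _
  have hCq : ∀ q, ColBdd (fun α => (modeWeight (-s) α : ℂ) •
      ((annih i ((S q).indicator fun x => (modeFun α x : ℂ)) ∘L
        mulOp (countPow i (S q) 1 (-γ)) : FockSpace n →L[ℂ] FockSpace n)))
          (if q = 0 then C else 0) := by
    intro q
    by_cases hq : q = 0
    · simpa [hS, hq] using hC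
    · refine ⟨by simp [hq], fun F X => ?_⟩
      have h0 : (annih i fun _ => 0 : FockSpace n →L[ℂ] FockSpace n) = 0 := annih_zero i
      simp [hS, hq, h0]
  have hsum : Summable fun q : ℕ => (if q = 0 then C else 0) * (2 * max 1 (1 / m)) ^ γ := by
    refine summable_of_ne_finset_zero (s := {0}) fun q hq => ?_
    rw [if_neg (by simpa using hq), zero_mul]
  exact ⟨_, colBdd_of_channels i isONSystem_modeFun (measurable_dispersion m) (dispersion_nonneg m)
      hSm hd hu hκ hSκ (fun _ => hγ) (fun _ => le_rfl) hCq hsum,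
    rowBdd_of_channels i isONSystem_modeFun (measurable_dispersion m) (dispersion_nonneg m)
      hSm hd hu hκ hSκ (fun _ => hγ) (fun _ => le_rfl) hCq hsum⟩

/-! ### Massless species. -/

/-- Dyadic shells in momentum space. -/
def shell : ℕ → Set Particle
  | 0 => {x | 1 ≤ dispersion 0 x.1}
  | q + 1 => {x | (1 / 2 : ℝ) ^ (q + 1) ≤ dispersion 0 x.1 ∧ dispersion 0 x.1 < (1 / 2 : ℝ) ^ q}

theorem measurableSet_shell (q : ℕ) : MeasurableSet (shell q) := by
  cases q with
  | zero => exact measurableSet_le measurable_const (measurable_dispersion 0)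
  | succ q =>
    exact (measurableSet_le measurable_const (measurable_dispersion 0)).inter
      (measurableSet_lt (measurable_dispersion 0) measurable_const)

theorem le_of_mem_shell {q : ℕ} {x : Particle} (hx : x ∈ shell q) :
    (1 / 2 : ℝ) ^ q ≤ dispersion 0 x.1 := by
  cases q with
  | zero =>
    rw [pow_zero]
    exact hx
  | succ q => exact hx.1

theorem disjoint_shell : Pairwise fun p q => Disjoint (shell p) (shell q) := by
  have h : ∀ p q, p < q → Disjoint (shell p) (shell q) := by
    intro p q hpq
    refine Set.disjoint_left.2 fun x hp hq => ?_
    obtain ⟨q, rfl⟩ := Nat.exists_eq_succ_of_ne_zero (by omega : q ≠ 0)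
    have h1 := le_of_mem_shell hp
    have h2 : (1 / 2 : ℝ) ^ q ≤ (1 / 2) ^ p :=
      pow_le_pow_of_le_one (by norm_num) (by norm_num) (by omega)
    linarith [hq.2]
  intro p q hpq
  rcases lt_or_gt_of_ne hpq with h1 | h1
  · exact h p q h1
  · exact (h q p h1).symm

theorem ae_mem_iUnion_shell : ∀ᵐ x, x ∈ ⋃ q, shell q := by
  have h0 : ∀ᵐ x : Particle, x.1 ≠ 0 := by
    have h1 : ∀ᵐ k : Fin 3 → ℝ, k ≠ 0 := by
      rw [ae_iff]
      simp
    exact (Measure.quasiMeasurePreserving_fst (μ := (volume : Measure (Fin 3 → ℝ)))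
      (ν := (volume : Measure Spin))).ae h1
  filter_upwards [h0] with x hx
  have hpos : 0 < dispersion 0 x.1 := by
    rw [dispersion, Real.sqrt_pos]
    obtain ⟨j, hj⟩ := Function.ne_iff.1 hx
    have h1 : 0 < x.1 j ^ 2 := by
      have : x.1 j ≠ 0 := hj
      positivity
    have h2 := Finset.single_le_sum (f := fun j => x.1 j ^ 2) (fun j _ => sq_nonneg _)
      (Finset.mem_univ j)
    linarith [sq_nonneg (0 : ℝ)]
  have hex : ∃ q : ℕ, (1 / 2 : ℝ) ^ q ≤ dispersion 0 x.1 := by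
    obtain ⟨q, hq⟩ := exists_pow_lt_of_lt_one hpos (by norm_num : (1 / 2 : ℝ) < 1)
    exact ⟨q, hq.le⟩
  classical
  refine Set.mem_iUnion.2 ⟨Nat.find hex, ?_⟩
  have h1 := Nat.find_spec hex
  rcases hq : Nat.find hex with _ | q
  · rw [hq] at h1
    simpa [shell] using h1
  · rw [hq] at h1
    exact ⟨h1, not_le.1 (Nat.find_min hex (by omega))⟩

theorem abs_le_dispersion (x : Particle) (j : Fin 3) : |x.1 j| ≤ dispersion 0 x.1 := by
  rw [dispersion, ← Real.sqrt_sq_eq_abs]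
  refine Real.sqrt_le_sqrt ?_
  have := Finset.single_le_sum (f := fun j => x.1 j ^ 2) (fun j _ => sq_nonneg _)
    (Finset.mem_univ j)
  linarith [sq_nonneg (0 : ℝ)]

/-- On the shell the momenta are at most 2^(-q), so the mass of e_α is of order 8^(-q) ∏ (2 r_j +
1)^(-1/2). The last factor adds 1/2 to the exponent 2s/θ, so s > θ/4 suffices here instead of s >
θ/2. -/
theorem exists_colBdd_shell (i : Fin n) {s θ : ℝ} (h0 : 0 < θ) (h1 : θ < 1) (hs : θ / 4 < s) :
    ∃ D : ℝ, 0 < D ∧ ∀ q, ColBdd (fun α => (modeWeight (-s) α : ℂ) •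
      ((annih i ((shell (q + 1)).indicator fun x => (modeFun α x : ℂ)) ∘L
        mulOp (countPow i (shell (q + 1)) 1 (-((1 - θ) / 2))) : FockSpace n →L[ℂ] FockSpace n)))
          ((D * (1 / 8) ^ q) ^ (θ / 2)) := by
  have hp : 1 < s * (2 / θ) + 1 / 2 := by
    have : 1 / 2 < s * (2 / θ) := by
      rw [← mul_div_assoc, lt_div_iff₀ h0]
      linarith
    linarith
  refine ⟨16 * 8 ^ 3 * (2 * (∑' r : ℕ, (2 * r + 1 : ℝ) ^ (-(s * (2 / θ) + 1 / 2))) ^ 3),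
    by have := tsum_odd_rpow_pos hp; positivity, fun q => ?_⟩
  refine colBdd_interpolation i isONSystem_modeFun (measurableSet_shell _) (modeWeight_pos _) h0 h1
    (by have := tsum_odd_rpow_pos hp; positivity) fun F => ?_
  have hint : ∀ α, ∫ x in shell (q + 1), modeFun α x ^ 2 ≤
      16 * 8 ^ 3 * (1 / 8) ^ q * modeWeight (-(1 / 2)) α := fun α => by
    have h := setIntegral_modeFun_sq_le α (S := shell (q + 1)) (δ := (1 / 2) ^ q) (by positivity)
      (pow_le_one₀ (by norm_num) (by norm_num))
      fun x hx j => (abs_le_dispersion x j).trans hx.2.le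
    have e : (((1 : ℝ) / 2) ^ q) ^ 3 = (1 / 8) ^ q := by
      rw [← pow_mul, mul_comm, pow_mul]
      norm_num
    rwa [e] at h
  calc ∑ α ∈ F, modeWeight (-s) α ^ (2 / θ) * ∫ x in shell (q + 1), modeFun α x ^ 2
      ≤ ∑ α ∈ F, 16 * 8 ^ 3 * (1 / 8) ^ q * modeWeight (-(s * (2 / θ) + 1 / 2)) α := by
        refine Finset.sum_le_sum fun α _ => ?_
        rw [modeWeight_rpow, neg_add, modeWeight_add, neg_mul]
        have := (modeWeight_pos (-(s * (2 / θ))) α).le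
        calc _ ≤ modeWeight (-(s * (2 / θ))) α *
              (16 * 8 ^ 3 * (1 / 8) ^ q * modeWeight (-(1 / 2)) α) := by
              gcongr
              exact hint α
          _ = _ := by ring
    _ ≤ 16 * 8 ^ 3 * (1 / 8) ^ q * (2 * (∑' r : ℕ, (2 * r + 1 : ℝ) ^ (-(s * (2 / θ) + 1 / 2))) ^ 3) := by
        rw [← Finset.mul_sum]
        gcongr
        exact sum_modeWeight_le hp F
    _ = _ := by ring

/-- The ratio of consecutive terms is 2^((1 - 4θ)/2): the gain 8^(-θ/2) from the small volume
against the loss 2^((1 - θ)/2) from the low energy. -/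
theorem summable_shell_bound {D θ : ℝ} (hD : 0 < D) (hθ : 1 / 4 < θ) :
    Summable fun q : ℕ => (D * (1 / 8) ^ q) ^ (θ / 2) * (2 * (2 : ℝ) ^ (q + 1)) ^ ((1 - θ) / 2) := by
  have hr : ((1 / 8 : ℝ) ^ (θ / 2) * 2 ^ ((1 - θ) / 2)) < 1 := by
    have e : (1 / 8 : ℝ) = 2 ^ (-3 : ℝ) := by
      rw [Real.rpow_neg (by norm_num)]
      norm_num
    rw [e, ← Real.rpow_mul (by norm_num), ← Real.rpow_add (by norm_num)]
    exact Real.rpow_lt_one_of_one_lt_of_neg (by norm_num) (by linarith)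
  refine ((summable_geometric_of_lt_one (by positivity) hr).mul_left
    (D ^ (θ / 2) * (4 : ℝ) ^ ((1 - θ) / 2))).congr fun q => ?_
  rw [show (2 : ℝ) * 2 ^ (q + 1) = 4 * 2 ^ q by ring, Real.mul_rpow hD.le (by positivity),
    Real.mul_rpow (by norm_num) (by positivity), mul_pow, ← Real.rpow_natCast, ← Real.rpow_natCast,
    ← Real.rpow_natCast, ← Real.rpow_natCast, ← Real.rpow_mul (by norm_num),
    ← Real.rpow_mul (by norm_num), ← Real.rpow_mul (by norm_num), ← Real.rpow_mul (by norm_num),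
    mul_comm (θ / 2), mul_comm ((1 - θ) / 2) (q : ℝ)]
  ring

theorem speciesBdd_zero (i : Fin n) {s γ : ℝ} (hs : 1 / 12 ≤ s) (hγ0 : 0 < γ) (hγ : γ < 1 / 2)
    (hsγ : 1 / 2 - γ < s) : SpeciesBdd i (fun x => dispersion 0 x.1) s γ := by
  obtain ⟨C₀, hC₀⟩ := exists_colBdd_channel (n := n) i (measurableSet_shell 0) hγ0 hγ hsγ
  -- The parameter may exceed 1 - 2γ, since a smaller power of the count is still dominated by (1 +
  -- E)^γ. Summing the shells requires θ > 1/4, and θ/4 < s holds because 3/10 < 1/3 ≤ 4s. The shell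
  -- at high momenta keeps the exponent γ.
  set θ : ℝ := max (1 - 2 * γ) (3 / 10) with hθ
  have h1 : θ < 1 := max_lt (by linarith) (by norm_num)
  have h2 : 1 / 4 < θ := lt_of_lt_of_le (by norm_num) (le_max_right _ _)
  have h3 : 1 - 2 * γ ≤ θ := le_max_left _ _
  have h4 : θ / 4 < s := by
    rw [div_lt_iff₀ (by norm_num)]
    exact max_lt (by linarith) (by linarith)
  obtain ⟨D, hD, hCD⟩ := exists_colBdd_shell (n := n) i (by linarith) h1 h4
  set γ' : ℕ → ℝ := fun q => if q = 0 then γ else (1 - θ) / 2 with hγ'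
  set C : ℕ → ℝ := fun q => if q = 0 then C₀ else (D * (1 / 8) ^ (q - 1)) ^ (θ / 2) with hC
  have hκ : ∀ q : ℕ, 1 ≤ (2 : ℝ) ^ q := fun q => one_le_pow₀ (by norm_num)
  have hSκ : ∀ q, ∀ x ∈ shell q, 1 ≤ (2 : ℝ) ^ q * dispersion 0 x.1 := fun q x hx => by
    calc (1 : ℝ) = 2 ^ q * (1 / 2) ^ q := by rw [← mul_pow]; norm_num
      _ ≤ _ := by gcongr; exact le_of_mem_shell hx
  have h0γ : ∀ q, 0 ≤ γ' q := fun q => by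
    simp only [hγ']
    split_ifs <;> linarith
  have hγγ : ∀ q, γ' q ≤ γ := fun q => by
    simp only [hγ']
    split_ifs <;> linarith
  have hCq : ∀ q, ColBdd (fun α => (modeWeight (-s) α : ℂ) •
      ((annih i ((shell q).indicator fun x => (modeFun α x : ℂ)) ∘L
        mulOp (countPow i (shell q) 1 (-(γ' q))) : FockSpace n →L[ℂ] FockSpace n))) (C q) := by
    intro q
    cases q with
    | zero => exact hC₀
    | succ q => exact hCD q
  have hsum : Summable fun q : ℕ => C q * (2 * 2 ^ q) ^ γ' q := by
    rw [← summable_nat_add_iff 1]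
    exact summable_shell_bound hD h2
  exact ⟨_, colBdd_of_channels i isONSystem_modeFun (measurable_dispersion 0) (dispersion_nonneg 0)
      measurableSet_shell disjoint_shell ae_mem_iUnion_shell hκ hSκ h0γ hγγ hCq hsum,
    rowBdd_of_channels i isONSystem_modeFun (measurable_dispersion 0) (dispersion_nonneg 0)
      measurableSet_shell disjoint_shell ae_mem_iUnion_shell hκ hSκ h0γ hγγ hCq hsum⟩

end SpeciesBounds

/-! ### Hermite coefficients of the kernels -/

section FormFactors

variable {n : ℕ}

/-- The Hermite basis of `L²(Xⁿ)`. -/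
abbrev modeProd (α : Fin n → Mode) (ξ : Fin n → Particle) : ℝ := piSystem modeFun α ξ

theorem isONSystem_modeProd : IsONSystem volume (modeProd (n := n)) := isONSystem_modeFun.pi n

theorem isTotal_modeProd : IsTotal volume (modeProd (n := n)) :=
  isTotal_modeFun.pi isONSystem_modeFun n

/-- The Hermite coefficients of a kernel. -/
def coeff (G : (Fin n → Particle) → ℂ) (α : Fin n → Mode) : ℂ := ∫ ξ, (modeProd α ξ : ℂ) * G ξ

theorem summable_coeff {G : (Fin n → Particle) → ℂ} (hG : MemLp G 2 volume) :
    Summable fun α => ‖coeff G α‖ ^ 2 := by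
  have h := isONSystem_modeProd.orthonormal.inner_products_summable (hG.toLp G)
  simp only [inner_toLp (isONSystem_modeProd.memLp _) hG, Complex.conj_ofReal] at h
  exact h

/-- Overwrite the `j`-th momentum component of the `i`-th variable. -/
def putMomentum (i : Fin n) (j : Fin 3) (ξ : Fin n → Particle) (t : ℝ) : Fin n → Particle :=
  Function.update ξ i (Function.update (ξ i).1 j t, (ξ i).2)

theorem isLens_momentum (i : Fin n) (j : Fin 3) :
    IsLens (volume : Measure (Fin n → Particle)) (volume : Measure ℝ) (fun ξ => (ξ i).1 j)
      (putMomentum i j) := by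
  have h1 := IsLens.pi (fun _ : Fin n => Particle) (fun _ => volume) i
  have h2 := IsLens.fst (volume : Measure (Fin 3 → ℝ)) (volume : Measure Spin)
  have h3 := IsLens.pi (fun _ : Fin 3 => ℝ) (fun _ => volume) j
  exact h1.comp (h2.comp h3)

theorem modeProd_putMomentum (i : Fin n) (j : Fin 3) (α : Fin n → Mode) (ξ : Fin n → Particle)
    (t : ℝ) : hermiteFun ((α i).1 j) ((ξ i).1 j) * modeProd α (putMomentum i j ξ t) =
      hermiteFun ((α i).1 j) t * modeProd α ξ := by
  have h1 : ∏ k ∈ Finset.univ.erase i, modeFun (α k) (putMomentum i j ξ t k) =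
      ∏ k ∈ Finset.univ.erase i, modeFun (α k) (ξ k) :=
    Finset.prod_congr rfl fun k hk => by
      rw [putMomentum, Function.update_of_ne (Finset.ne_of_mem_erase hk)]
  have h2 : ∏ k ∈ Finset.univ.erase j, hermiteFun ((α i).1 k) (Function.update (ξ i).1 j t k) =
      ∏ k ∈ Finset.univ.erase j, hermiteFun ((α i).1 k) ((ξ i).1 k) :=
    Finset.prod_congr rfl fun k hk => by rw [Function.update_of_ne (Finset.ne_of_mem_erase hk)]
  rw [modeProd, modeProd, piSystem, piSystem, ← Finset.mul_prod_erase _ _ (Finset.mem_univ i),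
    ← Finset.mul_prod_erase _ _ (Finset.mem_univ i), h1]
  simp only [modeFun, prodSystem, piSystem]
  rw [← Finset.mul_prod_erase _ _ (Finset.mem_univ j), ← Finset.mul_prod_erase (a := j) _ _ (Finset.mem_univ j)]
  simp only [putMomentum, Function.update_self, h2]
  ring

theorem slotProj_modeProd (i : Fin n) (j : Fin 3) (α : Fin n → Mode) (ξ : Fin n → Particle) :
    slotProj volume (fun ξ : Fin n → Particle => (ξ i).1 j) (putMomentum i j)
      (fun t => (hermiteFun ((α i).1 j) t : ℂ)) (fun ξ => (modeProd α ξ : ℂ)) ξ = modeProd α ξ := by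
  rw [slotProj, Complex.conj_ofReal, ← integral_const_mul]
  have e : ∀ t, (hermiteFun ((α i).1 j) ((ξ i).1 j) : ℂ) *
      ((hermiteFun ((α i).1 j) t : ℂ) * (modeProd α (putMomentum i j ξ t) : ℂ)) =
      ((hermiteFun ((α i).1 j) t * hermiteFun ((α i).1 j) t : ℝ) : ℂ) * (modeProd α ξ : ℂ) := by
    intro t
    rw [mul_left_comm, ← Complex.ofReal_mul, modeProd_putMomentum]
    push_cast
    ring
  simp only [e]
  rw [integral_mul_const, integral_complex_ofReal, integral_hermiteFun_mul, if_pos rfl]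
  simp

/-- The basis function is fixed by the projection onto its own Hermite factor in the variable
k_{i,j}. By symmetry this projection moves onto G and exposes `hermiteCoeff`, the only quantity that
`IsHarmonicPower` controls. -/
theorem coeff_eq_integral_hermiteCoeff (i : Fin n) (j : Fin 3) (α : Fin n → Mode)
    (G : FormFactor n) : coeff G α = ∫ ξ : Fin n → Particle, (modeProd α ξ : ℂ) *
      ((hermiteFun ((α i).1 j) ((ξ i).1 j) : ℂ) * hermiteCoeff i j ((α i).1 j) G ξ) := by
  have h := (isLens_momentum i j).inner_slotProj (isONSystem_hermiteFun.memLp ((α i).1 j))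
    (isONSystem_modeProd.memLp α) (Lp.memLp G)
  simp only [slotProj_modeProd, Complex.conj_ofReal] at h
  rw [coeff, h]
  simp only [slotProj, Complex.conj_ofReal]
  rfl

theorem IsHarmonicPower.coeff_eq {i : Fin n} {j : Fin 3} {s : ℝ} {G G' : FormFactor n}
    (h : IsHarmonicPower i j s G G') (α : Fin n → Mode) :
    coeff G' α = (((2 * (α i).1 j + 1 : ℝ) ^ s : ℝ) : ℂ) * coeff G α := by
  rw [coeff_eq_integral_hermiteCoeff i j, coeff_eq_integral_hermiteCoeff i j,
    ← integral_const_mul]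
  refine integral_congr_ae ?_
  filter_upwards [h ((α i).1 j)] with ξ hξ
  rw [hξ]
  ring

theorem InProductDomain.exists_coeff {L : List (Fin n × Fin 3 × ℝ)} {G : FormFactor n}
    (h : InProductDomain L G) : ∃ G' : FormFactor n, ∀ α, coeff G' α =
      (((L.map fun a => (2 * ((α a.1).1 a.2.1 : ℝ) + 1) ^ a.2.2).prod : ℝ) : ℂ) * coeff G α := by
  induction L generalizing G with
  | nil => exact ⟨G, fun α => by simp⟩
  | cons a L ih =>
    obtain ⟨G₁, h1, h2⟩ := h
    obtain ⟨G', hG'⟩ := ih h2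
    refine ⟨G', fun α => ?_⟩
    rw [hG', h1.coeff_eq, List.map_cons, List.prod_cons]
    push_cast
    ring

theorem prod_harmonicFactors (i₀ : Fin n) (P : Fin n → Prop) [DecidablePred P] (s : ℝ)
    (α : Fin n → Mode) :
    ((harmonicFactors i₀ P s).map fun a => (2 * ((α a.1).1 a.2.1 : ℝ) + 1) ^ a.2.2).prod =
      ∏ i ∈ Finset.univ.filter (fun i => i ≠ i₀ ∧ P i), modeWeight s (α i) := by
  classical
  have h : ∀ L : List (Fin n), ((L.flatMap fun i => (List.finRange 3).map fun j => (i, j, s)).map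
      fun a : Fin n × Fin 3 × ℝ => (2 * ((α a.1).1 a.2.1 : ℝ) + 1) ^ a.2.2).prod =
        (L.map fun i => modeWeight s (α i)).prod := by
    intro L
    induction L with
    | nil => simp
    | cons i L ih =>
      rw [List.flatMap_cons, List.map_append, List.prod_append, ih, List.map_cons, List.prod_cons,
        modeWeight, ← List.prod_ofFn, List.ofFn_eq_map, List.map_map]
      rfl
  rw [harmonicFactors, h, ← List.prod_toFinset _ ((List.nodup_finRange n).filter _)]
  refine Finset.prod_congr ?_ fun _ _ => rfl
  ext i
  simp

/-- Weighted square summability of the Hermite coefficients in the variables other than `i₀`. -/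
def HasDecay (i₀ : Fin n) (t : Fin n → ℝ) (G : FormFactor n) : Prop :=
  Summable fun α => (‖coeff G α‖ * ∏ i ∈ Finset.univ.erase i₀, modeWeight (t i) (α i)) ^ 2

theorem HasDecay.mono {i₀ : Fin n} {s t : Fin n → ℝ} {G : FormFactor n} (h : HasDecay i₀ s G)
    (hst : ∀ i, i ≠ i₀ → t i ≤ s i) : HasDecay i₀ t G := by
  refine h.of_nonneg_of_le (fun α => sq_nonneg _) fun α => ?_
  have h1 : ∏ i ∈ Finset.univ.erase i₀, modeWeight (t i) (α i) ≤
      ∏ i ∈ Finset.univ.erase i₀, modeWeight (s i) (α i) :=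
    Finset.prod_le_prod (fun i _ => (modeWeight_pos _ _).le) fun i hi =>
      Finset.prod_le_prod (fun _ _ => by positivity) fun j _ =>
        Real.rpow_le_rpow_of_exponent_le (by linarith [((α i).1 j).cast_nonneg (α := ℝ)])
          (hst i (Finset.ne_of_mem_erase hi))
  have h2 : 0 ≤ ∏ i ∈ Finset.univ.erase i₀, modeWeight (t i) (α i) :=
    Finset.prod_nonneg fun i _ => (modeWeight_pos _ _).le
  gcongr

theorem hasDecay_zero (i₀ : Fin n) (G : FormFactor n) : HasDecay i₀ (fun _ => 0) G := by
  refine (summable_coeff (Lp.memLp G)).congr fun α => ?_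
  simp [modeWeight]

/-- The last function in the chain defining the domain is in L², and its Hermite coefficients are
those of G times the eigenvalue powers. Bessel's inequality gives the decay, and the order of the
factors is irrelevant. -/
theorem IsRegularFormFactor.hasDecay {m : Fin n → ℝ} (hm : ∀ i, 0 ≤ m i) {i₀ : Fin n} {ε : ℝ}
    {G : FormFactor n} (h : IsRegularFormFactor m i₀ ε G) :
    HasDecay i₀ (fun i => if 0 < m i then 1 / 2 - 1 / ((n : ℝ) - 1) + ε
      else 1 / 2 - 5 / 6 * (1 / ((n : ℝ) - 1)) + ε) G := by
  classical
  obtain ⟨G', hG'⟩ := InProductDomain.exists_coeff h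
  refine (summable_coeff (Lp.memLp G')).congr fun α => ?_
  rw [hG', norm_mul, mul_comm, List.map_reverse, List.prod_reverse, List.map_append,
    List.prod_append, prod_harmonicFactors, prod_harmonicFactors]
  have e : ∏ i ∈ Finset.univ.erase i₀, modeWeight (if 0 < m i then 1 / 2 - 1 / ((n : ℝ) - 1) + ε
      else 1 / 2 - 5 / 6 * (1 / ((n : ℝ) - 1)) + ε) (α i) =
      (∏ i ∈ Finset.univ.filter (fun i => i ≠ i₀ ∧ 0 < m i),
        modeWeight (1 / 2 - 1 / ((n : ℝ) - 1) + ε) (α i)) *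
      ∏ i ∈ Finset.univ.filter (fun i => i ≠ i₀ ∧ m i = 0),
        modeWeight (1 / 2 - 5 / 6 * (1 / ((n : ℝ) - 1)) + ε) (α i) := by
    rw [← Finset.prod_filter_mul_prod_filter_not (Finset.univ.erase i₀) fun i => 0 < m i]
    congr 1
    · refine Finset.prod_congr (by ext i; simp) fun i hi => ?_
      rw [if_pos (Finset.mem_filter.1 hi).2.2]
    · refine Finset.prod_congr ?_ fun i hi => ?_
      · ext i
        simp only [Finset.mem_filter, Finset.mem_erase, Finset.mem_univ, true_and, and_true,
          not_lt]
        exact and_congr_right fun _ => ⟨fun h => le_antisymm h (hm i), fun h => h.le⟩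
      · rw [if_neg]
        rw [(Finset.mem_filter.1 hi).2.2]
        exact lt_irrefl _
  rw [e, Complex.norm_real, Real.norm_of_nonneg]
  exact mul_nonneg (Finset.prod_nonneg fun i _ => (modeWeight_pos _ _).le)
    (Finset.prod_nonneg fun i _ => (modeWeight_pos _ _).le)

end FormFactors

/-! ### Ordered products of operator families -/

section OrderedProducts

variable {H : Type*} [NormedAddCommGroup H] [InnerProductSpace ℂ H] {n : ℕ} {M : Type}

/-- The index type is an iterated product built along the list. The last clause, that the index
determines the labels of the listed species, serves to return to functions on `Fin n`. -/
theorem exists_rowBdd_prod {X : Fin n → M → H →L[ℂ] H} (L : List (Fin n))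
    (h : ∀ i ∈ L, ∃ C, RowBdd (X i) C) : ∃ (κ : Type) (f : (Fin n → M) → κ) (O : κ → H →L[ℂ] H)
      (C : ℝ), RowBdd O C ∧ (∀ α, O (f α) = (L.map fun i => X i (α i)).prod) ∧
        ∀ α β, f α = f β → ∀ i ∈ L, α i = β i := by
  induction L with
  | nil =>
    refine ⟨Unit, fun _ => (), fun _ => 1, 1, ⟨zero_le_one, fun F X => ?_⟩, fun _ => rfl, by simp⟩
    rcases F.eq_empty_or_nonempty with rfl | hF
    · simp
    · have : F = {()} := by
        ext u
        simpa using (hF.choose_spec : hF.choose ∈ F)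
      simp [this]
  | cons i L ih =>
    obtain ⟨κ, f, O, C, h1, h2, h3⟩ := ih fun j hj => h j (List.mem_cons_of_mem _ hj)
    obtain ⟨C', hC'⟩ := h i List.mem_cons_self
    refine ⟨M × κ, fun α => (α i, f α), _, _, hC'.prod h1, fun α => ?_, fun α β hαβ j hj => ?_⟩
    · rw [List.map_cons, List.prod_cons, ← h2]
      rfl
    · rw [Prod.ext_iff] at hαβ
      rcases List.mem_cons.1 hj with rfl | hj
      · exact hαβ.1
      · exact h3 α β hαβ.2 j hj

theorem exists_colBdd_prod {X : Fin n → M → H →L[ℂ] H} (L : List (Fin n))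
    (h : ∀ i ∈ L, ∃ C, ColBdd (X i) C) : ∃ (κ : Type) (f : (Fin n → M) → κ) (O : κ → H →L[ℂ] H)
      (C : ℝ), ColBdd O C ∧ (∀ α, O (f α) = (L.map fun i => X i (α i)).prod) ∧
        ∀ α β, f α = f β → ∀ i ∈ L, α i = β i := by
  induction L with
  | nil =>
    refine ⟨Unit, fun _ => (), fun _ => 1, 1, ⟨zero_le_one, fun F X => ?_⟩, fun _ => rfl, by simp⟩
    rcases F.eq_empty_or_nonempty with rfl | hF
    · simp
    · have : F = {()} := by
        ext u
        simpa using (hF.choose_spec : hF.choose ∈ F)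
      simp [this]
  | cons i L ih =>
    obtain ⟨κ, f, O, C, h1, h2, h3⟩ := ih fun j hj => h j (List.mem_cons_of_mem _ hj)
    obtain ⟨C', hC'⟩ := h i List.mem_cons_self
    refine ⟨M × κ, fun α => (α i, f α), _, _, hC'.prod h1, fun α => ?_, fun α β hαβ j hj => ?_⟩
    · rw [List.map_cons, List.prod_cons, ← h2]
      rfl
    · rw [Prod.ext_iff] at hαβ
      rcases List.mem_cons.1 hj with rfl | hj
      · exact hαβ.1
      · exact h3 α β hαβ.2 j hj

/-- All species occur in the list, so the index triple determines α and the composed bound can be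
restricted to these triples. -/
theorem exists_coeffBdd_prod {X : Fin n → M → H →L[ℂ] H} (L₁ : List (Fin n)) (i₀ : Fin n)
    (L₂ : List (Fin n)) (hL : ∀ i, i ∈ L₁ ++ i₀ :: L₂) (h₁ : ∀ i ∈ L₁, ∃ C, RowBdd (X i) C)
    (h₀ : ∃ C, CoeffBdd (X i₀) C) (h₂ : ∀ i ∈ L₂, ∃ C, ColBdd (X i) C) :
    ∃ C, CoeffBdd (fun α : Fin n → M => ((L₁ ++ i₀ :: L₂).map fun i => X i (α i)).prod) C := by
  obtain ⟨κ₁, f₁, O₁, C₁, a1, a2, a3⟩ := exists_rowBdd_prod L₁ h₁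
  obtain ⟨κ₂, f₂, O₂, C₂, b1, b2, b3⟩ := exists_colBdd_prod L₂ h₂
  obtain ⟨C₀, hC₀⟩ := h₀
  have h := (a1.comp_coeff (hC₀.comp_col b1)).precomp (κ := Fin n → M)
    (f := fun α => (f₁ α, (α i₀, f₂ α))) fun α β hαβ => by
      simp only [Prod.ext_iff] at hαβ
      funext i
      rcases List.mem_append.1 (hL i) with hi | hi
      · exact a3 α β hαβ.1 i hi
      · rcases List.mem_cons.1 hi with rfl | hi
        · exact hαβ.2.1
        · exact b3 α β hαβ.2.2 i hi
  refine ⟨C₁ * (C₀ * C₂), ?_⟩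
  convert! h using 1
  funext α
  rw [List.map_append, List.prod_append, List.map_cons, List.prod_cons, ← a2, ← b2]
  rfl

theorem prod_mul_prod_of_commute {R ι : Type*} [Monoid R] (a r : ι → R) (L : List ι) (hL : L.Nodup)
    (h : ∀ i j, i ≠ j → Commute (r i) (a j)) :
    (L.map a).prod * (L.map r).prod = (L.map fun i => a i * r i).prod := by
  induction L with
  | nil => simp
  | cons i L ih =>
    rw [List.nodup_cons] at hL
    have hc : Commute (r i) (L.map a).prod := Commute.list_prod_right _ _ fun x hx => by
      obtain ⟨j, hj, rfl⟩ := List.mem_map.1 hx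
      exact h i j fun e => hL.1 (e ▸ hj)
    rw [List.map_cons, List.map_cons, List.map_cons, List.prod_cons, List.prod_cons,
      List.prod_cons, ← ih hL.2]
    rw [mul_assoc, ← mul_assoc _ (r i), ← hc.eq]
    simp only [mul_assoc]

theorem list_prod_smul_comp {ι : Type*} (c : ι → ℂ) (a r : ι → H →L[ℂ] H) (L : List ι)
    (hL : L.Nodup) (h : ∀ i j, i ≠ j → Commute (r i) (a j)) :
    (L.map fun i => c i • (a i ∘L r i)).prod =
      (L.map c).prod • ((L.map a).prod ∘L (L.map r).prod) := by
  have h1 : ∀ b : ι → H →L[ℂ] H, (L.map fun i => c i • b i).prod =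
      (L.map c).prod • (L.map b).prod := by
    intro b
    clear h hL
    induction L with
    | nil => simp
    | cons i L ih => simp only [List.map_cons, List.prod_cons, ih, smul_mul_smul_comm]
  rw [h1]
  exact congrArg _ (prod_mul_prod_of_commute a r L hL h).symm

theorem list_prod_eq_smul_comp {ι : Type*} {c : ι → ℂ} {a r X : ι → H →L[ℂ] H} {L : List ι}
    (hL : L.Nodup) (h : ∀ i j, i ≠ j → Commute (r i) (a j)) (hX : ∀ i, X i = c i • (a i ∘L r i))
    {A R : H →L[ℂ] H} {z : ℂ} (hz : (L.map c).prod = z) (hA : (L.map a).prod = A)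
    (hR : (L.map r).prod = R) : (L.map X).prod = z • (A ∘L R) := by
  rw [← hz, ← hA, ← hR, ← list_prod_smul_comp c a r L hL h]
  simp only [← hX]

theorem adjoint_list_prod [CompleteSpace H] {ι : Type*} (a : ι → H →L[ℂ] H) (L : List ι) :
    (L.map a).prod.adjoint = (L.reverse.map fun i => (a i).adjoint).prod := by
  induction L with
  | nil =>
    simp only [List.map_nil, List.prod_nil, List.reverse_nil]
    exact ContinuousLinearMap.adjoint_id
  | cons i L ih =>
    rw [List.map_cons, List.prod_cons, List.reverse_cons, List.map_append, List.prod_append, ← ih]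
    simp only [List.map_cons, List.map_nil, List.prod_cons, List.prod_nil, mul_one]
    exact ContinuousLinearMap.adjoint_comp _ _

theorem list_prod_eq_adjoint_comp [CompleteSpace H] {ι : Type*} {a O : ι → H →L[ℂ] H}
    {L₁ L₂ : List ι} (h₁ : ∀ i ∈ L₁, O i = (a i).adjoint) (h₂ : ∀ i ∈ L₂, O i = a i) :
    ((L₁.reverse ++ L₂).map O).prod = (L₁.map a).prod.adjoint ∘L (L₂.map a).prod := by
  rw [List.map_append, List.prod_append, adjoint_list_prod]
  refine congrArg₂ (· * ·) (congrArg _ ?_) (congrArg _ ?_)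
  · exact List.map_congr_left fun i hi => h₁ i (List.mem_reverse.1 hi)
  · exact List.map_congr_left h₂

theorem _root_.Commute.adjoint_right [CompleteSpace H] {R A : H →L[ℂ] H} (h : Commute R A)
    (hR : R.adjoint = R) : Commute R A.adjoint := by
  have h1 : (R ∘L A).adjoint = (A ∘L R).adjoint := congrArg _ h.eq
  rw [ContinuousLinearMap.adjoint_comp, ContinuousLinearMap.adjoint_comp, hR] at h1
  exact h1.symm

theorem CoeffBdd.comp_right {ι : Type*} {O : ι → H →L[ℂ] H} {C : ℝ} (h : CoeffBdd O C)
    {T : H →L[ℂ] H} {K : ℝ} (hT : ‖T‖ ≤ K) : CoeffBdd (fun a => O a ∘L T) (C * K) := by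
  have hK : 0 ≤ K := (norm_nonneg _).trans hT
  refine ⟨mul_nonneg h.1 hK, fun F d X => ?_⟩
  refine (h.2 F d (T X)).trans ?_
  have h1 : ‖T X‖ ≤ K * ‖X‖ := (T.le_opNorm X).trans (by gcongr)
  have h2 : 0 ≤ ∑ a ∈ F, ‖d a‖ ^ 2 := Finset.sum_nonneg fun _ _ => sq_nonneg _
  calc C ^ 2 * (∑ a ∈ F, ‖d a‖ ^ 2) * ‖T X‖ ^ 2 ≤
        C ^ 2 * (∑ a ∈ F, ‖d a‖ ^ 2) * (K * ‖X‖) ^ 2 := by gcongr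
    _ = _ := by ring

end OrderedProducts

/-! ### The main estimate -/

section MainEstimate

variable {n : ℕ} {ω : Fin n → Particle → ℝ} {γ s : Fin n → ℝ}

/-- The operator `b_{i₁}(e_{α_{i₁}}) ⋯ b_{i_r}(e_{α_{i_r}})`. -/
def annihProd (L : List (Fin n)) (α : Fin n → Mode) : FockSpace n →L[ℂ] FockSpace n :=
  (L.map fun i => annih i fun x => (modeFun (α i) x : ℂ)).prod

/-- `∏ᵢ (1 + Eᵢ)^{-γᵢ}`. -/
def regularizer (ω : Fin n → Particle → ℝ) (γ : Fin n → ℝ) (l : Fin n → ℕ) (η : Config l) : ℝ :=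
  ∏ i, energyPow i (ω i) (-(γ i)) l η

theorem IsWeight.list_prod {ι : Type*} {v : ι → (l : Fin n → ℕ) → Config l → ℝ}
    (hv : ∀ i, IsWeight (v i) 1) (L : List ι) :
    IsWeight (fun l (η : Config l) => (L.map fun i => v i l η).prod) 1 ∧
      (L.map fun i => mulOp (v i)).prod = mulOp fun l (η : Config l) => (L.map fun i => v i l η).prod := by
  induction L with
  | nil =>
    have h1 : IsWeight (fun (l : Fin n → ℕ) (_ : Config l) => (1 : ℝ)) 1 :=
      ⟨zero_le_one, fun _ => measurable_const, fun _ _ _ => rfl, fun _ _ => by simp⟩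
    refine ⟨by simpa using h1, ?_⟩
    ext1 Ψ
    refine ext_wave fun l => ?_
    simp only [List.map_nil, List.prod_nil]
    filter_upwards [h1.wave_mulOp Ψ l] with η hη
    rw [hη]
    simp
  | cons i L ih =>
    have h1 := (hv i).mul ih.1
    rw [one_mul] at h1
    simp only [List.map_cons, List.prod_cons]
    refine ⟨h1, ?_⟩
    rw [ih.2]
    exact mulOp_comp_mulOp (hv i) ih.1

theorem commute_mulOp_annih {i j : Fin n} (hij : i ≠ j) {ω : Particle → ℝ} (hω : Measurable ω)
    (h0 : ∀ x, 0 ≤ ω x) {γ : ℝ} (hγ : 0 ≤ γ) {f : Particle → ℂ} (hf : MemLp f 2 volume) :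
    Commute (mulOp (energyPow i ω (-γ))) (annih j f : FockSpace n →L[ℂ] FockSpace n) := by
  refine (annih_comp_mulOp j hf (isWeight_energyPow i hω h0 hγ) (isWeight_energyPow i hω h0 hγ)
    fun l η x _ => ?_).symm
  rw [energyPow, energyPow, speciesSum_insert_ne hij]

theorem commute_mulOp_adjoint_annih {i j : Fin n} (hij : i ≠ j) {ω : Particle → ℝ}
    (hω : Measurable ω) (h0 : ∀ x, 0 ≤ ω x) {γ : ℝ} (hγ : 0 ≤ γ) {f : Particle → ℂ}
    (hf : MemLp f 2 volume) :
    Commute (mulOp (energyPow i ω (-γ)))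
      ((annih j f : FockSpace n →L[ℂ] FockSpace n).adjoint) := by
  exact (commute_mulOp_annih hij hω h0 hγ hf).adjoint_right
    (isWeight_energyPow (n := n) i hω h0 hγ).adjoint_mulOp

theorem list_prod_eq_prod {M : Type*} [CommMonoid M] {L : List (Fin n)} (hL : L.Nodup)
    (hm : ∀ i, i ∈ L) (f : Fin n → M) : (L.map f).prod = ∏ i, f i := by
  rw [← List.prod_toFinset f hL]
  exact Finset.prod_congr (by ext i; simp [hm]) fun _ _ => rfl

theorem isWeight_regularizer (hω : ∀ i, Measurable (ω i)) (h0 : ∀ i x, 0 ≤ ω i x)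
    (hγ : ∀ i, 0 ≤ γ i) : IsWeight (regularizer ω γ) 1 := by
  have h := (IsWeight.list_prod (v := fun i => energyPow i (ω i) (-(γ i)))
    (fun i => isWeight_energyPow i (hω i) (h0 i) (hγ i)) (List.finRange n)).1
  convert h using 3 with l η
  exact (list_prod_eq_prod (List.nodup_finRange n) (List.mem_finRange) _).symm

open scoped Classical in
/-- Creation operators for the species in `L`, annihilation operators for the others. -/
def stepOp (L : List (Fin n)) (i : Fin n) (a : Mode) : FockSpace n →L[ℂ] FockSpace n :=
  if i ∈ L then (annih i fun x => (modeFun a x : ℂ)).adjoint else annih i fun x => (modeFun a x : ℂ)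

/-- The weighted and regularized operators `stepOp`. -/
def weightedStep (ω : Fin n → Particle → ℝ) (γ s : Fin n → ℝ) (L : List (Fin n)) (i : Fin n)
    (a : Mode) : FockSpace n →L[ℂ] FockSpace n :=
  (modeWeight (-(s i)) a : ℂ) • (stepOp L i a ∘L mulOp (energyPow i (ω i) (-(γ i))))

theorem commute_mulOp_stepOp {i j : Fin n} (hij : i ≠ j) {ω : Particle → ℝ} (hω : Measurable ω)
    (h0 : ∀ x, 0 ≤ ω x) {γ : ℝ} (hγ : 0 ≤ γ) (L : List (Fin n)) (a : Mode) :
    Commute (mulOp (energyPow i ω (-γ))) (stepOp L j a) := by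
  rw [stepOp]
  split_ifs
  · exact commute_mulOp_adjoint_annih hij hω h0 hγ (isONSystem_modeFun.memLp _)
  · exact commute_mulOp_annih hij hω h0 hγ (isONSystem_modeFun.memLp _)

theorem prod_stepOp {L₁ L₂ : List (Fin n)} (hnd : (L₁ ++ L₂).Nodup) (α : Fin n → Mode) :
    ((L₁.reverse ++ L₂).map fun i => stepOp L₁ i (α i)).prod =
      (annihProd L₁ α).adjoint ∘L annihProd L₂ α := by
  refine list_prod_eq_adjoint_comp (fun i hi => ?_) fun i hi => ?_
  · rw [stepOp, if_pos hi]
  · rw [stepOp, if_neg fun h1 => (List.nodup_append.1 hnd).2.2 i h1 i hi rfl]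

/-- Each (1 + E_i)^(-γ_i) commutes with the operators of the other species, so these factors can be
distributed to the operators of their own species. -/
theorem prod_weightedStep (hω : ∀ i, Measurable (ω i)) (h0 : ∀ i x, 0 ≤ ω i x)
    (hγ : ∀ i, 0 ≤ γ i) {L₁ L₂ : List (Fin n)}
    (hmem : ∀ i, i ∈ L₁ ++ L₂) (hnd : (L₁ ++ L₂).Nodup) (α : Fin n → Mode) :
    ((L₁.reverse ++ L₂).map fun i => weightedStep ω γ s L₁ i (α i)).prod =
      ((∏ i, modeWeight (-(s i)) (α i) : ℝ) : ℂ) •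
        ((annihProd L₁ α).adjoint ∘L annihProd L₂ α ∘L mulOp (regularizer ω γ)) := by
  have hperm : (L₁.reverse ++ L₂).Perm (L₁ ++ L₂) := (List.reverse_perm L₁).append_right L₂
  have hSn : (L₁.reverse ++ L₂).Nodup := hperm.nodup_iff.2 hnd
  have hSm : ∀ i, i ∈ L₁.reverse ++ L₂ := fun i => hperm.mem_iff.2 (hmem i)
  have e1 : ((L₁.reverse ++ L₂).map fun i => mulOp (energyPow i (ω i) (-(γ i)))).prod =
      mulOp (regularizer ω γ) := by
    rw [(IsWeight.list_prod (v := fun i => energyPow i (ω i) (-(γ i)))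
      (fun i => isWeight_energyPow i (hω i) (h0 i) (hγ i)) _).2]
    congr 1
    funext l η
    exact list_prod_eq_prod hSn hSm _
  rw [← ContinuousLinearMap.comp_assoc]
  refine list_prod_eq_smul_comp hSn (fun i j hij => ?_) (fun i => rfl) ?_ (prod_stepOp hnd α) e1
  · exact commute_mulOp_stepOp hij (hω i) (h0 i) (hγ i) L₁ (α j)
  · rw [list_prod_eq_prod hSn hSm, Complex.ofReal_prod]

theorem exists_rowBdd_weightedStep {i : Fin n} (h : SpeciesBdd i (ω i) (s i) (γ i))
    {L : List (Fin n)} (hi : i ∈ L) : ∃ C, RowBdd (weightedStep ω γ s L i) C := by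
  obtain ⟨C, -, h⟩ := h
  refine ⟨C, ?_⟩
  have e : weightedStep ω γ s L i = _ := funext fun a => by rw [weightedStep, stepOp, if_pos hi]
  rw [e]
  exact h

theorem exists_colBdd_weightedStep {i : Fin n} (h : SpeciesBdd i (ω i) (s i) (γ i))
    {L : List (Fin n)} (hi : i ∉ L) : ∃ C, ColBdd (weightedStep ω γ s L i) C := by
  obtain ⟨C, h, -⟩ := h
  refine ⟨C, ?_⟩
  have e : weightedStep ω γ s L i = _ := funext fun a => by rw [weightedStep, stepOp, if_neg hi]
  rw [e]
  exact h

theorem exists_coeffBdd_weightedStep {i : Fin n} (hω : Measurable (ω i)) (h0 : ∀ x, 0 ≤ ω i x)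
    (hγ : 0 ≤ γ i) (hs : s i = 0) (L : List (Fin n)) :
    ∃ C, CoeffBdd (weightedStep ω γ s L i) C := by
  have hc := coeffBdd_annih (n := n) i isONSystem_modeFun
  have h1 : CoeffBdd (stepOp L i) 1 := by
    by_cases hi : i ∈ L
    · rw [show stepOp L i = _ from funext fun a => by rw [stepOp, if_pos hi]]
      exact hc.adjoint
    · rw [show stepOp L i = _ from funext fun a => by rw [stepOp, if_neg hi]]
      exact hc
  have e : ∀ a, modeWeight (-(s i)) a = 1 := fun a => by simp [hs, modeWeight]
  have e2 : weightedStep ω γ s L i =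
      fun a => stepOp L i a ∘L mulOp (energyPow i (ω i) (-(γ i))) := funext fun a => by
    rw [weightedStep, e, Complex.ofReal_one, one_smul]
  rw [e2]
  exact ⟨1 * 1, h1.comp_right (isWeight_energyPow i hω h0 hγ).norm_mulOp_le⟩

/-- Every other species must stand on the correct side of i₀: creation operators on the left, as
rows, and annihilation operators on the right, as columns. -/
theorem exists_coeffBdd_annihProd (hω : ∀ i, Measurable (ω i)) (h0 : ∀ i x, 0 ≤ ω i x)
    (hγ : ∀ i, 0 ≤ γ i) {i₀ : Fin n} (hs0 : s i₀ = 0)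
    (hsp : ∀ i, i ≠ i₀ → SpeciesBdd i (ω i) (s i) (γ i)) {L₁ L₂ : List (Fin n)}
    (hmem : ∀ i, i ∈ L₁ ++ L₂) (hnd : (L₁ ++ L₂).Nodup)
    (hhead : (∃ L, L₁ = i₀ :: L) ∨ ∃ L, L₂ = i₀ :: L) :
    ∃ C, CoeffBdd (fun α : Fin n → Mode => ((∏ i, modeWeight (-(s i)) (α i) : ℝ) : ℂ) •
      ((annihProd L₁ α).adjoint ∘L annihProd L₂ α ∘L mulOp (regularizer ω γ))) C := by
  have hperm : (L₁.reverse ++ L₂).Perm (L₁ ++ L₂) := (List.reverse_perm L₁).append_right L₂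
  have hSm : ∀ i, i ∈ L₁.reverse ++ L₂ := fun i => hperm.mem_iff.2 (hmem i)
  have hOL : ∀ i ∈ L₂, i ∉ L₁ := fun i hi h1 => (List.nodup_append.1 hnd).2.2 i h1 i hi rfl
  have hcenter := exists_coeffBdd_weightedStep (s := s) (hω i₀) (h0 i₀) (hγ i₀) hs0 L₁
  have hfin : ∃ C, CoeffBdd (fun α : Fin n → Mode =>
      ((L₁.reverse ++ L₂).map fun i => weightedStep ω γ s L₁ i (α i)).prod) C := by
    rcases hhead with ⟨L, hL⟩ | ⟨L, hL⟩
    · have hS' : L₁.reverse ++ L₂ = L.reverse ++ i₀ :: L₂ := by rw [hL]; simp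
      have hne : ∀ i ∈ L ++ L₂, i ≠ i₀ := fun i hi h => by
        rw [hL, List.cons_append, List.nodup_cons] at hnd
        exact hnd.1 (h ▸ hi)
      rw [hS'] at hSm ⊢
      exact exists_coeffBdd_prod _ _ _ hSm
        (fun i hi => exists_rowBdd_weightedStep
          (hsp i (hne i (List.mem_append_left _ (List.mem_reverse.1 hi))))
          (by rw [hL]; exact List.mem_cons_of_mem _ (List.mem_reverse.1 hi))) hcenter
        fun i hi => exists_colBdd_weightedStep (hsp i (hne i (List.mem_append_right _ hi))) (hOL i hi)
    · have hne : ∀ i ∈ L₁ ++ L, i ≠ i₀ := fun i hi h => by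
        have hnd2 : (i₀ :: (L₁ ++ L)).Nodup := by
          rw [hL] at hnd
          exact (List.perm_middle).nodup_iff.1 hnd
        rw [List.nodup_cons] at hnd2
        exact hnd2.1 (h ▸ hi)
      rw [hL] at hSm ⊢
      exact exists_coeffBdd_prod _ _ _ hSm
        (fun i hi => exists_rowBdd_weightedStep
          (hsp i (hne i (List.mem_append_left _ (List.mem_reverse.1 hi))))
          (List.mem_reverse.1 hi)) hcenter
        fun i hi => exists_colBdd_weightedStep (hsp i (hne i (List.mem_append_right _ hi)))
          (hOL i (by rw [hL]; exact List.mem_cons_of_mem _ hi))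
  obtain ⟨C, hC⟩ := hfin
  refine ⟨C, ?_⟩
  simpa only [prod_weightedStep hω h0 hγ hmem hnd] using hC

end MainEstimate

/-! ### Lists of variables -/

section Variables

variable {n : ℕ}

/-- Positions of one particle of each of the species in a list. -/
def Vars : List (Fin n) → Type
  | [] => Unit
  | _ :: L => Particle × Vars L

instance instMeasurableSpaceVars : (L : List (Fin n)) → MeasurableSpace (Vars L)
  | [] => inferInstanceAs (MeasurableSpace Unit)
  | _ :: L => @Prod.instMeasurableSpace Particle (Vars L) _ (instMeasurableSpaceVars L)

/-- Lebesgue and counting measure on `Vars L`. -/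
def varsMeasure : (L : List (Fin n)) → Measure (Vars L)
  | [] => (Measure.dirac () : Measure Unit)
  | _ :: L => (volume : Measure Particle).prod (varsMeasure L)

instance instSigmaFiniteVars : (L : List (Fin n)) → SigmaFinite (varsMeasure L)
  | [] => inferInstanceAs (SigmaFinite (Measure.dirac () : Measure Unit))
  | _ :: L => by
    have := instSigmaFiniteVars L
    exact inferInstanceAs (SigmaFinite ((volume : Measure Particle).prod (varsMeasure L)))

/-- Select the variables of the species in a list. -/
def proj : (L : List (Fin n)) → (Fin n → Particle) → Vars L
  | [], _ => ()
  | i :: L, ξ => (ξ i, proj L ξ)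

/-- The position of species `j`, if it is in the list. -/
def look : (L : List (Fin n)) → Vars L → Fin n → Particle
  | [], _, _ => Classical.arbitrary _
  | i :: L, u, j => if j = i then u.1 else look L u.2 j

theorem measurable_look (L : List (Fin n)) (j : Fin n) : Measurable fun u : Vars L => look L u j := by
  induction L with
  | nil => exact measurable_const
  | cons i L ih =>
    by_cases h : j = i
    · simp only [look, if_pos h]
      exact measurable_fst
    · simp only [look, if_neg h]
      exact ih.comp measurable_snd

theorem measurable_proj (L : List (Fin n)) : Measurable (proj L) := by
  induction L with
  | nil => exact measurable_const
  | cons i L ih => exact (measurable_pi_apply i).prodMk ih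

theorem proj_eq {L : List (Fin n)} (hL : L.Nodup) {ξ : Fin n → Particle} {u : Vars L}
    (h : ∀ j ∈ L, ξ j = look L u j) : proj L ξ = u := by
  induction L with
  | nil => rfl
  | cons i L ih =>
    rw [List.nodup_cons] at hL
    have h1 : ξ i = u.1 := by
      rw [h i List.mem_cons_self, look, if_pos rfl]
    have h2 : proj L ξ = u.2 := ih hL.2 fun j hj => by
      rw [h j (List.mem_cons_of_mem _ hj), look, if_neg fun e : j = i => hL.1 (e ▸ hj)]
    exact Prod.ext h1 h2

theorem varsMeasure_box {L : List (Fin n)} (hL : L.Nodup) (s : Fin n → Set Particle) :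
    varsMeasure L {u | ∀ j ∈ L, look L u j ∈ s j} = (L.map fun j => volume (s j)).prod := by
  induction L with
  | nil =>
    simp only [List.not_mem_nil, false_imp_iff, implies_true, Set.ofPred_true, List.map_nil,
      List.prod_nil]
    exact measure_univ (μ := (Measure.dirac () : Measure Unit))
  | cons i L ih =>
    rw [List.nodup_cons] at hL
    have e : {u : Vars (i :: L) | ∀ j ∈ i :: L, look (i :: L) u j ∈ s j} =
        s i ×ˢ {u : Vars L | ∀ j ∈ L, look L u j ∈ s j} := by
      ext u
      constructor
      · intro h
        refine ⟨?_, fun j hj => ?_⟩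
        · have := h i List.mem_cons_self
          rwa [look, if_pos rfl] at this
        · have := h j (List.mem_cons_of_mem _ hj)
          rwa [look, if_neg fun e : j = i => hL.1 (e ▸ hj)] at this
      · rintro ⟨h1, h2⟩ j hj
        rw [look]
        by_cases hji : j = i
        · rw [if_pos hji, hji]
          exact h1
        · rw [if_neg hji]
          exact h2 j ((List.mem_cons.1 hj).resolve_left hji)
    rw [e, List.map_cons, List.prod_cons, ← ih hL.2]
    exact Measure.prod_prod _ _

theorem measurePreserving_proj {L₁ L₂ : List (Fin n)} (hnd : (L₁ ++ L₂).Nodup)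
    (hmem : ∀ i, i ∈ L₁ ++ L₂) :
    MeasurePreserving (fun ξ : Fin n → Particle => (proj L₁ ξ, proj L₂ ξ)) volume
      ((varsMeasure L₁).prod (varsMeasure L₂)) := by
  classical
  obtain ⟨hn1, hn2, hdis⟩ := List.nodup_append.1 hnd
  set build : Vars L₁ × Vars L₂ → Fin n → Particle := fun p j =>
    if j ∈ L₁ then look L₁ p.1 j else look L₂ p.2 j with hbuild
  have hbm : Measurable build := measurable_pi_iff.2 fun j => by
    by_cases h : j ∈ L₁
    · simp only [hbuild, if_pos h]
      exact (measurable_look L₁ j).comp measurable_fst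
    · simp only [hbuild, if_neg h]
      exact (measurable_look L₂ j).comp measurable_snd
  have hpm : Measurable fun ξ : Fin n → Particle => (proj L₁ ξ, proj L₂ ξ) :=
    (measurable_proj L₁).prodMk (measurable_proj L₂)
  have hinv : (fun ξ : Fin n → Particle => (proj L₁ ξ, proj L₂ ξ)) ∘ build = id := by
    funext p
    refine Prod.ext (proj_eq hn1 fun j hj => ?_) (proj_eq hn2 fun j hj => ?_)
    · simp only [hbuild, if_pos hj, id]
    · simp only [hbuild, if_neg fun h => hdis j h j hj rfl, id]
  have hmap : (volume : Measure (Fin n → Particle)) =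
      Measure.map build ((varsMeasure L₁).prod (varsMeasure L₂)) := by
    rw [volume_pi]
    refine Measure.pi_eq fun s hs => ?_
    rw [Measure.map_apply hbm (MeasurableSet.univ_pi hs)]
    have e : build ⁻¹' Set.univ.pi s = {u | ∀ j ∈ L₁, look L₁ u j ∈ s j} ×ˢ
        {u | ∀ j ∈ L₂, look L₂ u j ∈ s j} := by
      ext p
      simp only [hbuild, Set.mem_preimage, Set.mem_pi, Set.mem_univ, true_imp_iff, Set.mem_prod,
        Set.mem_ofPred_eq]
      constructor
      · intro h
        refine ⟨fun j hj => ?_, fun j hj => ?_⟩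
        · have := h j
          rwa [if_pos hj] at this
        · have := h j
          rwa [if_neg fun h1 => hdis j h1 j hj rfl] at this
      · rintro ⟨h1, h2⟩ j
        split_ifs with hj
        · exact h1 j hj
        · exact h2 j ((List.mem_append.1 (hmem j)).resolve_left hj)
    rw [e, Measure.prod_prod, varsMeasure_box hn1, varsMeasure_box hn2, ← List.prod_append,
      ← List.map_append, list_prod_eq_prod hnd hmem]
  refine ⟨hpm, ?_⟩
  rw [hmap, Measure.map_map hpm hbm, hinv, Measure.map_id]

/-! ### Iterated annihilation operators -/

/-- The iterated annihilation operators, as functions of the list of variables. -/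
def annihilateVars : (L : List (Fin n)) → Vars L → WaveFunction n → WaveFunction n
  | [], _, Φ => Φ
  | i :: L, u, Φ => annihilate i u.1 (annihilateVars L u.2 Φ)

theorem annihilateList_eq (L : List (Fin n)) (ξ : Fin n → Particle) (Φ : WaveFunction n) :
    annihilateList L ξ Φ = annihilateVars L (proj L ξ) Φ := by
  induction L with
  | nil => rfl
  | cons i L ih =>
    rw [annihilateList, List.foldr_cons]
    exact congrArg (annihilate i (ξ i)) ih

theorem measurePreserving_insertVars (i : Fin n) (L : List (Fin n)) (l : Fin n → ℕ) :
    MeasurePreserving (fun p : (Particle × Vars L) × Config l =>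
        (p.1.2, (insertParticle i p.1.1 p.2 : Config (addOne l i))))
      (((volume : Measure Particle).prod (varsMeasure L)).prod volume)
      ((varsMeasure L).prod volume) := by
  have h1 : MeasurePreserving (Prod.map Prod.swap id)
      (((volume : Measure Particle).prod (varsMeasure L)).prod (volume : Measure (Config l)))
      (((varsMeasure L).prod volume).prod volume) :=
    Measure.measurePreserving_swap.prod (MeasurePreserving.id _)
  have h2 := measurePreserving_prodAssoc (varsMeasure L) (volume : Measure Particle)
    (volume : Measure (Config l))
  have h3 := (MeasurePreserving.id (varsMeasure L)).prod (measurePreserving_insertParticle l i)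
  exact h3.comp (h2.comp h1)

theorem memLp_annihilateVars {Φ : WaveFunction n} (h : ∀ l, MemLp (Φ l) 2 volume)
    (L : List (Fin n)) (l : Fin n → ℕ) :
    MemLp (fun p : Vars L × Config l => annihilateVars L p.1 Φ l p.2) 2
      ((varsMeasure L).prod volume) := by
  induction L generalizing l with
  | nil =>
    have h1 : MeasurePreserving (Prod.snd : Unit × Config l → Config l)
        ((Measure.dirac ()).prod volume) volume := measurePreserving_snd
    exact (h l).comp_measurePreserving h1
  | cons i L ih =>
    exact ((ih (addOne l i)).comp_measurePreserving (measurePreserving_insertVars i L l)).const_mul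
      (annCoeff i l)

/-- Annihilation evaluates Φ at larger occupation numbers only, so the same N works. -/
theorem annihilateVars_ae_zero {Φ : WaveFunction n} {N : ℕ}
    (h : ∀ l : Fin n → ℕ, (∃ i, N < l i) → Φ l =ᵐ[volume] 0) (L : List (Fin n)) (l : Fin n → ℕ)
    (hl : ∃ i, N < l i) :
    (fun p : Vars L × Config l => annihilateVars L p.1 Φ l p.2) =ᵐ[(varsMeasure L).prod volume] 0 := by
  induction L generalizing l with
  | nil =>
    have h1 : MeasurePreserving (Prod.snd : Unit × Config l → Config l)
        ((Measure.dirac ()).prod volume) volume := measurePreserving_snd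
    exact h1.quasiMeasurePreserving.ae_eq (h l hl)
  | cons i L ih =>
    have hl' : ∃ j, N < addOne l i j := by
      obtain ⟨j, hj⟩ := hl
      refine ⟨j, hj.trans_le ?_⟩
      by_cases hji : j = i
      · simp [hji]
      · simp [addOne, Function.update_of_ne hji]
    have h1 := (measurePreserving_insertVars i L l).quasiMeasurePreserving.ae_eq (ih _ hl')
    filter_upwards [h1] with p hp
    exact (congrArg (annCoeff i l * ·) hp).trans (mul_zero _)

/-- The product of the basis functions with labels `α`. -/
def modeVars (α : Fin n → Mode) : (L : List (Fin n)) → Vars L → ℝ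
  | [], _ => 1
  | i :: L, u => modeFun (α i) u.1 * modeVars α L u.2

theorem modeVars_proj (α : Fin n → Mode) (L : List (Fin n)) (ξ : Fin n → Particle) :
    modeVars α L (proj L ξ) = (L.map fun i => modeFun (α i) (ξ i)).prod := by
  induction L with
  | nil => rfl
  | cons i L ih =>
    rw [List.map_cons, List.prod_cons, ← ih]
    rfl

theorem modeProd_eq {L₁ L₂ : List (Fin n)} (hnd : (L₁ ++ L₂).Nodup) (hmem : ∀ i, i ∈ L₁ ++ L₂)
    (α : Fin n → Mode) (ξ : Fin n → Particle) :
    modeProd α ξ = modeVars α L₁ (proj L₁ ξ) * modeVars α L₂ (proj L₂ ξ) := by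
  rw [modeVars_proj, modeVars_proj, ← List.prod_append, ← List.map_append,
    list_prod_eq_prod hnd hmem]
  rfl

theorem memLp_modeVars (α : Fin n → Mode) (L : List (Fin n)) :
    MemLp (fun u => (modeVars α L u : ℂ)) 2 (varsMeasure L) := by
  induction L with
  | nil =>
    exact (memLp_const ((1 : ℝ) : ℂ) : MemLp (fun _ : Unit => ((1 : ℝ) : ℂ)) 2 (Measure.dirac ()))
  | cons i L ih =>
    have h := memLp_tensor (isONSystem_modeFun.memLp (α i)) ih
    have e : (fun u : Vars (i :: L) => (modeVars α (i :: L) u : ℂ)) =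
        fun p : Particle × Vars L => (modeFun (α i) p.1 : ℂ) * (modeVars α L p.2 : ℂ) :=
      funext fun u => Complex.ofReal_mul _ _
    rw [e]
    exact h

theorem wave_annihProd (α : Fin n → Mode) (Φ : FockSpace n) (L : List (Fin n)) (l : Fin n → ℕ) :
    wave (annihProd L α Φ) l =ᵐ[volume] fun η =>
      ∫ u, (modeVars α L u : ℂ) * annihilateVars L u (wave Φ) l η ∂(varsMeasure L) := by
  induction L generalizing l with
  | nil =>
    refine Filter.Eventually.of_forall fun η => ?_
    have : ∫ u : Unit, ((1 : ℝ) : ℂ) * wave Φ l η ∂(Measure.dirac ()) = wave Φ l η := by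
      rw [integral_dirac]
      simp
    exact this.symm
  | cons i L ih =>
    have h1 : wave (annihProd (i :: L) α Φ) l =ᵐ[volume]
        smear i (fun x => (modeFun (α i) x : ℂ)) (wave (annihProd L α Φ)) l :=
      wave_annih i (isONSystem_modeFun.memLp (α i)) (annihProd L α Φ) l
    have hF := memLp_annihilateVars (fun l => memLp_wave Φ l) (i :: L) l
    have hsec : ∀ᵐ η : Config l, MemLp (fun u : Vars (i :: L) =>
        annihilateVars (i :: L) u (wave Φ) l η) 2 (varsMeasure (i :: L)) := by
      have hF' := hF.comp_measurePreserving (Measure.measurePreserving_swap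
        (μ := (volume : Measure (Config l))) (ν := varsMeasure (i :: L)))
      have h2 := lintegral_enorm_sq_lt_top hF'
      rw [lintegral_prod _ (hF'.1.enorm.pow_const 2)] at h2
      filter_upwards [hF'.1.prodMk_left,
        ae_lt_top' ((hF'.1.enorm.pow_const 2).lintegral_prod_right') h2.ne] with η a1 a2
      exact (memLp_two_iff a1).2 a2
    filter_upwards [h1, ae_insertParticle i (ih (addOne l i)), hsec] with η a1 a2 a3
    rw [a1, smear_apply]
    have hint : Integrable (fun u : Particle × Vars L => ((modeFun (α i) u.1 * modeVars α L u.2 : ℝ) : ℂ) *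
        (annCoeff i l * annihilateVars L u.2 (wave Φ) (addOne l i) (insertParticle i u.1 η)))
        ((volume : Measure Particle).prod (varsMeasure L)) :=
      (memLp_modeVars α (i :: L)).integrable_mul a3
    have h3 := integral_prod _ hint
    refine Eq.trans ?_ h3.symm
    rw [← integral_const_mul]
    refine integral_congr_ae ?_
    filter_upwards [a2] with x hx
    rw [hx, ← integral_const_mul, ← integral_const_mul]
    congr 1
    funext u
    push_cast
    ring

end Variables

/-! ### Partial inner products -/

section PartialInner

variable {U V E : Type} [MeasurableSpace U] [MeasurableSpace V] [MeasurableSpace E]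
  {μ : Measure U} {ν : Measure V} {τ : Measure E}

/-- The inner product with respect to the last variables. -/
def partialInner (τ : Measure E) (a : U × E → ℂ) (b : V × E → ℂ) (p : U × V) : ℂ :=
  ∫ η, conj (a (p.1, η)) * b (p.2, η) ∂τ

theorem measurePreserving_regroup [SFinite μ] [SFinite ν] [SFinite τ] :
    MeasurePreserving (fun q : (U × V) × E => (q.1.1, (q.1.2, q.2)))
      ((μ.prod ν).prod τ) (μ.prod (ν.prod τ)) :=
  measurePreserving_prodAssoc μ ν τ

theorem measurePreserving_regroup_swap [SFinite μ] [SFinite ν] [SFinite τ] :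
    MeasurePreserving (fun q : (U × V) × E => (q.1.2, (q.1.1, q.2)))
      ((μ.prod ν).prod τ) (ν.prod (μ.prod τ)) :=
  (measurePreserving_prodAssoc ν μ τ).comp
    ((Measure.measurePreserving_swap (μ := μ) (ν := ν)).prod (MeasurePreserving.id τ))

theorem quasiMeasurePreserving_dropFst [SFinite μ] [SFinite ν] [SFinite τ] :
    Measure.QuasiMeasurePreserving (fun q : (U × V) × E => (q.1.2, q.2)) ((μ.prod ν).prod τ)
      (ν.prod τ) :=
  Measure.quasiMeasurePreserving_snd.comp measurePreserving_regroup.quasiMeasurePreserving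

theorem quasiMeasurePreserving_dropSnd [SFinite μ] [SFinite ν] [SFinite τ] :
    Measure.QuasiMeasurePreserving (fun q : (U × V) × E => (q.1.1, q.2)) ((μ.prod ν).prod τ)
      (μ.prod τ) :=
  Measure.quasiMeasurePreserving_snd.comp measurePreserving_regroup_swap.quasiMeasurePreserving

theorem memLp_partialInner [SFinite μ] [SFinite ν] [SFinite τ] {a : U × E → ℂ} {b : V × E → ℂ}
    (ha : MemLp a 2 (μ.prod τ)) (hb : MemLp b 2 (ν.prod τ)) :
    MemLp (partialInner τ a b) 2 (μ.prod ν) := by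
  have hca := MemLp.conj ha
  have hm : AEStronglyMeasurable (fun q : (U × V) × E => conj (a (q.1.1, q.2)) * b (q.1.2, q.2))
      ((μ.prod ν).prod τ) :=
    (hca.1.comp_quasiMeasurePreserving quasiMeasurePreserving_dropSnd).mul
      (hb.1.comp_quasiMeasurePreserving quasiMeasurePreserving_dropFst)
  have hr : AEStronglyMeasurable (partialInner τ a b) (μ.prod ν) := hm.integral_prod_right'
  rw [memLp_two_iff hr]
  have ma := (hca.1.enorm.pow_const 2).lintegral_prod_right'
  have mb := (hb.1.enorm.pow_const 2).lintegral_prod_right'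
  have hle : ∫⁻ p, ‖partialInner τ a b p‖ₑ ^ 2 ∂(μ.prod ν) ≤
      ∫⁻ p : U × V, (∫⁻ η, ‖conj (a (p.1, η))‖ₑ ^ 2 ∂τ) * (∫⁻ η, ‖b (p.2, η)‖ₑ ^ 2 ∂τ)
        ∂(μ.prod ν) := by
    refine lintegral_mono_ae ?_
    have h1 := Measure.quasiMeasurePreserving_fst (μ := μ) (ν := ν) |>.ae hca.1.prodMk_left
    have h2 := Measure.quasiMeasurePreserving_snd (μ := μ) (ν := ν) |>.ae hb.1.prodMk_left
    filter_upwards [h1, h2] with p p1 p2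
    exact enorm_integral_mul_sq_le p1 p2
  refine hle.trans_lt ?_
  rw [lintegral_prod_mul ma mb, ← lintegral_prod _ (hca.1.enorm.pow_const 2),
    ← lintegral_prod _ (hb.1.enorm.pow_const 2)]
  exact ENNReal.mul_lt_top (lintegral_enorm_sq_lt_top hca) (lintegral_enorm_sq_lt_top hb)

theorem integral_mul_partialInner [SFinite μ] [SFinite ν] [SFinite τ] {a : U × E → ℂ}
    {b : V × E → ℂ} (ha : MemLp a 2 (μ.prod τ)) (hb : MemLp b 2 (ν.prod τ)) {f : U → ℝ} {g : V → ℝ}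
    (hf : MemLp (fun u => (f u : ℂ)) 2 μ) (hg : MemLp (fun v => (g v : ℂ)) 2 ν) :
    ∫ p : U × V, ((f p.1 * g p.2 : ℝ) : ℂ) * partialInner τ a b p ∂(μ.prod ν) =
      ∫ η, conj (∫ u, (f u : ℂ) * a (u, η) ∂μ) * ∫ v, (g v : ℂ) * b (v, η) ∂ν ∂τ := by
  have h1 := (memLp_tensor hf hb).comp_measurePreserving (measurePreserving_regroup (μ := μ) (ν := ν) (τ := τ))
  have h2 := (memLp_tensor hg (MemLp.conj ha)).comp_measurePreserving
    (measurePreserving_regroup_swap (μ := μ) (ν := ν) (τ := τ))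
  have h3 := MemLp.integrable_mul h1 h2
  have h4 : Integrable (fun q : (U × V) × E => ((f q.1.1 : ℂ) * conj (a (q.1.1, q.2))) *
      ((g q.1.2 : ℂ) * b (q.1.2, q.2))) ((μ.prod ν).prod τ) := by
    refine h3.congr (Filter.Eventually.of_forall fun q => ?_)
    simp only [Function.comp_apply, Pi.mul_apply]
    ring
  calc ∫ p : U × V, ((f p.1 * g p.2 : ℝ) : ℂ) * partialInner τ a b p ∂(μ.prod ν)
      = ∫ p : U × V, ∫ η, ((f p.1 : ℂ) * conj (a (p.1, η))) * ((g p.2 : ℂ) * b (p.2, η)) ∂τ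
          ∂(μ.prod ν) := by
        refine integral_congr_ae (Filter.Eventually.of_forall fun p => ?_)
        simp only [partialInner]
        rw [← integral_const_mul]
        refine integral_congr_ae (Filter.Eventually.of_forall fun η => ?_)
        push_cast
        ring
    _ = ∫ η, ∫ p : U × V, ((f p.1 : ℂ) * conj (a (p.1, η))) * ((g p.2 : ℂ) * b (p.2, η))
          ∂(μ.prod ν) ∂τ := integral_integral_swap h4
    _ = _ := by
        refine integral_congr_ae (Filter.Eventually.of_forall fun η => ?_)
        simp only
        rw [integral_prod_mul (fun u => (f u : ℂ) * conj (a (u, η))) fun v => (g v : ℂ) * b (v, η),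
          ← integral_conj]
        simp only [map_mul, Complex.conj_ofReal]

theorem partialInner_ae_zero [SFinite μ] [SFinite ν] [SFinite τ] {a : U × E → ℂ}
    (ha : a =ᵐ[μ.prod τ] 0) (b : V × E → ℂ) : partialInner τ a b =ᵐ[μ.prod ν] 0 := by
  have h1 := Measure.quasiMeasurePreserving_fst (μ := μ) (ν := ν) |>.ae (Measure.ae_ae_of_ae_prod ha)
  filter_upwards [h1] with p hp
  refine integral_eq_zero_of_ae ?_
  filter_upwards [hp] with η h
  rw [h]
  simp

end PartialInner

/-! ### The interaction as a series -/

section Series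

variable {n : ℕ}

/-- Only finitely many occupation numbers occur. -/
def IsFiniteState (Φ : FockSpace n) : Prop :=
  ∃ N, ∀ l : Fin n → ℕ, (∃ i, N < l i) → wave Φ l =ᵐ[volume] 0

/-- Parseval's identity for G against ξ ↦ ⟨b(ξ)⋯Φ, b(ξ)⋯Ψ⟩. This function is in L² because only
finitely many sectors of Φ contribute, each through a partial inner product of L² functions. By
Fubini its Hermite coefficients are inner products of vectors obtained with smeared operators. -/
theorem hasSum_coeff {L₁ L₂ : List (Fin n)} (hnd : (L₁ ++ L₂).Nodup) (hmem : ∀ i, i ∈ L₁ ++ L₂)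
    {G : (Fin n → Particle) → ℂ} (hG : MemLp G 2 volume) {Φ : FockSpace n} (hΦ : IsFiniteState Φ)
    (Ψ : FockSpace n) :
    HasSum (fun α => coeff G α * inner ℂ (annihProd L₁ α Φ) (annihProd L₂ α Ψ))
      (∫ ξ : Fin n → Particle, G ξ *
        waveInner (annihilateList L₁ ξ (wave Φ)) (annihilateList L₂ ξ (wave Ψ))) := by
  obtain ⟨N, hN⟩ := hΦ
  have hmp := measurePreserving_proj hnd hmem
  set r : (l : Fin n → ℕ) → Vars L₁ × Vars L₂ → ℂ := fun l =>
    partialInner volume (fun p : Vars L₁ × Config l => annihilateVars L₁ p.1 (wave Φ) l p.2)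
      (fun p : Vars L₂ × Config l => annihilateVars L₂ p.1 (wave Ψ) l p.2) with hr
  have hrm : ∀ l, MemLp (r l) 2 ((varsMeasure L₁).prod (varsMeasure L₂)) := fun l =>
    memLp_partialInner (memLp_annihilateVars (memLp_wave Φ) L₁ l)
      (memLp_annihilateVars (memLp_wave Ψ) L₂ l)
  set S : Finset (Fin n → ℕ) := Fintype.piFinset fun _ => Finset.range (N + 1) with hS
  have hnS : ∀ l, l ∉ S → ∃ i, N < l i := fun l hl => by
    by_contra! h
    exact hl (Fintype.mem_piFinset.2 fun i => Finset.mem_range_succ_iff.2 (h i))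
  have hr0 : ∀ l, l ∉ S → r l =ᵐ[(varsMeasure L₁).prod (varsMeasure L₂)] 0 := fun l hl =>
    partialInner_ae_zero (annihilateVars_ae_zero hN L₁ l (hnS l hl)) _
  have hsum : ∀ᵐ p ∂((varsMeasure L₁).prod (varsMeasure L₂)), ∑' l, r l p = ∑ l ∈ S, r l p := by
    have h : ∀ᵐ p ∂((varsMeasure L₁).prod (varsMeasure L₂)), ∀ l, l ∉ S → r l p = 0 :=
      ae_all_iff.2 fun l => by
        by_cases hl : l ∈ S
        · exact Filter.Eventually.of_forall fun p h => absurd hl h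
        · filter_upwards [hr0 l hl] with p hp _
          exact hp
    filter_upwards [h] with p hp
    exact tsum_eq_sum fun l hl => hp l hl
  have hRm : MemLp (fun p => ∑ l ∈ S, r l p) 2 ((varsMeasure L₁).prod (varsMeasure L₂)) :=
    memLp_finsetSum S fun l _ => hrm l
  have hwave : ∀ᵐ ξ : Fin n → Particle, waveInner (annihilateList L₁ ξ (wave Φ))
      (annihilateList L₂ ξ (wave Ψ)) = ∑ l ∈ S, r l (proj L₁ ξ, proj L₂ ξ) := by
    filter_upwards [hmp.quasiMeasurePreserving.ae hsum] with ξ hξ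
    rw [annihilateList_eq, annihilateList_eq]
    exact hξ
  have hRξ : MemLp (fun ξ => ∑ l ∈ S, r l (proj L₁ ξ, proj L₂ ξ)) 2
      (volume : Measure (Fin n → Particle)) := hRm.comp_measurePreserving hmp
  have hmode : ∀ α l, ∫ p : Vars L₁ × Vars L₂, ((modeVars α L₁ p.1 * modeVars α L₂ p.2 : ℝ) : ℂ) *
      r l p ∂((varsMeasure L₁).prod (varsMeasure L₂)) =
      ∫ η, conj (wave (annihProd L₁ α Φ) l η) * wave (annihProd L₂ α Ψ) l η := fun α l => by
    refine (integral_mul_partialInner (memLp_annihilateVars (memLp_wave Φ) L₁ l)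
      (memLp_annihilateVars (memLp_wave Ψ) L₂ l) (memLp_modeVars α L₁)
      (memLp_modeVars α L₂)).trans (integral_congr_ae ?_)
    filter_upwards [wave_annihProd α Φ L₁ l, wave_annihProd α Ψ L₂ l] with η h1 h2
    rw [h1, h2]
  have hmodem : ∀ α, MemLp (fun p : Vars L₁ × Vars L₂ =>
      ((modeVars α L₁ p.1 * modeVars α L₂ p.2 : ℝ) : ℂ)) 2
      ((varsMeasure L₁).prod (varsMeasure L₂)) := fun α => by
    simpa only [Complex.ofReal_mul] using memLp_tensor (memLp_modeVars α L₁) (memLp_modeVars α L₂)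
  have hinner : ∀ α, ∫ ξ : Fin n → Particle, (modeProd α ξ : ℂ) *
      ∑ l ∈ S, r l (proj L₁ ξ, proj L₂ ξ) = inner ℂ (annihProd L₁ α Φ) (annihProd L₂ α Ψ) := by
    intro α
    have e1 : ∫ ξ : Fin n → Particle, (modeProd α ξ : ℂ) *
        ∑ l ∈ S, r l (proj L₁ ξ, proj L₂ ξ) = ∫ p, ((modeVars α L₁ p.1 * modeVars α L₂ p.2 : ℝ) : ℂ) *
        ∑ l ∈ S, r l p ∂((varsMeasure L₁).prod (varsMeasure L₂)) := by
      rw [← hmp.map_eq, integral_map hmp.measurable.aemeasurable]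
      · simp only [modeProd_eq hnd hmem]
      · rw [hmp.map_eq]
        exact (hmodem α).1.mul hRm.1
    rw [e1, inner_wave]
    simp only [← hmode, Finset.mul_sum]
    refine (integral_finsetSum S (f := fun l p => ((modeVars α L₁ p.1 * modeVars α L₂ p.2 : ℝ) : ℂ) *
      r l p) fun l _ => (hmodem α).integrable_mul (hrm l)).trans ?_
    refine (tsum_eq_sum fun l hl => integral_eq_zero_of_ae ?_).symm
    filter_upwards [hr0 l hl] with p hp
    rw [hp]
    simp
  have h := isONSystem_modeProd.hasSum_mul isTotal_modeProd hG hRξ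
  simp only [hinner] at h
  have e : ∫ ξ : Fin n → Particle, G ξ *
        waveInner (annihilateList L₁ ξ (wave Φ)) (annihilateList L₂ ξ (wave Ψ)) =
      ∫ ξ, G ξ * ∑ l ∈ S, r l (proj L₁ ξ, proj L₂ ξ) := by
    refine integral_congr_ae ?_
    filter_upwards [hwave] with ξ hξ
    rw [hξ]
  rw [e]
  exact h

end Series

/-! ### Anticommutation of different species -/

section Anticommute

variable {n : ℕ}

theorem wave_apply_congr (Φ : WaveFunction n) {l l' : Fin n → ℕ} (h : l = l') {η : Config l}
    {η' : Config l'} (hη : ∀ k (a : Fin (l k)) (b : Fin (l' k)), (a : ℕ) = b → η k a = η' k b) :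
    Φ l η = Φ l' η' := by
  subst h
  congr 1
  funext k a
  exact hη k a a rfl

theorem addOne_comm {i j : Fin n} (hij : i ≠ j) (l : Fin n → ℕ) :
    addOne (addOne l i) j = addOne (addOne l j) i := by
  simp only [addOne, Function.update_of_ne hij, Function.update_of_ne hij.symm]
  exact Function.update_comm hij _ _ l

theorem annCoeff_addOne {i j : Fin n} (hij : i ≠ j) (l : Fin n → ℕ) :
    annCoeff j (addOne l i) = (if i < j then -1 else 1) * annCoeff j l := by
  have h1 : addOne l i j = l j := Function.update_of_ne hij.symm _ _
  have h2 : ∑ k ∈ Finset.univ.filter (fun k => k < j), addOne l i k =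
      (∑ k ∈ Finset.univ.filter (fun k => k < j), l k) + if i < j then 1 else 0 := by
    have e : ∀ k, addOne l i k = l k + if k = i then 1 else 0 := fun k => by
      by_cases hk : k = i
      · subst hk
        simp
      · simp [addOne, hk]
    simp only [e, Finset.sum_add_distrib, Finset.sum_ite_eq', Finset.mem_filter, Finset.mem_univ,
      true_and]
  rw [annCoeff, annCoeff, h1, h2]
  split_ifs <;> ring

/-- An additional particle of species i changes the sign string of species j exactly when i < j, so
exactly one of the two orders picks up a sign. The inserted configurations agree, but their types
only up to `addOne_comm`. -/
theorem annihilate_anticomm {i j : Fin n} (hij : i ≠ j) (x y : Particle) (Φ : WaveFunction n) :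
    annihilate i x (annihilate j y Φ) = (-1 : ℂ) • annihilate j y (annihilate i x Φ) := by
  funext l η
  change annihilate i x (annihilate j y Φ) l η = -1 * annihilate j y (annihilate i x Φ) l η
  have hc : annCoeff i l * annCoeff j (addOne l i) = -(annCoeff j l * annCoeff i (addOne l j)) := by
    rw [annCoeff_addOne hij, annCoeff_addOne hij.symm]
    rcases lt_or_gt_of_ne hij with h | h
    · rw [if_pos h, if_neg h.not_gt]
      ring
    · rw [if_pos h, if_neg h.not_gt]
      ring
  have hΦ : Φ (addOne (addOne l i) j) (insertParticle j y (insertParticle i x η)) =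
      Φ (addOne (addOne l j) i) (insertParticle i x (insertParticle j y η)) := by
    have key : ∀ {i j : Fin n} (_ : i ≠ j) (x y : Particle) (a : Fin (addOne (addOne l i) j i))
        (b : Fin (addOne (addOne l j) i i)), (a : ℕ) = b →
        insertParticle j y (insertParticle i x η) i a =
          insertParticle i x (insertParticle j y η) i b := by
      intro i j hij x y a b hab
      have ha : (a : ℕ) < l i + 1 := by
        have := a.2
        simpa [addOne, Function.update_of_ne hij] using this
      rw [insertParticle_apply_ne hij y (insertParticle i x η) a ⟨a, by simpa [addOne] using ha⟩ rfl]
      rcases Nat.eq_zero_or_pos (a : ℕ) with h0 | h0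
      · rw [insertParticle_apply_self_zero i x η _ h0,
          insertParticle_apply_self_zero i x _ b (hab ▸ h0)]
      · obtain ⟨c, hc⟩ := Nat.exists_eq_succ_of_ne_zero h0.ne'
        have hcl : c < l i := by omega
        rw [insertParticle_apply_self_succ i x η _ ⟨c, hcl⟩ hc,
          insertParticle_apply_self_succ i x _ b
            ⟨c, by simpa [addOne, Function.update_of_ne hij] using hcl⟩ (hab ▸ hc),
          insertParticle_apply_ne hij y η _ ⟨c, hcl⟩ rfl]
    refine wave_apply_congr Φ (addOne_comm hij l) fun k a b hab => ?_
    by_cases hki : k = i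
    · subst hki
      exact key hij x y a b hab
    · by_cases hkj : k = j
      · subst hkj
        exact (key hij.symm y x b a hab.symm).symm
      · have ha : (a : ℕ) < l k := by
          have := a.2
          simpa [addOne, Function.update_of_ne hki, Function.update_of_ne hkj] using this
        rw [insertParticle_apply_ne hkj y _ a
            ⟨a, by simpa [addOne, Function.update_of_ne hki] using ha⟩ rfl,
          insertParticle_apply_ne hki x η _ ⟨a, ha⟩ rfl,
          insertParticle_apply_ne hki x _ b
            ⟨a, by simpa [addOne, Function.update_of_ne hkj] using ha⟩ hab.symm,
          insertParticle_apply_ne hkj y η _ ⟨a, ha⟩ rfl]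
  rw [annihilate_apply, annihilate_apply, annihilate_apply, annihilate_apply, hΦ]
  linear_combination hc * Φ (addOne (addOne l j) i) (insertParticle i x (insertParticle j y η))

theorem annihilate_smul (i : Fin n) (x : Particle) (c : ℂ) (Φ : WaveFunction n) :
    annihilate i x (c • Φ) = c • annihilate i x Φ := by
  funext l η
  change annCoeff i l * (c * Φ _ _) = c * (annCoeff i l * Φ _ _)
  ring

/-- Without repetitions only different species are transposed, so each transposition costs a sign
that does not depend on the variables. -/
theorem annihilateList_perm {L L' : List (Fin n)} (h : L.Perm L') (hL : L.Nodup) :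
    ∃ σ : ℂ, ‖σ‖ = 1 ∧ ∀ ξ Φ, annihilateList L ξ Φ = σ • annihilateList L' ξ Φ := by
  induction h with
  | nil => exact ⟨1, norm_one, fun ξ Φ => (one_smul _ _).symm⟩
  | cons i _ ih =>
    obtain ⟨σ, h1, h2⟩ := ih (List.nodup_cons.1 hL).2
    refine ⟨σ, h1, fun ξ Φ => ?_⟩
    exact (congrArg (annihilate i (ξ i)) (h2 ξ Φ)).trans (annihilate_smul _ _ _ _)
  | swap i j L =>
    have hij : j ≠ i := fun h => (List.nodup_cons.1 hL).1 (h ▸ List.mem_cons_self)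
    exact ⟨-1, by simp, fun ξ Φ => annihilate_anticomm hij _ _ _⟩
  | trans h1 _ ih1 ih2 =>
    obtain ⟨σ, a1, a2⟩ := ih1 hL
    obtain ⟨τ, b1, b2⟩ := ih2 (h1.nodup_iff.1 hL)
    exact ⟨σ * τ, by rw [norm_mul, a1, b1, one_mul], fun ξ Φ => by rw [a2, b2, smul_smul]⟩

theorem waveInner_smul_smul (σ τ : ℂ) (Φ Ψ : WaveFunction n) :
    waveInner (σ • Φ) (τ • Ψ) = conj σ * τ * waveInner Φ Ψ := by
  rw [waveInner, waveInner, ← tsum_mul_left]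
  refine tsum_congr fun l => ?_
  rw [← integral_const_mul]
  refine integral_congr_ae (Filter.Eventually.of_forall fun η => ?_)
  change conj (σ * Φ l η) * (τ * Ψ l η) = conj σ * τ * (conj (Φ l η) * Ψ l η)
  rw [map_mul]
  ring

theorem exists_perm_head {L : List (Fin n)} (i : Fin n) :
    ∃ L' : List (Fin n), L.Perm L' ∧ (i ∈ L → ∃ K, L' = i :: K) := by
  by_cases h : i ∈ L
  · exact ⟨i :: L.erase i, List.perm_cons_erase h, fun _ => ⟨_, rfl⟩⟩
  · exact ⟨L, List.Perm.refl L, fun h' => absurd h' h⟩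

/-- Species i₀ is moved to the head of the list that contains it. The resulting sign σ is the same
for all labels and does not affect any estimate. -/
theorem exists_hasSum_processForm (A : Finset (Fin n)) (i₀ : Fin n) :
    ∃ L₁ L₂ : List (Fin n), (L₁ ++ L₂).Nodup ∧ (∀ i, i ∈ L₁ ++ L₂) ∧
      ((∃ L, L₁ = i₀ :: L) ∨ ∃ L, L₂ = i₀ :: L) ∧ ∃ σ : ℂ, ‖σ‖ = 1 ∧
      ∀ (G : FormFactor n) (Φ Ψ : FockSpace n), IsFiniteState Φ →
        HasSum (fun α => σ * coeff G α * inner ℂ (annihProd L₁ α Φ) (annihProd L₂ α Ψ))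
          (processForm A G Φ Ψ) := by
  set M₁ := (A.sort (· ≤ ·)).reverse with hM₁
  set M₂ := Aᶜ.sort (· ≤ ·) with hM₂
  have m1 : ∀ i, i ∈ M₁ ↔ i ∈ A := fun i => by simp [hM₁]
  have m2 : ∀ i, i ∈ M₂ ↔ i ∉ A := fun i => by simp [hM₂]
  have n1 : M₁.Nodup := List.nodup_reverse.2 (Finset.sort_nodup _ _)
  have n2 : M₂.Nodup := Finset.sort_nodup _ _
  obtain ⟨L₁, p1, t1⟩ := exists_perm_head (L := M₁) i₀
  obtain ⟨L₂, p2, t2⟩ := exists_perm_head (L := M₂) i₀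
  obtain ⟨σ, s1, s2⟩ := annihilateList_perm p1 n1
  obtain ⟨τ, s3, s4⟩ := annihilateList_perm p2 n2
  have hnd : (L₁ ++ L₂).Nodup := ((p1.append p2).nodup_iff).1
    (List.nodup_append.2 ⟨n1, n2, fun a ha b hb e => (m2 b).1 hb (e ▸ (m1 a).1 ha)⟩)
  have hmem : ∀ i, i ∈ L₁ ++ L₂ := fun i => (p1.append p2).mem_iff.1 (by
    rw [List.mem_append, m1, m2]
    exact em _)
  refine ⟨L₁, L₂, hnd, hmem, ?_, conj σ * τ, ?_, fun G Φ Ψ hΦ => ?_⟩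
  · by_cases h : i₀ ∈ A
    · exact Or.inl (t1 ((m1 _).2 h))
    · exact Or.inr (t2 ((m2 _).2 h))
  · rw [norm_mul, RCLike.norm_conj, s1, s3, one_mul]
  · have h := (hasSum_coeff hnd hmem (Lp.memLp G) hΦ Ψ).mul_left (conj σ * τ)
    have e : processForm A G Φ Ψ = conj σ * τ * ∫ ξ : Fin n → Particle, G ξ *
        waveInner (annihilateList L₁ ξ (wave Φ)) (annihilateList L₂ ξ (wave Ψ)) := by
      rw [processForm, ← integral_const_mul]
      refine integral_congr_ae (Filter.Eventually.of_forall fun ξ => ?_)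
      simp only
      rw [← hM₁, ← hM₂, s2, s4, waveInner_smul_smul]
      ring
    rw [e]
    simpa only [mul_assoc] using h

end Anticommute

/-! ### Perturbations that factor through a regularization -/

section Factorization

variable {H : Type*} [NormedAddCommGroup H] [InnerProductSpace ℂ H]

/-- The form `q` on `F` is given by `S M⁻¹`, which is symmetric. -/
def Represents (M S : H →L[ℂ] H) (F : Set H) (q : H → H → ℂ) : Prop :=
  (∀ x y, (inner ℂ (S x) (M y) : ℂ) = inner ℂ (M x) (S y)) ∧
    ∀ Φ ∈ F, ∀ χ, M χ ∈ F → inner ℂ Φ (S χ) = q Φ (M χ)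

/-- The perturbation is `S M⁻¹`, where `M⁻¹` is relatively bounded with bound zero. -/
theorem exists_selfAdjoint_of_factorization [CompleteSpace H] {A : H →ₗ.[ℂ] H}
    (hd : Dense (A.domain : Set H)) (hs : A.IsFormalAdjoint A) {R : ℝ → H →L[ℂ] H}
    (hR : ∀ μ, 1 ≤ μ → IsResolvent A μ (R μ)) {M S : H →L[ℂ] H} {g : ℝ → H →L[ℂ] H}
    (hMg : ∀ y, M (g 1 y) = R 1 y)
    (hg : ∀ μ (h : 1 ≤ μ) y, g 1 (A ⟨R μ y, (hR μ h).mem y⟩ + R μ y) = g μ y)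
    (hg0 : Filter.Tendsto (fun μ => ‖g μ‖) Filter.atTop (nhds 0))
    {F : Set H} {q : H → H → ℂ} (hS : Represents M S F q) :
    ∃ B : H →ₗ.[ℂ] H, IsSelfAdjoint B ∧ B.domain = A.domain ∧
      (∀ Φ ∈ F, ∀ Ψ ∈ F, ∀ hΨ' : Ψ ∈ A.domain, ∃ hΨ : Ψ ∈ B.domain,
        inner ℂ Φ (B ⟨Ψ, hΨ⟩) = inner ℂ Φ (A ⟨Ψ, hΨ'⟩) + q Φ Ψ) ∧
      (∃ c : ℝ, ∀ x : B.domain, c * ‖(x : H)‖ ^ 2 ≤ (inner ℂ (x : H) (B x)).re) ∧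
      (∀ D : Submodule ℂ H, A.HasCore D → B.HasCore D) := by
  -- As `M (g 1 y) = R 1 y`, the vector g(1)(A + 1) x is a preimage of x under M. The perturbation S
  -- M⁻¹ is therefore S g(1)(A + 1), defined on the whole domain of A.
  set W : H →L[ℂ] H := S ∘L g 1 with hW
  set V : A.domain →ₗ[ℂ] H := W.toLinearMap ∘ₗ (A.toFun + A.domain.subtype) with hV
  have hreg : ∀ x : A.domain, M (g 1 (A x + (x : H))) = x := fun x => by
    rw [hMg]
    have h := (hR 1 le_rfl).left_inv x
    rwa [Complex.ofReal_one, one_smul] at h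
  have hsym : ∀ x y : A.domain, (inner ℂ (V x) (y : H) : ℂ) = inner ℂ (x : H) (V y) :=
    fun x y => by
      have h := hS.1 (g 1 (A x + (x : H))) (g 1 (A y + (y : H)))
      rw [hreg, hreg] at h
      exact h
  have hK : ∀ μ (h : 1 ≤ μ) y, (S ∘L g μ) y = V ⟨R μ y, (hR μ h).mem y⟩ :=
    fun μ h y => (congrArg S (hg μ h y)).symm
  have hK1 : ∀ᶠ μ in Filter.atTop, ‖S ∘L g μ‖ < 1 := by
    have h1 := hg0.const_mul ‖S‖
    rw [mul_zero] at h1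
    filter_upwards [h1.eventually (gt_mem_nhds zero_lt_one)] with μ a1
    exact (ContinuousLinearMap.opNorm_comp_le _ _).trans_lt a1
  obtain ⟨h1, h2, h3⟩ := katoRellich hd hs hR hsym (W := W) (fun x => rfl) hK hK1
  refine ⟨_, h1, rfl, fun Φ hΦ Ψ hΨ hΨ' => ⟨hΨ', ?_⟩, h2, h3⟩
  have e := hreg ⟨Ψ, hΨ'⟩
  have h := hS.2 Φ hΦ _ (show M _ ∈ F by rw [e]; exact hΨ)
  rw [e] at h
  have e1 : perturb A V ⟨Ψ, hΨ'⟩ = A ⟨Ψ, hΨ'⟩ + S (g 1 (A ⟨Ψ, hΨ'⟩ + Ψ)) := rfl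
  exact (congrArg (inner ℂ Φ) e1).trans ((inner_add_right _ _ _).trans (congrArg _ h))

end Factorization

/-! ### The free Hamiltonian and its resolvent -/

section Free

variable {n : ℕ} {m : Fin n → ℝ}

/-- The dispersion relations of the species. -/
abbrev speciesDispersion (m : Fin n → ℝ) (i : Fin n) (x : Particle) : ℝ := dispersion (m i) x.1

theorem measurable_freeEnergy (l : Fin n → ℕ) : Measurable fun η : Config l => freeEnergy m η :=
  Finset.measurable_sum _ fun i _ => measurable_speciesSum i (measurable_dispersion (m i)) l

theorem freeEnergy_permute {l : Fin n → ℕ} (σ : (i : Fin n) → Equiv.Perm (Fin (l i)))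
    (η : Config l) : freeEnergy m (permute σ η) = freeEnergy m η :=
  Finset.sum_congr rfl fun i _ => speciesSum_permute i (speciesDispersion m i) l σ η

theorem speciesSum_le_freeEnergy {l : Fin n → ℕ} (η : Config l) (i : Fin n) :
    speciesSum i (speciesDispersion m i) l η ≤ freeEnergy m η :=
  Finset.single_le_sum (f := fun i => speciesSum i (speciesDispersion m i) l η)
    (fun i _ => speciesSum_nonneg i (dispersion_nonneg (m i)) l η) (Finset.mem_univ i)

theorem freeEnergy_nonneg {l : Fin n → ℕ} (η : Config l) : 0 ≤ freeEnergy m η :=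
  Finset.sum_nonneg fun i _ => speciesSum_nonneg i (dispersion_nonneg (m i)) l η

theorem wave_freeHamiltonian (x : (freeHamiltonian m).domain) (l : Fin n → ℕ) :
    wave (freeHamiltonian m x) l =ᵐ[volume] fun η => (freeEnergy m η : ℂ) * wave x l η := by
  have h := (freeHamiltonian m).mem_graph x
  rw [freeHamiltonian_graph] at h
  exact h l

theorem freeHamiltonian_of_wave {Ψ Θ : FockSpace n}
    (h : ∀ l, wave Θ l =ᵐ[volume] fun η => (freeEnergy m η : ℂ) * wave Ψ l η) :
    ∃ hΨ : Ψ ∈ (freeHamiltonian m).domain, freeHamiltonian m ⟨Ψ, hΨ⟩ = Θ := by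
  have h1 : (Ψ, Θ) ∈ (freeHamiltonian m).graph := by
    rw [freeHamiltonian_graph]
    exact h
  obtain ⟨y, hy, h2⟩ := (LinearPMap.mem_graph_iff _).1 h1
  obtain ⟨y, hy'⟩ := y
  obtain rfl : y = Ψ := hy
  exact ⟨hy', h2⟩

/-- The function `(E + μ)⁻¹` of the free energy `E`. -/
def resolventWeight (m : Fin n → ℝ) (μ : ℝ) (l : Fin n → ℕ) (η : Config l) : ℝ :=
  (freeEnergy m η + μ)⁻¹

theorem isWeight_resolventWeight {μ : ℝ} (hμ : 1 ≤ μ) : IsWeight (resolventWeight m μ) 1 where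
  nonneg := zero_le_one
  meas l := ((measurable_freeEnergy l).add_const μ).inv
  symm l σ η := by rw [resolventWeight, resolventWeight, freeEnergy_permute]
  bound l η := by
    have h := freeEnergy_nonneg (m := m) η
    rw [resolventWeight, abs_of_nonneg (by positivity)]
    exact inv_le_one_of_one_le₀ (by linarith)

theorem isResolvent_freeHamiltonian {μ : ℝ} (hμ : 1 ≤ μ) :
    IsResolvent (freeHamiltonian m) μ (mulOp (resolventWeight m μ)) := by
  have hw := isWeight_resolventWeight (m := m) hμ
  have hne : ∀ {l : Fin n → ℕ} (η : Config l), ((freeEnergy m η : ℂ) + μ) ≠ 0 := fun η => by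
    have h := freeEnergy_nonneg (m := m) η
    have : freeEnergy m η + μ ≠ 0 := by positivity
    exact_mod_cast this
  have hmem : ∀ y, ∃ h : mulOp (resolventWeight m μ) y ∈ (freeHamiltonian m).domain,
      freeHamiltonian m ⟨_, h⟩ = y - (μ : ℂ) • mulOp (resolventWeight m μ) y := fun y => by
    refine freeHamiltonian_of_wave fun l => ?_
    have e : y - (μ : ℂ) • mulOp (resolventWeight m μ) y =
        y + (-(μ : ℂ)) • mulOp (resolventWeight m μ) y := by rw [neg_smul, sub_eq_add_neg]
    rw [e]
    filter_upwards [wave_add y ((-(μ : ℂ)) • mulOp (resolventWeight m μ) y) l,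
      wave_smul (-(μ : ℂ)) (mulOp (resolventWeight m μ) y) l, hw.wave_mulOp y l] with η h1 h2 h3
    rw [h1, h2, h3, resolventWeight]
    have := hne η
    push_cast
    field_simp
    ring
  refine ⟨fun y => (hmem y).1, fun y => (hmem y).2, fun x => ?_⟩
  refine ext_wave fun l => ?_
  filter_upwards [hw.wave_mulOp (freeHamiltonian m x + (μ : ℂ) • (x : FockSpace n)) l,
    wave_add (freeHamiltonian m x) ((μ : ℂ) • (x : FockSpace n)) l, wave_smul (μ : ℂ) (x : FockSpace n) l,
    wave_freeHamiltonian x l] with η h1 h2 h3 h4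
  rw [h1, h2, h3, h4, resolventWeight]
  have := hne η
  push_cast
  field_simp

theorem freeHamiltonian_isFormalAdjoint :
    (freeHamiltonian m).IsFormalAdjoint (freeHamiltonian m) := by
  intro x y
  rw [inner_wave, inner_wave]
  refine tsum_congr fun l => integral_congr_ae ?_
  filter_upwards [wave_freeHamiltonian x l, wave_freeHamiltonian y l] with η h1 h2
  rw [h1, h2, map_mul, Complex.conj_ofReal]
  ring

/-- A vector orthogonal to the domain is annihilated by the self-adjoint resolvent, which multiplies
by a function without zeros. -/
theorem dense_freeHamiltonian : Dense ((freeHamiltonian m).domain : Set (FockSpace n)) := by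
  rw [Submodule.dense_iff_topologicalClosure_eq_top, Submodule.topologicalClosure_eq_top_iff,
    Submodule.eq_bot_iff]
  intro z hz
  have hR := isResolvent_freeHamiltonian (m := m) le_rfl
  have hw := isWeight_resolventWeight (m := m) le_rfl
  have h1 : mulOp (resolventWeight m 1) z = 0 := by
    refine ext_inner_left ℂ fun y => ?_
    rw [inner_zero_right, ← hw.adjoint_mulOp, ContinuousLinearMap.adjoint_inner_right]
    exact Submodule.inner_right_of_mem_orthogonal (hR.mem y) hz
  refine ext_wave fun l => ?_
  have h2 := hw.wave_mulOp z l
  rw [h1] at h2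
  filter_upwards [h2, wave_zero (n := n) l] with η a1 a2
  rw [a2] at a1 ⊢
  have h := freeEnergy_nonneg (m := m) η
  refine ((mul_eq_zero.1 a1.symm).resolve_left ?_)
  rw [resolventWeight]
  have : (freeEnergy m η + 1)⁻¹ ≠ 0 := by positivity
  exact_mod_cast this

/-! ### Relative bounds -/

variable {γ : Fin n → ℝ}

/-- The function `(E + μ)⁻¹ ∏ᵢ (1 + Eᵢ)^{γᵢ}`. -/
def gainWeight (m γ : Fin n → ℝ) (μ : ℝ) (l : Fin n → ℕ) (η : Config l) : ℝ :=
  (regularizer (speciesDispersion m) γ l η)⁻¹ * resolventWeight m μ l η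

theorem regularizer_pos {l : Fin n → ℕ} (η : Config l) :
    0 < regularizer (speciesDispersion m) γ l η :=
  Finset.prod_pos fun i _ => Real.rpow_pos_of_pos
    (by linarith [speciesSum_nonneg i (dispersion_nonneg (m i)) l η]) _

theorem isWeight_regularizer_free (hγ : ∀ i, 0 ≤ γ i) :
    IsWeight (regularizer (speciesDispersion m) γ) 1 :=
  isWeight_regularizer (fun i => measurable_dispersion (m i)) (fun i => dispersion_nonneg (m i)) hγ

/-- For μ ≥ 1 every factor 1 + E_i is at most E + μ, so the powers add. -/
theorem inv_regularizer_le (hγ : ∀ i, 0 ≤ γ i) {μ : ℝ} (hμ : 1 ≤ μ) {l : Fin n → ℕ}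
    (η : Config l) : (regularizer (speciesDispersion m) γ l η)⁻¹ ≤
      (freeEnergy m η + μ) ^ (∑ i, γ i) := by
  have hE := freeEnergy_nonneg (m := m) η
  rw [Real.rpow_sum_of_pos (by linarith), regularizer, ← Finset.prod_inv_distrib]
  refine Finset.prod_le_prod (fun i _ => ?_) fun i _ => ?_
  all_goals
    have h0 := speciesSum_nonneg i (dispersion_nonneg (m i)) l η
    rw [energyPow, Real.rpow_neg (by linarith), inv_inv]
  · exact Real.rpow_nonneg (by linarith) _
  · refine Real.rpow_le_rpow (by linarith) ?_ (hγ i)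
    have := speciesSum_le_freeEnergy (m := m) η i
    linarith

/-- The weight is at most (E + μ)^(∑ γ_i - 1), and the negative exponent allows E to be dropped. The
resulting decay in μ is the reason for requiring ∑ γ_i < 1. -/
theorem isWeight_gainWeight (hγ : ∀ i, 0 ≤ γ i) (hΓ : ∑ i, γ i < 1) {μ : ℝ} (hμ : 1 ≤ μ) :
    IsWeight (gainWeight m γ μ) (μ ^ (∑ i, γ i - 1)) where
  nonneg := Real.rpow_nonneg (by linarith) _
  meas l := ((isWeight_regularizer_free hγ).meas l).inv.mul ((isWeight_resolventWeight hμ).meas l)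
  symm l σ η := by
    rw [gainWeight, gainWeight, (isWeight_regularizer_free hγ).symm,
      (isWeight_resolventWeight hμ).symm]
  bound l η := by
    have hE := freeEnergy_nonneg (m := m) η
    have h1 := inv_regularizer_le (m := m) hγ hμ η
    have h2 := inv_pos.2 (regularizer_pos (m := m) (γ := γ) η)
    rw [gainWeight, resolventWeight, abs_of_nonneg (by positivity)]
    calc _ ≤ (freeEnergy m η + μ) ^ (∑ i, γ i) * (freeEnergy m η + μ)⁻¹ := by gcongr
      _ = (freeEnergy m η + μ) ^ (∑ i, γ i - 1) := by
        rw [Real.rpow_sub_one (by positivity), div_eq_mul_inv]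
      _ ≤ _ := Real.rpow_le_rpow_of_nonpos (by linarith) (by linarith) (by linarith)

theorem mulOp_regularizer_gainWeight (hγ : ∀ i, 0 ≤ γ i) (hΓ : ∑ i, γ i < 1) {μ : ℝ} (hμ : 1 ≤ μ)
    (y : FockSpace n) : mulOp (regularizer (speciesDispersion m) γ) (mulOp (gainWeight m γ μ) y) =
      mulOp (resolventWeight m μ) y := by
  refine ext_wave fun l => ?_
  filter_upwards [(isWeight_regularizer_free hγ).wave_mulOp (mulOp (gainWeight m γ μ) y) l,
    (isWeight_gainWeight hγ hΓ hμ).wave_mulOp y l, (isWeight_resolventWeight hμ).wave_mulOp y l]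
    with η h1 h2 h3
  rw [h1, h2, h3, gainWeight, ← mul_assoc, ← Complex.ofReal_mul, ← mul_assoc,
    mul_inv_cancel₀ (regularizer_pos η).ne', one_mul]

theorem mulOp_gainWeight_resolvent (hγ : ∀ i, 0 ≤ γ i) (hΓ : ∑ i, γ i < 1) {μ : ℝ} (hμ : 1 ≤ μ)
    (y : FockSpace n) (h : mulOp (resolventWeight m μ) y ∈ (freeHamiltonian m).domain) :
    mulOp (gainWeight m γ 1) (freeHamiltonian m ⟨_, h⟩ + mulOp (resolventWeight m μ) y) =
      mulOp (gainWeight m γ μ) y := by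
  refine ext_wave fun l => ?_
  filter_upwards [(isWeight_gainWeight hγ hΓ le_rfl).wave_mulOp
      (freeHamiltonian m ⟨_, h⟩ + mulOp (resolventWeight m μ) y) l,
    wave_add (freeHamiltonian m ⟨_, h⟩) (mulOp (resolventWeight m μ) y) l,
    wave_freeHamiltonian ⟨_, h⟩ l, (isWeight_resolventWeight hμ).wave_mulOp y l,
    (isWeight_gainWeight hγ hΓ hμ).wave_mulOp y l] with η h1 h2 h3 h4 h5
  have hE := freeEnergy_nonneg (m := m) η
  have e : gainWeight m γ 1 l η * (freeEnergy m η + 1) = (regularizer (speciesDispersion m) γ l η)⁻¹ := by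
    rw [gainWeight, resolventWeight, mul_assoc, inv_mul_cancel₀ (by positivity), mul_one]
  rw [h1, h2, h3, h4, h5]
  calc _ = ((gainWeight m γ 1 l η * (freeEnergy m η + 1) : ℝ) : ℂ) *
        ((resolventWeight m μ l η : ℂ) * wave y l η) := by
        push_cast
        ring
    _ = _ := by
        rw [e, gainWeight]
        push_cast
        ring

theorem exists_selfAdjoint_of_represents (hγ : ∀ i, 0 ≤ γ i) (hΓ : ∑ i, γ i < 1)
    {S : FockSpace n →L[ℂ] FockSpace n} {F : Set (FockSpace n)} {q : FockSpace n → FockSpace n → ℂ}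
    (hS : Represents (mulOp (regularizer (speciesDispersion m) γ)) S F q) :
    ∃ H : FockSpace n →ₗ.[ℂ] FockSpace n, IsSelfAdjoint H ∧
      H.domain = (freeHamiltonian m).domain ∧
      (∀ Φ ∈ F, ∀ Ψ ∈ F, ∀ hΨ' : Ψ ∈ (freeHamiltonian m).domain, ∃ hΨ : Ψ ∈ H.domain,
        inner ℂ Φ (H ⟨Ψ, hΨ⟩) = inner ℂ Φ (freeHamiltonian m ⟨Ψ, hΨ'⟩) + q Φ Ψ) ∧
      (∃ c : ℝ, ∀ Ψ : H.domain,
        c * ‖(Ψ : FockSpace n)‖ ^ 2 ≤ (inner ℂ (Ψ : FockSpace n) (H Ψ)).re) ∧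
      (∀ D : Submodule ℂ (FockSpace n), (freeHamiltonian m).HasCore D → H.HasCore D) := by
  refine exists_selfAdjoint_of_factorization dense_freeHamiltonian freeHamiltonian_isFormalAdjoint
    (R := fun μ => mulOp (resolventWeight m μ)) (fun μ h => isResolvent_freeHamiltonian h)
    (g := fun μ => mulOp (gainWeight m γ μ)) (mulOp_regularizer_gainWeight hγ hΓ le_rfl)
    (fun μ h y => mulOp_gainWeight_resolvent hγ hΓ h y _) ?_ hS
  have h1 : Filter.Tendsto (fun μ : ℝ => μ ^ (∑ i, γ i - 1)) Filter.atTop (nhds 0) := by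
    simpa only [neg_sub] using tendsto_rpow_neg_atTop (y := 1 - ∑ i, γ i) (by linarith)
  refine squeeze_zero' (Filter.Eventually.of_forall fun μ => norm_nonneg _) ?_ h1
  filter_upwards [Filter.eventually_ge_atTop 1] with μ hμ
  exact (isWeight_gainWeight hγ hΓ hμ).norm_mulOp_le

end Free

/-! ### The form domain -/

section FormDomain

variable {n : ℕ}

theorem exists_norm_mul_pow_le {φ : (r : ℕ) → (Fin r → Particle) → ℂ} (h : IsFiniteSchwartz φ)
    (r M : ℕ) : ∃ C : ℝ, 0 ≤ C ∧ ∀ η : Fin r → Particle,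
      ‖φ r η‖ * (1 + ‖fun a => (η a).1‖) ^ M ≤ C := by
  choose f hf using h.schwartz r
  have h1 : ∀ s, ∃ C : ℝ, 0 ≤ C ∧ ∀ k, ‖f s k‖ * (1 + ‖k‖) ^ M ≤ C := fun s => by
    have h := SchwartzMap.one_add_le_sup_seminorm_apply (𝕜 := ℝ) (m := (M, 0)) (k := M) (n := 0)
      le_rfl le_rfl (f s)
    refine ⟨_, (mul_nonneg (by positivity) (norm_nonneg _)).trans (h 0), fun k => ?_⟩
    have := h k
    rw [norm_iteratedFDeriv_zero, mul_comm] at this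
    exact this
  choose C hC0 hC using h1
  refine ⟨∑ s, C s, Finset.sum_nonneg fun s _ => hC0 s, fun η => ?_⟩
  have h2 := hf (fun a => (η a).2) fun a => (η a).1
  have h3 : φ r η = f (fun a => (η a).2) fun a => (η a).1 := h2
  rw [h3]
  exact (hC _ _).trans (Finset.single_le_sum (f := C) (fun s _ => hC0 s) (Finset.mem_univ _))

theorem prod_one_add_norm_le {r : ℕ} (η : Fin r → Particle) :
    ∏ a, (1 + ‖(η a).1‖) ≤ (1 + ‖fun a => (η a).1‖) ^ r := by
  refine (Finset.prod_le_prod (fun a _ => by positivity) fun a _ =>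
    add_le_add_right (norm_le_pi_norm (fun a => (η a).1) a) 1).trans_eq ?_
  simp

theorem dispersion_le (m : ℝ) (hm : 0 ≤ m) (k : Fin 3 → ℝ) : dispersion m k ≤ (2 + m) * (1 + ‖k‖) := by
  have h1 : ∑ j, k j ^ 2 ≤ 3 * ‖k‖ ^ 2 := by
    refine (Finset.sum_le_card_nsmul _ _ (‖k‖ ^ 2) fun j _ => ?_).trans_eq (by simp)
    rw [← sq_abs]
    gcongr
    exact norm_le_pi_norm k j
  have h2 := norm_nonneg k
  rw [dispersion]
  refine Real.sqrt_le_iff.2 ⟨by positivity, ?_⟩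
  nlinarith [mul_nonneg hm h2, sq_nonneg m, sq_nonneg ‖k‖, mul_nonneg (mul_nonneg hm h2) h2]

theorem freeEnergy_le {m : Fin n → ℝ} (hm : ∀ i, 0 ≤ m i) {l : Fin n → ℕ} (η : Config l) :
    freeEnergy m η ≤ (∑ i, l i * (2 + m i)) * ∏ i, (1 + ‖fun a => (η i a).1‖) := by
  rw [freeEnergy, Finset.sum_mul]
  refine Finset.sum_le_sum fun i _ => ?_
  have h1 : (1 + ‖fun a => (η i a).1‖) ≤ ∏ i, (1 + ‖fun a => (η i a).1‖) := by
    rw [← Finset.mul_prod_erase _ _ (Finset.mem_univ i)]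
    refine le_mul_of_one_le_right (by positivity) ?_
    refine Finset.prod_const_one.symm.trans_le (Finset.prod_le_prod (fun _ _ => zero_le_one)
      fun j _ => ?_)
    linarith [norm_nonneg fun a => (η j a).1]
  refine (Finset.sum_le_card_nsmul _ _ ((2 + m i) * ∏ i, (1 + ‖fun a => (η i a).1‖))
    fun a _ => ?_).trans_eq (by simp [mul_assoc])
  refine (dispersion_le (m i) (hm i) _).trans ?_
  have := hm i
  gcongr
  exact (add_le_add_right (norm_le_pi_norm (fun a => (η i a).1) a) 1).trans h1

/-- The exponent 4 exceeds the dimension 3 of the momentum of each particle. -/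
theorem integrable_decay (C : ℝ) (l : Fin n → ℕ) : Integrable fun η : Config l =>
    C * ∏ i, ∏ a, (1 + ‖(η i a).1‖) ^ (-4 : ℝ) := by
  have h1 : Integrable fun k : Fin 3 → ℝ => (1 + ‖k‖) ^ (-4 : ℝ) :=
    integrable_one_add_norm (by simp; norm_num)
  have h2 : Integrable fun x : Particle => (1 + ‖x.1‖) ^ (-4 : ℝ) := h1.comp_fst _
  refine Integrable.const_mul ?_ C
  exact Integrable.fintype_prod_dep fun i => Integrable.fintype_prod_dep fun a => h2

theorem exists_norm_le_decay {m : Fin n → ℝ} (hm : ∀ i, 0 ≤ m i)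
    {φ : Fin n → (r : ℕ) → (Fin r → Particle) → ℂ} (hφ : ∀ i, IsFiniteSchwartz (φ i))
    (l : Fin n → ℕ) : ∃ C : ℝ, ∀ η : Config l,
      ‖(freeEnergy m η : ℂ) * ∏ i, φ i (l i) (η i)‖ ^ 2 ≤
        C * ∏ i, ∏ a, (1 + ‖(η i a).1‖) ^ (-4 : ℝ) := by
  -- Two powers for each particle, which become the integrable fourth power after squaring, and one
  -- more power to absorb the free energy.
  choose C hC0 hC using fun i => exists_norm_mul_pow_le (hφ i) (l i) (2 * l i + 1)
  set K : ℝ := ∑ i, l i * (2 + m i) with hK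
  have hK0 : 0 ≤ K := Finset.sum_nonneg fun i _ => mul_nonneg (Nat.cast_nonneg _) (by linarith [hm i])
  refine ⟨(K * ∏ i, C i) ^ 2, fun η => ?_⟩
  have hE := freeEnergy_nonneg (m := m) η
  have h1 : ‖(freeEnergy m η : ℂ) * ∏ i, φ i (l i) (η i)‖ ≤
      (K * ∏ i, C i) * ∏ i, ∏ a, ((1 + ‖(η i a).1‖) ^ 2)⁻¹ := by
    rw [norm_mul, Complex.norm_real, Real.norm_of_nonneg hE, norm_prod]
    calc freeEnergy m η * ∏ i, ‖φ i (l i) (η i)‖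
        ≤ (K * ∏ i, (1 + ‖fun a => (η i a).1‖)) * ∏ i, ‖φ i (l i) (η i)‖ := by
          gcongr
          exact freeEnergy_le hm η
      _ = K * ∏ i, ((1 + ‖fun a => (η i a).1‖) * ‖φ i (l i) (η i)‖) := by
          rw [Finset.prod_mul_distrib, mul_assoc]
      _ ≤ K * ∏ i, (C i * ∏ a, ((1 + ‖(η i a).1‖) ^ 2)⁻¹) := by
          refine mul_le_mul_of_nonneg_left (Finset.prod_le_prod (fun i _ => by positivity)
            fun i _ => ?_) hK0
          rw [Finset.prod_inv_distrib, ← div_eq_mul_inv, le_div_iff₀ (Finset.prod_pos fun a _ => by positivity),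
            Finset.prod_pow]
          refine le_trans ?_ (hC i (η i))
          have h2 : (∏ a, (1 + ‖(η i a).1‖)) ^ 2 ≤ ((1 + ‖fun a => (η i a).1‖) ^ l i) ^ 2 :=
            pow_le_pow_left₀ (Finset.prod_nonneg fun a _ => by positivity) (prod_one_add_norm_le (η i)) 2
          calc _ ≤ (1 + ‖fun a => (η i a).1‖) * ‖φ i (l i) (η i)‖ *
                ((1 + ‖fun a => (η i a).1‖) ^ l i) ^ 2 := by gcongr
            _ = _ := by ring
      _ = _ := by rw [Finset.prod_mul_distrib, mul_assoc]
  calc _ ≤ ((K * ∏ i, C i) * ∏ i, ∏ a, ((1 + ‖(η i a).1‖) ^ 2)⁻¹) ^ 2 := by gcongr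
    _ = _ := by
      rw [mul_pow, ← Finset.prod_pow]
      congr 1
      refine Finset.prod_congr rfl fun i _ => ?_
      rw [← Finset.prod_pow]
      refine Finset.prod_congr rfl fun a _ => ?_
      rw [Real.rpow_neg (by positivity), show (4 : ℝ) = (4 : ℕ) by norm_num, Real.rpow_natCast,
        inv_pow, ← pow_mul]

theorem IsFiniteState.of_product {φ : Fin n → (r : ℕ) → (Fin r → Particle) → ℂ}
    (hφ : ∀ i, IsFiniteSchwartz (φ i)) {Ψ : FockSpace n}
    (h : ∀ l, wave Ψ l =ᵐ[volume] fun η => ∏ i, φ i (l i) (η i)) : IsFiniteState Ψ := by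
  choose N hN using fun i => (hφ i).finite
  refine ⟨∑ i, N i, fun l ⟨i, hi⟩ => ?_⟩
  filter_upwards [h l] with η hη
  rw [hη]
  have h1 : N i ≤ ∑ i, N i := Finset.single_le_sum (fun _ _ => Nat.zero_le _) (Finset.mem_univ i)
  exact Finset.prod_eq_zero (Finset.mem_univ i) (hN i (l i) (h1.trans_lt hi) (η i))

theorem mem_freeHamiltonian_of_product {m : Fin n → ℝ} (hm : ∀ i, 0 ≤ m i)
    {φ : Fin n → (r : ℕ) → (Fin r → Particle) → ℂ} (hφ : ∀ i, IsFiniteSchwartz (φ i))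
    {Ψ : FockSpace n} (h : ∀ l, wave Ψ l =ᵐ[volume] fun η => ∏ i, φ i (l i) (η i)) :
    Ψ ∈ (freeHamiltonian m).domain := by
  obtain ⟨N, hN⟩ := IsFiniteState.of_product hφ h
  have hst : IsState fun l (η : Config l) => (freeEnergy m η : ℂ) * wave Ψ l η := by
    have hlt : ∀ l, ∫⁻ η : Config l, ‖(freeEnergy m η : ℂ) * wave Ψ l η‖ₑ ^ 2 < ⊤ := fun l => by
      obtain ⟨C, hC⟩ := exists_norm_le_decay hm hφ l
      refine lt_of_le_of_lt (lintegral_mono_ae ?_) (integrable_decay C l).2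
      filter_upwards [h l] with η hη
      rw [hη, ← ofReal_norm, ← ofReal_norm, ← ENNReal.ofReal_pow (norm_nonneg _)]
      exact ENNReal.ofReal_le_ofReal ((hC η).trans (Real.le_norm_self _))
    refine ⟨fun l => ?_, fun l σ => ?_, ?_⟩
    · exact (Complex.measurable_ofReal.comp (measurable_freeEnergy l)).aestronglyMeasurable.mul
        ((isState_wave Ψ).meas l)
    · filter_upwards [(isState_wave Ψ).antisymm l σ] with η hη
      rw [hη, freeEnergy_permute]
      ring
    · rw [normSq, tsum_eq_sum (s := Fintype.piFinset fun _ => Finset.range (N + 1))]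
      · exact ENNReal.sum_lt_top.2 fun l _ => hlt l
      · intro l hl
        have hl' : ∃ i, N < l i := by
          by_contra! hc
          exact hl (Fintype.mem_piFinset.2 fun i => Finset.mem_range_succ_iff.2 (hc i))
        rw [lintegral_eq_zero_iff' (by
          exact ((Complex.measurable_ofReal.comp (measurable_freeEnergy l)).aestronglyMeasurable.mul
            ((isState_wave Ψ).meas l)).enorm.pow_const 2)]
        filter_upwards [hN l hl'] with η hη
        rw [hη]
        simp
  obtain ⟨Θ, hΘ⟩ := hst.exists_wave
  exact (freeHamiltonian_of_wave hΘ).1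

theorem mem_freeHamiltonian_of_mem_formDomain {m : Fin n → ℝ} (hm : ∀ i, 0 ≤ m i)
    {Ψ : FockSpace n} (h : Ψ ∈ formDomain n) : Ψ ∈ (freeHamiltonian m).domain := by
  refine Submodule.span_le.2 ?_ h
  rintro _ ⟨φ, hφ, h⟩
  exact mem_freeHamiltonian_of_product hm hφ h

theorem isFiniteState_of_mem {Ψ : FockSpace n} (h : Ψ ∈ formDomain n) : IsFiniteState Ψ := by
  induction h using Submodule.span_induction with
  | mem Ψ h =>
    obtain ⟨φ, hφ, h⟩ := h
    exact IsFiniteState.of_product hφ h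
  | zero => exact ⟨0, fun l _ => wave_zero l⟩
  | add Φ Ψ _ _ h1 h2 =>
    obtain ⟨N, hN⟩ := h1
    obtain ⟨M, hM⟩ := h2
    refine ⟨max N M, fun l ⟨i, hi⟩ => ?_⟩
    filter_upwards [wave_add Φ Ψ l, hN l ⟨i, (le_max_left _ _).trans_lt hi⟩,
      hM l ⟨i, (le_max_right _ _).trans_lt hi⟩] with η a1 a2 a3
    rw [a1, a2, a3]
    simp
  | smul c Ψ _ h =>
    obtain ⟨N, hN⟩ := h
    refine ⟨N, fun l hl => ?_⟩
    filter_upwards [wave_smul c Ψ l, hN l hl] with η a1 a2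
    rw [a1, a2]
    simp

end FormDomain

/-! ### Forms represented by operators -/

section Represents

variable {H : Type*} [NormedAddCommGroup H] [InnerProductSpace ℂ H]

theorem exists_represents_sum {κ : Type*} {M : H →L[ℂ] H} {F : Set H} {q : κ → H → H → ℂ}
    (s : Finset κ) (h : ∀ a ∈ s, ∃ S, Represents M S F (q a)) :
    ∃ S, Represents M S F fun Φ Ψ => ∑ a ∈ s, q a Φ Ψ := by
  classical
  induction s using Finset.induction_on with
  | empty => exact ⟨0, by simp [Represents]⟩
  | insert a s ha ih =>
    obtain ⟨S, h1, h2⟩ := h a (Finset.mem_insert_self a s)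
    obtain ⟨T, h3, h4⟩ := ih fun b hb => h b (Finset.mem_insert_of_mem hb)
    refine ⟨S + T, fun x y => ?_, fun Φ hΦ χ hχ => ?_⟩
    · rw [add_apply, add_apply, inner_add_left,
        inner_add_right, h1, h3]
    · rw [add_apply, inner_add_right, h2 Φ hΦ χ hχ, h4 Φ hΦ χ hχ]
      exact (Finset.sum_insert (f := fun a => q a Φ (M χ)) ha).symm

/-- A form given by a series whose regularization converges in norm, plus its hermitian
conjugate. -/
theorem exists_represents_of_summable [CompleteSpace H] {κ : Type*} {c : κ → ℂ}
    {X : κ → H →L[ℂ] H} {M : H →L[ℂ] H} (h1 : Summable fun a => c a • (X a ∘L M))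
    (h2 : Summable fun a => conj (c a) • ((X a).adjoint ∘L M)) {F : Set H} {q : H → H → ℂ}
    (hq : ∀ Φ ∈ F, ∀ Ψ ∈ F, HasSum (fun a => c a * inner ℂ Φ (X a Ψ)) (q Φ Ψ)) :
    ∃ S, Represents M S F fun Φ Ψ => q Φ Ψ + conj (q Ψ Φ) := by
  obtain ⟨S₁, hS₁⟩ := h1
  obtain ⟨S₂, hS₂⟩ := h2
  -- The regularized series may be paired with arbitrary vectors. At Φ = M x its terms are hermitian
  -- in x and y, which gives the symmetry; on `F` it is compared with the series for q.
  have key : ∀ Φ χ, HasSum (fun a => c a * inner ℂ Φ (X a (M χ)) +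
      conj (c a * inner ℂ (M χ) (X a Φ))) (inner ℂ Φ ((S₁ + S₂) χ)) := fun Φ χ => by
    have e1 := (hS₁.mapL (ContinuousLinearMap.apply ℂ H χ)).mapL (innerSL ℂ Φ)
    have e2 := (hS₂.mapL (ContinuousLinearMap.apply ℂ H χ)).mapL (innerSL ℂ Φ)
    have e := e1.add e2
    rw [add_apply, inner_add_right]
    refine Eq.mp (congrArg (fun f => HasSum f _) (funext fun a => ?_)) e
    change inner ℂ Φ (c a • X a (M χ)) + inner ℂ Φ (conj (c a) • (X a).adjoint (M χ)) = _
    rw [inner_smul_right, inner_smul_right, ContinuousLinearMap.adjoint_inner_right, map_mul,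
      inner_conj_symm]
  refine ⟨S₁ + S₂, fun x y => ?_, fun Φ hΦ χ hχ => ?_⟩
  · have a1 := key (M x) y
    have a2 := (key (M y) x).mapL (Complex.conjCLE : ℂ →L[ℝ] ℂ)
    have a3 : HasSum (fun a => c a * inner ℂ (M x) (X a (M y)) +
        conj (c a * inner ℂ (M y) (X a (M x)))) (conj (inner ℂ (M y) ((S₁ + S₂) x))) := by
      refine Eq.mp (congrArg (fun f => HasSum f _) (funext fun a => ?_)) a2
      change conj (c a * inner ℂ (M y) (X a (M x)) + conj (c a * inner ℂ (M x) (X a (M y)))) = _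
      rw [map_add, Complex.conj_conj, add_comm]
    rw [← a3.unique a1, inner_conj_symm]
  · have a1 := hq Φ hΦ _ hχ
    have a2 := (hq _ hχ Φ hΦ).mapL (Complex.conjCLE : ℂ →L[ℝ] ℂ)
    exact (key Φ χ).unique (a1.add a2)

end Represents

/-! ### The interaction -/

section Interaction

variable {n : ℕ} {m γ s : Fin n → ℝ} {i₀ : Fin n}

theorem CoeffBdd.summable_of_weight {κ H : Type*} [NormedAddCommGroup H] [InnerProductSpace ℂ H]
    [CompleteSpace H] {O : κ → H →L[ℂ] H} {w : κ → ℝ} (hw : ∀ a, 0 < w a) {C : ℝ}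
    (h : CoeffBdd (fun a => ((w a)⁻¹ : ℂ) • O a) C) {c : κ → ℂ}
    (hc : Summable fun a => (‖c a‖ * w a) ^ 2) : Summable fun a => c a • O a := by
  have h1 := h.summable (d := fun a => c a * w a) (by
    refine hc.congr fun a => ?_
    rw [norm_mul, Complex.norm_real, Real.norm_of_nonneg (hw a).le])
  refine h1.congr fun a => ?_
  have : (w a : ℂ) ≠ 0 := by exact_mod_cast (hw a).ne'
  rw [smul_smul, mul_assoc, mul_inv_cancel₀ this, mul_one]

/-- The weight of the Hermite coefficients. -/
def decayWeight (s : Fin n → ℝ) (α : Fin n → Mode) : ℝ := ∏ i, modeWeight (s i) (α i)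

theorem decayWeight_pos (s : Fin n → ℝ) (α : Fin n → Mode) : 0 < decayWeight s α :=
  Finset.prod_pos fun _ _ => modeWeight_pos _ _

theorem prod_modeWeight_neg (s : Fin n → ℝ) (α : Fin n → Mode) :
    ((∏ i, modeWeight (-(s i)) (α i) : ℝ) : ℂ) = ((decayWeight s α : ℝ) : ℂ)⁻¹ := by
  rw [← Complex.ofReal_inv, decayWeight, ← Finset.prod_inv_distrib]
  congr 1
  refine Finset.prod_congr rfl fun i _ => ?_
  refine eq_inv_of_mul_eq_one_left ?_
  rw [← modeWeight_add, neg_add_cancel, modeWeight]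
  simp

theorem decayWeight_eq (hs0 : s i₀ = 0) (α : Fin n → Mode) :
    decayWeight s α = ∏ i ∈ Finset.univ.erase i₀, modeWeight (s i) (α i) := by
  rw [decayWeight, ← Finset.mul_prod_erase _ _ (Finset.mem_univ i₀), hs0]
  simp [modeWeight]

theorem summable_annihProd (hγ : ∀ i, 0 ≤ γ i) (hs0 : s i₀ = 0)
    (hsp : ∀ i, i ≠ i₀ → SpeciesBdd i (speciesDispersion m i) (s i) (γ i)) {L₁ L₂ : List (Fin n)}
    (hmem : ∀ i, i ∈ L₁ ++ L₂) (hnd : (L₁ ++ L₂).Nodup)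
    (hhead : (∃ L, L₁ = i₀ :: L) ∨ ∃ L, L₂ = i₀ :: L) {c : (Fin n → Mode) → ℂ}
    (hc : Summable fun α => (‖c α‖ * decayWeight s α) ^ 2) :
    Summable fun α => c α • (((annihProd L₁ α).adjoint ∘L annihProd L₂ α) ∘L
      mulOp (regularizer (speciesDispersion m) γ)) := by
  obtain ⟨C, hC⟩ := exists_coeffBdd_annihProd (fun i => measurable_dispersion (m i))
    (fun i => dispersion_nonneg (m i)) hγ hs0 hsp hmem hnd hhead
  simp only [prod_modeWeight_neg] at hC
  exact hC.summable_of_weight (decayWeight_pos s) hc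

theorem adjoint_adjoint_comp {H : Type*} [NormedAddCommGroup H] [InnerProductSpace ℂ H]
    [CompleteSpace H] (A B : H →L[ℂ] H) : (A.adjoint ∘L B).adjoint = B.adjoint ∘L A := by
  rw [ContinuousLinearMap.adjoint_comp, ContinuousLinearMap.adjoint_adjoint]

/-- The hermitian conjugate has the roles of the two lists exchanged. Species i₀ still heads one of
them, so the same summability applies. -/
theorem exists_represents_processForm (hγ : ∀ i, 0 ≤ γ i) (hs0 : s i₀ = 0)
    (hsp : ∀ i, i ≠ i₀ → SpeciesBdd i (speciesDispersion m i) (s i) (γ i)) (A : Finset (Fin n))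
    {G : FormFactor n} (hG : HasDecay i₀ s G) :
    ∃ S, Represents (mulOp (regularizer (speciesDispersion m) γ)) S {Φ | IsFiniteState Φ}
      fun Φ Ψ => processForm A G Φ Ψ + conj (processForm A G Ψ Φ) := by
  obtain ⟨L₁, L₂, hnd, hmem, hhead, σ, hσ, h⟩ := exists_hasSum_processForm A i₀
  have hperm : (L₂ ++ L₁).Perm (L₁ ++ L₂) := List.perm_append_comm
  have hc : Summable fun α => (‖σ * coeff G α‖ * decayWeight s α) ^ 2 := by
    refine hG.congr fun α => ?_
    rw [norm_mul, hσ, one_mul, decayWeight_eq hs0]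
  have h1 := summable_annihProd hγ hs0 hsp hmem hnd hhead hc
  have h2 := summable_annihProd hγ hs0 hsp (fun i => hperm.mem_iff.2 (hmem i))
    (hperm.nodup_iff.2 hnd) hhead.symm (c := fun α => conj (σ * coeff G α))
    (by simpa only [RCLike.norm_conj] using hc)
  simp only [← adjoint_adjoint_comp (annihProd L₁ _)] at h2
  refine exists_represents_of_summable h1 h2 fun Φ hΦ Ψ _ => ?_
  refine Eq.mp (congrArg (fun f => HasSum f _) (funext fun α => ?_)) (h G Φ Ψ hΦ)
  exact congrArg (σ * coeff G α * ·) (ContinuousLinearMap.adjoint_inner_right _ _ _).symm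

theorem speciesBdd_of_eq_zero {i : Fin n} (h : m i = 0) {t κ : ℝ} (ht : 1 / 12 ≤ t) (hκ0 : 0 < κ)
    (hκ : κ < 1 / 2) (htκ : 1 / 2 - κ < t) : SpeciesBdd i (speciesDispersion m i) t κ := by
  have e : speciesDispersion m i = fun x => dispersion 0 x.1 := by
    funext x
    rw [speciesDispersion, h]
  rw [e]
  exact speciesBdd_zero i ht hκ0 hκ htκ

/-- Exponents for which the interaction is relatively bounded with bound zero. -/
theorem exists_exponents (hn : 2 ≤ n) (hm : ∀ i, 0 ≤ m i) (i₀ : Fin n) {ε : ℝ} (hε : 0 < ε)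
    (hn2 : n = 2 → (∀ i, m i = 0) → 1 / 2 ≤ ε) :
    ∃ (i₁ : Fin n) (s γ : Fin n → ℝ), (∀ i, 0 ≤ γ i) ∧ ∑ i, γ i < 1 ∧ s i₁ = 0 ∧
      (∀ i, i ≠ i₁ → SpeciesBdd i (speciesDispersion m i) (s i) (γ i)) ∧
      ∀ G : FormFactor n, IsRegularFormFactor m i₀ ε G → HasDecay i₁ s G := by
  classical
  rcases hn.eq_or_lt with rfl | hn3
  · by_cases hpos : ∃ j, 0 < m j
    · obtain ⟨j, hj⟩ := hpos
      obtain ⟨i₁, hi₁, hu⟩ : ∃ i₁ : Fin 2, i₁ ≠ j ∧ ∀ i, i ≠ i₁ → i = j := by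
        refine ⟨j + 1, by fin_cases j <;> decide, fun i hi => ?_⟩
        fin_cases j <;> fin_cases i <;> simp_all
      -- With two species of which j is massive, the other species is taken as the exceptional one,
      -- whatever i₀ is. Half a power of the energy of j suffices and the kernel only has to be in
      -- L².
      refine ⟨i₁, fun _ => 0, fun i => if i = j then 1 / 2 else 0, fun i => by positivity, ?_, rfl,
        fun i hi => ?_, fun G _ => hasDecay_zero i₁ G⟩
      · rw [Finset.sum_ite_eq' Finset.univ j, if_pos (Finset.mem_univ j)]
        norm_num
      · obtain rfl := hu i hi
        simp only [if_true]
        exact speciesBdd_of_pos i hj (Or.inl ⟨rfl, le_rfl⟩)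
    · have h0 : ∀ i, m i = 0 := fun i => le_antisymm (not_lt.1 fun h => hpos ⟨i, h⟩) (hm i)
      have hε2 := hn2 rfl h0
      -- For ε ≥ 1/2 the kernel has decay exponent at least 1/2 - 5/6 + 1/2 = 1/6. The value γ =
      -- 5/12 stays below 1/2 and satisfies 1/2 - γ = 1/12 < 1/6.
      refine ⟨i₀, fun i => if i = i₀ then 0 else 1 / 6, fun i => if i = i₀ then 0 else 5 / 12,
        fun i => by positivity, ?_, if_pos rfl, fun i hi => ?_, fun G hG => ?_⟩
      · rw [← Finset.add_sum_erase _ _ (Finset.mem_univ i₀), if_pos rfl,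
          Finset.sum_congr rfl fun i hi => if_neg (Finset.ne_of_mem_erase hi)]
        simp
        norm_num
      · simp only [if_neg hi]
        exact speciesBdd_of_eq_zero (h0 i) (by norm_num) (by norm_num) (by norm_num) (by norm_num)
      · refine (hG.hasDecay hm).mono fun i hi => ?_
        rw [if_neg hi, if_neg (by rw [h0]; exact lt_irrefl 0)]
        norm_num
        linarith
  · set δ : ℝ := 1 / ((n : ℝ) - 1) with hδ
    have hn1 : (2 : ℝ) ≤ (n : ℝ) - 1 := by
      have : (3 : ℝ) ≤ n := by exact_mod_cast hn3
      linarith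
    have hδ0 : 0 < δ := by positivity
    have hδ2 : δ ≤ 1 / 2 := one_div_le_one_div_of_le (by norm_num) hn1
    -- With γ_i = δ - ε' the sum is 1 - (n - 1) ε' < 1, while ε' < ε keeps 1/2 - γ_i below the decay
    -- exponent and ε' < δ keeps γ_i positive.
    set ε' : ℝ := min ε δ / 2 with hε'
    have h1 : 0 < ε' := half_pos (lt_min hε hδ0)
    have h2 : ε' < ε := (half_lt_self (lt_min hε hδ0)).trans_le (min_le_left _ _)
    have h3 : ε' < δ := (half_lt_self (lt_min hε hδ0)).trans_le (min_le_right _ _)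
    -- As δ ≤ 1/2, the massless exponent is at least 1/2 - 5/12 = 1/12, as the estimate with dyadic
    -- shells requires.
    refine ⟨i₀, fun i => if i = i₀ then 0 else if 0 < m i then 1 / 2 - δ + ε else
      1 / 2 - 5 / 6 * δ + ε, fun i => if i = i₀ then 0 else δ - ε', fun i => ?_, ?_, if_pos rfl,
      fun i hi => ?_, fun G hG => ?_⟩
    · simp only
      split_ifs
      · exact le_rfl
      · linarith
    · rw [← Finset.add_sum_erase _ _ (Finset.mem_univ i₀), if_pos rfl,
        Finset.sum_congr rfl fun i hi => if_neg (Finset.ne_of_mem_erase hi), Finset.sum_const,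
        Finset.card_erase_of_mem (Finset.mem_univ i₀), Finset.card_univ, Fintype.card_fin,
        nsmul_eq_mul, Nat.cast_sub (by omega), Nat.cast_one, zero_add, mul_sub]
      have h4 : ((n : ℝ) - 1) * δ = 1 := mul_one_div_cancel (by linarith)
      rw [h4]
      have : 0 < ((n : ℝ) - 1) * ε' := by positivity
      linarith
    · simp only [if_neg hi]
      split_ifs with h
      · exact speciesBdd_of_pos i h (Or.inr ⟨by linarith, by linarith, by linarith⟩)
      · exact speciesBdd_of_eq_zero (le_antisymm (not_lt.1 h) (hm i)) (by linarith) (by linarith)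
          (by linarith) (by linarith)
    · refine (hG.hasDecay hm).mono fun i hi => ?_
      rw [if_neg hi]

theorem exists_represents_interactionForm (hγ : ∀ i, 0 ≤ γ i) (hs0 : s i₀ = 0)
    (hsp : ∀ i, i ≠ i₀ → SpeciesBdd i (speciesDispersion m i) (s i) (γ i))
    {G : ℕ → Finset (Fin n) → FormFactor n}
    (hG : ∀ p ≤ n, ∀ A ∈ processes n p, HasDecay i₀ s (G p A)) :
    ∃ S, Represents (mulOp (regularizer (speciesDispersion m) γ)) S {Φ | IsFiniteState Φ}
      (interactionForm G) := by
  have h : ∀ p ∈ Finset.range (n + 1), ∃ S,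
      Represents (mulOp (regularizer (speciesDispersion m) γ)) S {Φ | IsFiniteState Φ}
        fun Φ Ψ => ∑ A ∈ processes n p,
          (processForm A (G p A) Φ Ψ + conj (processForm A (G p A) Ψ Φ)) := fun p hp =>
    exists_represents_sum (q := fun A Φ Ψ =>
      processForm A (G p A) Φ Ψ + conj (processForm A (G p A) Ψ Φ)) (processes n p) fun A hA =>
        exists_represents_processForm hγ hs0 hsp A (hG p (Finset.mem_range_succ_iff.1 hp) A hA)
  exact exists_represents_sum (q := fun p Φ Ψ => ∑ A ∈ processes n p,
    (processForm A (G p A) Φ Ψ + conj (processForm A (G p A) Ψ Φ))) _ h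

end Interaction

end FermiFields

end

open FermiFields
set_option maxHeartbeats 400000 in
theorem theorem1p1 (n : ℕ) (hn : 2 ≤ n) (m : Fin n → ℝ) (hm : ∀ i, 0 ≤ m i)
    (i₀ : Fin n) (ε : ℝ) (hε : 0 < ε)
    (hn2 : n = 2 → (∀ i, m i = 0) → 1 / 2 ≤ ε)
    (G : ℕ → Finset (Fin n) → FormFactor n)
    (hG : ∀ p ≤ n, ∀ A ∈ processes n p, IsRegularFormFactor m i₀ ε (G p A)) :
    ∃ H : FockSpace n →ₗ.[ℂ] FockSpace n,
      IsSelfAdjoint H ∧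
      H.domain = (freeHamiltonian m).domain ∧
      (∀ Φ ∈ formDomain n, ∀ Ψ ∈ formDomain n,
        ∃ (hΨ : Ψ ∈ H.domain) (hΨ' : Ψ ∈ (freeHamiltonian m).domain),
          inner ℂ Φ (H ⟨Ψ, hΨ⟩) =
            inner ℂ Φ (freeHamiltonian m ⟨Ψ, hΨ'⟩) + interactionForm G Φ Ψ) ∧
      (∃ c : ℝ, ∀ Ψ : H.domain,
        c * ‖(Ψ : FockSpace n)‖ ^ 2 ≤ (inner ℂ (Ψ : FockSpace n) (H Ψ)).re) ∧
      (∀ D : Submodule ℂ (FockSpace n), (freeHamiltonian m).HasCore D → H.HasCore D) := by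
  obtain ⟨i₁, s, γ, hγ, hΓ, hs0, hsp, hdec⟩ := exists_exponents hn hm i₀ hε hn2
  obtain ⟨S, hS⟩ := exists_represents_interactionForm hγ hs0 hsp fun p hp A hA =>
    hdec _ (hG p hp A hA)
  obtain ⟨H, h1, h2, h3, h4, h5⟩ := exists_selfAdjoint_of_represents hγ hΓ hS
  refine ⟨H, h1, h2, fun Φ hΦ Ψ hΨ => ?_, h4, h5⟩
  obtain ⟨hΨH, h⟩ := h3 Φ (isFiniteState_of_mem hΦ) Ψ (isFiniteState_of_mem hΨ) (mem_freeHamiltonian_of_mem_formDomain hm hΨ)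
  exact ⟨hΨH, mem_freeHamiltonian_of_mem_formDomain hm hΨ, h⟩
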